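/- Let $N\ge 2$, $p\in[2,N]$, $c_1>0$, $c>0$ and $K\in\mathbf R$. Fix a Littlewood--Paley decomposition $\Delta_k=\varphi(2^{-k}D)$, $k\in\mathbf Z$, of $\mathbf R^N$, with $\varphi$ smooth, radial, supported in $\{\frac34\le|\xi|\le\frac83\}$ and $\sum_{j\in\mathbf Z}\varphi(2^{-j}\xi)=1$ for $\xi\ne0$. Put $$e_\ell(t)=(1-e^{-c2^{2\ell}t})^{1/2},\qquad \omega_k(t)=\sum_{\ell\ge k}2^{k-\ell}e_\ell(t),$$ $$\|f\|_{\dot B^s_{p,r}}=\bigl\|2^{ks}\|\Delta_kf\|_{L^p}\bigr\|_{\ell^r(\mathbf Z)},\qquad \|f\|_{\widetilde L^q_T(\dot B^s_{p,r})}=\bigl\|2^{ks}\|\Delta_kf\|_{L^q(0,T;L^p)}\bigr\|_{\ell^r(\mathbf Z)},$$ $$\|f\|_{\widetilde L^q_T(\dot B^s_{p,r}(\omega))}=\bigl\|2^{ks}\omega_k(T)\|\Delta_kf\|_{L^q(0,T;L^p)}\bigr\|_{\ell^r(\mathbf Z)}.$$ Then there is a constant $C>0$, depending only on $N,p,\varphi,c_1,c,K$,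 such that the following holds. Let $0<T<\infty$, $\underline\rho\in\mathbf R$, let $\overline\mu,\overline\lambda:\mathbf R\to\mathbf R$ be smooth, and let $\rho:(0,T)\times\mathbf R^N\to\mathbf R$ satisfy $\rho-\underline\rho\in L^\infty(0,T;\dot B^{N/p}_{p,1})$ (where elements of $\dot B^{N/p}_{p,1}$ are identified with bounded functions equal to the sum of their Littlewood--Paley series). Assume that $\overline\mu(\rho)\ge c_1$ and $\overline\lambda(\rho)+2\overline\mu(\rho)\ge c_1$ almost everywhere, and that the derivatives of $\overline\mu$ and $\overline\lambda$ of orders $1,\dots,[N/p]+3$ are bounded by $K$ on the interval $|r|\le\|\rho\|_{L^\infty_T(L^\infty)}$. Let $G\in L^1(0,T;\dot B^{-N/p}_{p,\infty})$ and $u_0\in\dot B^{-N/p}_{p,\infty}$ be vector valued, and let $u$, with $\Delta_ku\in L^1(0,T;L^p)$ for every $k$, be a solution on $(0,T)$ of $$\partial_tu-\mathrm{div}(\overline\mu(\rho)\nabla u)-\nabla\bigl((\overline\lambda(\rho)+\overline\mu(\rho))\,\mathrm{div}\,u\bigr)=G,\qquad u|_{t=0}=u_0,$$ in the sense of distributions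 modulo polynomials, the products being understood through $\nabla u=\sum_k\nabla\Delta_ku$. Then $$\|u\|_{\widetilde L^1_T(\dot B^{-\frac Np+2}_{p,\infty})}+\|u\|_{\widetilde L^2_T(\dot B^{-\frac Np+1}_{p,\infty})}\le C\Bigl(\|u_0\|_{\dot B^{-\frac Np}_{p,\infty}}+\|G\|_{\widetilde L^1_T(\dot B^{-\frac Np}_{p,\infty}(\omega))}+A(T)\,\|\rho-\underline\rho\|_{\widetilde L^\infty_T(\dot B^{\frac Np}_{p,1}(\omega))}\,\|u\|_{\widetilde L^1_T(\dot B^{-\frac Np+2}_{p,\infty})}\Bigr),$$ where $A(T)=\bigl(1+\|\rho\|_{L^\infty_T(L^\infty)}\bigr)^{[N/p]+2}$, norms may take the value $+\infty$, and $0\cdot\infty=0$. -/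

import Mathlib

open MeasureTheory
open scoped ENNReal SchwartzMap FourierTransform

noncomputable section

namespace BesovMomentum

/-- The physical space `ℝ^N`. -/
abbrev Space (N : ℕ) : Type := EuclideanSpace ℝ (Fin N)

/-- The values of (possibly complex) vector fields. -/
abbrev CVec (N : ℕ) : Type := EuclideanSpace ℂ (Fin N)

/-- The `j`-th vector of the canonical basis of `ℝ^N`. -/
def unitVec {N : ℕ} (j : Fin N) : Space N := EuclideanSpace.single j (1 : ℝ)

/-- A function `φ` generating a homogeneous Littlewood-Paley decomposition: smooth, radial,
supported in `{3/4 ≤ |ξ| ≤ 8/3}`, with `∑_j φ(2^{-j} ξ) = 1` for all `ξ ≠ 0`. -/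
structure LittlewoodPaley (N : ℕ) where
  φ : Space N → ℝ
  smooth : ContDiff ℝ ((⊤ : ℕ∞) : WithTop ℕ∞) φ
  radial : ∀ ξ η : Space N, ‖ξ‖ = ‖η‖ → φ ξ = φ η
  support_subset : Function.support φ ⊆ {ξ : Space N | 3 / 4 ≤ ‖ξ‖ ∧ ‖ξ‖ ≤ 8 / 3}
  partition : ∀ ξ : Space N, ξ ≠ 0 → HasSum (fun j : ℤ => φ ((2 : ℝ) ^ (-j) • ξ)) 1

namespace LittlewoodPaley

variable {N : ℕ} (P : LittlewoodPaley N)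

/-- The symbol of `Δ_k = φ(2^{-k} D)`. The factor `2π` converts the frequency variable of Mathlib's
Fourier transform (kernel `e^{-2πi x·η}`) into that of the transform with kernel `e^{-i x·ξ}`. -/
def symbol (k : ℤ) (η : Space N) : ℂ :=
  ((P.φ (((2 : ℝ) ^ (-k) * (2 * Real.pi)) • η) : ℝ) : ℂ)

theorem symbol_contDiff (k : ℤ) : ContDiff ℝ ((⊤ : ℕ∞) : WithTop ℕ∞) (P.symbol k) :=
  Complex.ofRealCLM.contDiff.comp (P.smooth.comp (contDiff_const_smul _))

theorem symbol_hasCompactSupport (k : ℤ) : HasCompactSupport (P.symbol k) := by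
  have h1 : HasCompactSupport P.φ := by
    refine HasCompactSupport.of_support_subset_isCompact
      (isCompact_closedBall (0 : Space N) (8 / 3)) ?_
    intro ξ hξ
    simpa using (P.support_subset hξ).2
  have h2 : HasCompactSupport
      (fun η : Space N => P.φ (((2 : ℝ) ^ (-k) * (2 * Real.pi)) • η)) :=
    h1.comp_smul (by positivity)
  exact h2.comp_left (g := fun r : ℝ => (r : ℂ)) (by simp)

/-- The symbol of `Δ_k` as a Schwartz function. -/
def symbolS (k : ℤ) : 𝓢(Space N, ℂ) :=
  (P.symbol_hasCompactSupport k).toSchwartzMap (P.symbol_contDiff k)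

/-- The Schwartz function `y ↦ h_k(x - y)`, where `h_k` is the convolution kernel of `Δ_k`, i.e. the
inverse Fourier transform of its symbol. -/
def kernel (k : ℤ) (x : Space N) : 𝓢(Space N, ℂ) :=
  (𝓕 (P.symbolS k)).compSubConstCLM ℂ x

theorem kernel_apply (k : ℤ) (x y : Space N) :
    P.kernel k x y = 𝓕⁻ (⇑(P.symbolS k)) (x - y) := by
  rw [Real.fourierInv_eq_fourier_neg, neg_sub]
  rfl

/-- The dyadic block `Δ_k f = h_k * f` of a vector valued tempered distribution. -/
def block (k : ℤ) (f : 𝓢'(Space N, CVec N)) (x : Space N) : CVec N :=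
  f (P.kernel k x)

/-- The dyadic block `Δ_k f = h_k * f` of a function. -/
def blockFun (k : ℤ) (f : Space N → ℝ) (x : Space N) : ℂ :=
  ∫ y, P.kernel k x y * (f y : ℂ)

end LittlewoodPaley

section Norms

variable {N : ℕ} {F : Type*} [NormedAddCommGroup F]

/-- The norm of `L^q(0,T)` of a function with values in `[0,∞]`. -/
def timeNorm (T : ℝ) (q : ℝ≥0∞) (g : ℝ → ℝ≥0∞) : ℝ≥0∞ :=
  eLpNorm g q (volume.restrict (Set.Ioc 0 T))

/-- The norm `‖ 2^{ks} ‖Δ_k f‖_p ‖_{ℓ^r}` of `Ḃ^s_{p,r}`, in terms of the blocks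
`b k = Δ_k f`. -/
def besovNorm (s : ℝ) (p r : ℝ≥0∞) (b : ℤ → Space N → F) : ℝ≥0∞ :=
  eLpNorm (fun k : ℤ => ENNReal.ofReal ((2 : ℝ) ^ ((k : ℝ) * s)) * eLpNorm (b k) p volume)
    r Measure.count

/-- The norm `‖ 2^{ks} w_k ‖Δ_k f‖_{L^q(0,T;L^p)} ‖_{ℓ^r}` of the (weighted) Chemin-Lerner space
`L̃^q_T(Ḃ^s_{p,r}(w))`, in terms of the blocks `b k t = Δ_k f(t)`. -/
def cheminLernerNorm (w : ℤ → ℝ) (T s : ℝ) (q p r : ℝ≥0∞) (b : ℤ → ℝ → Space N → F) : ℝ≥0∞ :=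
  eLpNorm (fun k : ℤ => ENNReal.ofReal ((2 : ℝ) ^ ((k : ℝ) * s) * w k) *
    timeNorm T q (fun t => eLpNorm (b k t) p volume)) r Measure.count

/-- The norm of `L^∞(0,T; L^∞(ℝ^N))`. -/
def supNorm (T : ℝ) (f : ℝ → Space N → ℝ) : ℝ≥0∞ :=
  timeNorm T ∞ (fun t => eLpNorm (f t) ∞ volume)

end Norms

/-- `e_l(t) = (1 - e^{-c 2^{2l} t})^{1/2}`. -/
def eWeight (c : ℝ) (l : ℤ) (t : ℝ) : ℝ :=
  Real.sqrt (1 - Real.exp (-(c * (2 : ℝ) ^ (2 * l) * t)))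

/-- `ω_k(t) = ∑_{l ≥ k} 2^{k-l} e_l(t)`. -/
def omegaWeight (c : ℝ) (k : ℤ) (t : ℝ) : ℝ :=
  ∑' l : Set.Ici k, (2 : ℝ) ^ (k - (l : ℤ)) * eWeight c (l : ℤ) t

/-- The test functions `𝓩(ℝ^N)`: Schwartz functions whose Fourier transform vanishes at the origin
together with all its derivatives. The dual of `𝓩` is the space of tempered distributions modulo
polynomials. -/
def testSpace (N : ℕ) : Set 𝓢(Space N, ℂ) :=
  {ψ | ∀ n : ℕ, iteratedFDeriv ℝ n (⇑(𝓕 ψ : 𝓢(Space N, ℂ))) 0 = 0}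

/-- `∫ (m(r) ∇v^i · ∇ψ + (l(r) + m(r)) div v ∂_i ψ) dx`, which is the `i`-th component of
`-div(m(r) ∇v) - ∇((l(r) + m(r)) div v)` tested against `ψ`. -/
def viscousPairing {N : ℕ} (m l : ℝ → ℝ) (r : Space N → ℝ) (v : Space N → CVec N)
    (ψ : 𝓢(Space N, ℂ)) (i : Fin N) : ℂ :=
  ∫ x, ((∑ j, (m (r x) : ℂ) * (fderiv ℝ v x (unitVec j)) i * fderiv ℝ ψ x (unitVec j)) +
    ((l (r x) + m (r x) : ℝ) : ℂ) * (∑ j, (fderiv ℝ v x (unitVec j)) j) *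
      fderiv ℝ ψ x (unitVec i))

/-- `u` is a solution on `(0,T)` of
`∂_t u - div(m(ρ) ∇u) - ∇((l(ρ) + m(ρ)) div u) = G`, `u|_{t=0} = u₀`,
in the sense of distributions modulo polynomials. The derivatives of `u` enter the products with the
coefficients through their Littlewood-Paley series, `m(ρ) ∇u = ∑_k m(ρ) ∇Δ_k u`. -/
structure IsMomentumSolution {N : ℕ} (P : LittlewoodPaley N) (p : ℝ≥0∞) (T : ℝ) (m l : ℝ → ℝ)
    (ρ : ℝ → Space N → ℝ) (G : ℝ → 𝓢'(Space N, CVec N)) (u₀ : 𝓢'(Space N, CVec N))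
    (u : ℝ → 𝓢'(Space N, CVec N)) : Prop where
  measurable : ∀ ψ : 𝓢(Space N, ℂ),
    AEStronglyMeasurable (fun t => u t ψ) (volume.restrict (Set.Ioc 0 T))
  block_integrable : ∀ k : ℤ, timeNorm T 1 (fun t => eLpNorm (P.block k (u t)) p volume) < ∞
  equation : ∀ ψ ∈ testSpace N, ∀ i : Fin N, ∀ᵐ t ∂(volume.restrict (Set.Ioc 0 T)),
    HasSum (fun k : ℤ => ∫ τ in Set.Ioc 0 t, viscousPairing m l (ρ τ) (P.block k (u τ)) ψ i)
      (u₀ ψ i - u t ψ i + ∫ τ in Set.Ioc 0 t, G τ ψ i)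

/-- `f ∈ L^∞(0,T; Ḃ^{N/p}_{p,1})` for a bounded measurable function `f`: the norm is finite and
`f(t)` is the sum of its Littlewood-Paley series (this selects the representative of a class modulo
polynomials that gives the embedding of `Ḃ^{N/p}_{p,1}` in `L^∞`). -/
structure IsCriticalPerturbation {N : ℕ} (P : LittlewoodPaley N) (p T : ℝ)
    (f : ℝ → Space N → ℝ) : Prop where
  measurable : AEMeasurable (Function.uncurry f) ((volume.restrict (Set.Ioc 0 T)).prod volume)
  bounded : supNorm T f < ∞
  norm_lt : timeNorm T ∞ (fun t =>
    besovNorm ((N : ℝ) / p) (ENNReal.ofReal p) 1 (fun k => P.blockFun k (f t))) < ∞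
  series : ∀ᵐ t ∂(volume.restrict (Set.Ioc 0 T)), ∀ᵐ x ∂(volume : Measure (Space N)),
    HasSum (fun k : ℤ => P.blockFun k (f t) x) ((f t x : ℝ) : ℂ)

end BesovMomentum

end

open MeasureTheory
open scoped ENNReal SchwartzMap FourierTransform

noncomputable section

/-! The equation is localized both at a frequency 2^k and at a point x: it is tested against
convolution kernels of frequency 2^k centred at x. The coefficients are frozen in space at that
point x, but kept as merely bounded measurable functions of time. A Helmholtz splitting of the test
field (`exists_vectorSymbol`) makes the frozen operator a scalar multiple of the Laplacian, by μ + λ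
+ μ = λ + 2μ on gradients and by μ on solenoidal fields. Both multiples are at least c₁. Testing
against kernels evolved by the heat flow for the time σ = ∫_s^t ν, where ν is 2^{2k} times this
multiple, cancels the frozen term exactly (`duhamel`). The result is a pointwise bound of Δ_k u(t,x)
by local averages of Δ_k u₀, of Δ_k G and of a commutator, with parabolic decay at rate c₁
2^{2k}/16. No energy estimate and no time regularity of ρ enter.

The commutator is a sum over the blocks Δ_j u. For |j-k| ≤ 2 it contains b(y) - b(x), which is at
most Y_k (1 + 2^k|x-y|), where Y_k sums the sizes of the blocks of ρ - ρ̲ with weights min(1,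
2^{l-k}); the growth is absorbed by the decay of the kernels. For |j-k| ≥ 3 the product of the test
function with the gradient of Δ_j u has no frequencies below a fraction of 2^{max(j,k)}, so the
coefficient b may be replaced by averages of its differences of order M at scale 2^{-max(j,k)}
(`exists_enorm_integral_smoothCoef_le`). Since b is a smooth function of ρ, these differences are
estimated by telescoping over the dyadic blocks of ρ (`abs_fwdDiff_iter_comp_sum_le`). This produces
the factor (1 + ‖ρ‖_∞)^M, and M = [N/p] + 2 exceeds N/p enough for the low frequencies to be
summable with the weights above.

Bernstein inequalities then give (`lp_remTerm_le`, `exists_commutator_le`) a bound of the commutator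
in L^1_T(L^p) by 2^{kN/p} Y_k ∑_j 2^{-|j-k|} 2^{j(2-N/p)} ‖Δ_j u‖. The case j > k uses p ≥ 2, the
case j < k uses p ≤ N.

Finally, the heat factor in L^q(0,T) is of size 2^{-2k/q} e_k(T) for 1 ≤ q ≤ 2 (`lp_exp_le`). The
weights ω are made so that e_k min(1, 2^{l-k}) ≤ ω_l (`eWeight_mul_ysum_le`), hence e_k Y_k is at
most the weighted norm of ρ - ρ̲. Taking the supremum over k with q = 1 and q = 2 ends the proof.
Nothing is absorbed in the left-hand side, so no smallness is needed. -/

namespace BesovMomentum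

/-! ### L^p norms of functions with values in [0,∞] and Minkowski's inequality -/

section Lp

variable {α β : Type*} [MeasurableSpace α] [MeasurableSpace β]

/-- The `L^p` norm of a function with values in `[0,∞]`. -/
def lp (p : ℝ) (μ : Measure α) (f : α → ℝ≥0∞) : ℝ≥0∞ := (∫⁻ a, f a ^ p ∂μ) ^ (1 / p)

theorem lp_congr {p : ℝ} {μ : Measure α} {f g : α → ℝ≥0∞} (h : f =ᵐ[μ] g) :
    lp p μ f = lp p μ g := by
  unfold lp
  congr 1
  exact lintegral_congr_ae (h.mono fun a ha => by simp only [ha])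

theorem lp_mono_ae {p : ℝ} (hp : 0 ≤ p) {μ : Measure α} {f g : α → ℝ≥0∞}
    (h : ∀ᵐ a ∂μ, f a ≤ g a) : lp p μ f ≤ lp p μ g := by
  unfold lp
  refine ENNReal.rpow_le_rpow (lintegral_mono_ae ?_) (by positivity)
  filter_upwards [h] with a ha using ENNReal.rpow_le_rpow ha hp

theorem lp_mono {p : ℝ} (hp : 0 ≤ p) {μ : Measure α} {f g : α → ℝ≥0∞}
    (h : ∀ a, f a ≤ g a) : lp p μ f ≤ lp p μ g :=
  lp_mono_ae hp (Filter.Eventually.of_forall h)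

theorem lp_const_mul {p : ℝ} (hp : 0 < p) {μ : Measure α} {f : α → ℝ≥0∞}
    (hf : AEMeasurable f μ) (c : ℝ≥0∞) : lp p μ (fun a => c * f a) = c * lp p μ f := by
  unfold lp
  simp_rw [ENNReal.mul_rpow_of_nonneg _ _ hp.le]
  rw [lintegral_const_mul'' _ (hf.pow_const p), ENNReal.mul_rpow_of_nonneg _ _ (by positivity),
    ← ENNReal.rpow_mul, mul_one_div_cancel hp.ne', ENNReal.rpow_one]

theorem lp_add_le {p : ℝ} (hp : 1 ≤ p) {μ : Measure α} {f g : α → ℝ≥0∞}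
    (hf : AEMeasurable f μ) (hg : AEMeasurable g μ) :
    lp p μ (fun a => f a + g a) ≤ lp p μ f + lp p μ g :=
  ENNReal.lintegral_Lp_add_le hf hg hp

theorem lp_rpow {p : ℝ} (hp : 0 < p) {μ : Measure α} (f : α → ℝ≥0∞) :
    lp p μ f ^ p = ∫⁻ a, f a ^ p ∂μ := by
  unfold lp
  rw [← ENNReal.rpow_mul, one_div_mul_cancel hp.ne', ENNReal.rpow_one]

theorem lp_eq_zero {p : ℝ} (hp : 0 < p) {μ : Measure α} {f : α → ℝ≥0∞}
    (hf : AEMeasurable f μ) : lp p μ f = 0 ↔ f =ᵐ[μ] 0 := by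
  unfold lp
  rw [ENNReal.rpow_eq_zero_iff_of_pos (by positivity), lintegral_eq_zero_iff' (hf.pow_const p)]
  constructor <;> intro h <;> filter_upwards [h] with a ha
  · simpa [hp, hp.le, hp.not_gt] using ha
  · simp only [Pi.zero_apply] at ha
    simp [ha, hp]

theorem eLpNorm_eq_lp {E : Type*} [NormedAddCommGroup E] {p : ℝ} (hp : 0 < p) {μ : Measure α}
    (f : α → E) : eLpNorm f (ENNReal.ofReal p) μ = lp p μ (fun a => ‖f a‖ₑ) := by
  rw [eLpNorm_eq_lintegral_rpow_enorm_toReal (by simpa using hp) ENNReal.ofReal_ne_top,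
    ENNReal.toReal_ofReal hp.le]
  rfl

theorem measurable_lp_prod {p : ℝ} {μ : Measure α} [SFinite μ] {f : α → β → ℝ≥0∞}
    (hf : Measurable (Function.uncurry f)) : Measurable fun b => lp p μ fun a => f a b := by
  have : Measurable (Function.uncurry fun b a => f a b ^ p) :=
    (hf.comp measurable_swap).pow_const p
  exact (this.lintegral_prod_right').pow_const _

/-- Minkowski's integral inequality, for measurable integrands. -/
theorem lp_lintegral_le_of_measurable {p : ℝ} (hp : 1 ≤ p) {μ : Measure α} {ν : Measure β}
    [SFinite μ] [SFinite ν] {f : α → β → ℝ≥0∞} (hf : Measurable (Function.uncurry f)) :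
    lp p μ (fun a => ∫⁻ b, f a b ∂ν) ≤ ∫⁻ b, lp p μ (fun a => f a b) ∂ν := by
  have hp0 : 0 < p := by linarith
  rcases hp.eq_or_lt with rfl | hp1
  · simp only [lp, ENNReal.rpow_one, one_div, inv_one]
    rw [lintegral_lintegral_swap hf.aemeasurable]
  have hn : Measurable fun b => lp p μ fun a => f a b := measurable_lp_prod hf
  by_cases hI : ∫⁻ b, lp p μ (fun a => f a b) ∂ν = ⊤
  · rw [hI]; exact le_top
  have hfa : ∀ a, Measurable (f a) := fun a => hf.comp measurable_prodMk_left
  have hfb : ∀ b, Measurable (fun a => f a b) := fun b => hf.comp measurable_prodMk_right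
  set n : β → ℝ≥0∞ := fun b => lp p μ fun a => f a b with hn_def
  set I := ∫⁻ b, n b ∂ν with hI_def
  have hnt : ∀ᵐ b ∂ν, n b < ⊤ := ae_lt_top hn hI
  have hpq : p.HolderConjugate (p.conjExponent) := Real.HolderConjugate.conjExponent hp1
  set q := p.conjExponent with hq_def
  have hq0 : 0 < q := hpq.symm.pos
  have hpq1 : p / q = p - 1 := by
    rw [hq_def, Real.conjExponent]
    have : p - 1 ≠ 0 := by linarith
    field_simp
  -- Where the slice norm n(b) vanishes, its negative powers are infinite; there f itself vanishes
  -- for almost every a, so such b do not contribute.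
  have hz : ∀ᵐ a ∂μ, ∀ᵐ b ∂ν, n b = 0 → f a b = 0 := by
    have hm : MeasurableSet {x : α × β | n x.2 = 0 → f x.1 x.2 = 0} := by
      have h1 : MeasurableSet {x : α × β | n x.2 = 0} :=
        (hn.comp measurable_snd) (measurableSet_singleton 0)
      have h2 : MeasurableSet {x : α × β | f x.1 x.2 = 0} := hf (measurableSet_singleton 0)
      convert! h1.compl.union h2 using 1
      ext z
      simp [imp_iff_not_or]
    rw [Measure.ae_ae_comm hm]
    refine Filter.Eventually.of_forall fun b => ?_
    by_cases hb : n b = 0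
    · have := (lp_eq_zero hp0 (hfb b).aemeasurable).1 hb
      filter_upwards [this] with a ha _ using ha
    · exact Filter.Eventually.of_forall fun a h => absurd h hb
  -- Hölder's inequality in b for the splitting f = (f n^{-1/q}) n^{1/q}. Integrating the result in
  -- a turns f^p n^{-(p-1)} into n, so that the right-hand side becomes I · I^{p-1}.
  have key : ∀ᵐ a ∂μ, (∫⁻ b, f a b ∂ν) ^ p ≤ (∫⁻ b, f a b ^ p * n b ^ (-(p - 1)) ∂ν) * I ^ (p - 1) := by
    filter_upwards [hz] with a ha
    have h1 : ∫⁻ b, f a b ∂ν = ∫⁻ b, ((fun b => f a b * n b ^ (-(1 / q))) * fun b => n b ^ (1 / q)) b ∂ν := by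
      refine lintegral_congr_ae ?_
      filter_upwards [ha, hnt] with b hb hb'
      by_cases h0 : n b = 0
      · simp [hb h0]
      · simp only [Pi.mul_apply]
        rw [mul_assoc, ENNReal.rpow_neg, ENNReal.inv_mul_cancel, mul_one]
        · simp [h0, hb'.ne]
        · exact (ENNReal.rpow_lt_top_of_nonneg (by positivity) hb'.ne).ne
    have h2 := ENNReal.lintegral_mul_le_Lp_mul_Lq ν hpq
      (f := fun b => f a b * n b ^ (-(1 / q))) (g := fun b => n b ^ (1 / q))
      ((hfa a).mul (hn.pow_const _)).aemeasurable (hn.pow_const _).aemeasurable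
    rw [← h1] at h2
    refine (ENNReal.rpow_le_rpow h2 hp0.le).trans (le_of_eq ?_)
    rw [ENNReal.mul_rpow_of_nonneg _ _ hp0.le, ← ENNReal.rpow_mul, ← ENNReal.rpow_mul,
      one_div_mul_cancel hp0.ne', ENNReal.rpow_one]
    congr 1
    · refine lintegral_congr fun b => ?_
      rw [ENNReal.mul_rpow_of_nonneg _ _ hp0.le, ← ENNReal.rpow_mul]
      congr 2
      rw [← hpq1]; ring
    · rw [one_div_mul_eq_div, hpq1]
      congr 1
      refine lintegral_congr fun b => ?_
      rw [← ENNReal.rpow_mul, one_div_mul_cancel hq0.ne', ENNReal.rpow_one]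
  have hmeas : Measurable (Function.uncurry fun a b => f a b ^ p * n b ^ (-(p - 1))) :=
    (hf.pow_const p).mul ((hn.comp measurable_snd).pow_const _)
  have h3 : ∫⁻ a, (∫⁻ b, f a b ∂ν) ^ p ∂μ ≤ I ^ p := by
    calc ∫⁻ a, (∫⁻ b, f a b ∂ν) ^ p ∂μ
        ≤ ∫⁻ a, (∫⁻ b, f a b ^ p * n b ^ (-(p - 1)) ∂ν) * I ^ (p - 1) ∂μ := lintegral_mono_ae key
      _ = (∫⁻ a, ∫⁻ b, f a b ^ p * n b ^ (-(p - 1)) ∂ν ∂μ) * I ^ (p - 1) :=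
          lintegral_mul_const _ hmeas.lintegral_prod_right'
      _ = (∫⁻ b, ∫⁻ a, f a b ^ p * n b ^ (-(p - 1)) ∂μ ∂ν) * I ^ (p - 1) := by
          rw [lintegral_lintegral_swap hmeas.aemeasurable]
      _ ≤ I * I ^ (p - 1) := by
          gcongr
          refine lintegral_mono_ae ?_
          filter_upwards [hnt] with b hb
          rw [lintegral_mul_const _ ((hfb b).pow_const p), ← lp_rpow hp0]
          change n b ^ p * n b ^ (-(p - 1)) ≤ n b
          by_cases h0 : n b = 0
          · simp [h0, hp0]
          · rw [← ENNReal.rpow_add _ _ h0 hb.ne]; simp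
      _ = I ^ p := by
          conv_lhs => rw [← ENNReal.rpow_one I, ← ENNReal.rpow_mul, one_mul]
          rw [← ENNReal.rpow_add_of_nonneg _ _ zero_le_one (by linarith)]; simp
  calc lp p μ (fun a => ∫⁻ b, f a b ∂ν) ≤ (I ^ p) ^ (1 / p) :=
        ENNReal.rpow_le_rpow h3 (by positivity)
    _ = I := by rw [← ENNReal.rpow_mul, mul_one_div_cancel hp0.ne', ENNReal.rpow_one]

/-- Minkowski's integral inequality. -/
theorem lp_lintegral_le {p : ℝ} (hp : 1 ≤ p) {μ : Measure α} {ν : Measure β}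
    [SFinite μ] [SFinite ν] {f : α → β → ℝ≥0∞}
    (hf : AEMeasurable (Function.uncurry f) (μ.prod ν)) :
    lp p μ (fun a => ∫⁻ b, f a b ∂ν) ≤ ∫⁻ b, lp p μ (fun a => f a b) ∂ν := by
  obtain ⟨g, hg, hfg⟩ := hf
  have h1 : ∀ᵐ a ∂μ, ∀ᵐ b ∂ν, f a b = g (a, b) := Measure.ae_ae_of_ae_prod hfg
  have h2 : ∀ᵐ b ∂ν, ∀ᵐ a ∂μ, f a b = g (a, b) := by
    have : ∀ᵐ z ∂(ν.prod μ), f z.2 z.1 = g (z.2, z.1) :=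
      (Measure.measurePreserving_swap (μ := ν) (ν := μ)).quasiMeasurePreserving.ae hfg
    exact Measure.ae_ae_of_ae_prod this
  rw [lp_congr (g := fun a => ∫⁻ b, g (a, b) ∂ν) (h1.mono fun a ha => lintegral_congr_ae ha),
    lintegral_congr_ae (g := fun b => lp p μ fun a => g (a, b)) (h2.mono fun b hb => lp_congr hb)]
  exact lp_lintegral_le_of_measurable hp (f := fun a b => g (a, b)) hg

theorem lp_tsum_le {ι : Type*} [Countable ι] {p : ℝ} (hp : 1 ≤ p) {μ : Measure α} [SFinite μ]
    {f : ι → α → ℝ≥0∞} (hf : ∀ i, AEMeasurable (f i) μ) :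
    lp p μ (fun a => ∑' i, f i a) ≤ ∑' i, lp p μ (f i) := by
  let : MeasurableSpace ι := ⊤
  choose g hg hfg using hf
  have h := lp_lintegral_le_of_measurable hp (μ := μ) (ν := (Measure.count : Measure ι))
    (f := fun a i => g i a) (measurable_from_prod_countable_left fun i => hg i)
  simp only [lintegral_count] at h
  rw [lp_congr (g := fun a => ∑' i, g i a)]
  · refine h.trans (le_of_eq ?_)
    exact tsum_congr fun i => (lp_congr (hfg i)).symm
  · filter_upwards [ae_all_iff.2 hfg] with a ha using tsum_congr ha

end Lp

/-! ### Joint measurability of Carathéodory functions -/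

section JointMeasurability

variable {α X E : Type*} [MeasurableSpace α] {μ : Measure α}
  [TopologicalSpace X] [SecondCountableTopology X] [TopologicalSpace.MetrizableSpace X]
  [MeasurableSpace X] [BorelSpace X] [NormedAddCommGroup E]

/-- Measurability in `a` holds for each x only up to a null set that depends on x. A countable dense
set of points x costs a single null set; off it, continuity carries measurability to every x, and a
function that is measurable in one variable and continuous in the other is jointly measurable. -/
theorem aestronglyMeasurable_uncurry_of_continuous {f : α → X → E} (ν : Measure X) [SFinite ν]
    (hc : ∀ᵐ a ∂μ, Continuous (f a)) (hm : ∀ x, AEStronglyMeasurable (fun a => f a x) μ) :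
    AEStronglyMeasurable (Function.uncurry f) (μ.prod ν) := by
  rcases isEmpty_or_nonempty X with hX | hX
  · have : Function.uncurry f = fun _ => 0 := by
      ext ⟨a, x⟩; exact (hX.false x).elim
    rw [this]; exact aestronglyMeasurable_const
  let := TopologicalSpace.metrizableSpaceMetric X
  have hgood : ∀ᵐ a ∂μ, Continuous (f a) ∧ ∀ n : ℕ, f a (TopologicalSpace.denseSeq X n) =
      (hm (TopologicalSpace.denseSeq X n)).mk _ a :=
    hc.and (ae_all_iff.2 fun n => (hm _).ae_eq_mk)
  obtain ⟨S, hSs, hSm, hS⟩ : ∃ S ⊆ {a | Continuous (f a) ∧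
      ∀ n : ℕ, f a (TopologicalSpace.denseSeq X n) =
      (hm (TopologicalSpace.denseSeq X n)).mk _ a}, MeasurableSet S ∧ μ Sᶜ = 0 := by
    refine ⟨(toMeasurable μ {a | Continuous (f a) ∧ ∀ n : ℕ, f a (TopologicalSpace.denseSeq X n) =
      (hm (TopologicalSpace.denseSeq X n)).mk _ a}ᶜ)ᶜ, ?_, ?_, ?_⟩
    · exact Set.compl_subset_comm.1 (subset_toMeasurable _ _)
    · exact (measurableSet_toMeasurable _ _).compl
    · rw [compl_compl, measure_toMeasurable]; exact hgood
  classical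
  set g : α → X → E := fun a x => if a ∈ S then f a x else 0 with hg
  have hgc : ∀ a, Continuous (g a) := by
    intro a
    by_cases ha : a ∈ S
    · simpa [hg, ha] using (hSs ha).1
    · simpa [hg, ha] using continuous_const
  have hgd : ∀ n : ℕ, StronglyMeasurable fun a => g a (TopologicalSpace.denseSeq X n) := by
    intro n
    have : (fun a => g a (TopologicalSpace.denseSeq X n)) =
        S.indicator ((hm (TopologicalSpace.denseSeq X n)).mk _) := by
      ext a
      by_cases ha : a ∈ S
      · simp [hg, ha, (hSs ha).2 n]
      · simp [hg, ha]
    rw [this]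
    exact (AEStronglyMeasurable.stronglyMeasurable_mk _).indicator hSm
  have hgx : ∀ x, StronglyMeasurable fun a => g a x := by
    intro x
    obtain ⟨v, hv, hvx⟩ := mem_closure_iff_seq_limit.1 (TopologicalSpace.denseRange_denseSeq X x)
    refine stronglyMeasurable_of_tendsto Filter.atTop (f := fun n a => g a (v n)) ?_ ?_
    · intro n
      obtain ⟨i, hi⟩ := hv n
      rw [← hi]; exact hgd i
    · exact tendsto_pi_nhds.2 fun a => ((hgc a).tendsto x).comp hvx
  have hgm : StronglyMeasurable (Function.uncurry fun x a => g a x) :=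
    stronglyMeasurable_uncurry_of_continuous_of_stronglyMeasurable hgc hgx
  refine ⟨fun z => g z.1 z.2, hgm.comp_measurable measurable_swap, ?_⟩
  have hSae : ∀ᵐ a ∂μ, a ∈ S := by rw [ae_iff]; exact hS
  filter_upwards [Measure.quasiMeasurePreserving_fst.ae hSae] with z hz
  simp [hg, hz, Function.uncurry]

end JointMeasurability

/-! ### Powers of two in [0,∞] -/

section TwoPow

/-- The number `2^x`, as an element of `[0,∞]`. -/
def tw (x : ℝ) : ℝ≥0∞ := ENNReal.ofReal ((2 : ℝ) ^ x)

theorem tw_add (x y : ℝ) : tw (x + y) = tw x * tw y := by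
  unfold tw
  rw [Real.rpow_add (by norm_num), ENNReal.ofReal_mul (by positivity)]

theorem tw_zero : tw 0 = 1 := by simp [tw]

theorem tw_ne_zero (x : ℝ) : tw x ≠ 0 := by
  have : (0 : ℝ) < 2 ^ x := by positivity
  simpa [tw] using this

theorem tw_ne_top (x : ℝ) : tw x ≠ ⊤ := ENNReal.ofReal_ne_top

theorem tw_mono {x y : ℝ} (h : x ≤ y) : tw x ≤ tw y :=
  ENNReal.ofReal_le_ofReal (Real.rpow_le_rpow_of_exponent_le (by norm_num) h)

theorem tw_rpow (x y : ℝ) : tw x ^ y = tw (x * y) := by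
  unfold tw
  rw [ENNReal.ofReal_rpow_of_pos (by positivity), ← Real.rpow_mul (by norm_num)]

theorem tw_intCast (k : ℤ) : tw k = ENNReal.ofReal ((2 : ℝ) ^ k) := by
  simp [tw]

end TwoPow

/-! ### Averages against polynomially decaying kernels: Young and Bernstein inequalities -/

variable {N : ℕ}

/-- The kernel `2^{kN} (1 + 2^k |z|)^{-(N+1)}`. -/
def Phi (k : ℤ) (z : Space N) : ℝ := ((2 : ℝ) ^ k) ^ N / (1 + (2 : ℝ) ^ k * ‖z‖) ^ (N + 1)

theorem Phi_pos (k : ℤ) (z : Space N) : 0 < Phi k z := by unfold Phi; positivity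

theorem Phi_continuous (k : ℤ) : Continuous (Phi k : Space N → ℝ) := by
  unfold Phi
  refine continuous_const.div (by fun_prop) fun z => ?_
  positivity

theorem Phi_le (k : ℤ) (z : Space N) : Phi k z ≤ ((2 : ℝ) ^ k) ^ N := by
  unfold Phi
  refine div_le_self (by positivity) (one_le_pow₀ ?_)
  have : 0 ≤ (2 : ℝ) ^ k * ‖z‖ := by positivity
  linarith

/-- Peetre's inequality: 1 + 2^k|z| ≤ (1 + 2^k|w|)(1 + 2^k|z+w|). It allows averages to be moved
from one point to another at a polynomial cost in the distance measured in units 2^{-k}. -/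
theorem Phi_peetre (k : ℤ) (z w : Space N) :
    Phi k (z + w) ≤ (1 + (2 : ℝ) ^ k * ‖w‖) ^ (N + 1) * Phi k z := by
  unfold Phi
  rw [mul_div_assoc', div_le_div_iff₀ (by positivity) (by positivity)]
  have h : 1 + (2 : ℝ) ^ k * ‖z‖ ≤ (1 + (2 : ℝ) ^ k * ‖w‖) * (1 + (2 : ℝ) ^ k * ‖z + w‖) := by
    have h1 : ‖z‖ ≤ ‖z + w‖ + ‖w‖ := by simpa using norm_sub_le (z + w) w
    have h2 : (2 : ℝ) ^ k * ‖z‖ ≤ (2 : ℝ) ^ k * (‖z + w‖ + ‖w‖) := by gcongr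
    have h3 : 0 ≤ (2 : ℝ) ^ k * ‖w‖ * ((2 : ℝ) ^ k * ‖z + w‖) := by positivity
    nlinarith
  have h2 := pow_le_pow_left₀ (by positivity) h (N + 1)
  rw [mul_pow] at h2
  calc ((2 : ℝ) ^ k) ^ N * (1 + (2 : ℝ) ^ k * ‖z‖) ^ (N + 1)
      ≤ ((2 : ℝ) ^ k) ^ N * ((1 + (2 : ℝ) ^ k * ‖w‖) ^ (N + 1) *
          (1 + (2 : ℝ) ^ k * ‖z + w‖) ^ (N + 1)) := by gcongr
    _ = _ := by ring

/-- The mass of the kernels `Phi k`. -/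
def CPhi (N : ℕ) : ℝ≥0∞ := ∫⁻ z : Space N, ENNReal.ofReal (Phi 0 z)

theorem Phi_zero_integrable : Integrable (Phi 0 : Space N → ℝ) := by
  have h := integrable_one_add_norm (E := Space N) (μ := volume) (r := (N + 1 : ℝ))
    (by simp [Space])
  refine h.congr (Filter.Eventually.of_forall fun z => ?_)
  simp only [Phi, zpow_zero, one_pow, one_mul]
  rw [Real.rpow_neg (by positivity), one_div]
  norm_cast

theorem CPhi_ne_top (N : ℕ) : CPhi N ≠ ⊤ := by
  have := (Phi_zero_integrable (N := N)).hasFiniteIntegral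
  rw [hasFiniteIntegral_iff_ofReal (Filter.Eventually.of_forall fun z => (Phi_pos 0 z).le)] at this
  exact this.ne

theorem lintegral_Phi (k : ℤ) : ∫⁻ z : Space N, ENNReal.ofReal (Phi k z) = CPhi N := by
  have hc : (0 : ℝ) < 2 ^ k := by positivity
  have h1 : ∀ z : Space N, Phi k z = ((2 : ℝ) ^ k) ^ N * Phi 0 (((2 : ℝ) ^ k) • z) := by
    intro z
    simp only [Phi, zpow_zero, one_pow, one_mul, norm_smul, Real.norm_eq_abs, abs_of_pos hc]
    ring
  have hint : Integrable (Phi k : Space N → ℝ) := by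
    have := (Phi_zero_integrable (N := N)).comp_smul hc.ne'
    refine (this.const_mul (((2 : ℝ) ^ k) ^ N)).congr (Filter.Eventually.of_forall fun z => ?_)
    exact (h1 z).symm
  rw [CPhi, ← ofReal_integral_eq_lintegral_ofReal hint
    (Filter.Eventually.of_forall fun z => (Phi_pos k z).le),
    ← ofReal_integral_eq_lintegral_ofReal Phi_zero_integrable
    (Filter.Eventually.of_forall fun z => (Phi_pos 0 z).le)]
  congr 1
  simp_rw [h1]
  rw [integral_const_mul, Measure.integral_comp_smul]
  simp only [Space, finrank_euclideanSpace, Fintype.card_fin, abs_inv, abs_pow, abs_of_pos hc,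
    smul_eq_mul]
  field_simp

/-- The average `∫ Φ_k(x - y) f(y) dy`. -/
def cv (k : ℤ) (f : Space N → ℝ≥0∞) (x : Space N) : ℝ≥0∞ :=
  ∫⁻ y, ENNReal.ofReal (Phi k (x - y)) * f y

theorem cv_mono (k : ℤ) {f g : Space N → ℝ≥0∞} (h : ∀ᵐ y, f y ≤ g y) (x : Space N) :
    cv k f x ≤ cv k g x := by
  refine lintegral_mono_ae ?_
  filter_upwards [h] with y hy
  gcongr

theorem cv_congr (k : ℤ) {f g : Space N → ℝ≥0∞} (h : f =ᵐ[volume] g) (x : Space N) :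
    cv k f x = cv k g x := by
  refine lintegral_congr_ae ?_
  filter_upwards [h] with y hy
  rw [hy]

theorem Phi_sub_measurable (k : ℤ) :
    Measurable fun z : Space N × Space N => ENNReal.ofReal (Phi k (z.1 - z.2)) :=
  ENNReal.measurable_ofReal.comp
    ((Phi_continuous k).comp (continuous_fst.sub continuous_snd)).measurable

theorem cv_measurable (k : ℤ) {f : Space N → ℝ≥0∞} (hf : AEMeasurable f volume) :
    Measurable (cv k f) := by
  obtain ⟨g, hg, hfg⟩ := hf
  have : cv k f = cv k g := funext fun x => cv_congr k hfg x
  rw [this]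
  exact ((Phi_sub_measurable k).mul (hg.comp measurable_snd)).lintegral_prod_right'

theorem cv_joint_aemeasurable {α : Type*} [MeasurableSpace α] {μ : Measure α} [SFinite μ] (k : ℤ)
    {f : α → Space N → ℝ≥0∞} (hf : AEMeasurable (Function.uncurry f) (μ.prod volume)) :
    AEMeasurable (Function.uncurry fun a => cv k (f a)) (μ.prod volume) := by
  obtain ⟨g, hg, hfg⟩ := hf
  refine ⟨fun z => cv k (fun y => g (z.1, y)) z.2, ?_, ?_⟩
  · have h : Measurable fun w : (α × Space N) × Space N =>
        ENNReal.ofReal (Phi k (w.1.2 - w.2)) * g (w.1.1, w.2) :=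
      ((Phi_sub_measurable k).comp ((measurable_snd.comp measurable_fst).prodMk measurable_snd)).mul
        (hg.comp ((measurable_fst.comp measurable_fst).prodMk measurable_snd))
    exact h.lintegral_prod_right'
  · have h1 := Measure.ae_ae_of_ae_prod hfg
    filter_upwards [Measure.quasiMeasurePreserving_fst.ae h1] with z hz
    exact cv_congr k hz z.2

theorem cv_const_mul (k : ℤ) (c : ℝ≥0∞) (hc : c ≠ ⊤) (f : Space N → ℝ≥0∞) (x : Space N) :
    cv k (fun y => c * f y) x = c * cv k f x := by
  unfold cv
  rw [← lintegral_const_mul' _ _ hc]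
  refine lintegral_congr fun y => ?_
  ring

theorem lintegral_Phi_sub_left (k : ℤ) (x : Space N) :
    ∫⁻ y, ENNReal.ofReal (Phi k (x - y)) = CPhi N := by
  rw [← lintegral_Phi k]
  exact lintegral_sub_left_eq_self (fun z => ENNReal.ofReal (Phi k z)) x

theorem cv_one (k : ℤ) (x : Space N) : cv k (fun _ => 1) x = CPhi N := by
  simp [cv, lintegral_Phi_sub_left]

theorem cv_peetre (k : ℤ) (f : Space N → ℝ≥0∞) (x w : Space N) :
    cv k f (x + w) ≤ ENNReal.ofReal ((1 + (2 : ℝ) ^ k * ‖w‖) ^ (N + 1)) * cv k f x := by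
  unfold cv
  rw [← lintegral_const_mul' _ _ ENNReal.ofReal_ne_top]
  refine lintegral_mono fun y => ?_
  simp only
  rw [← mul_assoc, ← ENNReal.ofReal_mul (by positivity)]
  gcongr
  rw [add_sub_right_comm]
  exact Phi_peetre k _ _

/-- Young's inequality for the averages `cv k`. -/
theorem lp_cv_le {p : ℝ} (hp : 1 ≤ p) (k : ℤ) {f : Space N → ℝ≥0∞} (hf : AEMeasurable f volume) :
    lp p volume (cv k f) ≤ CPhi N * lp p volume f := by
  have h1 : ∀ x, cv k f x = ∫⁻ z, ENNReal.ofReal (Phi k z) * f (x - z) := by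
    intro x
    have := lintegral_sub_left_eq_self (μ := (volume : Measure (Space N)))
      (fun z => ENNReal.ofReal (Phi k z) * f (x - z)) x
    rw [← this]
    simp [cv]
  have hm : AEMeasurable (Function.uncurry fun x z : Space N => ENNReal.ofReal (Phi k z) * f (x - z))
      (volume.prod volume) := by
    refine AEMeasurable.mul ?_ ?_
    · exact (ENNReal.measurable_ofReal.comp
        ((Phi_continuous k).comp continuous_snd).measurable).aemeasurable
    · exact hf.comp_quasiMeasurePreserving (quasiMeasurePreserving_sub volume volume)
  rw [show cv k f = fun x => ∫⁻ z, ENNReal.ofReal (Phi k z) * f (x - z) from funext h1]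
  refine (lp_lintegral_le hp hm).trans ?_
  have h2 : ∀ z, lp p volume (fun x => ENNReal.ofReal (Phi k z) * f (x - z)) =
      ENNReal.ofReal (Phi k z) * lp p volume f := by
    intro z
    have h3 : AEMeasurable (fun x => f (x - z)) volume :=
      hf.comp_quasiMeasurePreserving (measurePreserving_sub_right volume z).quasiMeasurePreserving
    rw [lp_const_mul (by linarith) h3]
    congr 1
    unfold lp
    rw [lintegral_sub_right_eq_self (fun x => f x ^ p) z]
  simp_rw [h2]
  have h4 : Measurable fun z : Space N => ENNReal.ofReal (Phi k z) :=
    ENNReal.measurable_ofReal.comp (Phi_continuous k).measurable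
  rw [lintegral_mul_const _ h4, lintegral_Phi]

theorem lp_eq_eLpNorm' {α : Type*} [MeasurableSpace α] (p : ℝ) (μ : Measure α) (f : α → ℝ≥0∞) :
    lp p μ f = eLpNorm' f p μ := rfl

/-- Reading the average as an integral for a finite measure gives access to Hölder's inequality and
to the comparison of L^q norms. The mass of this measure depends neither on k nor on x. -/
theorem cv_eq_withDensity (k : ℤ) {f : Space N → ℝ≥0∞} (hf : AEMeasurable f volume) (x : Space N) :
    cv k f x = ∫⁻ y, f y ∂(volume.withDensity fun y => ENNReal.ofReal (Phi k (x - y))) := by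
  have h : Measurable fun y => ENNReal.ofReal (Phi k (x - y)) :=
    ENNReal.measurable_ofReal.comp
      ((Phi_continuous k).comp (continuous_const.sub continuous_id)).measurable
  rw [lintegral_withDensity_eq_lintegral_mul₀ h.aemeasurable hf]
  rfl

theorem lp_withDensity (k : ℤ) {p : ℝ} {f : Space N → ℝ≥0∞} (hf : AEMeasurable f volume)
    (x : Space N) :
    lp p (volume.withDensity fun y => ENNReal.ofReal (Phi k (x - y))) f =
      (cv k (fun y => f y ^ p) x) ^ (1 / p) := by
  rw [lp, cv_eq_withDensity k (hf.pow_const p)]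

/-- The kernel is at most 2^{kN}, and the p-th root leaves the Bernstein factor 2^{kN/p}. -/
theorem cv_rpow_le (k : ℤ) {p : ℝ} (hp : 0 < p) (f : Space N → ℝ≥0∞) (x : Space N) :
    (cv k (fun y => f y ^ p) x) ^ (1 / p) ≤ tw (k * (N / p)) * lp p volume f := by
  have h : cv k (fun y => f y ^ p) x ≤ tw (k * N) * ∫⁻ y, f y ^ p := by
    rw [← lintegral_const_mul' _ _ (tw_ne_top _)]
    refine lintegral_mono fun y => ?_
    simp only
    gcongr
    refine ENNReal.ofReal_le_ofReal ((Phi_le k _).trans (le_of_eq ?_))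
    rw [Real.rpow_mul (by norm_num)]
    norm_cast
  refine (ENNReal.rpow_le_rpow h (by positivity)).trans (le_of_eq ?_)
  rw [ENNReal.mul_rpow_of_nonneg _ _ (by positivity), tw_rpow, lp]
  congr 2
  ring

/-- Bernstein's inequality for the averages `cv k`: from `L^p` to `L^∞`. -/
theorem cv_le {p : ℝ} (hp : 1 ≤ p) (k : ℤ) {f : Space N → ℝ≥0∞} (hf : AEMeasurable f volume)
    (x : Space N) :
    cv k f x ≤ (1 + CPhi N) * (tw (k * (N / p)) * lp p volume f) := by
  -- The L^1 norm for a finite measure is controlled by its L^p norm and its mass; the L^p norm for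
  -- this measure is then bounded by the supremum of the density.
  set ν := volume.withDensity fun y => ENNReal.ofReal (Phi k (x - y)) with hν
  have hu : ν Set.univ = CPhi N := by
    rw [hν, withDensity_apply _ MeasurableSet.univ, Measure.restrict_univ, lintegral_Phi_sub_left]
  have h1 : eLpNorm' f 1 ν ≤ eLpNorm' f p ν * ν Set.univ ^ (1 / (1 : ℝ) - 1 / p) :=
    eLpNorm'_le_eLpNorm'_mul_rpow_measure_univ one_pos hp
      (hf.mono_ac (withDensity_absolutelyContinuous _ _)).aestronglyMeasurable
  rw [hu, ← lp_eq_eLpNorm', ← lp_eq_eLpNorm', hν, lp_withDensity k hf x (p := p), ← hν] at h1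
  have h2 : cv k f x = lp 1 ν f := by simp [lp, cv_eq_withDensity k hf, hν]
  rw [h2, mul_comm]
  refine h1.trans ?_
  gcongr
  · exact cv_rpow_le k (by linarith) f x
  · have h3 : 1 / p ≤ 1 := by rw [div_le_one (by linarith)]; exact hp
    have h4 : 0 < 1 / p := by positivity
    calc CPhi N ^ (1 / 1 - 1 / p) ≤ (1 + CPhi N) ^ (1 / 1 - 1 / p) := by
          refine ENNReal.rpow_le_rpow le_add_self (by linarith)
      _ ≤ (1 + CPhi N) ^ (1 : ℝ) :=
          ENNReal.rpow_le_rpow_of_exponent_le le_self_add (by linarith)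
      _ = 1 + CPhi N := ENNReal.rpow_one _

/-- Bernstein's inequality for the averages `cv k`: from `L^{p/2}` to `L^p`. -/
theorem lp_cv_mul_le {p : ℝ} (hp : 2 ≤ p) (k : ℤ) {f g : Space N → ℝ≥0∞}
    (hf : AEMeasurable f volume) (hg : AEMeasurable g volume) :
    lp p volume (cv k fun y => f y * g y) ≤
      (1 + CPhi N) ^ 2 * (tw (k * (N / p)) * (lp p volume f * lp p volume g)) := by
  have hp1 : 1 < p := by linarith
  have hp0 : 0 < p := by linarith
  have hpq : p.HolderConjugate p.conjExponent := Real.HolderConjugate.conjExponent hp1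
  set q := p.conjExponent with hq
  have hq0 : 0 < q := hpq.symm.pos
  have hqp : q ≤ p := by
    rw [hq, Real.conjExponent, div_le_iff₀ (by linarith)]
    nlinarith
  have hq1 : 1 ≤ q := hpq.symm.lt.le
  -- Hölder's inequality with exponents p and q; since p ≥ 2, q ≤ p, and the L^q norm of g for the
  -- finite measure is at most its L^p norm up to a power of the mass. Only g pays the factor
  -- 2^{kN/p}; f stays inside an L^p average, whose L^p norm in x is Young's inequality in L^1
  -- applied to f^p.
  have key : ∀ x, cv k (fun y => f y * g y) x ≤
      ((1 + CPhi N) * (tw (k * (N / p)) * lp p volume g)) * (cv k (fun y => f y ^ p) x) ^ (1 / p) := by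
    intro x
    set ν := volume.withDensity fun y => ENNReal.ofReal (Phi k (x - y)) with hν
    have hac : ν ≪ volume := withDensity_absolutelyContinuous _ _
    have hu : ν Set.univ = CPhi N := by
      rw [hν, withDensity_apply _ MeasurableSet.univ, Measure.restrict_univ, lintegral_Phi_sub_left]
    have h1 : ∫⁻ y, f y * g y ∂ν ≤ lp p ν f * lp q ν g :=
      ENNReal.lintegral_mul_le_Lp_mul_Lq ν hpq (hf.mono_ac hac) (hg.mono_ac hac)
    have h2 : eLpNorm' g q ν ≤ eLpNorm' g p ν * ν Set.univ ^ (1 / q - 1 / p) :=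
      eLpNorm'_le_eLpNorm'_mul_rpow_measure_univ hq0 hqp (hg.mono_ac hac).aestronglyMeasurable
    rw [hu, ← lp_eq_eLpNorm', ← lp_eq_eLpNorm'] at h2
    have h3 : CPhi N ^ (1 / q - 1 / p) ≤ 1 + CPhi N := by
      have h4 : 1 / q ≤ 1 := by rw [div_le_one hq0]; exact hq1
      have h5 : 1 / p ≤ 1 / q := one_div_le_one_div_of_le hq0 hqp
      have h6 : 0 < 1 / p := by positivity
      calc CPhi N ^ (1 / q - 1 / p) ≤ (1 + CPhi N) ^ (1 / q - 1 / p) :=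
            ENNReal.rpow_le_rpow le_add_self (by linarith)
        _ ≤ (1 + CPhi N) ^ (1 : ℝ) :=
            ENNReal.rpow_le_rpow_of_exponent_le le_self_add (by linarith)
        _ = 1 + CPhi N := ENNReal.rpow_one _
    have h4 : lp q ν g ≤ (1 + CPhi N) * (tw (k * (N / p)) * lp p volume g) := by
      refine h2.trans ?_
      rw [mul_comm, hν, lp_withDensity k hg]
      gcongr
      exact cv_rpow_le k hp0 g x
    have h5 : AEMeasurable (fun y => f y * g y) volume := hf.mul hg
    rw [cv_eq_withDensity k h5]
    refine h1.trans ?_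
    rw [hν, lp_withDensity k hf, mul_comm]
    gcongr
  have hm : Measurable (cv k fun y => f y ^ p) := cv_measurable k (hf.pow_const p)
  refine (lp_mono hp0.le key).trans ?_
  rw [lp_const_mul hp0 (hm.pow_const _).aemeasurable]
  have h5 : lp p volume (fun x => cv k (fun y => f y ^ p) x ^ (1 / p)) ≤
      (1 + CPhi N) * lp p volume f := by
    have h6 := lp_cv_le (le_refl (1 : ℝ)) k (hf.pow_const p)
    simp only [lp, ENNReal.rpow_one, one_div, inv_one] at h6
    unfold lp
    simp_rw [← ENNReal.rpow_mul, one_div_mul_cancel hp0.ne', ENNReal.rpow_one]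
    refine (ENNReal.rpow_le_rpow h6 (by positivity)).trans ?_
    rw [ENNReal.mul_rpow_of_nonneg _ _ (by positivity)]
    gcongr
    calc CPhi N ^ (1 / p) ≤ (1 + CPhi N) ^ (1 / p) :=
            ENNReal.rpow_le_rpow le_add_self (by positivity)
        _ ≤ (1 + CPhi N) ^ (1 : ℝ) :=
            ENNReal.rpow_le_rpow_of_exponent_le le_self_add (by
              rw [div_le_one hp0]; linarith)
        _ = 1 + CPhi N := ENNReal.rpow_one _
  calc _ ≤ ((1 + CPhi N) * (tw (k * (N / p)) * lp p volume g)) *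
        ((1 + CPhi N) * lp p volume f) := by gcongr
    _ = _ := by ring

/-! ### Tempered distributions and integrals of Schwartz functions depending on a parameter -/

/-- Scalar tempered distributions. -/
abbrev Dist (N : ℕ) : Type := 𝓢(Space N, ℂ) →L[ℂ] ℂ

section Aux

variable {E : Type*} [NormedAddCommGroup E] [NormedSpace ℝ E]

theorem exists_seminorm_comp_le (L : 𝓢(E, ℂ) →L[ℂ] 𝓢(E, ℂ)) (k n : ℕ) :
    ∃ s : Finset (ℕ × ℕ), ∃ C : ℝ, 0 ≤ C ∧ ∀ f, SchwartzMap.seminorm ℂ k n (L f) ≤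
      C * ∑ i ∈ s, SchwartzMap.seminorm ℂ i.1 i.2 f := by
  obtain ⟨s, C, -, hC⟩ := Seminorm.bound_of_continuous (schwartz_withSeminorms ℂ E ℂ)
    ((SchwartzMap.seminorm ℂ k n).comp (L : 𝓢(E, ℂ) →ₗ[ℂ] 𝓢(E, ℂ))) (by
      change Continuous fun f => SchwartzMap.seminorm ℂ k n (L f)
      exact ((schwartz_withSeminorms ℂ E ℂ).continuous_seminorm (k, n)).comp L.continuous)
  refine ⟨s, C, C.2, fun f => (hC f).trans ?_⟩
  change (C : ℝ) * (s.sup (schwartzSeminormFamily ℂ E ℂ)) f ≤ _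
  gcongr
  refine Seminorm.finset_sup_apply_le (Finset.sum_nonneg fun i _ => apply_nonneg _ _) fun i hi => ?_
  exact Finset.single_le_sum (f := fun i : ℕ × ℕ => SchwartzMap.seminorm ℂ i.1 i.2 f)
      (fun i _ => apply_nonneg _ _) hi

variable {α : Type*} [TopologicalSpace α]
    [MeasurableSpace α] [OpensMeasurableSpace α] {μ : Measure α} {K : α → 𝓢(E, ℂ)}

theorem integrable_seminorm_comp (hK : Continuous K)
    (hint : ∀ k n : ℕ, Integrable (fun a => SchwartzMap.seminorm ℂ k n (K a)) μ)
    (L : 𝓢(E, ℂ) →L[ℂ] 𝓢(E, ℂ)) (k n : ℕ) :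
    Integrable (fun a => SchwartzMap.seminorm ℂ k n (L (K a))) μ := by
  obtain ⟨s, C, -, hC⟩ := exists_seminorm_comp_le L k n
  refine Integrable.mono' ((integrable_finsetSum s fun i _ => hint i.1 i.2).const_mul C) ?_ ?_
  · exact (((schwartz_withSeminorms ℂ E ℂ).continuous_seminorm (k, n)).comp
      (L.continuous.comp hK)).aestronglyMeasurable
  · refine Filter.Eventually.of_forall fun a => ?_
    rw [Real.norm_of_nonneg (apply_nonneg _ _)]
    exact hC _

theorem continuous_eval (y : E) : Continuous fun f : 𝓢(E, ℂ) => f y :=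
  (BoundedContinuousFunction.evalCLM ℂ y).continuous.comp
    (SchwartzMap.toBoundedContinuousFunctionCLM ℂ E ℂ).continuous

/-- Differentiation under the integral sign. The domination is by a seminorm of the derivative,
which does not depend on the point. -/
theorem lineDeriv_of_eq_integral (hK : Continuous K)
    (hint : ∀ k n : ℕ, Integrable (fun a => SchwartzMap.seminorm ℂ k n (K a)) μ)
    {W : 𝓢(E, ℂ)} (hW : ∀ y, W y = ∫ a, K a y ∂μ) (v y : E) :
    (LineDeriv.lineDerivOp v W) y = ∫ a, (LineDeriv.lineDerivOp v (K a)) y ∂μ := by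
  have hc : Continuous fun f : 𝓢(E, ℂ) => LineDeriv.lineDerivOp v f :=
    (LineDeriv.lineDerivOpCLM ℂ 𝓢(E, ℂ) v).continuous
  have hline : ∀ (f : 𝓢(E, ℂ)) (t : ℝ),
      HasDerivAt (fun t : ℝ => f (y + t • v)) ((LineDeriv.lineDerivOp v f) (y + t • v)) t := by
    intro f t
    rw [SchwartzMap.lineDerivOp_apply_eq_fderiv]
    have h1 : HasDerivAt (fun t : ℝ => y + t • v) v t := by
      simpa using ((hasDerivAt_id t).smul_const v).const_add y
    exact (f.hasFDerivAt (y + t • v)).comp_hasDerivAt t h1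
  have h := (hasDerivAt_integral_of_dominated_loc_of_deriv_le (μ := μ) (𝕜 := ℝ)
    (F := fun t a => K a (y + t • v))
    (F' := fun t a => (LineDeriv.lineDerivOp v (K a)) (y + t • v)) (x₀ := 0)
    (bound := fun a => SchwartzMap.seminorm ℂ 0 0
      ((LineDeriv.lineDerivOpCLM ℂ 𝓢(E, ℂ) v) (K a))) (s := Set.univ) Filter.univ_mem
    (Filter.Eventually.of_forall fun t => ((continuous_eval _).comp hK).aestronglyMeasurable)
    ((hint 0 0).mono' ((continuous_eval _).comp hK).aestronglyMeasurable
      (Filter.Eventually.of_forall fun a => SchwartzMap.norm_le_seminorm ℂ _ _))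
    ((continuous_eval _).comp (hc.comp hK)).aestronglyMeasurable
    (Filter.Eventually.of_forall fun a t _ => SchwartzMap.norm_le_seminorm ℂ _ _)
    (integrable_seminorm_comp hK hint _ 0 0)
    (Filter.Eventually.of_forall fun a t _ => hline _ t)).2
  have h2 := hline W 0
  simp_rw [hW] at h2
  simpa using h2.unique h

theorem iteratedLineDeriv_of_eq_integral (hK : Continuous K)
    (hint : ∀ k n : ℕ, Integrable (fun a => SchwartzMap.seminorm ℂ k n (K a)) μ)
    {W : 𝓢(E, ℂ)} (hW : ∀ y, W y = ∫ a, K a y ∂μ) (n : ℕ) :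
    ∀ (v : Fin n → E) (y : E), (LineDeriv.iteratedLineDerivOp v W) y =
      ∫ a, (LineDeriv.iteratedLineDerivOp v (K a)) y ∂μ := by
  induction n with
  | zero => intro v y; simpa using hW y
  | succ n ih =>
    intro v y
    have h : Continuous fun f : 𝓢(E, ℂ) => LineDeriv.iteratedLineDerivOp (Fin.tail v) f :=
      (LineDeriv.iteratedLineDerivOpCLM ℂ 𝓢(E, ℂ) (Fin.tail v)).continuous
    simp only [LineDeriv.iteratedLineDerivOp_succ_left]
    exact lineDeriv_of_eq_integral (h.comp hK)
      (integrable_seminorm_comp hK hint (LineDeriv.iteratedLineDerivOpCLM ℂ 𝓢(E, ℂ) (Fin.tail v)))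
      (fun y => ih (Fin.tail v) y) (v 0) y

/-- A functional dominated by the norm of the image under an injective linear map factors through a
bounded functional. -/
theorem exists_functional_comp_eq {V X : Type*} [AddCommGroup V] [Module ℂ V]
    [NormedAddCommGroup X] [NormedSpace ℂ X] (J₀ : V → X)
    (hadd : ∀ f g, J₀ (f + g) = J₀ f + J₀ g) (hsmul : ∀ (c : ℂ) f, J₀ (c • f) = c • J₀ f)
    (hinj : Function.Injective J₀)
    (U : V → ℂ) (U' : V →ₗ[ℂ] ℂ) (hU : ∀ f, U' f = U f) (C : ℝ) (h : ∀ f, ‖U f‖ ≤ C * ‖J₀ f‖) :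
    ∃ F : X →L[ℂ] ℂ, ∀ f, F (J₀ f) = U f := by
  let J : V →ₗ[ℂ] X := { toFun := J₀, map_add' := hadd, map_smul' := hsmul }
  let e := LinearEquiv.ofInjective J hinj
  let F₀ : LinearMap.range J →ₗ[ℂ] ℂ := U' ∘ₗ e.symm.toLinearMap
  have hF₀ : ∀ f (h : J f ∈ LinearMap.range J), F₀ ⟨J f, h⟩ = U f := by
    intro f h
    have : e.symm ⟨J f, h⟩ = f := by
      rw [LinearEquiv.symm_apply_eq]; rfl
    simp [F₀, this, hU]
  have hF₀b : ∀ x : LinearMap.range J, ‖F₀ x‖ ≤ C * ‖x‖ := by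
    rintro ⟨x, hx⟩
    obtain ⟨f, rfl⟩ := LinearMap.mem_range.1 hx
    rw [hF₀]
    exact h f
  obtain ⟨F, hF, -⟩ := exists_extension_norm_eq (LinearMap.range J) (F₀.mkContinuous C hF₀b)
  refine ⟨F, fun f => ?_⟩
  have hm : J f ∈ LinearMap.range J := LinearMap.mem_range_self J f
  exact (hF ⟨J f, hm⟩).trans (hF₀ f hm)

end Aux

section Interchange

open BoundedContinuousFunction

/-- The index set of the Banach space in which Schwartz functions are embedded. -/
def SchwartzIndex (N : ℕ) : Type := (ℕ × ℕ) × Space N × (ℕ → Space N)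

/-- With the discrete topology every bounded function is continuous, so the target is simply the
Banach space of bounded functions. Directions are indexed by ℕ so that the index type does not
depend on the order of the derivative; an order n uses the first n of them. -/
instance : TopologicalSpace (SchwartzIndex N) := ⊥

instance : DiscreteTopology (SchwartzIndex N) := ⟨rfl⟩

open Classical in
/-- The values `|x|^k D^n f(x)(v₁, …, vₙ)` for `(k,n) ∈ s` and `|vᵢ| ≤ 1`. -/
def derivValue (s : Finset (ℕ × ℕ)) (f : 𝓢(Space N, ℂ)) (z : SchwartzIndex N) : ℂ :=
  if z.1 ∈ s ∧ ∀ j, ‖z.2.2 j‖ ≤ 1 then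
    (‖z.2.1‖ ^ z.1.1 : ℝ) • LineDeriv.iteratedLineDerivOp (fun j : Fin z.1.2 => z.2.2 j) f z.2.1
  else 0

theorem norm_multilinear_le_of_unit {n : ℕ} (T : Space N [×n]→L[ℝ] ℂ) {C : ℝ} (hC : 0 ≤ C)
    (h : ∀ v : Fin n → Space N, (∀ j, ‖v j‖ ≤ 1) → ‖T v‖ ≤ C) : ‖T‖ ≤ C := by
  refine T.opNorm_le_bound hC fun m => ?_
  have h1 : m = fun j => ‖m j‖ • (‖m j‖⁻¹ • m j) := by
    ext1 j
    by_cases hj : m j = 0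
    · simp [hj]
    · rw [smul_smul, mul_inv_cancel₀ (norm_ne_zero_iff.2 hj), one_smul]
  have h2 : T m = (∏ j, ‖m j‖) • T (fun j => ‖m j‖⁻¹ • m j) := by
    conv_lhs => rw [h1]
    exact T.map_smul_univ _ _
  rw [h2, norm_smul, norm_prod]
  simp only [norm_norm]
  rw [mul_comm]
  gcongr
  refine h _ fun j => ?_
  rw [norm_smul, norm_inv, norm_norm]
  exact inv_mul_le_one

theorem norm_iteratedLineDeriv_le {n : ℕ} (f : 𝓢(Space N, ℂ)) (v : Fin n → Space N)
    (hv : ∀ j, ‖v j‖ ≤ 1) (x : Space N) :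
    ‖LineDeriv.iteratedLineDerivOp v f x‖ ≤ ‖iteratedFDeriv ℝ n f x‖ := by
  rw [SchwartzMap.iteratedLineDerivOp_eq_iteratedFDeriv]
  refine (ContinuousMultilinearMap.le_opNorm _ _).trans (mul_le_of_le_one_right (norm_nonneg _) ?_)
  exact Finset.prod_le_one (fun _ _ => norm_nonneg _) fun j _ => hv j

theorem norm_derivValue_le (s : Finset (ℕ × ℕ)) (f : 𝓢(Space N, ℂ)) (z : SchwartzIndex N) :
    ‖derivValue s f z‖ ≤ ∑ i ∈ s, SchwartzMap.seminorm ℂ i.1 i.2 f := by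
  unfold derivValue
  split_ifs with h
  · refine le_trans ?_ (Finset.single_le_sum
      (f := fun i : ℕ × ℕ => SchwartzMap.seminorm ℂ i.1 i.2 f) (fun i _ => apply_nonneg _ _) h.1)
    refine le_trans ?_ (SchwartzMap.le_seminorm ℂ z.1.1 z.1.2 f z.2.1)
    rw [norm_smul, norm_pow, norm_norm]
    gcongr
    exact norm_iteratedLineDeriv_le f _ (fun j => h.2 j) _
  · simpa using Finset.sum_nonneg fun i _ => apply_nonneg _ _

/-- The embedding of Schwartz functions in a space of bounded functions. -/
def derivEmb (s : Finset (ℕ × ℕ)) (f : 𝓢(Space N, ℂ)) : SchwartzIndex N →ᵇ ℂ :=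
  ofNormedAddCommGroupDiscrete (derivValue s f) _ (norm_derivValue_le s f)

theorem derivEmb_apply (s : Finset (ℕ × ℕ)) (f : 𝓢(Space N, ℂ)) (z : SchwartzIndex N) :
    derivEmb s f z = derivValue s f z := rfl

theorem derivEmb_add (s : Finset (ℕ × ℕ)) (f g : 𝓢(Space N, ℂ)) :
    derivEmb s (f + g) = derivEmb s f + derivEmb s g := by
  ext z
  simp only [derivEmb_apply, coe_add, Pi.add_apply, derivValue]
  split_ifs
  · rw [LineDeriv.iteratedLineDerivOp_add, _root_.add_apply, smul_add]
  · simp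

theorem derivEmb_smul (s : Finset (ℕ × ℕ)) (c : ℂ) (f : 𝓢(Space N, ℂ)) :
    derivEmb s (c • f) = c • derivEmb s f := by
  ext z
  simp only [derivEmb_apply, coe_smul, derivValue]
  split_ifs
  · rw [LineDeriv.iteratedLineDerivOp_smul, _root_.smul_apply, smul_comm]
  · simp

theorem norm_derivEmb_le (s : Finset (ℕ × ℕ)) (f : 𝓢(Space N, ℂ)) :
    ‖derivEmb s f‖ ≤ ∑ i ∈ s, SchwartzMap.seminorm ℂ i.1 i.2 f :=
  (norm_le (Finset.sum_nonneg fun _ _ => apply_nonneg _ _)).2 (norm_derivValue_le s f)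

theorem seminorm_le_norm_derivEmb {s : Finset (ℕ × ℕ)} {i : ℕ × ℕ} (hi : i ∈ s)
    (f : 𝓢(Space N, ℂ)) : SchwartzMap.seminorm ℂ i.1 i.2 f ≤ ‖derivEmb s f‖ := by
  have h0 : 0 ≤ ‖derivEmb s f‖ := by positivity
  refine SchwartzMap.seminorm_le_bound ℂ i.1 i.2 f h0 fun x => ?_
  have h1 : ‖(‖x‖ ^ i.1) • iteratedFDeriv ℝ i.2 f x‖ ≤ ‖derivEmb s f‖ := by
    refine norm_multilinear_le_of_unit _ h0 fun v hv => ?_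
    let w : ℕ → Space N := fun j => if h : j < i.2 then v ⟨j, h⟩ else 0
    have hw : ∀ j, ‖w j‖ ≤ 1 := fun j => by
      by_cases h : j < i.2
      · simpa [w, h] using hv _
      · simp [w, h]
    have hwv : (fun j : Fin i.2 => w j) = v := by ext1 j; simp [w]
    have h2 : ‖derivValue s f (i, x, w)‖ ≤ ‖derivEmb s f‖ :=
      (derivEmb s f).norm_coe_le_norm (i, x, w)
    simp only [derivValue, hi, hw, implies_true, and_self, if_true] at h2
    rw [hwv, SchwartzMap.iteratedLineDerivOp_eq_iteratedFDeriv] at h2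
    exact h2
  rwa [norm_smul, norm_pow, norm_norm] at h1

theorem continuous_derivEmb (s : Finset (ℕ × ℕ)) : Continuous (derivEmb s : 𝓢(Space N, ℂ) → _) := by
  let J : 𝓢(Space N, ℂ) →ₗ[ℂ] (SchwartzIndex N →ᵇ ℂ) :=
    { toFun := derivEmb s, map_add' := derivEmb_add s, map_smul' := derivEmb_smul s }
  change Continuous J
  refine continuous_of_continuousAt_zero J ?_
  rw [ContinuousAt, map_zero]
  refine squeeze_zero_norm (norm_derivEmb_le s) ?_
  have : Continuous fun f : 𝓢(Space N, ℂ) => ∑ i ∈ s, SchwartzMap.seminorm ℂ i.1 i.2 f :=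
    continuous_finsetSum _ fun i _ =>
      (schwartz_withSeminorms ℂ (Space N) ℂ).continuous_seminorm i
  simpa using this.tendsto 0

theorem Dist.exists_bound (U : Dist N) :
    ∃ s : Finset (ℕ × ℕ), ∃ C : ℝ, 0 ≤ C ∧ ∀ f, ‖U f‖ ≤ C * ‖derivEmb s f‖ := by
  obtain ⟨s, C, -, hC⟩ := Seminorm.bound_of_continuous (schwartz_withSeminorms ℂ (Space N) ℂ)
    ((normSeminorm ℂ ℂ).comp (U : 𝓢(Space N, ℂ) →ₗ[ℂ] ℂ)) (by
      change Continuous fun f => ‖U f‖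
      exact U.continuous.norm)
  refine ⟨s, C, C.2, fun f => (hC f).trans ?_⟩
  change (C : ℝ) * (s.sup (schwartzSeminormFamily ℂ (Space N) ℂ)) f ≤ _
  gcongr
  refine Seminorm.finset_sup_apply_le (by positivity) fun i hi => ?_
  exact seminorm_le_norm_derivEmb hi f

/-- A tempered distribution commutes with integrals of Schwartz functions depending continuously on
a parameter. -/
theorem Dist.integral_comm {α : Type*} [TopologicalSpace α] [SecondCountableTopology α]
    [MeasurableSpace α] [OpensMeasurableSpace α] (U : Dist N) {μ : Measure α}
    {K : α → 𝓢(Space N, ℂ)} (hK : Continuous K)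
    (hint : ∀ k n : ℕ, Integrable (fun a => SchwartzMap.seminorm ℂ k n (K a)) μ)
    {W : 𝓢(Space N, ℂ)} (hW : ∀ y, W y = ∫ a, K a y ∂μ) :
    Integrable (fun a => U (K a)) μ ∧ U W = ∫ a, U (K a) ∂μ := by
  obtain ⟨s₀, C, hC0, hC⟩ := U.exists_bound
  -- The pair (0,0) is added so that the values of f itself are part of the image, which makes the
  -- embedding injective.
  set s : Finset (ℕ × ℕ) := insert (0, 0) s₀ with hs
  have hss : ∀ f : 𝓢(Space N, ℂ), ‖derivEmb s₀ f‖ ≤ ‖derivEmb s f‖ := by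
    intro f
    refine (norm_le (norm_nonneg (derivEmb s f))).2 fun z => ?_
    refine le_trans ?_ ((derivEmb s f).norm_coe_le_norm z)
    rw [derivEmb_apply, derivEmb_apply]
    unfold derivValue
    by_cases h : z.1 ∈ s₀ ∧ ∀ j, ‖z.2.2 j‖ ≤ 1
    · have h' : z.1 ∈ s ∧ ∀ j, ‖z.2.2 j‖ ≤ 1 := ⟨by simp [hs, h.1], h.2⟩
      rw [if_pos h, if_pos h']
    · rw [if_neg h]; simp
  have hinj : Function.Injective (derivEmb s : 𝓢(Space N, ℂ) → _) := by
    intro f g hfg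
    ext y
    have h : derivValue s f ((0, 0), y, fun _ => 0) = derivValue s g ((0, 0), y, fun _ => 0) :=
      congrArg (fun F : SchwartzIndex N →ᵇ ℂ => F ((0, 0), y, fun _ => 0)) hfg
    simpa [derivValue, hs] using h
  -- By Hahn-Banach the distribution is the restriction of a bounded functional on a Banach space,
  -- where bounded functionals commute with Bochner integrals. It remains to identify the Bochner
  -- integral with the image of `W`, which is checked coordinate by coordinate.
  obtain ⟨F, hFU⟩ := exists_functional_comp_eq (derivEmb s) (derivEmb_add s) (derivEmb_smul s)
    hinj U (U : 𝓢(Space N, ℂ) →ₗ[ℂ] ℂ) (fun _ => rfl) C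
    (fun f => (hC f).trans (mul_le_mul_of_nonneg_left (hss f) hC0))
  have hJi : Integrable (fun a => derivEmb s (K a)) μ := by
    refine Integrable.mono' (integrable_finsetSum s fun i _ => hint i.1 i.2)
      ((continuous_derivEmb s).comp hK).aestronglyMeasurable ?_
    exact Filter.Eventually.of_forall fun a => norm_derivEmb_le s _
  have hJW : derivEmb s W = ∫ a, derivEmb s (K a) ∂μ := by
    ext z
    have h1 : (∫ a, derivEmb s (K a) ∂μ) z = ∫ a, derivEmb s (K a) z ∂μ :=
      ((evalCLM ℝ z).integral_comp_comm hJi).symm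
    rw [h1]
    simp only [derivEmb_apply]
    unfold derivValue
    split_ifs with h
    · rw [integral_smul, iteratedLineDeriv_of_eq_integral hK hint hW]
    · simp
  refine ⟨?_, ?_⟩
  · exact (F.integrable_comp hJi).congr (Filter.Eventually.of_forall fun a => hFU _)
  · rw [← hFU W, hJW, ← F.integral_comp_comm hJi]
    simp_rw [hFU]

end Interchange

/-! ### Translations, derivatives and convolutions of Schwartz functions -/

/-- The translation `g ↦ g(· - x)` of Schwartz functions. -/
abbrev tr (x : Space N) : 𝓢(Space N, ℂ) →L[ℂ] 𝓢(Space N, ℂ) := SchwartzMap.compSubConstCLM ℂ x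

/-- The directional derivative of a Schwartz function. -/
abbrev dv (v : Space N) : 𝓢(Space N, ℂ) →L[ℂ] 𝓢(Space N, ℂ) :=
  LineDeriv.lineDerivOpCLM ℂ 𝓢(Space N, ℂ) v

theorem tr_apply (x : Space N) (g : 𝓢(Space N, ℂ)) (y : Space N) : tr x g y = g (y - x) := rfl

theorem dv_apply (v : Space N) (g : 𝓢(Space N, ℂ)) (y : Space N) : dv v g y = fderiv ℝ g y v :=
  SchwartzMap.lineDerivOp_apply_eq_fderiv v g y

theorem dv_tr (v x : Space N) (g : 𝓢(Space N, ℂ)) : dv v (tr x g) = tr x (dv v g) := by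
  ext y
  rw [dv_apply, tr_apply, dv_apply]
  have : (⇑(tr x g)) = fun y => g (y - x) := rfl
  rw [this, fderiv_comp_sub]

theorem norm_pow_le_add (a b : Space N) (k : ℕ) : ‖a + b‖ ^ k ≤ 2 ^ k * (‖a‖ ^ k + ‖b‖ ^ k) := by
  calc ‖a + b‖ ^ k ≤ (‖a‖ + ‖b‖) ^ k := pow_le_pow_left₀ (norm_nonneg _) (norm_add_le _ _) k
    _ ≤ 2 ^ (k - 1) * (‖a‖ ^ k + ‖b‖ ^ k) := add_pow_le (norm_nonneg _) (norm_nonneg _) k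
    _ ≤ 2 ^ k * (‖a‖ ^ k + ‖b‖ ^ k) := by
        gcongr
        · norm_num
        · omega

theorem seminorm_tr_le (k n : ℕ) (g : 𝓢(Space N, ℂ)) (x : Space N) :
    SchwartzMap.seminorm ℂ k n (tr x g) ≤
      2 ^ k * (SchwartzMap.seminorm ℂ k n g + ‖x‖ ^ k * SchwartzMap.seminorm ℂ 0 n g) := by
  refine SchwartzMap.seminorm_le_bound ℂ k n _ (by positivity) fun y => ?_
  have h1 : iteratedFDeriv ℝ n (tr x g) y = iteratedFDeriv ℝ n g (y - x) :=
    iteratedFDeriv_comp_sub n x y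
  rw [h1]
  have h2 := norm_pow_le_add (y - x) x k
  rw [sub_add_cancel] at h2
  calc ‖y‖ ^ k * ‖iteratedFDeriv ℝ n g (y - x)‖
      ≤ 2 ^ k * (‖y - x‖ ^ k + ‖x‖ ^ k) * ‖iteratedFDeriv ℝ n g (y - x)‖ := by gcongr
    _ = 2 ^ k * (‖y - x‖ ^ k * ‖iteratedFDeriv ℝ n g (y - x)‖ +
        ‖x‖ ^ k * ‖iteratedFDeriv ℝ n g (y - x)‖) := by ring
    _ ≤ _ := by
        gcongr
        · exact SchwartzMap.le_seminorm ℂ k n g (y - x)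
        · exact SchwartzMap.norm_iteratedFDeriv_le_seminorm ℂ g n (y - x)

/-- Mean value inequality on the segment from y - x₀ to y - x. The weight |y|^k is transferred to
the points z of the segment, since |y - z| ≤ R. -/
theorem seminorm_tr_sub_tr_le (k n : ℕ) (g : 𝓢(Space N, ℂ)) (x x₀ : Space N) (R : ℝ)
    (hx : ‖x‖ ≤ R) (hx₀ : ‖x₀‖ ≤ R) :
    SchwartzMap.seminorm ℂ k n (tr x g - tr x₀ g) ≤
      2 ^ k * (SchwartzMap.seminorm ℂ k (n + 1) g + R ^ k * SchwartzMap.seminorm ℂ 0 (n + 1) g) *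
        ‖x - x₀‖ := by
  have hR : 0 ≤ R := (norm_nonneg x).trans hx
  refine SchwartzMap.seminorm_le_bound ℂ k n _ (by positivity) fun y => ?_
  have h1 : iteratedFDeriv ℝ n (⇑(tr x g - tr x₀ g)) y =
      iteratedFDeriv ℝ n g (y - x) - iteratedFDeriv ℝ n g (y - x₀) := by
    have h2 : ∀ z, iteratedFDeriv ℝ n (tr z g) y = iteratedFDeriv ℝ n g (y - z) :=
      fun z => iteratedFDeriv_comp_sub n z y
    rw [← h2, ← h2]
    exact iteratedFDeriv_sub_apply ((tr x g).smooth ⊤ |>.contDiffAt.of_le (by exact_mod_cast le_top))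
      ((tr x₀ g).smooth ⊤ |>.contDiffAt.of_le (by exact_mod_cast le_top))
  rw [h1]
  have hseg : ∀ z ∈ segment ℝ (y - x₀) (y - x), ‖y‖ ^ k * ‖iteratedFDeriv ℝ (n + 1) g z‖ ≤
      2 ^ k * (SchwartzMap.seminorm ℂ k (n + 1) g + R ^ k * SchwartzMap.seminorm ℂ 0 (n + 1) g) := by
    intro z hz
    obtain ⟨a, b, ha, hb, hab, rfl⟩ := hz
    set z := a • (y - x₀) + b • (y - x) with hz
    have hw : ‖y - z‖ ≤ R := by
      have : y - z = a • x₀ + b • x := by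
        rw [hz]
        have : y = (a + b) • y := by rw [hab, one_smul]
        nth_rewrite 1 [this]
        simp only [smul_sub, add_smul]
        abel
      rw [this]
      calc ‖a • x₀ + b • x‖ ≤ ‖a • x₀‖ + ‖b • x‖ := norm_add_le _ _
        _ = a * ‖x₀‖ + b * ‖x‖ := by
            rw [norm_smul, norm_smul, Real.norm_of_nonneg ha, Real.norm_of_nonneg hb]
        _ ≤ a * R + b * R := by gcongr
        _ = R := by rw [← add_mul, hab, one_mul]
    have h2 := norm_pow_le_add z (y - z) k
    rw [add_sub_cancel] at h2
    calc ‖y‖ ^ k * ‖iteratedFDeriv ℝ (n + 1) g z‖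
        ≤ 2 ^ k * (‖z‖ ^ k + ‖y - z‖ ^ k) * ‖iteratedFDeriv ℝ (n + 1) g z‖ := by gcongr
      _ = 2 ^ k * (‖z‖ ^ k * ‖iteratedFDeriv ℝ (n + 1) g z‖ +
          ‖y - z‖ ^ k * ‖iteratedFDeriv ℝ (n + 1) g z‖) := by ring
      _ ≤ _ := by
          gcongr
          · exact SchwartzMap.le_seminorm ℂ k (n + 1) g z
          · exact SchwartzMap.norm_iteratedFDeriv_le_seminorm ℂ g (n + 1) z
  by_cases hy : ‖y‖ ^ k = 0
  · rw [hy, zero_mul]; positivity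
  have hypos : 0 < ‖y‖ ^ k := lt_of_le_of_ne (by positivity) (Ne.symm hy)
  have h3 : ‖iteratedFDeriv ℝ n g (y - x) - iteratedFDeriv ℝ n g (y - x₀)‖ ≤
      (2 ^ k * (SchwartzMap.seminorm ℂ k (n + 1) g +
        R ^ k * SchwartzMap.seminorm ℂ 0 (n + 1) g)) / ‖y‖ ^ k * ‖(y - x) - (y - x₀)‖ := by
    refine Convex.norm_image_sub_le_of_norm_fderiv_le (𝕜 := ℝ) (s := segment ℝ (y - x₀) (y - x))
      (fun z _ => ((g.smooth ⊤).differentiable_iteratedFDeriv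
          (by exact_mod_cast ENat.natCast_lt_top n) z)) (fun z hz => ?_)
      (convex_segment _ _) (left_mem_segment ℝ _ _) (right_mem_segment ℝ _ _)
    rw [norm_fderiv_iteratedFDeriv, le_div_iff₀ hypos, mul_comm]
    exact hseg z hz
  have h4 : ‖(y - x) - (y - x₀)‖ = ‖x - x₀‖ := by
    rw [sub_sub_sub_cancel_left, norm_sub_rev]
  rw [h4] at h3
  calc _ ≤ ‖y‖ ^ k * _ := mul_le_mul_of_nonneg_left h3 hypos.le
    _ = _ := by field_simp

theorem continuous_tr (g : 𝓢(Space N, ℂ)) : Continuous fun x : Space N => tr x g := by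
  rw [continuous_iff_continuousAt]
  intro x₀
  rw [ContinuousAt, (schwartz_withSeminorms ℂ (Space N) ℂ).tendsto_nhds]
  rintro ⟨k, n⟩ ε hε
  set A := 2 ^ k * (SchwartzMap.seminorm ℂ k (n + 1) g +
    (‖x₀‖ + 1) ^ k * SchwartzMap.seminorm ℂ 0 (n + 1) g) with hA
  have hA0 : 0 ≤ A := by positivity
  have h1 : ∀ᶠ x in nhds x₀, ‖x - x₀‖ < min 1 (ε / (A + 1)) := by
    have := Metric.ball_mem_nhds x₀ (show 0 < min 1 (ε / (A + 1)) by positivity)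
    filter_upwards [this] with x hx
    rwa [Metric.mem_ball, dist_eq_norm] at hx
  filter_upwards [h1] with x hx
  have hx1 : ‖x - x₀‖ < 1 := hx.trans_le (min_le_left _ _)
  have hx2 : ‖x - x₀‖ < ε / (A + 1) := hx.trans_le (min_le_right _ _)
  have hxR : ‖x‖ ≤ ‖x₀‖ + 1 := by
    have := norm_le_norm_add_norm_sub x₀ x
    rw [norm_sub_rev] at this
    linarith
  refine (seminorm_tr_sub_tr_le k n g x x₀ (‖x₀‖ + 1) hxR (by linarith)).trans_lt ?_
  rw [← hA]
  rw [lt_div_iff₀ (by positivity)] at hx2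
  nlinarith [norm_nonneg (x - x₀)]

/-- The convolution of Schwartz functions. -/
abbrev conv (f g : 𝓢(Space N, ℂ)) : 𝓢(Space N, ℂ) :=
  SchwartzMap.convolution (ContinuousLinearMap.mul ℂ ℂ) f g

theorem conv_apply (f g : 𝓢(Space N, ℂ)) (y : Space N) : conv f g y = ∫ x, f x * g (y - x) := by
  rw [SchwartzMap.convolution_apply]; rfl

/-- A convolution is a superposition of translates, and U passes under the integral. This is how
products of a test function with a smooth function x ↦ U(g(· - x)) are reduced to U applied to a
convolution, hence to a computation on the Fourier side. -/
theorem Dist.integral_tr_mul (U : Dist N) (g S : 𝓢(Space N, ℂ)) :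
    Integrable (fun x => S x * U (tr x g)) ∧ U (conv S g) = ∫ x, S x * U (tr x g) := by
  have h := U.integral_comm (μ := volume) (K := fun x => S x • tr x g) (W := conv S g)
    (S.continuous.smul (continuous_tr g)) (fun k n => ?_) (fun y => by
      rw [conv_apply]; rfl)
  · simpa [map_smul] using h
  · simp_rw [map_smul_eq_mul]
    have h1 := (S.integrable_pow_mul (volume : Measure (Space N)) 0)
    have h2 := (S.integrable_pow_mul (volume : Measure (Space N)) k)
    refine Integrable.mono' (((h1.const_mul (2 ^ k * SchwartzMap.seminorm ℂ k n g)).add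
      (h2.const_mul (2 ^ k * SchwartzMap.seminorm ℂ 0 n g)))) ?_ ?_
    · refine (S.continuous.norm.mul ?_).aestronglyMeasurable
      exact ((schwartz_withSeminorms ℂ (Space N) ℂ).continuous_seminorm (k, n)).comp
        (continuous_tr g)
    · refine Filter.Eventually.of_forall fun x => ?_
      rw [Real.norm_of_nonneg (by positivity)]
      have := mul_le_mul_of_nonneg_left (seminorm_tr_le k n g x) (norm_nonneg (S x))
      simp only [Pi.add_apply, pow_zero, one_mul]
      linarith

/-- Fundamental theorem of calculus along the segment from x to x + v, performed on the Schwartz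
functions and then passed through U. It yields the differentiability of x ↦ U(g(· - x)). -/
theorem Dist.tr_sub_tr (U : Dist N) (g : 𝓢(Space N, ℂ)) (x v : Space N) :
    U (tr (x + v) g) - U (tr x g) =
      - ∫ s in Set.Ioc (0 : ℝ) 1, U (tr (x + s • v) (dv v g)) := by
  have hc : Continuous fun s : ℝ => tr (x + s • v) (dv v g) :=
    (continuous_tr (dv v g)).comp (by fun_prop)
  have h := (U.integral_comm (μ := volume.restrict (Set.Ioc (0 : ℝ) 1))
    (K := fun s : ℝ => tr (x + s • v) (dv v g))
    (W := tr x g - tr (x + v) g) hc (fun k n => ?_) (fun y => ?_)).2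
  · rw [← h, map_sub, neg_sub]
  · have : Continuous fun s : ℝ => SchwartzMap.seminorm ℂ k n (tr (x + s • v) (dv v g)) :=
      ((schwartz_withSeminorms ℂ (Space N) ℂ).continuous_seminorm (k, n)).comp hc
    exact (this.integrableOn_Icc (a := 0) (b := 1)).mono_set Set.Ioc_subset_Icc_self
  · have hd : ∀ s : ℝ, HasDerivAt (fun s : ℝ => - g (y - (x + s • v)))
        (tr (x + s • v) (dv v g) y) s := by
      intro s
      rw [tr_apply, dv_apply]
      have h1 : HasDerivAt (fun s : ℝ => y - (x + s • v)) (-v) s := by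
        simpa using (((hasDerivAt_id s).smul_const v).const_add x).const_sub y
      have h2 : HasDerivAt (fun s : ℝ => g (y - (x + s • v)))
          (fderiv ℝ g (y - (x + s • v)) (-v)) s :=
        (g.hasFDerivAt (y - (x + s • v))).comp_hasDerivAt s h1
      have h3 := h2.fun_neg
      rw [map_neg, neg_neg] at h3
      convert h3 using 3
    have h3 := intervalIntegral.integral_eq_sub_of_hasDerivAt (a := 0) (b := 1)
      (fun s _ => hd s) (((continuous_eval y).comp hc).intervalIntegrable 0 1)
    rw [intervalIntegral.integral_of_le zero_le_one] at h3
    rw [h3]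
    simp [sub_eq_add_neg, add_comm]

theorem dv_add_left (v w : Space N) (g : 𝓢(Space N, ℂ)) : dv (v + w) g = dv v g + dv w g := by
  ext y
  simp only [_root_.add_apply, dv_apply, map_add]

theorem dv_smul_left (c : ℝ) (v : Space N) (g : 𝓢(Space N, ℂ)) :
    dv (c • v) g = (c : ℂ) • dv v g := by
  ext y
  simp only [_root_.smul_apply, dv_apply, map_smul]
  simp

/-- The differential of `x ↦ U(g(· - x))`. -/
def Dist.trDeriv (U : Dist N) (g : 𝓢(Space N, ℂ)) (x : Space N) : Space N →L[ℝ] ℂ :=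
  LinearMap.toContinuousLinearMap
    { toFun := fun v => - U (tr x (dv v g))
      map_add' := fun v w => by rw [dv_add_left, map_add, map_add]; ring
      map_smul' := fun c v => by
        rw [dv_smul_left, map_smul, map_smul]; simp }

theorem Dist.trDeriv_apply (U : Dist N) (g : 𝓢(Space N, ℂ)) (x v : Space N) :
    U.trDeriv g x v = - U (tr x (dv v g)) := rfl

theorem Dist.continuous_tr (U : Dist N) (g : 𝓢(Space N, ℂ)) : Continuous fun x => U (tr x g) :=
  U.continuous.comp (BesovMomentum.continuous_tr g)

theorem Dist.continuous_trDeriv (U : Dist N) (g : 𝓢(Space N, ℂ)) : Continuous (U.trDeriv g) := by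
  refine continuous_clm_apply.2 fun v => ?_
  simp_rw [Dist.trDeriv_apply]
  exact (U.continuous_tr (dv v g)).neg

theorem Dist.hasFDerivAt_tr (U : Dist N) (g : 𝓢(Space N, ℂ)) (x : Space N) :
    HasFDerivAt (fun x => U (tr x g)) (U.trDeriv g x) x := by
  rw [hasFDerivAt_iff_isLittleO_nhds_zero, Asymptotics.isLittleO_iff]
  intro ε hε
  have hc := (U.continuous_trDeriv g).continuousAt (x := x)
  obtain ⟨δ, hδ, hb⟩ := Metric.continuousAt_iff.1 hc ε hε
  filter_upwards [Metric.ball_mem_nhds (0 : Space N) hδ] with v hv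
  rw [mem_ball_zero_iff] at hv
  have h1 : U (tr (x + v) g) - U (tr x g) - U.trDeriv g x v =
      ∫ s in Set.Ioc (0 : ℝ) 1, (U.trDeriv g (x + s • v) v - U.trDeriv g x v) := by
    have hi : IntegrableOn (fun s : ℝ => U.trDeriv g (x + s • v) v) (Set.Ioc 0 1) := by
      have : Continuous fun s : ℝ => U.trDeriv g (x + s • v) v := by
        simp_rw [Dist.trDeriv_apply]
        exact ((U.continuous_tr (dv v g)).comp (by fun_prop)).neg
      exact (this.integrableOn_Icc (a := 0) (b := 1)).mono_set Set.Ioc_subset_Icc_self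
    rw [integral_sub hi (by simp), U.tr_sub_tr g x v, ← integral_neg]
    simp [Dist.trDeriv_apply]
  rw [h1]
  have h2 : ∀ s ∈ Set.Ioc (0 : ℝ) 1, ‖U.trDeriv g (x + s • v) v - U.trDeriv g x v‖ ≤ ε * ‖v‖ := by
    intro s hs
    rw [← _root_.sub_apply]
    refine (ContinuousLinearMap.le_opNorm _ _).trans ?_
    gcongr
    rw [← dist_eq_norm]
    refine (hb ?_).le
    rw [dist_eq_norm, add_sub_cancel_left, norm_smul, Real.norm_of_nonneg hs.1.le]
    calc s * ‖v‖ ≤ 1 * ‖v‖ := by gcongr; exact hs.2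
      _ < δ := by rwa [one_mul]
  have h3 := norm_setIntegral_le_of_norm_le_const (μ := volume) (s := Set.Ioc (0 : ℝ) 1)
    (by simp) h2
  simpa using h3

/-! ### Fourier side: kernels are transforms of symbols, and `𝓕⁻` recovers the symbol -/

section FourierIdentities

theorem fourier_conv_apply (f g : 𝓢(Space N, ℂ)) (η : Space N) :
    𝓕 (conv f g) η = 𝓕 f η * 𝓕 g η := by
  rw [SchwartzMap.fourier_convolution_apply, Real.fourier_mul_convolution_eq f.integrable
    g.integrable]
  rfl

theorem fInv_apply (f : 𝓢(Space N, ℂ)) (η : Space N) : 𝓕⁻ f η = 𝓕 f (-η) := rfl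

theorem fInv_conv (f g : 𝓢(Space N, ℂ)) (η : Space N) : 𝓕⁻ (conv f g) η = 𝓕⁻ f η * 𝓕⁻ g η := by
  simp only [fInv_apply, fourier_conv_apply]

theorem fourier_fInv (f : 𝓢(Space N, ℂ)) : 𝓕 (𝓕⁻ f) = f :=
  FourierInvPair.fourier_fourierInv_eq f

theorem fInv_zero : 𝓕⁻ (0 : 𝓢(Space N, ℂ)) = 0 :=
  map_zero (FourierTransform.fourierInvCLM ℂ 𝓢(Space N, ℂ))

theorem fInv_injective {f g : 𝓢(Space N, ℂ)} (h : ∀ η, 𝓕⁻ f η = 𝓕⁻ g η) : f = g := by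
  have h1 : 𝓕⁻ f = 𝓕⁻ g := by ext η; exact h η
  rw [← fourier_fInv f, h1, fourier_fInv]

theorem fInv_fourier (f : 𝓢(Space N, ℂ)) : 𝓕⁻ (𝓕 f) = f :=
  FourierPair.fourierInv_fourier_eq f

theorem fInv_tr (x : Space N) (f : 𝓢(Space N, ℂ)) (η : Space N) :
    𝓕⁻ (tr x f) η = Real.fourierChar (inner ℝ x η) * 𝓕⁻ f η := by
  rw [SchwartzMap.fourierInv_coe, SchwartzMap.fourierInv_coe, Real.fourierInv_eq,
    Real.fourierInv_eq, ← integral_const_mul]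
  rw [← integral_add_right_eq_self _ x]
  refine integral_congr_ae (Filter.Eventually.of_forall fun y => ?_)
  simp only [tr_apply, add_sub_cancel_right, inner_add_left, AddChar.map_add_eq_mul,
    Circle.smul_def, Circle.coe_mul, smul_eq_mul]
  ring

theorem fInv_tr_eq_zero_iff (x : Space N) (f : 𝓢(Space N, ℂ)) (η : Space N) :
    𝓕⁻ (tr x f) η = 0 ↔ 𝓕⁻ f η = 0 := by
  rw [fInv_tr, mul_eq_zero]
  simp

theorem fInv_dv (v : Space N) (f : 𝓢(Space N, ℂ)) (η : Space N) :
    𝓕⁻ (dv v f) η = -(2 * Real.pi * Complex.I) * (inner ℝ η v : ℝ) * 𝓕⁻ f η := by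
  have h := congrArg (fun g : 𝓢(Space N, ℂ) => g η) (SchwartzMap.fourierInv_lineDerivOp_eq f v)
  have ht : (fun x : Space N => inner ℝ x v).HasTemperateGrowth := by fun_prop
  simp only [_root_.smul_apply, SchwartzMap.smulLeftCLM_apply ht] at h
  change 𝓕⁻ (LineDeriv.lineDerivOp v f) η = _
  rw [h]
  simp [mul_assoc]

theorem conv_eq_zero {S g : 𝓢(Space N, ℂ)} (h : ∀ η, 𝓕⁻ S η = 0 ∨ 𝓕⁻ g η = 0) : conv S g = 0 := by
  refine fInv_injective fun η => ?_
  rw [fInv_conv, fInv_zero]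
  rcases h η with h | h <;> simp [h]

theorem conv_dv (v : Space N) (S g : 𝓢(Space N, ℂ)) : conv S (dv v g) = dv v (conv S g) := by
  refine fInv_injective fun η => ?_
  rw [fInv_conv, fInv_dv, fInv_dv, fInv_conv]
  ring

/-- The pointwise product of Schwartz functions, through its Fourier transform. -/
def pmul (f g : 𝓢(Space N, ℂ)) : 𝓢(Space N, ℂ) := 𝓕 (conv (𝓕⁻ f) (𝓕⁻ g))

theorem pmul_apply (f g : 𝓢(Space N, ℂ)) (x : Space N) : pmul f g x = f x * g x := by
  rw [pmul, fourier_conv_apply, fourier_fInv, fourier_fInv]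

theorem fInv_pmul_eq_zero {f g : 𝓢(Space N, ℂ)} {η : Space N}
    (h : ∀ ζ, 𝓕⁻ f ζ = 0 ∨ 𝓕⁻ g (η - ζ) = 0) : 𝓕⁻ (pmul f g) η = 0 := by
  rw [pmul, fInv_fourier, conv_apply]
  refine integral_eq_zero_of_ae (Filter.Eventually.of_forall fun ζ => ?_)
  rcases h ζ with h | h <;> simp [h]

end FourierIdentities

/-! ### Dilations of symbols, and derivatives as multiplications -/

section Scaling

/-- The dilation `χ ↦ χ(h ·)` of symbols. -/
def dilate (h : ℝˣ) : 𝓢(Space N, ℂ) →L[ℂ] 𝓢(Space N, ℂ) :=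
  SchwartzMap.compCLMOfContinuousLinearEquiv ℂ
    (ContinuousLinearEquiv.smulLeft (R₁ := ℝ) (M₁ := Space N) h)

theorem dilate_apply (h : ℝˣ) (χ : 𝓢(Space N, ℂ)) (η : Space N) :
    dilate h χ η = χ ((h : ℝ) • η) := rfl

theorem fourier_dilate (h : ℝˣ) (χ : 𝓢(Space N, ℂ)) (y : Space N) :
    𝓕 (dilate h χ) y = (|((h : ℝ) ^ N)⁻¹| : ℝ) * 𝓕 χ ((h : ℝ)⁻¹ • y) := by
  rw [SchwartzMap.fourier_coe, SchwartzMap.fourier_coe, Real.fourier_eq, Real.fourier_eq]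
  have h1 := Measure.integral_comp_smul (volume : Measure (Space N))
    (fun v => (Real.fourierChar (-(inner ℝ v ((h : ℝ)⁻¹ • y)))) • χ v) (h : ℝ)
  have h2 : ∀ v, (Real.fourierChar (-(inner ℝ ((h : ℝ) • v) ((h : ℝ)⁻¹ • y)))) •
      χ ((h : ℝ) • v) = (Real.fourierChar (-(inner ℝ v y))) • dilate h χ v := by
    intro v
    rw [real_inner_smul_left, real_inner_smul_right, ← mul_assoc, mul_inv_cancel₀ h.ne_zero,
      one_mul]
    rfl
  simp_rw [h2] at h1
  rw [h1]
  simp [Space]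

/-- The dilation `χ ↦ χ(2^{-k} ·)` of symbols. -/
def dl (k : ℤ) : 𝓢(Space N, ℂ) →L[ℂ] 𝓢(Space N, ℂ) :=
  dilate (Units.mk0 ((2 : ℝ) ^ (-k)) (by positivity))

theorem dl_apply (k : ℤ) (χ : 𝓢(Space N, ℂ)) (η : Space N) :
    dl k χ η = χ ((2 : ℝ) ^ (-k) • η) := rfl

theorem fourier_dl (k : ℤ) (χ : 𝓢(Space N, ℂ)) (y : Space N) :
    𝓕 (dl k χ) y = (((2 : ℝ) ^ k) ^ N : ℝ) * 𝓕 χ ((2 : ℝ) ^ k • y) := by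
  rw [dl, fourier_dilate]
  simp only [Units.val_mk0, zpow_neg, inv_pow, inv_inv]
  rw [abs_of_pos (by positivity)]

/-- The multiplication of symbols by `-2πi η_v`, i.e. the derivative in direction `v` after Fourier
transform. -/
def mulc (v : Space N) : 𝓢(Space N, ℂ) →L[ℂ] 𝓢(Space N, ℂ) :=
  SchwartzMap.smulLeftCLM ℂ
    (fun x : Space N => -(2 * Real.pi * Complex.I) * ((inner ℝ x v : ℝ) : ℂ))

theorem mulc_apply (v : Space N) (χ : 𝓢(Space N, ℂ)) (η : Space N) :
    mulc v χ η = -(2 * Real.pi * Complex.I) * (inner ℝ η v : ℝ) * χ η := by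
  have ht : (fun x : Space N => -(2 * Real.pi * Complex.I) *
      ((inner ℝ x v : ℝ) : ℂ)).HasTemperateGrowth := by
    have h1 : (fun x : Space N => inner ℝ x v).HasTemperateGrowth := by fun_prop
    have h2 : (fun x : Space N => ((inner ℝ x v : ℝ) : ℂ)).HasTemperateGrowth :=
      Complex.ofRealCLM.hasTemperateGrowth.comp h1
    exact (Function.HasTemperateGrowth.const _).mul h2
  rw [mulc, SchwartzMap.smulLeftCLM_apply ht]
  rfl

theorem dv_fourier (v : Space N) (χ : 𝓢(Space N, ℂ)) : dv v (𝓕 χ) = 𝓕 (mulc v χ) := by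
  have h : mulc v χ = -(2 * Real.pi * Complex.I) •
      SchwartzMap.smulLeftCLM ℂ (fun x : Space N => inner ℝ x v) χ := by
    ext η
    have ht : (fun x : Space N => inner ℝ x v).HasTemperateGrowth := by fun_prop
    rw [mulc_apply, _root_.smul_apply, SchwartzMap.smulLeftCLM_apply ht]
    simp [mul_assoc]
  rw [h]
  exact SchwartzMap.lineDerivOp_fourier_eq χ v

theorem mulc_dl (v : Space N) (k : ℤ) (χ : 𝓢(Space N, ℂ)) :
    mulc v (dl k χ) = ((2 : ℂ) ^ k) • dl k (mulc v χ) := by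
  ext η
  rw [_root_.smul_apply, mulc_apply, dl_apply, dl_apply, mulc_apply, real_inner_smul_left]
  have h0 : (2 : ℂ) ^ k * (2 : ℂ) ^ (-k) = 1 := by rw [← zpow_add₀ two_ne_zero]; simp
  push_cast
  rw [smul_eq_mul]
  linear_combination (2 * Real.pi * Complex.I) * (inner ℝ η v : ℝ) *
    χ ((2 : ℝ) ^ (-k) • η) * h0

theorem dv_fourier_dl (v : Space N) (k : ℤ) (χ : 𝓢(Space N, ℂ)) :
    dv v (𝓕 (dl k χ)) = ((2 : ℂ) ^ k) • 𝓕 (dl k (mulc v χ)) := by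
  rw [dv_fourier, mulc_dl]
  exact FourierTransform.fourier_smul _ _

theorem mulc_support {v : Space N} {χ : 𝓢(Space N, ℂ)} {η : Space N} (h : mulc v χ η ≠ 0) :
    χ η ≠ 0 := by
  intro h0
  rw [mulc_apply, h0, mul_zero] at h
  exact h rfl

end Scaling

/-! ### Annular symbols and the Littlewood-Paley symbols -/

/-- Symbols supported in the annulus `3/8 ≤ |2πη| ≤ 16/3`. -/
def Annular (χ : 𝓢(Space N, ℂ)) : Prop :=
  ∀ η, χ η ≠ 0 → 3 / 8 ≤ 2 * Real.pi * ‖η‖ ∧ 2 * Real.pi * ‖η‖ ≤ 16 / 3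

theorem Annular.mulc {χ : 𝓢(Space N, ℂ)} (h : Annular χ) (v : Space N) :
    Annular (BesovMomentum.mulc v χ) := fun η hη => h η (mulc_support hη)

namespace LittlewoodPaley

variable (P : LittlewoodPaley N)

theorem symbolS_apply (k : ℤ) (η : Space N) : P.symbolS k η = P.symbol k η := rfl

theorem symbolS_eq_dl (k : ℤ) : P.symbolS k = dl k (P.symbolS 0) := by
  ext η
  rw [dl_apply, symbolS_apply, symbolS_apply]
  unfold symbol
  congr 2
  rw [smul_smul]
  congr 1
  simp [mul_comm]

theorem symbolS_support {k : ℤ} {η : Space N} (hη : P.symbolS k η ≠ 0) :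
    3 / 4 * (2 : ℝ) ^ k ≤ 2 * Real.pi * ‖η‖ ∧ 2 * Real.pi * ‖η‖ ≤ 8 / 3 * (2 : ℝ) ^ k := by
  rw [symbolS_apply, symbol] at hη
  have h1 : P.φ (((2 : ℝ) ^ (-k) * (2 * Real.pi)) • η) ≠ 0 := fun h => hη (by rw [h]; simp)
  have h2 := P.support_subset h1
  have hk : (0 : ℝ) < 2 ^ k := by positivity
  simp only [Set.mem_ofPred_eq, norm_smul] at h2
  rw [Real.norm_of_nonneg (by positivity), zpow_neg] at h2
  have h3 : ((2 : ℝ) ^ k)⁻¹ * (2 * Real.pi) * ‖η‖ = (2 * Real.pi * ‖η‖) / 2 ^ k := by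
    field_simp
  rwa [h3, le_div_iff₀ hk, div_le_iff₀ hk] at h2

theorem annular_symbolS : Annular (P.symbolS 0) := by
  intro η hη
  have := P.symbolS_support hη
  rw [zpow_zero] at this
  constructor <;> linarith [this.1, this.2]

theorem kernel_eq (k : ℤ) (x : Space N) : P.kernel k x = tr x (𝓕 (dl k (P.symbolS 0))) := by
  rw [← symbolS_eq_dl]; rfl

/-- The indices of the blocks that see frequencies of size `2^k`. -/
abbrev near (k : ℤ) : Finset ℤ := Finset.Icc (k - 1) (k + 1)

/-- On the annulus of Δ_k only the indices k-1, k, k+1 of the partition of unity contribute: for i ≤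
k-2 the frequencies are at most (2/3) 2^k < (3/4) 2^k, and for i ≥ k+2 they are at least 3 · 2^k >
(8/3) 2^k. -/
theorem sum_symbol_near {k : ℤ} {η : Space N} (h1 : 3 / 4 * (2 : ℝ) ^ k ≤ 2 * Real.pi * ‖η‖)
    (h2 : 2 * Real.pi * ‖η‖ ≤ 8 / 3 * (2 : ℝ) ^ k) : ∑ i ∈ near k, P.symbolS i η = 1 := by
  have hk : (0 : ℝ) < 2 ^ k := by positivity
  have hη : η ≠ 0 := by
    rintro rfl
    simp at h1
    linarith
  have hs := P.partition ((2 * Real.pi) • η) (by simp [hη, Real.pi_ne_zero])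
  have h3 := hasSum_sum_of_ne_finset_zero (s := near k) (L := SummationFilter.unconditional ℤ)
    (f := fun j : ℤ => P.φ ((2 : ℝ) ^ (-j) • (2 * Real.pi) • η)) ?_
  · have h4 := hs.unique h3
    have h5 : ∀ i, P.symbolS i η = ((P.φ ((2 : ℝ) ^ (-i) • (2 * Real.pi) • η) : ℝ) : ℂ) := by
      intro i
      rw [symbolS_apply, symbol, smul_smul]
    simp_rw [h5]
    rw [← Complex.ofReal_sum, ← h4, Complex.ofReal_one]
  · intro j hj
    by_contra h
    have h6 := P.support_subset h
    simp only [Set.mem_ofPred_eq, norm_smul] at h6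
    rw [Real.norm_of_nonneg (by positivity), Real.norm_of_nonneg (by positivity)] at h6
    have h7 : (2 : ℝ) ^ (-j) * (2 * Real.pi * ‖η‖) = (2 * Real.pi * ‖η‖) / 2 ^ j := by
      rw [zpow_neg]; field_simp
    rw [h7, le_div_iff₀ (by positivity), div_le_iff₀ (by positivity)] at h6
    rw [Finset.mem_Icc, not_and_or] at hj
    rcases hj with hj | hj
    · have : (2 : ℝ) ^ j ≤ 2 ^ (k - 2) := zpow_le_zpow_right₀ (by norm_num) (by omega)
      rw [zpow_sub₀ two_ne_zero] at this
      norm_num at this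
      linarith
    · have : (2 : ℝ) ^ (k + 2) ≤ 2 ^ j := zpow_le_zpow_right₀ (by norm_num) (by omega)
      rw [zpow_add₀ two_ne_zero] at this
      norm_num at this
      linarith

/-- A symbol equal to `1` on the support of the symbol of `Δ_0`. -/
def fat : 𝓢(Space N, ℂ) := ∑ i ∈ near 0, P.symbolS i

theorem fat_mul (η : Space N) : P.fat η * P.symbolS 0 η = P.symbolS 0 η := by
  by_cases h : P.symbolS 0 η = 0
  · simp [h]
  · have h1 := P.symbolS_support h
    rw [fat, _root_.sum_apply, P.sum_symbol_near h1.1 h1.2, one_mul]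

/-- The bounds 3/8 and 16/3 are (3/4)/2 and (8/3) · 2, the reach of the three blocks of index -1, 0,
1. This fixes the annulus used for all symbols. -/
theorem annular_fat : Annular P.fat := by
  intro η hη
  rw [fat, _root_.sum_apply] at hη
  obtain ⟨i, hi, h⟩ := Finset.exists_ne_zero_of_sum_ne_zero hη
  have h1 := P.symbolS_support h
  rw [Finset.mem_Icc] at hi
  have h2 : (2 : ℝ) ^ (-1 : ℤ) ≤ 2 ^ i := zpow_le_zpow_right₀ (by norm_num) (by omega)
  have h3 : (2 : ℝ) ^ i ≤ 2 ^ (1 : ℤ) := zpow_le_zpow_right₀ (by norm_num) (by omega)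
  norm_num at h2 h3
  constructor <;> linarith [h1.1, h1.2]

end LittlewoodPaley

/-! ### Reproducing formulas and decay of kernels -/

section Reproducing

variable (P : LittlewoodPaley N)

theorem sum_conv_eq {S g : 𝓢(Space N, ℂ)} {I : Finset ℤ} {h : ℤ → 𝓢(Space N, ℂ)}
    (hI : ∀ η, 𝓕⁻ S η * ∑ i ∈ I, 𝓕⁻ (h i) η = 𝓕⁻ g η) :
    ∑ i ∈ I, conv S (h i) = g := by
  have h1 : ∀ (J : Finset ℤ) η, 𝓕⁻ (∑ i ∈ J, conv S (h i)) η = ∑ i ∈ J, 𝓕⁻ S η * 𝓕⁻ (h i) η := by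
    intro J η
    have := map_sum (FourierTransform.fourierInvCLM ℂ 𝓢(Space N, ℂ)) (fun i => conv S (h i)) J
    have h2 := congrArg (fun f : 𝓢(Space N, ℂ) => f η) this
    simp only [FourierTransform.fourierInvCLM_apply, _root_.sum_apply] at h2
    rw [h2]
    exact Finset.sum_congr rfl fun i _ => fInv_conv _ _ _
  refine fInv_injective fun η => ?_
  rw [h1, ← Finset.mul_sum, hI]

/-- Symbols localized at frequencies of size `2^k` only see the blocks with index near `k`. -/
theorem sum_conv_near (k : ℤ) {S : 𝓢(Space N, ℂ)}
    (hS : ∀ η, 𝓕⁻ S η ≠ 0 → 3 / 4 * (2 : ℝ) ^ k ≤ 2 * Real.pi * ‖η‖ ∧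
      2 * Real.pi * ‖η‖ ≤ 8 / 3 * (2 : ℝ) ^ k) :
    ∑ i ∈ LittlewoodPaley.near k, conv S (𝓕 (P.symbolS i)) = S := by
  refine sum_conv_eq fun η => ?_
  simp_rw [fInv_fourier]
  by_cases h : 𝓕⁻ S η = 0
  · simp [h]
  · rw [P.sum_symbol_near (hS η h).1 (hS η h).2, mul_one]

theorem Dist.continuous_kernel (U : Dist N) (i : ℤ) : Continuous fun y => U (P.kernel i y) := by
  simp_rw [P.kernel_eq]
  exact U.continuous_tr _

/-- A bound for the decay of the convolution kernel with symbol `χ`. -/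
def KernelBound (B : ℝ) (χ : 𝓢(Space N, ℂ)) : Prop :=
  ∀ y, ‖𝓕 χ y‖ * (1 + ‖y‖) ^ (N + 2) ≤ B

theorem exists_kernelBound (χ : 𝓢(Space N, ℂ)) : ∃ B, 0 ≤ B ∧ KernelBound B χ := by
  refine ⟨2 ^ (N + 2) * ((Finset.Iic ((N + 2, 0) : ℕ × ℕ)).sup
    fun m => SchwartzMap.seminorm ℂ m.1 m.2) (𝓕 χ), by positivity, fun y => ?_⟩
  have := SchwartzMap.one_add_le_sup_seminorm_apply (𝕜 := ℂ) (m := (N + 2, 0)) (k := N + 2) (n := 0)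
    le_rfl le_rfl (𝓕 χ) y
  rwa [norm_iteratedFDeriv_zero, mul_comm] at this

/-- The decay of order N + 2 is one more than the decay of `Phi`. The spare factor (1 +
2^k|x-y|)^{-1} is what absorbs the growth of b(y) - b(x) when coefficients are frozen at x. -/
theorem KernelBound.norm_le {B : ℝ} {χ : 𝓢(Space N, ℂ)} (h : KernelBound B χ) (k : ℤ)
    (x y : Space N) :
    ‖tr x (𝓕 (dl k χ)) y‖ ≤ B * (Phi k (x - y) / (1 + (2 : ℝ) ^ k * ‖x - y‖)) := by
  have hk : (0 : ℝ) < 2 ^ k := by positivity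
  rw [tr_apply, fourier_dl, norm_mul, Complex.norm_real, Real.norm_of_nonneg (by positivity)]
  have h1 := h ((2 : ℝ) ^ k • (y - x))
  rw [norm_smul, Real.norm_of_nonneg hk.le, norm_sub_rev] at h1
  rw [Phi, div_div, ← pow_succ, mul_div_assoc', le_div_iff₀ (by positivity)]
  calc _ = ((2 : ℝ) ^ k) ^ N * (‖𝓕 χ ((2 : ℝ) ^ k • (y - x))‖ *
        (1 + (2 : ℝ) ^ k * ‖x - y‖) ^ (N + 2)) := by ring
    _ ≤ ((2 : ℝ) ^ k) ^ N * B := by gcongr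
    _ = _ := by ring

theorem KernelBound.enorm_le {B : ℝ} (hB : 0 ≤ B) {χ : 𝓢(Space N, ℂ)} (h : KernelBound B χ) (k : ℤ)
    (x y : Space N) :
    ‖tr x (𝓕 (dl k χ)) y‖ₑ ≤ ENNReal.ofReal B * ENNReal.ofReal (Phi k (x - y)) := by
  rw [← ofReal_norm, ← ENNReal.ofReal_mul hB]
  refine ENNReal.ofReal_le_ofReal ((h.norm_le k x y).trans ?_)
  gcongr
  refine div_le_self (Phi_pos _ _).le ?_
  have : 0 ≤ (2 : ℝ) ^ k * ‖x - y‖ := by positivity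
  linarith

theorem enorm_integral_mul_le {B : ℝ} (hB : 0 ≤ B) {χ : 𝓢(Space N, ℂ)} (h : KernelBound B χ) (k : ℤ)
    (x : Space N) (f : Space N → ℂ) :
    ‖∫ y, tr x (𝓕 (dl k χ)) y * f y‖ₑ ≤ ENNReal.ofReal B * cv k (fun y => ‖f y‖ₑ) x := by
  refine (enorm_integral_le_lintegral_enorm _).trans ?_
  unfold cv
  rw [← lintegral_const_mul' _ _ ENNReal.ofReal_ne_top]
  refine lintegral_mono fun y => ?_
  rw [enorm_mul, ← mul_assoc]
  gcongr
  exact h.enorm_le hB k x y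

/-- The symbol `χ` is the product of `χ₁` and of the symbol of `Δ_0`. -/
def FactorsThrough (χ χ₁ : 𝓢(Space N, ℂ)) : Prop := ∀ η, χ η = χ₁ η * P.symbolS 0 η

theorem factorsThrough_symbolS : FactorsThrough P (P.symbolS 0) P.fat := fun η => (P.fat_mul η).symm

variable {P}

theorem FactorsThrough.mulc {χ χ₁ : 𝓢(Space N, ℂ)} (h : FactorsThrough P χ χ₁) (v : Space N) :
    FactorsThrough P (mulc v χ) (mulc v χ₁) := by
  intro η
  rw [mulc_apply, mulc_apply, h η]
  ring

theorem FactorsThrough.fInv_support {χ χ₁ : 𝓢(Space N, ℂ)} (h : FactorsThrough P χ χ₁) {k : ℤ}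
    {x η : Space N} (hη : 𝓕⁻ (tr x (𝓕 (dl k χ))) η ≠ 0) :
    3 / 4 * (2 : ℝ) ^ k ≤ 2 * Real.pi * ‖η‖ ∧ 2 * Real.pi * ‖η‖ ≤ 8 / 3 * (2 : ℝ) ^ k := by
  rw [Ne, fInv_tr_eq_zero_iff, fInv_fourier, dl_apply, h] at hη
  refine P.symbolS_support fun h0 => hη ?_
  rw [P.symbolS_eq_dl, dl_apply] at h0
  rw [h0, mul_zero]

/-- Frequency localized functionals are expressed through the corresponding dyadic block. -/
theorem Dist.eq_integral_block (U : Dist N) {χ χ₁ : 𝓢(Space N, ℂ)} (h : FactorsThrough P χ χ₁)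
    (k : ℤ) (x : Space N) :
    U (tr x (𝓕 (dl k χ))) = ∫ y, tr x (𝓕 (dl k χ₁)) y * U (P.kernel k y) := by
  have h1 := (U.integral_tr_mul (𝓕 (dl k (P.symbolS 0))) (tr x (𝓕 (dl k χ₁)))).2
  simp_rw [P.kernel_eq]
  rw [← h1]
  congr 1
  refine fInv_injective fun η => ?_
  rw [fInv_conv, fInv_tr, fInv_tr, fInv_fourier, fInv_fourier, fInv_fourier, dl_apply, dl_apply,
    dl_apply, h]
  ring

/-- Frequency localized functionals are controlled by the corresponding dyadic block. -/
theorem Dist.enorm_le_cv (U : Dist N) {B : ℝ} (hB : 0 ≤ B) {χ χ₁ : 𝓢(Space N, ℂ)}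
    (h : FactorsThrough P χ χ₁) (hχ₁ : KernelBound B χ₁) (k : ℤ) (x : Space N) :
    ‖U (tr x (𝓕 (dl k χ)))‖ₑ ≤ ENNReal.ofReal B * cv k (fun y => ‖U (P.kernel k y)‖ₑ) x := by
  rw [U.eq_integral_block h]
  exact enorm_integral_mul_le hB hχ₁ k x _

end Reproducing

/-! ### Heat flow on annular symbols: exponential decay of the kernels -/

/-- The symbol `|2πη|²` of `-Δ`. -/
def sqSymbol (η : Space N) : ℝ := (2 * Real.pi) ^ 2 * ‖η‖ ^ 2

theorem sqSymbol_contDiff {n : WithTop ℕ∞} : ContDiff ℝ n (sqSymbol : Space N → ℝ) := by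
  unfold sqSymbol
  exact contDiff_const.mul (contDiff_norm_sq ℝ)

theorem Annular.sqSymbol_mem {χ : 𝓢(Space N, ℂ)} (h : Annular χ) {η : Space N} (hη : χ η ≠ 0) :
    sqSymbol η ∈ Set.Icc (9 / 64 : ℝ) (256 / 9) := by
  have h1 := h η hη
  have h2 : sqSymbol η = (2 * Real.pi * ‖η‖) ^ 2 := by unfold sqSymbol; ring
  rw [h2]
  constructor <;> nlinarith

theorem Annular.hasCompactSupport {χ : 𝓢(Space N, ℂ)} (h : Annular χ) : HasCompactSupport χ := by
  refine HasCompactSupport.of_support_subset_isCompact (isCompact_closedBall (0 : Space N) 1) ?_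
  intro η hη
  have h1 := (h η hη).2
  have h2 : (3 : ℝ) < Real.pi := Real.pi_gt_three
  rw [mem_closedBall_zero_iff]
  nlinarith [norm_nonneg η]

theorem Annular.tsupport_subset {χ : 𝓢(Space N, ℂ)} (h : Annular χ) :
    tsupport χ ⊆ Metric.closedBall 0 1 ∩ sqSymbol ⁻¹' Set.Icc (9 / 64 : ℝ) (256 / 9) := by
  refine closure_minimal (fun η hη => ⟨?_, h.sqSymbol_mem hη⟩) (Metric.isClosed_closedBall.inter
    (isClosed_Icc.preimage (sqSymbol_contDiff (n := 0)).continuous))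
  have h1 := (h η hη).2
  have h2 : (3 : ℝ) < Real.pi := Real.pi_gt_three
  rw [mem_closedBall_zero_iff]
  nlinarith [norm_nonneg η]

theorem hasCompactSupport_smul_symbol {χ : 𝓢(Space N, ℂ)} (h : HasCompactSupport χ) (g : ℝ → ℝ) :
    HasCompactSupport fun η => g (sqSymbol η) • χ η :=
  HasCompactSupport.smul_left (f := fun η => g (sqSymbol η)) h

theorem contDiff_smul_symbol (χ : 𝓢(Space N, ℂ)) {g : ℝ → ℝ}
    (hg : ContDiff ℝ ((⊤ : ℕ∞) : WithTop ℕ∞) g) :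
    ContDiff ℝ ((⊤ : ℕ∞) : WithTop ℕ∞) fun η => g (sqSymbol η) • χ η :=
  ContDiff.smul (f := fun η => g (sqSymbol η)) (hg.comp sqSymbol_contDiff) (χ.smooth ⊤)

open Classical in
/-- The symbol `g(|2πη|²) χ(η)`. -/
def fc (χ : 𝓢(Space N, ℂ)) (g : ℝ → ℝ) : 𝓢(Space N, ℂ) :=
  if h : HasCompactSupport χ ∧ ContDiff ℝ ((⊤ : ℕ∞) : WithTop ℕ∞) g then
    (hasCompactSupport_smul_symbol h.1 g).toSchwartzMap (contDiff_smul_symbol χ h.2)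
  else 0

theorem fc_apply {χ : 𝓢(Space N, ℂ)} (hχ : Annular χ) {g : ℝ → ℝ}
    (hg : ContDiff ℝ ((⊤ : ℕ∞) : WithTop ℕ∞) g) (η : Space N) :
    fc χ g η = g (sqSymbol η) * χ η := by
  rw [fc, dif_pos ⟨hχ.hasCompactSupport, hg⟩, ← Complex.real_smul]
  rfl

/-- Leibniz and Faà di Bruno formulas. The constant is independent of g and the bound is linear in
the C^n size of g on the range of |2πη|² over the annulus. With g = e^{-σr} it gives decay in σ,
with differences of two such functions it gives continuity in σ. -/
theorem exists_seminorm_fc_le {χ : 𝓢(Space N, ℂ)} (hχ : Annular χ) (k n : ℕ) :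
    ∃ C : ℝ, 0 ≤ C ∧ ∀ (g : ℝ → ℝ) (B : ℝ), ContDiff ℝ ((⊤ : ℕ∞) : WithTop ℕ∞) g →
      (∀ r ∈ Set.Icc (9 / 64 : ℝ) (256 / 9), ∀ i ≤ n, |iteratedDeriv i g r| ≤ B) →
      SchwartzMap.seminorm ℂ k n (fc χ g) ≤ C * B := by
  have hX : ∀ j : ℕ, ∃ C, ∀ η ∈ Metric.closedBall (0 : Space N) 1,
      ‖iteratedFDeriv ℝ j sqSymbol η‖ ≤ C := fun j =>
    (isCompact_closedBall (0 : Space N) 1).exists_bound_of_continuousOn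
      ((sqSymbol_contDiff (n := j)).continuous_iteratedFDeriv le_rfl).continuousOn
  choose CX hCX using hX
  set D : ℝ := 1 + ∑ j ∈ Finset.range (n + 1), |CX j| with hD
  have hD1 : 1 ≤ D := by
    have : 0 ≤ ∑ j ∈ Finset.range (n + 1), |CX j| := Finset.sum_nonneg fun _ _ => abs_nonneg _
    linarith
  have hXD : ∀ η ∈ Metric.closedBall (0 : Space N) 1, ∀ j, 1 ≤ j → j ≤ n →
      ‖iteratedFDeriv ℝ j sqSymbol η‖ ≤ D ^ j := by
    intro η hη j hj hjn
    calc ‖iteratedFDeriv ℝ j sqSymbol η‖ ≤ |CX j| := (hCX j η hη).trans (le_abs_self _)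
      _ ≤ D := by
          have := Finset.single_le_sum (f := fun j => |CX j|) (fun _ _ => abs_nonneg _)
            (Finset.mem_range.2 (Nat.lt_succ_of_le hjn))
          simp only [hD]
          linarith
      _ ≤ D ^ j := le_self_pow₀ hD1 (by omega)
  refine ⟨∑ i ∈ Finset.range (n + 1), (n.choose i : ℝ) * (i.factorial * D ^ i) *
    SchwartzMap.seminorm ℂ k (n - i) χ, Finset.sum_nonneg fun i _ => by positivity, ?_⟩
  intro g B hg hB
  have hB0 : 0 ≤ B := (abs_nonneg _).trans (hB (9 / 64) (by norm_num) 0 (Nat.zero_le _))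
  refine SchwartzMap.seminorm_le_bound ℂ k n _ (by positivity) fun η => ?_
  have hfc : (fc χ g : Space N → ℂ) = fun η => g (sqSymbol η) • χ η := by
    ext η; rw [fc_apply hχ hg, Complex.real_smul]
  rw [hfc]
  by_cases hη : η ∈ tsupport χ
  · obtain ⟨hη1, hη2⟩ := hχ.tsupport_subset hη
    have h1 := norm_iteratedFDeriv_smul_le (𝕜 := ℝ) (n := n) (N := ((⊤ : ℕ∞) : WithTop ℕ∞))
      (hg.comp sqSymbol_contDiff) (χ.smooth ⊤) η (by exact_mod_cast le_top)
    have h2 : ∀ i ≤ n, ‖iteratedFDeriv ℝ i (g ∘ sqSymbol) η‖ ≤ i.factorial * B * D ^ i := by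
      intro i hi
      refine norm_iteratedFDeriv_comp_le (N := ((⊤ : ℕ∞) : WithTop ℕ∞)) hg sqSymbol_contDiff
        (by exact_mod_cast le_top) η (fun j hj => ?_)
        (fun j hj hji => hXD η hη1 j hj (hji.trans hi))
      rw [norm_iteratedFDeriv_eq_norm_iteratedDeriv]
      exact hB _ hη2 j (hj.trans hi)
    refine (mul_le_mul_of_nonneg_left h1 (by positivity)).trans ?_
    rw [Finset.mul_sum, Finset.sum_mul]
    refine Finset.sum_le_sum fun i hi => ?_
    have hi' : i ≤ n := Nat.lt_succ_iff.1 (Finset.mem_range.1 hi)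
    calc _ = (n.choose i : ℝ) * ‖iteratedFDeriv ℝ i (g ∘ sqSymbol) η‖ *
          (‖η‖ ^ k * ‖iteratedFDeriv ℝ (n - i) χ η‖) := by ring
      _ ≤ (n.choose i : ℝ) * (i.factorial * B * D ^ i) * SchwartzMap.seminorm ℂ k (n - i) χ := by
          gcongr
          · exact h2 i hi'
          · exact SchwartzMap.le_seminorm ℂ k (n - i) χ η
      _ = _ := by ring
  · have h0 : iteratedFDeriv ℝ n (fun η => g (sqSymbol η) • χ η) η = 0 := by
      have h1 : η ∉ tsupport (fun η => g (sqSymbol η) • χ η) := fun h =>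
        hη (closure_mono (Function.support_smul_subset_right (fun η => g (sqSymbol η)) χ) h)
      by_contra h2
      exact h1 (support_iteratedFDeriv_subset n h2)
    rw [h0, norm_zero, mul_zero]
    exact mul_nonneg (Finset.sum_nonneg fun i _ => by positivity) hB0

/-- The symbol of `χ(D) e^{σΔ}`. -/
def hs (χ : 𝓢(Space N, ℂ)) (σ : ℝ) : 𝓢(Space N, ℂ) := fc χ fun r => Real.exp (-σ * r)

theorem exp_mul_contDiff (σ : ℝ) :
    ContDiff ℝ ((⊤ : ℕ∞) : WithTop ℕ∞) fun r : ℝ => Real.exp (-σ * r) := by fun_prop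

theorem hs_apply {χ : 𝓢(Space N, ℂ)} (hχ : Annular χ) (σ : ℝ) (η : Space N) :
    hs χ σ η = Real.exp (-σ * sqSymbol η) * χ η := fc_apply hχ (exp_mul_contDiff σ) η

theorem hs_zero {χ : 𝓢(Space N, ℂ)} (hχ : Annular χ) : hs χ 0 = χ := by
  ext η; simp [hs_apply hχ]

theorem Annular.hs {χ : 𝓢(Space N, ℂ)} (hχ : Annular χ) (σ : ℝ) :
    Annular (BesovMomentum.hs χ σ) := by
  intro η hη
  refine hχ η fun h => hη ?_
  rw [hs_apply hχ, h, mul_zero]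

/-- The symbol of `χ(D) Δ`. -/
def lap : 𝓢(Space N, ℂ) →L[ℂ] 𝓢(Space N, ℂ) := ∑ b, mulc (unitVec b) ∘L mulc (unitVec b)

theorem inner_unitVec (η : Space N) (b : Fin N) : (inner ℝ η (unitVec b) : ℝ) = η b := by
  simp [unitVec, EuclideanSpace.inner_single_right]

theorem lap_eq_sum (χ : 𝓢(Space N, ℂ)) : lap χ = ∑ b, mulc (unitVec b) (mulc (unitVec b) χ) := by
  simp [lap, _root_.sum_apply]

theorem lap_apply (χ : 𝓢(Space N, ℂ)) (η : Space N) : lap χ η = -(sqSymbol η : ℂ) * χ η := by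
  rw [lap_eq_sum, _root_.sum_apply]
  simp only [mulc_apply, inner_unitVec]
  have h : sqSymbol η = (2 * Real.pi) ^ 2 * ∑ b, η b ^ 2 := by
    rw [sqSymbol, EuclideanSpace.norm_sq_eq]; simp
  rw [h]
  push_cast
  rw [Finset.mul_sum, ← Finset.sum_neg_distrib, Finset.sum_mul]
  refine Finset.sum_congr rfl fun b _ => ?_
  linear_combination (4 * Real.pi ^ 2 * (η b : ℂ) ^ 2 * χ η) * Complex.I_sq

theorem Annular.lap {χ : 𝓢(Space N, ℂ)} (hχ : Annular χ) : Annular (BesovMomentum.lap χ) := by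
  intro η hη
  refine hχ η fun h => hη ?_
  rw [lap_apply, h, mul_zero]

theorem mulc_hs {χ : 𝓢(Space N, ℂ)} (hχ : Annular χ) (v : Space N) (σ : ℝ) :
    mulc v (hs χ σ) = hs (mulc v χ) σ := by
  ext η
  rw [hs_apply (hχ.mulc v), mulc_apply, mulc_apply, hs_apply hχ]
  ring

theorem lap_hs {χ : 𝓢(Space N, ℂ)} (hχ : Annular χ) (σ : ℝ) :
    lap (hs χ σ) = hs (lap χ) σ := by
  ext η
  rw [hs_apply hχ.lap, lap_apply, lap_apply, hs_apply hχ]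
  ring

/-- The rate available on the annulus is 9/64. A part 1/16 = 4/64 of it absorbs the power of σ, and
the remaining 5/64 is still at least 1/16. This is the origin of the factor 1/16 in all later rates.
-/
theorem pow_mul_exp_le (i : ℕ) {σ r : ℝ} (hσ : 0 ≤ σ) (hr : 9 / 64 ≤ r) :
    σ ^ i * Real.exp (-σ * r) ≤ (16 ^ i * i.factorial) * Real.exp (-(σ / 16)) := by
  have h1 := Real.pow_div_factorial_le_exp (σ / 16) (by positivity) i
  rw [div_le_iff₀ (by positivity), div_pow, div_le_iff₀ (by positivity)] at h1
  calc σ ^ i * Real.exp (-σ * r) ≤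
        (Real.exp (σ / 16) * i.factorial * 16 ^ i) * Real.exp (-σ * (9 / 64)) := by
        gcongr ?_ * Real.exp ?_
        nlinarith
    _ = (16 ^ i * i.factorial) * (Real.exp (σ / 16) * Real.exp (-σ * (9 / 64))) := by ring
    _ ≤ _ := by rw [← Real.exp_add]; gcongr; linarith

theorem exists_seminorm_hs_le {χ : 𝓢(Space N, ℂ)} (hχ : Annular χ) (k n : ℕ) :
    ∃ C : ℝ, 0 ≤ C ∧ ∀ σ, 0 ≤ σ →
      SchwartzMap.seminorm ℂ k n (hs χ σ) ≤ C * Real.exp (-(σ / 16)) := by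
  obtain ⟨C, hC0, hC⟩ := exists_seminorm_fc_le hχ k n
  refine ⟨C * (16 ^ n * n.factorial), by positivity, fun σ hσ => ?_⟩
  rw [mul_assoc]
  refine hC _ _ (exp_mul_contDiff σ) fun r hr i hi => ?_
  rw [iteratedDeriv_exp_const_mul, abs_mul, abs_pow, abs_neg, abs_of_nonneg hσ, Real.abs_exp]
  refine (pow_mul_exp_le i hσ hr.1).trans ?_
  gcongr
  norm_num

theorem continuous_hs {χ : 𝓢(Space N, ℂ)} (hχ : Annular χ) : Continuous (hs χ) := by
  rw [continuous_iff_continuousAt]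
  intro σ₀
  rw [ContinuousAt, (schwartz_withSeminorms ℂ (Space N) ℂ).tendsto_nhds]
  rintro ⟨k, n⟩ ε hε
  obtain ⟨C, hC0, hC⟩ := exists_seminorm_fc_le hχ k n
  set δ := ε / (C + 1) with hδ
  have hδ0 : 0 < δ := by positivity
  have h1 : ∀ i ∈ Finset.range (n + 1), ∀ᶠ σ in nhds σ₀, ∀ r ∈ Set.Icc (9 / 64 : ℝ) (256 / 9),
      |(-σ) ^ i * Real.exp (-σ * r) - (-σ₀) ^ i * Real.exp (-σ₀ * r)| < δ := by
    intro i _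
    refine isCompact_Icc.eventually_forall_of_forall_eventually fun r _ => ?_
    have hc : Continuous fun z : ℝ × ℝ =>
        |(-z.1) ^ i * Real.exp (-z.1 * z.2) - (-σ₀) ^ i * Real.exp (-σ₀ * z.2)| := by fun_prop
    exact (hc.tendsto (σ₀, r)).eventually_lt_const (by simpa using hδ0)
  filter_upwards [(Finset.eventually_all _).2 h1] with σ hσ
  have h2 : hs χ σ - hs χ σ₀ = fc χ fun r => Real.exp (-σ * r) - Real.exp (-σ₀ * r) := by
    ext η
    rw [_root_.sub_apply, hs_apply hχ, hs_apply hχ,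
      fc_apply hχ ((exp_mul_contDiff σ).sub (exp_mul_contDiff σ₀))]
    push_cast
    ring
  change SchwartzMap.seminorm ℂ k n (hs χ σ - hs χ σ₀) < ε
  rw [h2]
  refine (hC _ δ ((exp_mul_contDiff σ).sub (exp_mul_contDiff σ₀)) fun r hr i hi => ?_).trans_lt ?_
  · rw [iteratedDeriv_fun_sub (exp_mul_contDiff σ |>.contDiffAt.of_le (by exact_mod_cast le_top))
      (exp_mul_contDiff σ₀ |>.contDiffAt.of_le (by exact_mod_cast le_top)),
      iteratedDeriv_exp_const_mul, iteratedDeriv_exp_const_mul]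
    exact (hσ i (Finset.mem_range.2 (Nat.lt_succ_of_le hi)) r hr).le
  · rw [hδ, mul_div_assoc', div_lt_iff₀ (by positivity)]
    nlinarith

theorem Dist.continuous_hs (V : Dist N) {χ : 𝓢(Space N, ℂ)} (hχ : Annular χ) :
    Continuous fun σ => V (hs χ σ) := V.continuous.comp (BesovMomentum.continuous_hs hχ)

/-- Pointwise in η, the derivative of e^{-σ|2πη|²}χ in σ is the symbol of the Laplacian of the flow.
Its integrated form passes through V by `Dist.integral_comm`, and the fundamental theorem of
calculus for a continuous integrand returns the derivative. -/
theorem Dist.hasDerivAt_hs (V : Dist N) {χ : 𝓢(Space N, ℂ)} (hχ : Annular χ) (σ : ℝ) :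
    HasDerivAt (fun σ => V (hs χ σ)) (V (hs (lap χ) σ)) σ := by
  have hc := BesovMomentum.continuous_hs hχ.lap
  have key : ∀ a b : ℝ, a ≤ b →
      V (hs χ b) - V (hs χ a) = ∫ s in a..b, V (hs (lap χ) s) := by
    intro a b hab
    rw [← map_sub, intervalIntegral.integral_of_le hab]
    refine (V.integral_comm hc (fun k n => ?_) fun η => ?_).2
    · have : Continuous fun s : ℝ => SchwartzMap.seminorm ℂ k n (hs (lap χ) s) :=
        ((schwartz_withSeminorms ℂ (Space N) ℂ).continuous_seminorm (k, n)).comp hc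
      exact (this.integrableOn_Icc (a := a) (b := b)).mono_set Set.Ioc_subset_Icc_self
    · have hd : ∀ s : ℝ, HasDerivAt (fun s : ℝ => hs χ s η) (hs (lap χ) s η) s := by
        intro s
        simp_rw [hs_apply hχ, hs_apply hχ.lap, lap_apply]
        have h1 : HasDerivAt (fun s : ℝ => Real.exp (-s * sqSymbol η))
            (Real.exp (-s * sqSymbol η) * (-sqSymbol η)) s := by
          simpa using ((hasDerivAt_id s).neg.mul_const (sqSymbol η)).exp
        exact ((h1.ofReal_comp).mul_const (χ η)).congr_deriv (by push_cast; ring)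
      rw [_root_.sub_apply, ← intervalIntegral.integral_of_le hab]
      exact (intervalIntegral.integral_eq_sub_of_hasDerivAt (fun s _ => hd s)
        (((continuous_eval η).comp hc).intervalIntegrable a b)).symm
  have key' : ∀ b : ℝ, V (hs χ b) = V (hs χ σ) + ∫ s in σ..b, V (hs (lap χ) s) := by
    intro b
    rcases le_total σ b with h | h
    · rw [← key σ b h]; ring
    · rw [intervalIntegral.integral_symm, ← key b σ h]; ring
  have h3 := (intervalIntegral.integral_hasDerivAt_right
    ((V.continuous_hs hχ.lap).intervalIntegrable σ σ)
    ((V.continuous_hs hχ.lap).stronglyMeasurableAtFilter _ _)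
    (V.continuous_hs hχ.lap).continuousAt).const_add (V (hs χ σ))
  exact h3.congr_of_eventuallyEq (Filter.Eventually.of_forall key')

/-- The Fourier transform is continuous on Schwartz space, so the exponential decay of the seminorms
of the symbols passes to the kernels. -/
theorem exists_kernelBound_hs {χ : 𝓢(Space N, ℂ)} (hχ : Annular χ) :
    ∃ B, 0 ≤ B ∧ ∀ σ, 0 ≤ σ → KernelBound (B * Real.exp (-(σ / 16))) (hs χ σ) := by
  let L : 𝓢(Space N, ℂ) →L[ℂ] 𝓢(Space N, ℂ) := FourierTransform.fourierCLM ℂ 𝓢(Space N, ℂ)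
  have h1 : ∀ m : ℕ × ℕ, ∃ C : ℝ, 0 ≤ C ∧ ∀ σ, 0 ≤ σ →
      SchwartzMap.seminorm ℂ m.1 m.2 (𝓕 (hs χ σ)) ≤ C * Real.exp (-(σ / 16)) := by
    intro m
    obtain ⟨s, C, hC0, hC⟩ := exists_seminorm_comp_le L m.1 m.2
    choose C' hC'0 hC' using fun i : ℕ × ℕ => exists_seminorm_hs_le hχ i.1 i.2
    refine ⟨C * ∑ i ∈ s, C' i, mul_nonneg hC0 (Finset.sum_nonneg fun i _ => hC'0 i), ?_⟩
    intro σ hσ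
    refine (hC (hs χ σ)).trans ?_
    rw [mul_assoc, Finset.sum_mul]
    gcongr with i _
    exact hC' i σ hσ
  choose C hC0 hC using h1
  refine ⟨2 ^ (N + 2) * ∑ m ∈ Finset.Iic ((N + 2, 0) : ℕ × ℕ), C m,
    mul_nonneg (by positivity) (Finset.sum_nonneg fun i _ => hC0 i), fun σ hσ y => ?_⟩
  have := SchwartzMap.one_add_le_sup_seminorm_apply (𝕜 := ℂ) (m := (N + 2, 0)) (k := N + 2) (n := 0)
    le_rfl le_rfl (𝓕 (hs χ σ)) y
  rw [norm_iteratedFDeriv_zero, mul_comm] at this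
  refine this.trans ?_
  rw [mul_assoc]
  gcongr
  refine Seminorm.finset_sup_apply_le
    (mul_nonneg (Finset.sum_nonneg fun i _ => hC0 i) (Real.exp_pos _).le) fun i hi => ?_
  refine (hC i σ hσ).trans ?_
  gcongr
  exact Finset.single_le_sum (fun i _ => hC0 i) hi

theorem hs_add {χ : 𝓢(Space N, ℂ)} (hχ : Annular χ) (a b : ℝ) : hs (hs χ a) b = hs χ (a + b) := by
  ext η
  rw [hs_apply (hχ.hs a), hs_apply hχ, hs_apply hχ, ← mul_assoc, ← Complex.ofReal_mul,
    ← Real.exp_add]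
  congr 3
  ring

/-- The flow is started at time -1, which is harmless on annular symbols. Bounds on an open interval
around [0,∞) are needed to differentiate a series in σ at σ = 0. -/
theorem exists_kernelBound_hs_of_neg_one_le {χ : 𝓢(Space N, ℂ)} (hχ : Annular χ) :
    ∃ B, 0 ≤ B ∧ ∀ σ, -1 ≤ σ → KernelBound (B * Real.exp (-(σ / 16))) (hs χ σ) := by
  obtain ⟨B, hB0, hB⟩ := exists_kernelBound_hs (hχ.hs (-1))
  refine ⟨B * Real.exp (-(1 / 16)), by positivity, fun σ hσ => ?_⟩
  have := hB (σ + 1) (by linarith)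
  rw [hs_add hχ] at this
  convert this using 1
  · rw [mul_assoc, ← Real.exp_add]; congr 2; ring
  · congr 1; ring

/-! ### Duhamel's formula along time-dependent characteristics -/

section Duhamel

/-- The chain rule along a primitive of a bounded function. -/
theorem eq_add_integral_comp_primitive {a a' : ℝ → ℂ} (ha : ∀ σ, 0 ≤ σ → HasDerivAt a (a' σ) σ)
    (ha' : ContinuousOn a' (Set.Ici 0)) {ν : ℝ → ℝ} (hν : Measurable ν) {B : ℝ}
    (hν0 : ∀ s, 0 ≤ ν s) (hνB : ∀ s, ν s ≤ B) {s t : ℝ} (hst : s ≤ t) :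
    a 0 = a (∫ x in s..t, ν x) -
      ∫ r in Set.Ioc s t, (ν r : ℂ) * a' (max 0 (∫ x in r..t, ν x)) := by
  have hB : 0 ≤ B := (hν0 0).trans (hνB 0)
  have hνint : LocallyIntegrable ν volume := by
    refine (locallyIntegrable_const B).mono hν.aestronglyMeasurable ?_
    refine Filter.Eventually.of_forall fun x => ?_
    rw [Real.norm_of_nonneg (hν0 x), Real.norm_of_nonneg hB]
    exact hνB x
  have hνii : ∀ u v, IntervalIntegrable ν volume u v := fun u v =>
    (hνint.integrableOn_isCompact isCompact_uIcc).intervalIntegrable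
  set S : ℝ → ℝ := fun r => ∫ x in r..t, ν x with hS
  have hSsub : ∀ u v, S u - S v = ∫ x in u..v, ν x := by
    intro u v
    simp only [hS]
    rw [← intervalIntegral.integral_add_adjacent_intervals (hνii u v) (hνii v t)]
    ring
  have hSlip : ∀ u v, |S u - S v| ≤ B * |u - v| := by
    intro u v
    rw [hSsub, ← Real.norm_eq_abs, abs_sub_comm]
    exact intervalIntegral.norm_integral_le_of_norm_le_const fun x _ => by
      rw [Real.norm_of_nonneg (hν0 x)]; exact hνB x
  have hScont : Continuous S :=
    (LipschitzWith.of_dist_le_mul (K := B.toNNReal) fun u v => by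
      rw [Real.dist_eq, Real.dist_eq, Real.coe_toNNReal B hB]; exact hSlip u v).continuous
  have hS0 : ∀ r, r ≤ t → 0 ≤ S r := fun r hr =>
    intervalIntegral.integral_nonneg hr fun x _ => hν0 x
  set c : ℝ → ℂ := fun σ => a' (max 0 σ) with hc
  have hccont : Continuous c :=
    ha'.comp_continuous (continuous_const.max continuous_id) fun σ => Set.mem_Ici.2 (le_max_left _ _)
  set g : ℝ → ℂ := fun r => (ν r : ℂ) * c (S r) with hg
  have hgm : AEStronglyMeasurable g volume :=
    (Complex.measurable_ofReal.comp hν).aestronglyMeasurable.mul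
      (hccont.comp hScont).aestronglyMeasurable
  obtain ⟨M, hM⟩ := (isCompact_Icc (a := (0 : ℝ)) (b := S s)).exists_bound_of_continuousOn
    (ha'.mono Set.Icc_subset_Ici_self)
  have hM0 : 0 ≤ M := (norm_nonneg _).trans (hM 0 ⟨le_rfl, hS0 s hst⟩)
  have hSmem : ∀ r ∈ Set.Icc s t, S r ∈ Set.Icc 0 (S s) := by
    intro r hr
    refine ⟨hS0 r hr.2, ?_⟩
    have : 0 ≤ S s - S r := by
      rw [hSsub]; exact intervalIntegral.integral_nonneg hr.1 fun x _ => hν0 x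
    linarith
  have hgloc : LocallyIntegrable g volume := by
    have h1 : LocallyIntegrable (fun r => B * ‖c (S r)‖) volume :=
      (continuous_const.mul (hccont.comp hScont).norm).locallyIntegrable
    refine h1.mono hgm (Filter.Eventually.of_forall fun r => ?_)
    rw [hg, norm_mul, Complex.norm_real, Real.norm_of_nonneg (hν0 r),
      Real.norm_of_nonneg (by positivity)]
    gcongr
    exact hνB r
  have hgii : ∀ u v, IntervalIntegrable g volume u v := fun u v =>
    (hgloc.integrableOn_isCompact isCompact_uIcc).intervalIntegrable
  have hgM : ∀ r ∈ Set.Icc s t, ‖g r‖ ≤ B * M := by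
    intro r hr
    rw [hg, norm_mul, Complex.norm_real, Real.norm_of_nonneg (hν0 r)]
    have h1 : c (S r) = a' (S r) := by rw [hc]; simp only; rw [max_eq_right (hS0 r hr.2)]
    rw [h1]
    exact mul_le_mul (hνB r) (hM _ (hSmem r hr)) (norm_nonneg _) hB
  -- Since ν is only measurable, its primitive S is only Lipschitz and the classical chain rule
  -- fails. The candidate constant r ↦ a(S r) + ∫_s^r g is Lipschitz, and by Lebesgue's
  -- differentiation theorem its derivative vanishes almost everywhere.
  have hAC : AbsolutelyContinuousOnInterval (fun r => a (S r) + ∫ x in s..r, g x) s t := by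
    refine LipschitzOnWith.absolutelyContinuousOnInterval (K := (M * B + B * M).toNNReal) ?_
    rw [Set.uIcc_of_le hst]
    refine LipschitzOnWith.of_dist_le_mul fun u hu v hv => ?_
    rw [Real.coe_toNNReal _ (by positivity), dist_eq_norm, add_sub_add_comm, add_mul]
    refine (norm_add_le _ _).trans (add_le_add ?_ ?_)
    · have h1 := (convex_Icc (0 : ℝ) (S s)).norm_image_sub_le_of_norm_hasDerivWithin_le
        (fun x hx => (ha x hx.1).hasDerivWithinAt) (fun x hx => hM x hx) (hSmem v hv) (hSmem u hu)
      refine h1.trans ?_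
      rw [mul_assoc, Real.dist_eq]
      gcongr
      exact hSlip u v
    · rw [intervalIntegral.integral_interval_sub_left (hgii _ _) (hgii _ _), Real.dist_eq]
      refine intervalIntegral.norm_integral_le_of_norm_le_const fun x hx => hgM x ?_
      have hx' := Set.uIoc_subset_uIcc hx
      exact (Set.uIcc_subset_Icc hv hu) hx'
  obtain ⟨C, hC⟩ := hAC.const_of_ae_hasDerivAt_zero (by
    filter_upwards [_root_.LocallyIntegrable.ae_hasDerivAt_integral hνint,
      _root_.LocallyIntegrable.ae_hasDerivAt_integral hgloc] with r h1 h2 hr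
    rw [Set.uIcc_of_le hst] at hr
    have h3 : HasDerivAt S (-ν r) r := by
      have : S = fun r => - ∫ x in t..r, ν x := by
        funext r; rw [hS]; exact intervalIntegral.integral_symm _ _
      rw [this]
      exact (h1 t).neg
    have h4 := (ha (S r) (hS0 r hr.2)).scomp r h3
    have h5 := h4.add (h2 s)
    refine h5.congr_deriv ?_
    have h6 : c (S r) = a' (S r) := by rw [hc]; simp only; rw [max_eq_right (hS0 r hr.2)]
    rw [hg]
    simp only [h6, Complex.real_smul]
    push_cast
    ring)
  have e1 := hC s (by rw [Set.uIcc_of_le hst]; exact ⟨le_rfl, hst⟩)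
  have e2 := hC t (by rw [Set.uIcc_of_le hst]; exact ⟨hst, le_rfl⟩)
  simp only [intervalIntegral.integral_same, add_zero] at e1
  rw [← e1] at e2
  have h7 : S t = 0 := by simp [hS]
  rw [h7, intervalIntegral.integral_of_le hst] at e2
  rw [← e2]
  ring

/-- A Duhamel formula along the characteristics `σ(s) = ∫_s^t ν`. -/
theorem duhamel {T : ℝ} {A A' : ℝ → ℝ → ℂ} {bnd : ℝ → ℝ} {b b' : ℝ → ℂ} {w w' : ℝ → ℝ → ℂ}
    (hA : ∀ᵐ s ∂(volume.restrict (Set.Ioc 0 T)), ∀ σ, 0 ≤ σ → HasDerivAt (A s) (A' s σ) σ)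
    (hA' : ∀ᵐ s ∂(volume.restrict (Set.Ioc 0 T)), ContinuousOn (A' s) (Set.Ici 0))
    (hAm : ∀ σ, 0 ≤ σ → AEStronglyMeasurable (fun s => A s σ) (volume.restrict (Set.Ioc 0 T)))
    (hAm' : ∀ σ, 0 ≤ σ → AEStronglyMeasurable (fun s => A' s σ) (volume.restrict (Set.Ioc 0 T)))
    (hbnd : Integrable bnd (volume.restrict (Set.Ioc 0 T)))
    (hAb : ∀ᵐ s ∂(volume.restrict (Set.Ioc 0 T)), ∀ σ, 0 ≤ σ → ‖A s σ‖ ≤ bnd s)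
    (hAb' : ∀ᵐ s ∂(volume.restrict (Set.Ioc 0 T)), ∀ σ, 0 ≤ σ → ‖A' s σ‖ ≤ bnd s)
    (hb : ∀ σ, 0 ≤ σ → HasDerivAt b (b' σ) σ) (hb' : ContinuousOn b' (Set.Ici 0))
    (hw : ∀ᵐ t ∂(volume.restrict (Set.Ioc 0 T)), w t 0 = b 0 + ∫ s in Set.Ioc 0 t, A s 0)
    (hw' : ∀ σ, 0 ≤ σ → ∀ᵐ t ∂(volume.restrict (Set.Ioc 0 T)),
      w' t σ = b' σ + ∫ s in Set.Ioc 0 t, A' s σ)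
    (hwc : ∀ᵐ t ∂(volume.restrict (Set.Ioc 0 T)), ContinuousOn (w' t) (Set.Ici 0))
    {ν : ℝ → ℝ} (hν : Measurable ν) {B : ℝ} (hν0 : ∀ s, 0 ≤ ν s) (hνB : ∀ s, ν s ≤ B) :
    ∀ᵐ t ∂(volume.restrict (Set.Ioc 0 T)), w t 0 = b (∫ x in (0 : ℝ)..t, ν x) +
      ∫ s in Set.Ioc 0 t, (A s (∫ x in s..t, ν x) - (ν s : ℂ) * w' s (∫ x in s..t, ν x)) := by
  have hB : 0 ≤ B := (hν0 0).trans (hνB 0)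
  set m : ℝ → ℝ := fun σ => max 0 σ with hm
  have hmc : Continuous m := continuous_const.max continuous_id
  have hm0 : ∀ σ, 0 ≤ m σ := fun σ => le_max_left _ _
  have hsub : ∀ t, t ≤ T → volume.restrict (Set.Ioc 0 t) ≤ volume.restrict (Set.Ioc 0 T) :=
    fun t ht => Measure.restrict_mono (Set.Ioc_subset_Ioc_right ht) le_rfl
  -- the equation for the derivative, simultaneously for all values of the parameter
  have hall : ∀ᵐ t ∂(volume.restrict (Set.Ioc 0 T)), ∀ σ,
      w' t (m σ) = b' (m σ) + ∫ s in Set.Ioc 0 t, A' s (m σ) := by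
    have h1 : ∀ᵐ t ∂(volume.restrict (Set.Ioc 0 T)), ∀ q : ℚ,
        w' t (m q) = b' (m q) + ∫ s in Set.Ioc 0 t, A' s (m q) :=
      ae_all_iff.2 fun q => hw' _ (hm0 q)
    filter_upwards [h1, hwc, ae_restrict_mem measurableSet_Ioc] with t ht htc htm
    have hc1 : Continuous fun σ => w' t (m σ) := htc.comp_continuous hmc hm0
    have hc2 : Continuous fun σ => b' (m σ) + ∫ s in Set.Ioc 0 t, A' s (m σ) := by
      refine (hb'.comp_continuous hmc hm0).add ?_
      refine continuous_of_dominated (bound := bnd)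
        (fun σ => (hAm' _ (hm0 σ)).mono_measure (hsub t htm.2)) (fun σ => ?_)
        (hbnd.mono_measure (hsub t htm.2)) ?_
      · filter_upwards [ae_mono (hsub t htm.2) hAb'] with s hs using hs _ (hm0 σ)
      · filter_upwards [ae_mono (hsub t htm.2) hA'] with s hs using hs.comp_continuous hmc hm0
    exact congrFun (DenseRange.equalizer Rat.denseRange_cast hc1 hc2 (funext ht))
  have hνint : LocallyIntegrable ν volume := by
    refine (locallyIntegrable_const B).mono hν.aestronglyMeasurable ?_
    refine Filter.Eventually.of_forall fun x => ?_
    rw [Real.norm_of_nonneg (hν0 x), Real.norm_of_nonneg hB]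
    exact hνB x
  have hνii : ∀ u v, IntervalIntegrable ν volume u v := fun u v =>
    (hνint.integrableOn_isCompact isCompact_uIcc).intervalIntegrable
  filter_upwards [hw, ae_restrict_mem measurableSet_Ioc] with t ht htm
  have ht0 : 0 ≤ t := htm.1.le
  set S : ℝ → ℝ := fun r => ∫ x in r..t, ν x with hS
  have hScont : Continuous S := by
    have : S = fun r => - ∫ x in t..r, ν x := by
      funext r; rw [hS]; exact intervalIntegral.integral_symm _ _
    rw [this]
    exact (intervalIntegral.continuous_primitive hνii t).neg
  have hS0 : ∀ r, r ≤ t → m (S r) = S r := fun r hr =>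
    max_eq_right (intervalIntegral.integral_nonneg hr fun x _ => hν0 x)
  set μ := volume.restrict (Set.Ioc 0 t) with hμ
  have hle : μ ≤ volume.restrict (Set.Ioc 0 T) := hsub t htm.2
  -- measurability along the characteristic
  have hjoint : AEStronglyMeasurable (Function.uncurry fun s r => A' s (m (S r))) (μ.prod μ) := by
    refine aestronglyMeasurable_uncurry_of_continuous μ ?_ fun r => (hAm' _ (hm0 _)).mono_measure hle
    filter_upwards [ae_mono hle hA'] with s hs
    exact hs.comp_continuous (hmc.comp hScont) fun r => hm0 _
  -- Fubini on the triangle s < r ≤ t. Integrating in r first gives, by the chain rule, A(s, S s) -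
  -- A(s, 0); integrating in s first gives, by the equation for w', ν(r)(w'(r, S r) - b'(S r)).
  -- Combined with the equation at σ = 0 and the chain rule for b, the equality of the two is the
  -- formula.
  set F : ℝ → ℝ → ℂ := fun s r => (Set.Ioi s).indicator (fun r => (ν r : ℂ) * A' s (m (S r))) r
    with hF
  have hFint : Integrable (Function.uncurry F) (μ.prod μ) := by
    have hdom : Integrable (fun z : ℝ × ℝ => bnd z.1 * B) (μ.prod μ) :=
      (hbnd.mono_measure hle).mul_prod (integrable_const B)
    have hFm : AEStronglyMeasurable (Function.uncurry F) (μ.prod μ) := by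
      have h1 : Function.uncurry F = {z : ℝ × ℝ | z.1 < z.2}.indicator
          (fun z => (ν z.2 : ℂ) * A' z.1 (m (S z.2))) := by
        ext z; rfl
      rw [h1]
      refine AEStronglyMeasurable.indicator ?_ (measurableSet_lt measurable_fst measurable_snd)
      refine AEStronglyMeasurable.mul ?_ hjoint
      exact (Complex.measurable_ofReal.comp (hν.comp measurable_snd)).aestronglyMeasurable
    refine hdom.mono' hFm ?_
    have hb1 : ∀ᵐ z ∂(μ.prod μ), ∀ σ, 0 ≤ σ → ‖A' z.1 σ‖ ≤ bnd z.1 :=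
      Measure.quasiMeasurePreserving_fst.ae (ae_mono hle hAb')
    filter_upwards [hb1] with z hz
    have h0 : 0 ≤ bnd z.1 := (norm_nonneg _).trans (hz 0 le_rfl)
    change ‖(Set.Ioi z.1).indicator (fun r => (ν r : ℂ) * A' z.1 (m (S r))) z.2‖ ≤ _
    refine (norm_indicator_le_norm_self (fun r => (ν r : ℂ) * A' z.1 (m (S r))) z.2).trans ?_
    rw [norm_mul, Complex.norm_real, Real.norm_of_nonneg (hν0 _), mul_comm]
    exact mul_le_mul (hz _ (hm0 _)) (hνB _) (hν0 _) h0
  have hswap := integral_integral_swap hFint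
  have hL : ∫ s, ∫ r, F s r ∂μ ∂μ = ∫ s in Set.Ioc 0 t, (A s (S s) - A s 0) := by
    refine integral_congr_ae ?_
    filter_upwards [ae_mono hle hA, ae_mono hle hA', ae_restrict_mem measurableSet_Ioc]
      with s h1 h2 hs
    have h3 := eq_add_integral_comp_primitive h1 h2 hν hν0 hνB hs.2
    have h4 : ∫ r, F s r ∂μ = ∫ r in Set.Ioc s t, (ν r : ℂ) * A' s (m (S r)) := by
      simp only [hF, hμ]
      rw [setIntegral_indicator measurableSet_Ioi]
      congr 2
      ext r
      simp only [Set.mem_inter_iff, Set.mem_Ioc, Set.mem_Ioi]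
      have := hs.1
      grind
    rw [h4]
    linear_combination h3
  have hR : ∫ r, ∫ s, F s r ∂μ ∂μ =
      ∫ r in Set.Ioc 0 t, ((ν r : ℂ) * w' r (S r) - (ν r : ℂ) * b' (m (S r))) := by
    refine integral_congr_ae ?_
    filter_upwards [ae_mono hle hall, ae_restrict_mem measurableSet_Ioc] with r h1 hr
    have h2 : ∫ s, F s r ∂μ = ∫ s in Set.Ioo 0 r, (ν r : ℂ) * A' s (m (S r)) := by
      have h3 : ∀ s, F s r = (Set.Iio r).indicator (fun s => (ν r : ℂ) * A' s (m (S r))) s :=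
        fun s => rfl
      simp_rw [h3, hμ]
      rw [setIntegral_indicator measurableSet_Iio]
      congr 2
      ext s
      simp only [Set.mem_inter_iff, Set.mem_Ioc, Set.mem_Iio, Set.mem_Ioo]
      have := hr.2
      grind
    rw [h2, ← integral_Ioc_eq_integral_Ioo, integral_const_mul, ← mul_sub]
    have h4 := h1 (S r)
    rw [← hS0 r hr.2]
    rw [hm] at h4 ⊢
    simp only at h4 ⊢
    rw [max_eq_right (le_max_left (0 : ℝ) (S r)), h4]
    ring
  have hbint := eq_add_integral_comp_primitive hb hb' hν hν0 hνB ht0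
  have i1 : IntegrableOn (fun s => A s 0) (Set.Ioc 0 t) :=
    (hbnd.mono_measure hle).mono' ((hAm 0 le_rfl).mono_measure hle)
      (by filter_upwards [ae_mono hle hAb] with s hs using hs 0 le_rfl)
  have i2 : IntegrableOn (fun s => A s (S s)) (Set.Ioc 0 t) := by
    have h5 : Integrable (fun s => ∫ r, F s r ∂μ) μ := hFint.integral_prod_left
    refine (h5.add i1).congr ?_
    filter_upwards [ae_mono hle hA, ae_mono hle hA', ae_restrict_mem measurableSet_Ioc]
      with s h1 h2 hs
    have h3 := eq_add_integral_comp_primitive h1 h2 hν hν0 hνB hs.2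
    have h4 : ∫ r, F s r ∂μ = ∫ r in Set.Ioc s t, (ν r : ℂ) * A' s (m (S r)) := by
      simp only [hF, hμ]
      rw [setIntegral_indicator measurableSet_Ioi]
      congr 2
      ext r
      simp only [Set.mem_inter_iff, Set.mem_Ioc, Set.mem_Ioi]
      have := hs.1
      grind
    rw [Pi.add_apply, h4]
    linear_combination h3
  have i3 : IntegrableOn (fun r => (ν r : ℂ) * b' (m (S r))) (Set.Ioc 0 t) := by
    have hc : Continuous fun r => b' (m (S r)) :=
      hb'.comp_continuous (hmc.comp hScont) fun _ => hm0 _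
    have h1 : IntegrableOn (fun r => B * ‖b' (m (S r))‖) (Set.Ioc 0 t) :=
      ((continuous_const.mul hc.norm).integrableOn_Icc).mono_set Set.Ioc_subset_Icc_self
    refine h1.mono' ((Complex.measurable_ofReal.comp hν).aestronglyMeasurable.mul
      hc.aestronglyMeasurable) (Filter.Eventually.of_forall fun r => ?_)
    rw [norm_mul, Complex.norm_real, Real.norm_of_nonneg (hν0 _)]
    gcongr
    exact hνB r
  have i4 : IntegrableOn (fun r => (ν r : ℂ) * w' r (S r)) (Set.Ioc 0 t) := by
    have h5 : Integrable (fun r => ∫ s, F s r ∂μ) μ := hFint.integral_prod_right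
    refine (h5.add i3).congr ?_
    filter_upwards [ae_mono hle hall, ae_restrict_mem measurableSet_Ioc] with r h1 hr
    have h2 : ∫ s, F s r ∂μ = ∫ s in Set.Ioo 0 r, (ν r : ℂ) * A' s (m (S r)) := by
      have h3 : ∀ s, F s r = (Set.Iio r).indicator (fun s => (ν r : ℂ) * A' s (m (S r))) s :=
        fun s => rfl
      simp_rw [h3, hμ]
      rw [setIntegral_indicator measurableSet_Iio]
      congr 2
      ext s
      simp only [Set.mem_inter_iff, Set.mem_Ioc, Set.mem_Iio, Set.mem_Ioo]
      have := hr.2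
      grind
    have h4 := h1 (S r)
    rw [hS0 r hr.2] at h4
    rw [Pi.add_apply, h2, ← integral_Ioc_eq_integral_Ioo, integral_const_mul, hS0 r hr.2, h4]
    ring
  rw [hL, hR, integral_sub i2 i1, integral_sub i4 i3] at hswap
  rw [integral_sub i2 i4, ht, hbint]
  linear_combination -hswap

end Duhamel

/-! ### Extension of the coefficient functions to the whole line -/

section Extension

/-- Induction on the order: the derivative is extended first and then integrated, while at order
zero the argument is clamped to [-R, R]. The extension is used only on [-R-1, R+1], so each
integration runs over a length at most 1 outside the original interval and adds K times the constant
of the previous stage, independently of R. -/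
theorem exists_local_extension (j : ℕ) : ∀ (f : ℝ → ℝ) (R K : ℝ),
    ContDiff ℝ ((⊤ : ℕ∞) : WithTop ℕ∞) f → 0 ≤ R →
    (∀ n ≤ j, ∀ r, |r| ≤ R → |iteratedDeriv n f r| ≤ K) →
    ∃ F : ℝ → ℝ, ContDiff ℝ j F ∧ (∀ r, |r| ≤ R → F r = f r) ∧
      ∀ n ≤ j, ∀ r, |r| ≤ R + 1 → |iteratedDeriv n F r| ≤ (j + 1) * K := by
  induction j with
  | zero =>
    intro f R K hf hR hK
    refine ⟨fun r => f (max (-R) (min R r)), ?_, fun r hr => ?_, fun n hn r _ => ?_⟩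
    · exact contDiff_zero.2 (hf.continuous.comp (by fun_prop))
    · rw [abs_le] at hr
      simp only
      rw [min_eq_right hr.2, max_eq_right hr.1]
    · obtain rfl : n = 0 := by omega
      have := hK 0 le_rfl (max (-R) (min R r)) (by
        rw [abs_le]
        exact ⟨le_max_left _ _, max_le (by linarith) (min_le_left _ _)⟩)
      simpa using this
  | succ j ih =>
    intro f R K hf hR hK
    have hf' : ContDiff ℝ ((⊤ : ℕ∞) : WithTop ℕ∞) (deriv f) :=
      ((contDiff_infty_iff_deriv).1 hf).2
    obtain ⟨F, hF, hFf, hFK⟩ := ih (deriv f) R K hf' hR fun n hn r hr => by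
      rw [← iteratedDeriv_succ']; exact hK (n + 1) (by omega) r hr
    have hK0 : 0 ≤ K := (abs_nonneg _).trans (hK 0 (by omega) 0 (by simpa using hR))
    have hd : ∀ r, HasDerivAt (fun r => f 0 + ∫ s in (0 : ℝ)..r, F s) (F r) r := fun r =>
      (hF.continuous.integral_hasStrictDerivAt 0 r).hasDerivAt.const_add _
    have hde : deriv (fun r => f 0 + ∫ s in (0 : ℝ)..r, F s) = F := funext fun r => (hd r).deriv
    have hfd : ∀ r, HasDerivAt f (deriv f r) r := fun r =>
      (hf.differentiable (by simp) r).hasDerivAt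
    have heq : ∀ r, |r| ≤ R → f 0 + ∫ s in (0 : ℝ)..r, F s = f r := by
      intro r hr
      have h1 : ∫ s in (0 : ℝ)..r, F s = ∫ s in (0 : ℝ)..r, deriv f s := by
        refine intervalIntegral.integral_congr fun s hs => hFf s ?_
        rw [abs_le] at hr ⊢
        rw [Set.mem_uIcc] at hs
        rcases hs with hs | hs <;> constructor <;> linarith [hs.1, hs.2]
      rw [h1, intervalIntegral.integral_eq_sub_of_hasDerivAt (fun s _ => hfd s)
        (hf'.continuous.intervalIntegrable _ _)]
      ring
    refine ⟨fun r => f 0 + ∫ s in (0 : ℝ)..r, F s, ?_, heq, fun n hn r hr => ?_⟩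
    · push_cast
      rw [contDiff_succ_iff_deriv]
      refine ⟨fun r => (hd r).differentiableAt, by simp, ?_⟩
      rw [hde]; exact hF
    · rcases n with _ | n
      · rw [iteratedDeriv_zero]
        set c := max (-R) (min R r) with hc
        have hcR : |c| ≤ R := by
          rw [abs_le]
          exact ⟨le_max_left _ _, max_le (by linarith) (min_le_left _ _)⟩
        rw [abs_le] at hr
        have hrc : |r - c| ≤ 1 := by
          rw [hc, abs_le]
          rcases le_total R r with h | h
          · rw [min_eq_left h, max_eq_right (by linarith)]; constructor <;> linarith [hr.2]
          · rw [min_eq_right h]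
            rcases le_total (-R) r with h' | h'
            · rw [max_eq_right h']; simp
            · rw [max_eq_left h']; constructor <;> linarith [hr.1]
        have h2 : f 0 + ∫ s in (0 : ℝ)..r, F s = f c + ∫ s in c..r, F s := by
          rw [← heq c hcR, add_assoc, intervalIntegral.integral_add_adjacent_intervals
            (hF.continuous.intervalIntegrable _ _) (hF.continuous.intervalIntegrable _ _)]
        rw [h2]
        have h3 : ‖∫ s in c..r, F s‖ ≤ (j + 1) * K * |r - c| := by
          refine intervalIntegral.norm_integral_le_of_norm_le_const fun s hs => ?_
          have hs' := Set.uIoc_subset_uIcc hs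
          have := hFK 0 (Nat.zero_le _) s (by
            rw [abs_le] at hcR ⊢
            rw [Set.mem_uIcc] at hs'
            rcases hs' with h | h <;> constructor <;> linarith [h.1, h.2, hr.1, hr.2])
          rwa [iteratedDeriv_zero] at this
        have h4 := hK 0 (by omega) c hcR
        rw [iteratedDeriv_zero] at h4
        rw [Real.norm_eq_abs] at h3
        have h5 : (j + 1) * K * |r - c| ≤ (j + 1) * K * 1 := by gcongr
        push_cast
        linarith [abs_add_le (f c) (∫ s in c..r, F s)]
      · rw [iteratedDeriv_succ', hde]
        refine (hFK n (by omega) r hr).trans ?_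
        push_cast
        nlinarith

theorem exists_iteratedDeriv_smoothTransition_le (i : ℕ) :
    ∃ B : ℝ, 0 ≤ B ∧ ∀ x, |iteratedDeriv i Real.smoothTransition x| ≤ B := by
  have hc : Continuous (iteratedDeriv i Real.smoothTransition) :=
    (Real.smoothTransition.contDiff (n := i)).continuous_iteratedDeriv i le_rfl
  obtain ⟨B, hB⟩ := (isCompact_Icc (a := (0 : ℝ)) (b := 1)).exists_bound_of_continuousOn
    hc.continuousOn
  have hconst : ∀ (x c : ℝ), (Real.smoothTransition =ᶠ[nhds x] fun _ => c) → |c| ≤ 1 →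
      |iteratedDeriv i Real.smoothTransition x| ≤ 1 := by
    intro x c h hc1
    rw [Filter.EventuallyEq.iteratedDeriv_eq i h, iteratedDeriv_const]
    split_ifs <;> simp [hc1]
  refine ⟨max 1 B, by positivity, fun x => ?_⟩
  rcases lt_or_ge x 0 with h0 | h0
  · refine (hconst x 0 ?_ (by simp)).trans (le_max_left _ _)
    filter_upwards [eventually_lt_nhds h0] with y hy
      using Real.smoothTransition.zero_of_nonpos hy.le
  rcases le_or_gt x 1 with h1 | h1
  · exact (hB x ⟨h0, h1⟩).trans (le_max_right _ _)
  · refine (hconst x 1 ?_ (by simp)).trans (le_max_left _ _)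
    filter_upwards [eventually_gt_nhds h1] with y hy
      using Real.smoothTransition.one_of_one_le hy.le

/-- Functions with bounded derivatives on an interval are extended with a control of the derivatives
that does not depend on the interval. -/
theorem exists_extension (M : ℕ) : ∃ C : ℝ, 0 ≤ C ∧ ∀ (f : ℝ → ℝ) (R K : ℝ),
    ContDiff ℝ ((⊤ : ℕ∞) : WithTop ℕ∞) f → 0 ≤ R →
    (∀ n, 1 ≤ n → n ≤ M + 1 → ∀ r, |r| ≤ R → |iteratedDeriv n f r| ≤ K) →
    ∃ g : ℝ → ℝ, ContDiff ℝ (M + 1) g ∧ (∀ r, |r| ≤ R → g r = f r) ∧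
      ∀ n, 1 ≤ n → n ≤ M + 1 → ∀ r, |iteratedDeriv n g r| ≤ C * K := by
  choose B hB0 hB using exists_iteratedDeriv_smoothTransition_le
  set D : ℕ → ℝ := fun n => ∑ i ∈ Finset.range (n + 1), (n.choose i : ℝ) * B i * B (n - i) with hD
  have hD0 : ∀ n, 0 ≤ D n := fun n => Finset.sum_nonneg fun i _ =>
    mul_nonneg (mul_nonneg (by positivity) (hB0 _)) (hB0 _)
  set E : ℕ → ℝ := fun n => ∑ i ∈ Finset.range (n + 1), (n.choose i : ℝ) * D i * (M + 1) with hE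
  have hE0 : ∀ n, 0 ≤ E n := fun n => Finset.sum_nonneg fun i _ =>
    mul_nonneg (mul_nonneg (by positivity) (hD0 _)) (by positivity)
  refine ⟨∑ n ∈ Finset.range (M + 1), E n, Finset.sum_nonneg fun n _ => hE0 n, ?_⟩
  intro f R K hf hR hK
  have hK0 : 0 ≤ K := (abs_nonneg _).trans (hK 1 le_rfl (by omega) 0 (by simpa using hR))
  have hf' : ContDiff ℝ ((⊤ : ℕ∞) : WithTop ℕ∞) (deriv f) := ((contDiff_infty_iff_deriv).1 hf).2
  obtain ⟨F, hF, hFf, hFK⟩ := exists_local_extension M (deriv f) R K hf' hR fun n hn r hr => by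
    rw [← iteratedDeriv_succ']; exact hK (n + 1) (by omega) (by omega) r hr
  -- The cutoffs go from 1 to 0 over unit length whatever R is, so their derivatives have bounds
  -- independent of R. It is the extended derivative of f that is cut off; integrating it back
  -- recovers f on [-R, R]. Only derivatives of order at least 1 are controlled, and g itself may be
  -- unbounded.
  set c1 : ℝ → ℝ := fun r => Real.smoothTransition (R + 1 - r) with hc1
  set c2 : ℝ → ℝ := fun r => Real.smoothTransition (R + 1 + r) with hc2
  have hc1s : ∀ n : ℕ, ContDiff ℝ n c1 := fun n =>
    Real.smoothTransition.contDiff.comp (contDiff_const.sub contDiff_id)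
  have hc2s : ∀ n : ℕ, ContDiff ℝ n c2 := fun n =>
    Real.smoothTransition.contDiff.comp (contDiff_const.add contDiff_id)
  have hc1B : ∀ n r, |iteratedDeriv n c1 r| ≤ B n := by
    intro n r
    rw [hc1, iteratedDeriv_comp_const_sub]
    simp only [smul_eq_mul, abs_mul, abs_pow, abs_neg, abs_one, one_pow, one_mul]
    exact hB _ _
  have hc2B : ∀ n r, |iteratedDeriv n c2 r| ≤ B n := by
    intro n r
    rw [hc2, iteratedDeriv_comp_const_add]
    exact hB _ _
  have hcD : ∀ n r, |iteratedDeriv n (fun r => c1 r * c2 r) r| ≤ D n := by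
    intro n r
    rw [iteratedDeriv_fun_mul (hc1s n).contDiffAt (hc2s n).contDiffAt]
    refine (Finset.abs_sum_le_sum_abs _ _).trans (Finset.sum_le_sum fun i _ => ?_)
    rw [abs_mul, abs_mul, Nat.abs_cast]
    gcongr
    · exact mul_nonneg (by positivity) (hB0 _)
    · exact hc1B _ _
    · exact hc2B _ _
  set h : ℝ → ℝ := fun r => (c1 r * c2 r) * F r with hh
  have hhs : ContDiff ℝ M h := ((hc1s M).mul (hc2s M)).mul hF
  have hhR : ∀ r, |r| ≤ R → h r = deriv f r := by
    intro r hr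
    have hr' := abs_le.1 hr
    simp only [hh, hc1, hc2]
    rw [Real.smoothTransition.one_of_one_le (by linarith),
      Real.smoothTransition.one_of_one_le (by linarith), hFf r hr]
    ring
  have hhK : ∀ n ≤ M, ∀ r, |iteratedDeriv n h r| ≤ E n * K := by
    intro n hn r
    by_cases hr : |r| ≤ R + 1
    · rw [hh, iteratedDeriv_fun_mul ((hc1s n).mul (hc2s n)).contDiffAt
        (hF.of_le (by exact_mod_cast hn)).contDiffAt]
      refine (Finset.abs_sum_le_sum_abs _ _).trans ?_
      rw [hE, Finset.sum_mul]
      refine Finset.sum_le_sum fun i _ => ?_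
      rw [abs_mul, abs_mul, Nat.abs_cast, mul_assoc _ _ K]
      gcongr
      · exact mul_nonneg (by positivity) (hD0 _)
      · exact hcD _ _
      · exact hFK _ (by omega) r hr
    · have h0 : h =ᶠ[nhds r] fun _ => 0 := by
        have hlt : ∀ᶠ y in nhds r, R + 1 < |y| :=
          continuous_abs.continuousAt.eventually_const_lt (not_le.1 hr)
        filter_upwards [hlt] with y hy
        simp only [hh, hc1, hc2]
        rcases lt_abs.1 hy with hy | hy
        · rw [Real.smoothTransition.zero_of_nonpos (x := R + 1 - y) (by linarith)]; ring
        · rw [Real.smoothTransition.zero_of_nonpos (x := R + 1 + y) (by linarith)]; ring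
      rw [Filter.EventuallyEq.iteratedDeriv_eq n h0, iteratedDeriv_const]
      simpa using mul_nonneg (hE0 n) hK0
  have hd : ∀ r, HasDerivAt (fun r => f 0 + ∫ s in (0 : ℝ)..r, h s) (h r) r := fun r =>
    (hhs.continuous.integral_hasStrictDerivAt 0 r).hasDerivAt.const_add _
  have hde : deriv (fun r => f 0 + ∫ s in (0 : ℝ)..r, h s) = h := funext fun r => (hd r).deriv
  refine ⟨fun r => f 0 + ∫ s in (0 : ℝ)..r, h s, ?_, fun r hr => ?_, fun n hn hnM r => ?_⟩
  · rw [contDiff_succ_iff_deriv]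
    refine ⟨fun r => (hd r).differentiableAt, by simp, ?_⟩
    rw [hde]; exact hhs
  · have h1 : ∫ s in (0 : ℝ)..r, h s = ∫ s in (0 : ℝ)..r, deriv f s := by
      refine intervalIntegral.integral_congr fun s hs => hhR s ?_
      rw [abs_le] at hr ⊢
      rw [Set.mem_uIcc] at hs
      rcases hs with hs | hs <;> constructor <;> linarith [hs.1, hs.2]
    beta_reduce
    rw [h1, intervalIntegral.integral_eq_sub_of_hasDerivAt
      (fun s _ => (hf.differentiable (by simp) s).hasDerivAt)
      (hf'.continuous.intervalIntegrable _ _)]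
    ring
  · obtain ⟨n, rfl⟩ : ∃ m, n = m + 1 := ⟨n - 1, by omega⟩
    rw [iteratedDeriv_succ', hde]
    refine (hhK n (by omega) r).trans ?_
    gcongr
    exact Finset.single_le_sum (f := E) (fun n _ => hE0 n) (Finset.mem_range.2 (by omega))

end Extension

/-! ### High-order differences of compositions with dyadic sums -/

section Differences

theorem abs_fwdDiff_iter_le (M : ℕ) : ∀ (H : ℝ → ℝ) (y B : ℝ), ContDiff ℝ M H →
    (∀ t ∈ Set.Icc y (y + M), |iteratedDeriv M H t| ≤ B) → |((fwdDiff (1 : ℝ))^[M] H) y| ≤ B := by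
  induction M with
  | zero =>
    intro H y B _ hB
    simpa using hB y (by simp)
  | succ M ih =>
    intro H y B hH hB
    rw [Function.iterate_succ_apply]
    have hH' : ContDiff ℝ M H := hH.of_le (by exact_mod_cast Nat.le_succ M)
    have hs : ContDiff ℝ M fun t => H (t + 1) := hH'.comp (contDiff_id.add contDiff_const)
    refine ih _ y B (hs.sub hH') fun t ht => ?_
    have h1 : iteratedDeriv M (fwdDiff 1 H) t = iteratedDeriv M H (t + 1) - iteratedDeriv M H t := by
      have : fwdDiff 1 H = fun t => H (t + 1) - H t := rfl
      rw [this, iteratedDeriv_fun_sub hs.contDiffAt hH'.contDiffAt, iteratedDeriv_comp_add_const]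
    rw [h1]
    have hd : ∀ x ∈ Set.Icc t (t + 1), HasDerivWithinAt (iteratedDeriv M H)
        (iteratedDeriv (M + 1) H x) (Set.Icc t (t + 1)) x := by
      intro x _
      have h2 : Differentiable ℝ (iteratedDeriv M H) :=
        hH.differentiable_iteratedDeriv M (by exact_mod_cast Nat.lt_succ_self M)
      rw [iteratedDeriv_succ]
      exact (h2 x).hasDerivAt.hasDerivWithinAt
    have h3 := (convex_Icc t (t + 1)).norm_image_sub_le_of_norm_hasDerivWithin_le hd
      (C := B) (fun x hx => hB x ⟨ht.1.trans hx.1, hx.2.trans (by push_cast; linarith [ht.2])⟩)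
      (Set.left_mem_Icc.2 (by linarith)) (Set.right_mem_Icc.2 (by linarith))
    simpa using h3

theorem fwdDiff_iter_zero_eq_sum (M : ℕ) (H : ℝ → ℝ) :
    ((fwdDiff (1 : ℝ))^[M] H) 0 =
      ∑ k ∈ Finset.range (M + 1), ((-1 : ℝ) ^ (M - k) * M.choose k) * H k := by
  rw [fwdDiff_iter_eq_sum_shift]
  refine Finset.sum_congr rfl fun k _ => ?_
  simp

theorem fwdDiff_iter_const {M : ℕ} (hM : 1 ≤ M) (r : ℝ) :
    ((fwdDiff (1 : ℝ))^[M] fun _ => r) 0 = 0 := by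
  refine abs_nonpos_iff.1 (abs_fwdDiff_iter_le M _ 0 0 contDiff_const fun t _ => ?_)
  rw [iteratedDeriv_const, if_neg (by omega), abs_zero]

/-- Leibniz and Faà di Bruno formulas, with a single scale L: each derivative of p or of S costs one
factor L, hence M derivatives cost L^M in total, and the prefactor c of p is kept to the first
power. -/
theorem abs_iteratedDeriv_mul_comp_le {M : ℕ} {g p S : ℝ → ℝ} {K D L c t : ℝ}
    (hg : ContDiff ℝ M g) (hp : ContDiff ℝ M p) (hS : ContDiff ℝ M S) (hL : 0 ≤ L)
    (hgK : ∀ i ≤ M, ∀ r, |iteratedDeriv i g r| ≤ K)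
    (hpc : ∀ i ≤ M, |iteratedDeriv i p t| ≤ L ^ i * c)
    (hSD : ∀ i, 1 ≤ i → i ≤ M → |iteratedDeriv i S t| ≤ (D * L) ^ i) (hD1 : 1 ≤ D) :
    |iteratedDeriv M (fun t => p t * g (S t)) t| ≤
      (∑ i ∈ Finset.range (M + 1), (M.choose i : ℝ) * (M - i).factorial) * K * D ^ M *
        (L ^ M * c) := by
  have hK0 : 0 ≤ K := (abs_nonneg _).trans (hgK 0 (Nat.zero_le _) 0)
  have hc0 : 0 ≤ c := by simpa using (abs_nonneg _).trans (hpc 0 (Nat.zero_le _))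
  have hgS : ContDiff ℝ M fun t => g (S t) := hg.comp hS
  rw [iteratedDeriv_fun_mul hp.contDiffAt hgS.contDiffAt]
  refine (Finset.abs_sum_le_sum_abs _ _).trans ?_
  rw [Finset.sum_mul, Finset.sum_mul, Finset.sum_mul]
  refine Finset.sum_le_sum fun i hi => ?_
  have hi' : i ≤ M := Nat.lt_succ_iff.1 (Finset.mem_range.1 hi)
  have h1 : |iteratedDeriv (M - i) (fun t => g (S t)) t| ≤
      (M - i).factorial * K * (D * L) ^ (M - i) := by
    have h2 := norm_iteratedFDeriv_comp_le (𝕜 := ℝ) (n := M - i) hg hS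
      (by exact_mod_cast Nat.sub_le M i) t (C := K) (D := D * L)
      (fun j hj => by
        rw [norm_iteratedFDeriv_eq_norm_iteratedDeriv]; exact hgK j (by omega) _)
      (fun j hj hji => by
        rw [norm_iteratedFDeriv_eq_norm_iteratedDeriv]; exact hSD j hj (by omega))
    rw [norm_iteratedFDeriv_eq_norm_iteratedDeriv] at h2
    exact h2
  rw [abs_mul, abs_mul, Nat.abs_cast]
  calc (M.choose i : ℝ) * |iteratedDeriv i p t| * |iteratedDeriv (M - i) (fun t => g (S t)) t|
      ≤ (M.choose i : ℝ) * (L ^ i * c) * ((M - i).factorial * K * (D * L) ^ (M - i)) := by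
        gcongr
        exact hpc i hi'
    _ = (M.choose i : ℝ) * (M - i).factorial * K * D ^ (M - i) * (L ^ (i + (M - i)) * c) := by
        rw [pow_add, mul_pow]; ring
    _ ≤ (M.choose i : ℝ) * (M - i).factorial * K * D ^ M * (L ^ M * c) := by
        rw [Nat.add_sub_cancel' hi']
        gcongr
        · omega

theorem sum_two_pow_le (i n : ℕ) (hi : 1 ≤ i) :
    ∑ l ∈ Finset.range (n + 1), ((2 : ℝ) ^ l) ^ i ≤ 2 * (2 ^ n) ^ i := by
  induction n with
  | zero => simp
  | succ n ih =>
    rw [Finset.sum_range_succ]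
    have : (2 : ℝ) * (2 ^ n) ^ i ≤ (2 ^ (n + 1)) ^ i := by
      rw [pow_succ' 2 n, mul_pow]
      gcongr
      exact le_self_pow₀ (by norm_num) (by omega)
    linarith

/-- Differences of a function of a sum of dyadic oscillations. -/
theorem abs_fwdDiff_iter_comp_sum_le {M : ℕ} (hM : 1 ≤ M) {g : ℝ → ℝ} {K R Λ r₀ : ℝ}
    {p : ℕ → ℝ → ℝ} {c : ℕ → ℝ} (hg : ContDiff ℝ (M + 1) g) (hp : ∀ q, ContDiff ℝ M (p q))
    (hΛ : 0 ≤ Λ) (hR : 0 ≤ R)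
    (hgK : ∀ i, 1 ≤ i → i ≤ M + 1 → ∀ r, |iteratedDeriv i g r| ≤ K)
    (hpR : ∀ q, ∀ i ≤ M, ∀ t ∈ Set.Icc (0 : ℝ) M, |iteratedDeriv i (p q) t| ≤ (2 ^ q * Λ) ^ i * R)
    (n : ℕ) (hpc : ∀ q < n, ∀ i ≤ M, ∀ t ∈ Set.Icc (0 : ℝ) M,
      |iteratedDeriv i (p q) t| ≤ (2 ^ q * Λ) ^ i * c q) :
    |((fwdDiff (1 : ℝ))^[M] fun t => g (r₀ + ∑ l ∈ Finset.range n, p l t)) 0| ≤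
      (∑ i ∈ Finset.range (M + 1), (M.choose i : ℝ) * (M - i).factorial) * K * (1 + 2 * R) ^ M *
        ∑ q ∈ Finset.range n, (2 ^ q * Λ) ^ M * c q := by
  induction n with
  | zero => simp [fwdDiff_iter_const hM]
  | succ n ih =>
    replace ih := ih fun q hq => hpc q (by omega)
    set A := (∑ i ∈ Finset.range (M + 1), (M.choose i : ℝ) * (M - i).factorial) * K *
      (1 + 2 * R) ^ M with hA
    set S : ℝ → ℝ := fun t => r₀ + ∑ l ∈ Finset.range n, p l t with hS
    have hSs : ContDiff ℝ M S := contDiff_const.add (ContDiff.sum fun l _ => hp l)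
    have hg' : ContDiff ℝ M (deriv g) := ((contDiff_succ_iff_deriv).1 hg).2.2
    have hgd : ∀ r, HasDerivAt g (deriv g r) r := fun r =>
      (((contDiff_succ_iff_deriv).1 hg).1 r).hasDerivAt
    -- Telescoping: the n-th piece is switched on by a parameter τ in [0,1]. The derivative in τ is
    -- the difference of p_n · g'(S + τ p_n), so the new piece appears linearly through c_n. The
    -- derivatives of order i ≥ 1 of the pieces of lower index form a geometric sum dominated by
    -- (2^n Λ)^i, so that the whole product varies at the single scale 2^n Λ. This is where g is
    -- differentiated M + 1 times.
    set ψ : ℝ → ℝ := fun τ => ((fwdDiff (1 : ℝ))^[M] fun t => g (S t + τ * p n t)) 0 with hψ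
    have hψd : ∀ τ, HasDerivAt ψ
        (((fwdDiff (1 : ℝ))^[M] fun t => p n t * deriv g (S t + τ * p n t)) 0) τ := by
      intro τ
      simp only [hψ, fwdDiff_iter_zero_eq_sum]
      refine HasDerivAt.fun_sum fun k _ => ?_
      have h1 : HasDerivAt (fun τ => S k + τ * p n k) (p n k) τ := by
        simpa using ((hasDerivAt_id τ).mul_const (p n k)).const_add (S k)
      have h2 : HasDerivAt (fun τ => g (S k + τ * p n k))
          (deriv g (S k + τ * p n k) * p n k) τ := (hgd (S k + τ * p n k)).comp τ h1
      exact (h2.const_mul _).congr_deriv (by ring)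
    have hψb : ∀ τ ∈ Set.Icc (0 : ℝ) 1,
        |((fwdDiff (1 : ℝ))^[M] fun t => p n t * deriv g (S t + τ * p n t)) 0| ≤
          A * ((2 ^ n * Λ) ^ M * c n) := by
      intro τ hτ
      have hSτ : ContDiff ℝ M fun t => S t + τ * p n t := hSs.add (contDiff_const.mul (hp n))
      refine abs_fwdDiff_iter_le M _ 0 _ ((hp n).mul (hg'.comp hSτ)) fun t ht => ?_
      rw [zero_add] at ht
      refine abs_iteratedDeriv_mul_comp_le hg' (hp n) hSτ (by positivity)
        (fun i hi r => ?_) (fun i hi => hpc n (Nat.lt_succ_self n) i hi t ht) (fun i hi hiM => ?_) (by linarith)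
      · rw [← iteratedDeriv_succ']; exact hgK (i + 1) (by omega) (by omega) r
      · have h1 : iteratedDeriv i (fun t => S t + τ * p n t) t =
            ∑ l ∈ Finset.range n, iteratedDeriv i (p l) t + τ * iteratedDeriv i (p n) t := by
          have hle : (i : WithTop ℕ∞) ≤ M := by exact_mod_cast hiM
          rw [iteratedDeriv_fun_add (hSs.of_le hle).contDiffAt
            ((contDiff_const.mul (hp n)).of_le hle).contDiffAt, iteratedDeriv_const_mul_field, hS,
            iteratedDeriv_const_add hi, iteratedDeriv_fun_sum]
          exact fun l _ => ((hp l).of_le hle).contDiffAt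
        rw [h1]
        calc _ ≤ ∑ l ∈ Finset.range n, |iteratedDeriv i (p l) t| +
              1 * |iteratedDeriv i (p n) t| := by
              refine (abs_add_le _ _).trans (add_le_add (Finset.abs_sum_le_sum_abs _ _) ?_)
              rw [abs_mul, abs_of_nonneg hτ.1]
              gcongr
              exact hτ.2
          _ = ∑ l ∈ Finset.range (n + 1), |iteratedDeriv i (p l) t| := by
              rw [Finset.sum_range_succ, one_mul]
          _ ≤ ∑ l ∈ Finset.range (n + 1), (2 ^ l * Λ) ^ i * R :=
              Finset.sum_le_sum fun l _ => hpR l i hiM t ht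
          _ = (∑ l ∈ Finset.range (n + 1), ((2 : ℝ) ^ l) ^ i) * (Λ ^ i * R) := by
              rw [Finset.sum_mul]
              exact Finset.sum_congr rfl fun l _ => by rw [mul_pow]; ring
          _ ≤ 2 * (2 ^ n) ^ i * (Λ ^ i * R) := by gcongr; exact sum_two_pow_le i n hi
          _ = (2 * R) * (2 ^ n * Λ) ^ i := by rw [mul_pow]; ring
          _ ≤ (1 + 2 * R) ^ i * (2 ^ n * Λ) ^ i := by
              gcongr
              calc 2 * R ≤ 1 + 2 * R := by linarith
                _ ≤ (1 + 2 * R) ^ i := le_self_pow₀ (by linarith) (by omega)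
          _ = _ := (mul_pow _ _ _).symm
    have hmv := (convex_Icc (0 : ℝ) 1).norm_image_sub_le_of_norm_hasDerivWithin_le
      (fun τ _ => (hψd τ).hasDerivWithinAt) (fun τ hτ => hψb τ hτ)
      (Set.left_mem_Icc.2 zero_le_one) (Set.right_mem_Icc.2 zero_le_one)
    have e0 : ψ 0 = ((fwdDiff (1 : ℝ))^[M] fun t => g (r₀ + ∑ l ∈ Finset.range n, p l t)) 0 := by
      simp [hψ, hS]
    have e1 : ψ 1 =
        ((fwdDiff (1 : ℝ))^[M] fun t => g (r₀ + ∑ l ∈ Finset.range (n + 1), p l t)) 0 := by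
      simp only [hψ, hS, one_mul, Finset.sum_range_succ, add_assoc]
    rw [← e1, Finset.sum_range_succ, mul_add]
    rw [← e0] at ih
    rw [Real.norm_eq_abs, sub_zero, norm_one, mul_one] at hmv
    have : |ψ 1| ≤ |ψ 0| + |ψ 1 - ψ 0| := by
      have := abs_add_le (ψ 0) (ψ 1 - ψ 0)
      rwa [add_sub_cancel] at this
    linarith

end Differences

/-! ### Derivatives of dyadic blocks along lines -/

section LineDerivatives

theorem Dist.hasDerivAt_line (U : Dist N) (g : 𝓢(Space N, ℂ)) (y v : Space N) (t : ℝ) :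
    HasDerivAt (fun t : ℝ => U (tr (y + t • v) g)) (-U (tr (y + t • v) (dv v g))) t := by
  have h1 : HasDerivAt (fun t : ℝ => y + t • v) v t := by
    simpa using ((hasDerivAt_id t).smul_const v).const_add y
  exact (U.hasFDerivAt_tr g (y + t • v)).comp_hasDerivAt t h1

theorem Dist.iteratedDeriv_line (U : Dist N) (y v : Space N) (i : ℕ) : ∀ (g : 𝓢(Space N, ℂ)),
    iteratedDeriv i (fun t : ℝ => (U (tr (y + t • v) g)).re) =
      fun t => (U (tr (y + t • v) ((-dv v)^[i] g))).re := by
  induction i with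
  | zero => intro g; simp
  | succ i ih =>
    intro g
    have h1 : deriv (fun t : ℝ => (U (tr (y + t • v) g)).re) =
        fun t => (U (tr (y + t • v) ((-dv v) g))).re := by
      funext t
      have h2 := (Complex.reCLM.hasFDerivAt (x := U (tr (y + t • v) g))).comp_hasDerivAt t
        (U.hasDerivAt_line g y v t)
      have h3 : Complex.reCLM (-U (tr (y + t • v) (dv v g))) =
          (U (tr (y + t • v) ((-dv v) g))).re := by
        rw [_root_.neg_apply, map_neg, map_neg, map_neg]; rfl
      rw [← h3]
      exact h2.deriv
    rw [iteratedDeriv_succ', h1, ih, Function.iterate_succ_apply]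

theorem Dist.contDiff_line (U : Dist N) (g : 𝓢(Space N, ℂ)) (y v : Space N) :
    ContDiff ℝ ((⊤ : ℕ∞) : WithTop ℕ∞) fun t : ℝ => (U (tr (y + t • v) g)).re := by
  refine contDiff_of_differentiable_iteratedDeriv fun m _ => ?_
  rw [U.iteratedDeriv_line]
  intro t
  exact ((Complex.reCLM.hasFDerivAt).comp_hasDerivAt t
    (U.hasDerivAt_line ((-dv v)^[m] g) y v t)).differentiableAt

theorem iterate_neg_dv_fourier (v : Space N) (l : ℤ) (i : ℕ) : ∀ χ : 𝓢(Space N, ℂ),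
    (-dv v)^[i] (𝓕 (dl l χ)) = (((2 : ℂ) ^ l) ^ i) • 𝓕 (dl l ((-mulc v)^[i] χ)) := by
  induction i with
  | zero => intro χ; simp
  | succ i ih =>
    intro χ
    have h1 : (-dv v) (𝓕 (dl l χ)) = 𝓕 (dl l (((2 : ℂ) ^ l) • (-mulc v) χ)) := by
      rw [_root_.neg_apply, dv_fourier_dl, _root_.neg_apply, smul_neg, map_neg, map_smul]
      exact ((FourierTransform.fourier_neg _).trans
        (congrArg Neg.neg (FourierTransform.fourier_smul _ _))).symm
    rw [Function.iterate_succ_apply, h1, ih, Function.iterate_succ_apply]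
    have h2 : ∀ (j : ℕ) (c : ℂ) (χ : 𝓢(Space N, ℂ)),
        (-mulc v)^[j] (c • χ) = c • (-mulc v)^[j] χ := by
      intro j
      induction j with
      | zero => intro c χ; rfl
      | succ j ihj => intro c χ; rw [Function.iterate_succ_apply, map_smul, ihj]; rfl
    rw [h2, map_smul, FourierTransform.fourier_smul, smul_smul, pow_succ]

theorem KernelBound.add {B₁ B₂ : ℝ} {χ₁ χ₂ : 𝓢(Space N, ℂ)} (h₁ : KernelBound B₁ χ₁)
    (h₂ : KernelBound B₂ χ₂) : KernelBound (B₁ + B₂) (χ₁ + χ₂) := by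
  intro y
  rw [FourierTransform.fourier_add, _root_.add_apply]
  calc _ ≤ (‖𝓕 χ₁ y‖ + ‖𝓕 χ₂ y‖) * (1 + ‖y‖) ^ (N + 2) := by gcongr; exact norm_add_le _ _
    _ ≤ B₁ + B₂ := by rw [add_mul]; exact add_le_add (h₁ y) (h₂ y)

theorem KernelBound.smul {B : ℝ} {χ : 𝓢(Space N, ℂ)} (h : KernelBound B χ) (c : ℂ) :
    KernelBound (‖c‖ * B) (c • χ) := by
  intro y
  rw [FourierTransform.fourier_smul, _root_.smul_apply, norm_smul, mul_assoc]
  exact mul_le_mul_of_nonneg_left (h y) (norm_nonneg _)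

theorem KernelBound.mono {B B' : ℝ} {χ : 𝓢(Space N, ℂ)} (h : KernelBound B χ) (hB : B ≤ B') :
    KernelBound B' χ := fun y => (h y).trans hB

theorem kernelBound_zero : KernelBound 0 (0 : 𝓢(Space N, ℂ)) := by
  intro y
  have : 𝓕 (0 : 𝓢(Space N, ℂ)) = 0 := map_zero (FourierTransform.fourierCLM ℂ 𝓢(Space N, ℂ))
  simp [this]

theorem KernelBound.sum {ι : Type*} (s : Finset ι) {B : ι → ℝ} {χ : ι → 𝓢(Space N, ℂ)}
    (h : ∀ i ∈ s, KernelBound (B i) (χ i)) : KernelBound (∑ i ∈ s, B i) (∑ i ∈ s, χ i) := by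
  classical
  induction s using Finset.induction_on with
  | empty => simpa using kernelBound_zero
  | insert a s ha ih =>
    rw [Finset.sum_insert ha, Finset.sum_insert ha]
    exact (h a (Finset.mem_insert_self _ _)).add (ih fun i hi => h i (Finset.mem_insert_of_mem hi))

theorem mulc_eq_sum (v : Space N) (χ : 𝓢(Space N, ℂ)) :
    mulc v χ = ∑ b, (v b : ℂ) • mulc (unitVec b) χ := by
  ext η
  rw [_root_.sum_apply]
  simp only [_root_.smul_apply, mulc_apply, inner_unitVec, smul_eq_mul]
  have h : (inner ℝ η v : ℝ) = ∑ b, η b * v b := by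
    simp [PiLp.inner_apply, mul_comm]
  rw [h]
  push_cast
  rw [Finset.mul_sum, Finset.sum_mul]
  exact Finset.sum_congr rfl fun b _ => by ring

/-- The multiplier is expanded in coordinates of v, one factor at a time. Only finitely many symbols
occur, so that the bound is uniform in the direction and homogeneous in |v|. -/
theorem exists_kernelBound_iterate_mulc (i : ℕ) : ∀ χ : 𝓢(Space N, ℂ),
    ∃ B, 0 ≤ B ∧ ∀ v : Space N, KernelBound (B * ‖v‖ ^ i) ((-mulc v)^[i] χ) := by
  induction i with
  | zero =>
    intro χ
    obtain ⟨B, hB0, hB⟩ := exists_kernelBound χ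
    exact ⟨B, hB0, fun v => by simpa using hB⟩
  | succ i ih =>
    intro χ
    choose B hB0 hB using fun b : Fin N => ih (mulc (unitVec b) χ)
    refine ⟨∑ b, B b, Finset.sum_nonneg fun b _ => hB0 b, fun v => ?_⟩
    have h1 : ∀ (s : Finset (Fin N)) (j : ℕ) (c : Fin N → ℂ) (f : Fin N → 𝓢(Space N, ℂ)),
        (-mulc v)^[j] (∑ b ∈ s, c b • f b) = ∑ b ∈ s, c b • (-mulc v)^[j] (f b) := by
      intro s j
      induction j with
      | zero => intro c f; rfl
      | succ j ihj =>
        intro c f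
        rw [Function.iterate_succ_apply, map_sum]
        simp_rw [map_smul]
        rw [ihj]; rfl
    have h2 : (-mulc v)^[i + 1] χ = ∑ b, (-(v b : ℂ)) • (-mulc v)^[i] (mulc (unitVec b) χ) := by
      rw [Function.iterate_succ_apply, _root_.neg_apply, mulc_eq_sum, ← Finset.sum_neg_distrib,
        ← h1]
      simp
    rw [h2]
    refine (KernelBound.sum Finset.univ (B := fun b => ‖v‖ * (B b * ‖v‖ ^ i))
      fun b _ => ((hB b v).smul _).mono ?_).mono (le_of_eq ?_)
    · have := hB0 b
      gcongr
      rw [norm_neg, Complex.norm_real]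
      exact PiLp.norm_apply_le v b
    · rw [Finset.sum_mul]
      exact Finset.sum_congr rfl fun b _ => by rw [pow_succ]; ring

theorem FactorsThrough.iterate {P : LittlewoodPaley N} (v : Space N) (i : ℕ) :
    ∀ {χ χ₁ : 𝓢(Space N, ℂ)}, FactorsThrough P χ χ₁ →
    FactorsThrough P ((-BesovMomentum.mulc v)^[i] χ) ((-BesovMomentum.mulc v)^[i] χ₁) := by
  induction i with
  | zero => intro χ χ₁ h; exact h
  | succ i ih =>
    intro χ χ₁ h
    rw [Function.iterate_succ_apply, Function.iterate_succ_apply]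
    refine ih fun η => ?_
    rw [_root_.neg_apply, _root_.neg_apply, _root_.neg_apply, _root_.neg_apply, (h.mulc v) η]
    ring

/-- Bernstein's inequality for the derivatives of the dyadic blocks along lines. -/
theorem exists_iteratedDeriv_block_le (P : LittlewoodPaley N) (i : ℕ) :
    ∃ B, 0 ≤ B ∧ ∀ (U : Dist N) (l : ℤ) (y v : Space N) (t : ℝ),
      ‖iteratedDeriv i (fun t : ℝ => (U (P.kernel l (y + t • v))).re) t‖ₑ ≤
        ENNReal.ofReal (((2 : ℝ) ^ l * ‖v‖) ^ i * B) *
          cv l (fun y => ‖U (P.kernel l y)‖ₑ) (y + t • v) := by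
  obtain ⟨B, hB0, hB⟩ := exists_kernelBound_iterate_mulc i P.fat
  refine ⟨B, hB0, fun U l y v t => ?_⟩
  have h1 : (fun t : ℝ => (U (P.kernel l (y + t • v))).re) =
      fun t : ℝ => (U (tr (y + t • v) (𝓕 (dl l (P.symbolS 0))))).re := by
    funext t; rw [P.kernel_eq]
  rw [h1, U.iteratedDeriv_line, iterate_neg_dv_fourier]
  simp only [map_smul]
  have h2 := U.enorm_le_cv (by positivity : 0 ≤ B * ‖v‖ ^ i)
    ((factorsThrough_symbolS P).iterate v i) (hB v) l (y + t • v)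
  calc _ ≤ ‖((2 : ℂ) ^ l) ^ i • U (tr (y + t • v) (𝓕 (dl l ((-mulc v)^[i] (P.symbolS 0)))))‖ₑ := by
        rw [← ofReal_norm, ← ofReal_norm]
        exact ENNReal.ofReal_le_ofReal (Complex.abs_re_le_norm _)
    _ = ENNReal.ofReal (((2 : ℝ) ^ l) ^ i) *
        ‖U (tr (y + t • v) (𝓕 (dl l ((-mulc v)^[i] (P.symbolS 0)))))‖ₑ := by
        rw [enorm_smul]
        congr 1
        rw [← ofReal_norm]
        congr 1
        rw [norm_pow, norm_zpow, Complex.norm_ofNat]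
    _ ≤ ENNReal.ofReal (((2 : ℝ) ^ l) ^ i) * (ENNReal.ofReal (B * ‖v‖ ^ i) *
        cv l (fun y => ‖U (P.kernel l y)‖ₑ) (y + t • v)) := by gcongr
    _ = _ := by
        rw [← mul_assoc, ← ENNReal.ofReal_mul (by positivity)]
        congr 2
        rw [mul_pow]; ring

end LineDerivatives

/-! ### Oscillation of the low-frequency part of a coefficient -/

section LowFrequencies

/-- The modulus of the block `Δ_l U`. -/
def bk (P : LittlewoodPaley N) (U : Dist N) (l : ℤ) (y : Space N) : ℝ≥0∞ := ‖U (P.kernel l y)‖ₑ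

/-- The real part of the block `Δ_l U`. -/
def rb (P : LittlewoodPaley N) (U : Dist N) (l : ℤ) (y : Space N) : ℝ := (U (P.kernel l y)).re

variable (P : LittlewoodPaley N)

theorem bk_measurable (U : Dist N) (l : ℤ) : Measurable (bk P U l) :=
  (U.continuous_kernel P l).enorm.measurable

theorem rb_continuous (U : Dist N) (l : ℤ) : Continuous (rb P U l) :=
  Complex.continuous_re.comp (U.continuous_kernel P l)

theorem enorm_rb_le (U : Dist N) (l : ℤ) (y : Space N) : ‖rb P U l y‖ₑ ≤ bk P U l y := by
  rw [bk, ← ofReal_norm, ← ofReal_norm]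
  exact ENNReal.ofReal_le_ofReal (Complex.abs_re_le_norm _)

theorem cv_bk_le_of_bound {U : Dist N} {R : ℝ} {l : ℤ} (hb : ∀ y, bk P U l y ≤ ENNReal.ofReal R)
    (y : Space N) : cv l (bk P U l) y ≤ CPhi N * ENNReal.ofReal R := by
  calc cv l (bk P U l) y ≤ cv l (fun _ => ENNReal.ofReal R * 1) y :=
        cv_mono l (Filter.Eventually.of_forall fun y => by simpa using hb y) y
    _ = _ := by rw [cv_const_mul l _ ENNReal.ofReal_ne_top, cv_one, mul_comm]

/-- The contribution of the frequencies lower than `2^n` to the oscillation of order `M` at scale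
`2^{-n}`. -/
def lo (M : ℕ) (U : Dist N) (n : ℤ) (y : Space N) : ℝ≥0∞ :=
  ∑' j : ℕ, tw (-((j + 1) * M)) * cv (n - 1 - j) (bk P U (n - 1 - j)) y

/-- Along the increment 2^{-n}z the block of index n-1-j varies at rate 2^{-(j+1)}|z|, by Bernstein.
The telescoping estimate turns M differences into the weight 2^{-(j+1)M} of `lo`. Peetre's
inequality brings the averages back from y + tv to y, at a polynomial cost in z that the kernel of
the cutoff will integrate. The number Q of blocks does not enter the bound. -/
theorem exists_fwdDiff_low_le {M : ℕ} (hM : 1 ≤ M) : ∃ C : ℝ, 0 ≤ C ∧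
    ∀ (U : Dist N) (R : ℝ), 0 ≤ R → (∀ l y, bk P U l y ≤ ENNReal.ofReal R) →
    ∀ (g : ℝ → ℝ) (K : ℝ), ContDiff ℝ (M + 1) g →
      (∀ i, 1 ≤ i → i ≤ M + 1 → ∀ r, |iteratedDeriv i g r| ≤ K) →
    ∀ (r₀ : ℝ) (n : ℤ) (y z : Space N) (Q : ℕ),
      ‖((fwdDiff (1 : ℝ))^[M] fun t : ℝ => g (r₀ + ∑ j ∈ Finset.range Q,
          rb P U (n - 1 - j) (y + t • ((2 : ℝ) ^ (-n) • z)))) 0‖ₑ ≤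
        ENNReal.ofReal (C * K * (1 + R) ^ M * (1 + ‖z‖) ^ (M + N + 1)) * lo P M U n y := by
  choose B hB0 hB using fun i => exists_iteratedDeriv_block_le P i
  set b : ℝ := 1 + ∑ i ∈ Finset.range (M + 1), B i with hb_def
  have hb1 : 1 ≤ b := by
    have := Finset.sum_nonneg fun i (_ : i ∈ Finset.range (M + 1)) => hB0 i
    linarith
  have hBb : ∀ i ≤ M, B i ≤ b := fun i hi => by
    have := Finset.single_le_sum (f := B) (fun i _ => hB0 i)
      (Finset.mem_range.2 (Nat.lt_succ_of_le hi))
    linarith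
  set Cn : ℝ := (CPhi N).toReal with hCn
  set A : ℝ := ∑ i ∈ Finset.range (M + 1), (M.choose i : ℝ) * (M - i).factorial with hA
  have hA0 : 0 ≤ A := Finset.sum_nonneg fun i _ => by positivity
  refine ⟨A * (1 + 2 * (b * Cn)) ^ M * (b * M ^ (N + 1)), by positivity, ?_⟩
  intro U R hR hbR g K hg hgK r₀ n y z Q
  have hK0 : 0 ≤ K := (abs_nonneg _).trans (hgK 1 le_rfl (by omega) 0)
  set v : Space N := (2 : ℝ) ^ (-n) • z with hv
  have hcvt : ∀ l x, cv l (bk P U l) x ≤ ENNReal.ofReal (Cn * R) := by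
    intro l x
    refine (cv_bk_le_of_bound P (hbR l) x).trans (le_of_eq ?_)
    rw [ENNReal.ofReal_mul ENNReal.toReal_nonneg, ENNReal.ofReal_toReal (CPhi_ne_top N)]
  have hcvtop : ∀ l x, cv l (bk P U l) x ≠ ⊤ := fun l x =>
    ne_top_of_le_ne_top ENNReal.ofReal_ne_top (hcvt l x)
  -- The blocks are renumbered from the lowest one: index n - Q becomes q = 0, with rate Λ along v,
  -- and the block q has rate 2^q Λ, at most |z| for the blocks kept.
  set Λ : ℝ := (2 : ℝ) ^ (-(Q : ℤ)) * ‖z‖ with hΛ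
  have hΛ0 : 0 ≤ Λ := by positivity
  have hscale : ∀ q : ℕ, (2 : ℝ) ^ (n - Q + q) * ‖v‖ = 2 ^ q * Λ := by
    intro q
    rw [hv, norm_smul, Real.norm_of_nonneg (by positivity), hΛ, ← mul_assoc, ← mul_assoc,
      ← zpow_natCast, ← zpow_add₀ two_ne_zero, ← zpow_add₀ two_ne_zero]
    congr 2
    ring
  set p : ℕ → ℝ → ℝ := fun q t => rb P U (n - Q + q) (y + t • v) with hp
  have hpi : ∀ q, ∀ i ≤ M, ∀ t, |iteratedDeriv i (p q) t| ≤
      (2 ^ q * Λ) ^ i * b * (cv (n - Q + q) (bk P U (n - Q + q)) (y + t • v)).toReal := by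
    intro q i hi t
    have h1 := hB i U (n - Q + q) y v t
    rw [hscale] at h1
    have h2 := ENNReal.toReal_mono
      (ENNReal.mul_ne_top ENNReal.ofReal_ne_top (hcvtop _ _)) h1
    have hBi := hB0 i
    rw [ENNReal.toReal_mul, ENNReal.toReal_ofReal (by positivity), toReal_enorm] at h2
    refine h2.trans ?_
    gcongr
    exact hBb i hi
  have key := abs_fwdDiff_iter_comp_sum_le hM (R := b * (Cn * R)) (Λ := Λ) (r₀ := r₀) (p := p)
    (c := fun q => b * (1 + M * ‖z‖) ^ (N + 1) * (cv (n - Q + q) (bk P U (n - Q + q)) y).toReal)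
    hg (fun q => by
      have := U.contDiff_line (𝓕 (dl (n - Q + q) (P.symbolS 0))) y v
      simp_rw [← P.kernel_eq] at this
      exact this.of_le (by exact_mod_cast le_top)) hΛ0
    (by positivity) hgK (fun q i hi t _ => by
      refine (hpi q i hi t).trans ?_
      rw [mul_assoc]
      gcongr
      refine ENNReal.toReal_le_of_le_ofReal (by positivity) (hcvt _ _)) Q
    (fun q hq i hi t ht => by
      refine (hpi q i hi t).trans ?_
      rw [mul_assoc, mul_assoc b]
      gcongr
      have h3 := cv_peetre (n - Q + q) (bk P U (n - Q + q)) y (t • v)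
      have h4 := ENNReal.toReal_mono
        (ENNReal.mul_ne_top ENNReal.ofReal_ne_top (hcvtop _ _)) h3
      rw [ENNReal.toReal_mul, ENNReal.toReal_ofReal (by positivity)] at h4
      have h5 : (2 : ℝ) ^ (n - Q + q) * ‖t • v‖ ≤ M * ‖z‖ := by
        rw [norm_smul, Real.norm_of_nonneg ht.1]
        calc (2 : ℝ) ^ (n - Q + q) * (t * ‖v‖) = t * (2 ^ q * Λ) := by rw [← hscale]; ring
          _ ≤ M * ‖z‖ := by
              refine mul_le_mul ht.2 ?_ (by positivity) (by positivity)
              rw [hΛ, ← mul_assoc, ← zpow_natCast, ← zpow_add₀ two_ne_zero]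
              refine mul_le_of_le_one_left (norm_nonneg z)
                (zpow_le_one_of_nonpos₀ (by norm_num) ?_)
              omega
      have h6 : 1 + (2 : ℝ) ^ (n - Q + q) * ‖t • v‖ ≤ 1 + M * ‖z‖ := by linarith
      refine h4.trans ?_
      gcongr)
  have hsum : ∀ t : ℝ, ∑ l ∈ Finset.range Q, p l t =
      ∑ j ∈ Finset.range Q, rb P U (n - 1 - j) (y + t • v) := by
    intro t
    rw [← Finset.sum_range_reflect]
    refine Finset.sum_congr rfl fun j hj => ?_
    rw [Finset.mem_range] at hj
    simp only [hp]
    congr 1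
    omega
  simp_rw [hsum] at key
  rw [← ofReal_norm, Real.norm_eq_abs]
  refine (ENNReal.ofReal_le_ofReal key).trans ?_
  have hpow : (1 + 2 * (b * (Cn * R))) ^ M ≤ ((1 + 2 * (b * Cn)) * (1 + R)) ^ M := by
    have h0 : 0 ≤ b * Cn := by positivity
    gcongr
    nlinarith
  have hz : ‖z‖ ^ M * (1 + M * ‖z‖) ^ (N + 1) ≤ M ^ (N + 1) * (1 + ‖z‖) ^ (M + N + 1) := by
    have hM' : (1 : ℝ) ≤ M := by exact_mod_cast hM
    calc ‖z‖ ^ M * (1 + M * ‖z‖) ^ (N + 1) ≤ (1 + ‖z‖) ^ M * (M * (1 + ‖z‖)) ^ (N + 1) := by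
          gcongr
          · linarith
          · nlinarith [norm_nonneg z]
      _ = _ := by rw [mul_pow]; ring
  have hterm : ∀ q ∈ Finset.range Q, (2 ^ q * Λ) ^ M * (b * (1 + M * ‖z‖) ^ (N + 1) *
      (cv (n - Q + q) (bk P U (n - Q + q)) y).toReal) ≤
      (b * M ^ (N + 1) * (1 + ‖z‖) ^ (M + N + 1)) * (((2 : ℝ) ^ (-(((Q - 1 - q : ℕ) : ℝ) + 1) * M)) *
        (cv (n - Q + q) (bk P U (n - Q + q)) y).toReal) := by
    intro q hq
    rw [Finset.mem_range] at hq
    have h5 : (2 ^ q * Λ) ^ M = (2 : ℝ) ^ (-(((Q - 1 - q : ℕ) : ℝ) + 1) * M) * ‖z‖ ^ M := by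
      have : (2 : ℝ) ^ q * (2 : ℝ) ^ (-(Q : ℤ)) = (2 : ℝ) ^ (-(((Q - 1 - q : ℕ) : ℝ) + 1)) := by
        rw [← Real.rpow_natCast, ← Real.rpow_intCast, ← Real.rpow_add (by norm_num)]
        congr 1
        have : Q - 1 - q + 1 + q = Q := by omega
        have h' : ((Q - 1 - q : ℕ) : ℝ) + 1 + q = Q := by exact_mod_cast this
        push_cast
        linarith
      rw [hΛ, ← mul_assoc, mul_pow, this, Real.rpow_mul (by norm_num), Real.rpow_natCast]
    rw [h5]
    have h6 : 0 ≤ (2 : ℝ) ^ (-(((Q - 1 - q : ℕ) : ℝ) + 1) * M) *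
        (cv (n - Q + q) (bk P U (n - Q + q)) y).toReal := by positivity
    calc _ = b * (‖z‖ ^ M * (1 + M * ‖z‖) ^ (N + 1)) *
          ((2 : ℝ) ^ (-(((Q - 1 - q : ℕ) : ℝ) + 1) * M) *
            (cv (n - Q + q) (bk P U (n - Q + q)) y).toReal) := by ring
      _ ≤ b * (M ^ (N + 1) * (1 + ‖z‖) ^ (M + N + 1)) * _ := by gcongr
      _ = _ := by ring
  calc ENNReal.ofReal (A * K * (1 + 2 * (b * (Cn * R))) ^ M * ∑ q ∈ Finset.range Q,
          (2 ^ q * Λ) ^ M * (b * (1 + M * ‖z‖) ^ (N + 1) *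
          (cv (n - Q + q) (bk P U (n - Q + q)) y).toReal))
      ≤ ENNReal.ofReal (A * K * ((1 + 2 * (b * Cn)) * (1 + R)) ^ M * ∑ q ∈ Finset.range Q,
          (b * M ^ (N + 1) * (1 + ‖z‖) ^ (M + N + 1)) *
          (((2 : ℝ) ^ (-(((Q - 1 - q : ℕ) : ℝ) + 1) * M)) *
          (cv (n - Q + q) (bk P U (n - Q + q)) y).toReal)) := by
        refine ENNReal.ofReal_le_ofReal ?_
        refine mul_le_mul ?_ (Finset.sum_le_sum hterm)
          (Finset.sum_nonneg fun q _ => by positivity) (by positivity)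
        gcongr
    _ = ENNReal.ofReal (A * (1 + 2 * (b * Cn)) ^ M * (b * M ^ (N + 1)) * K * (1 + R) ^ M *
          (1 + ‖z‖) ^ (M + N + 1)) * ∑ q ∈ Finset.range Q,
          tw (-(((Q - 1 - q : ℕ) : ℝ) + 1) * M) * cv (n - Q + q) (bk P U (n - Q + q)) y := by
        have h7 : ∑ q ∈ Finset.range Q, tw (-(((Q - 1 - q : ℕ) : ℝ) + 1) * M) *
            cv (n - Q + q) (bk P U (n - Q + q)) y = ENNReal.ofReal (∑ q ∈ Finset.range Q,
            (2 : ℝ) ^ (-(((Q - 1 - q : ℕ) : ℝ) + 1) * M) *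
            (cv (n - Q + q) (bk P U (n - Q + q)) y).toReal) := by
          rw [ENNReal.ofReal_sum_of_nonneg fun q _ => by positivity]
          refine Finset.sum_congr rfl fun q _ => ?_
          rw [ENNReal.ofReal_mul (by positivity), ENNReal.ofReal_toReal (hcvtop _ _)]
          rfl
        rw [h7, ← ENNReal.ofReal_mul (by positivity), ← Finset.mul_sum]
        congr 1
        rw [mul_pow]
        ring
    _ ≤ _ := by
        gcongr
        rw [← Finset.sum_range_reflect]
        refine le_trans (le_of_eq ?_) (ENNReal.sum_le_tsum (Finset.range Q))
        refine Finset.sum_congr rfl fun j hj => ?_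
        rw [Finset.mem_range] at hj
        have h8 : Q - 1 - (Q - 1 - j) = j := by omega
        have h9 : n - (Q : ℤ) + ((Q - 1 - j : ℕ) : ℤ) = n - 1 - j := by omega
        rw [h8, h9]
        congr 2
        ring

/-- The part of the coefficient with frequencies lower than `2^n`. -/
def lowPart (U : Dist N) (r₀ : ℝ) (n : ℤ) (x : Space N) : ℝ := r₀ + ∑' j : ℕ, rb P U (n - 1 - j) x

/-- Limit Q → ∞ in the previous estimate, whose constants do not depend on Q. -/
theorem exists_fwdDiff_lowPart_le {M : ℕ} (hM : 1 ≤ M) : ∃ C : ℝ, 0 ≤ C ∧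
    ∀ (U : Dist N) (R : ℝ), 0 ≤ R → (∀ l y, bk P U l y ≤ ENNReal.ofReal R) →
    ∀ (g : ℝ → ℝ) (K : ℝ), ContDiff ℝ (M + 1) g →
      (∀ i, 1 ≤ i → i ≤ M + 1 → ∀ r, |iteratedDeriv i g r| ≤ K) →
    ∀ (r₀ : ℝ) (n : ℤ), (∀ x, Summable fun j : ℕ => rb P U (n - 1 - j) x) →
    ∀ y z : Space N,
      ‖∑ k ∈ Finset.range (M + 1), ((-1 : ℝ) ^ (M - k) * M.choose k) *
          g (lowPart P U r₀ n (y + (k : ℝ) • ((2 : ℝ) ^ (-n) • z)))‖ₑ ≤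
        ENNReal.ofReal (C * K * (1 + R) ^ M * (1 + ‖z‖) ^ (M + N + 1)) * lo P M U n y := by
  obtain ⟨C, hC0, hC⟩ := exists_fwdDiff_low_le P hM
  refine ⟨C, hC0, fun U R hR hb g K hg hgK r₀ n hs y z => ?_⟩
  have h1 : Filter.Tendsto (fun Q : ℕ => ‖∑ k ∈ Finset.range (M + 1),
      ((-1 : ℝ) ^ (M - k) * M.choose k) * g (r₀ + ∑ j ∈ Finset.range Q,
        rb P U (n - 1 - j) (y + (k : ℝ) • ((2 : ℝ) ^ (-n) • z)))‖ₑ) Filter.atTop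
      (nhds ‖∑ k ∈ Finset.range (M + 1), ((-1 : ℝ) ^ (M - k) * M.choose k) *
          g (lowPart P U r₀ n (y + (k : ℝ) • ((2 : ℝ) ^ (-n) • z)))‖ₑ) := by
    refine (continuous_enorm.tendsto _).comp (tendsto_finsetSum _ fun k _ => ?_)
    refine ((hg.continuous.tendsto _).comp ?_).const_mul _
    exact (hs _).hasSum.tendsto_sum_nat.const_add _
  refine le_of_tendsto' h1 fun Q => ?_
  have h2 := hC U R hR hb g K hg hgK r₀ n y z Q
  rwa [fwdDiff_iter_zero_eq_sum] at h2

end LowFrequencies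

/-! ### Coefficients that are smooth functions of a Littlewood-Paley series -/

section SmoothCoefficients

variable {P : LittlewoodPaley N} {M : ℕ} {U : Dist N} {R K : ℝ} {b : Space N → ℝ}

/-- The function `b` is the composition of a smooth function and of the sum of the blocks of `U`. -/
structure SmoothCoef (P : LittlewoodPaley N) (M : ℕ) (U : Dist N) (R K : ℝ) (b : Space N → ℝ) :
    Prop where
  nonneg : 0 ≤ R
  bound : ∀ l y, bk P U l y ≤ ENNReal.ofReal R
  summable : ∃ X : ℤ → ℝ≥0∞, (∀ l y, bk P U l y ≤ X l) ∧ ∑' l, X l ≠ ⊤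
  repr : ∃ (g : ℝ → ℝ) (r₀ : ℝ), ContDiff ℝ (M + 1) g ∧
    (∀ i, 1 ≤ i → i ≤ M + 1 → ∀ r, |iteratedDeriv i g r| ≤ K) ∧
    ∀ x, b x = g (r₀ + ∑' l, rb P U l x)

/-- The contribution of the frequencies higher than `2^n`. -/
def hi (P : LittlewoodPaley N) (U : Dist N) (n : ℤ) (y : Space N) : ℝ≥0∞ := ∑' j : ℕ, bk P U (n + j) y

theorem hi_measurable (n : ℤ) : Measurable (hi P U n) := by
  unfold hi
  exact Measurable.tsum fun j => bk_measurable P U (n + j)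

theorem lo_measurable (n : ℤ) : Measurable (lo P M U n) :=
  Measurable.tsum fun _ => (cv_measurable _ (bk_measurable P U _).aemeasurable).const_mul _

theorem summable_of_tsum_enorm_ne_top {ι E : Type*} [NormedAddCommGroup E] [CompleteSpace E]
    {f : ι → E} (h : ∑' i, ‖f i‖ₑ ≠ ⊤) : Summable f :=
  Summable.of_norm ((ENNReal.summable_toReal h).congr fun i => by rw [toReal_enorm])

theorem enorm_tsum_le_tsum_enorm {ι E : Type*} [NormedAddCommGroup E] {f : ι → E} :
    ‖∑' i, f i‖ₑ ≤ ∑' i, ‖f i‖ₑ := by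
  by_cases h : ∑' i, ‖f i‖ₑ = ⊤
  · simp [h]
  · have h1 : Summable fun i => ‖f i‖ :=
      (ENNReal.summable_toReal h).congr fun i => by rw [toReal_enorm]
    rw [← ofReal_norm]
    calc ENNReal.ofReal ‖∑' i, f i‖ ≤ ENNReal.ofReal (∑' i, ‖f i‖) :=
          ENNReal.ofReal_le_ofReal (norm_tsum_le_tsum_norm h1)
      _ = _ := by
          rw [ENNReal.ofReal_tsum_of_nonneg (fun _ => norm_nonneg _) h1]
          simp_rw [ofReal_norm]

theorem lipschitz_of_iteratedDeriv {g : ℝ → ℝ} (hg : ContDiff ℝ (M + 1) g)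
    (hK : ∀ i, 1 ≤ i → i ≤ M + 1 → ∀ r, |iteratedDeriv i g r| ≤ K) (r s : ℝ) :
    ‖g r - g s‖ₑ ≤ ENNReal.ofReal K * ‖r - s‖ₑ := by
  have hK0 : 0 ≤ K := (abs_nonneg _).trans (hK 1 le_rfl (by omega) 0)
  have hd : Differentiable ℝ g := hg.differentiable (by simp)
  have h1 : LipschitzWith K.toNNReal g := by
    refine lipschitzWith_of_nnnorm_deriv_le hd fun x => ?_
    have := hK 1 le_rfl (by omega) x
    rw [iteratedDeriv_one] at this
    rw [← NNReal.coe_le_coe, Real.coe_toNNReal _ hK0]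
    simpa using this
  have h2 := h1 r s
  rwa [edist_eq_enorm_sub, edist_eq_enorm_sub] at h2

namespace SmoothCoef

theorem tsum_bk_ne_top (h : SmoothCoef P M U R K b) (x : Space N) : ∑' l, bk P U l x ≠ ⊤ := by
  obtain ⟨X, hX, hX'⟩ := h.summable
  exact ne_top_of_le_ne_top hX' (ENNReal.tsum_le_tsum fun l => hX l x)

theorem summable_rb (h : SmoothCoef P M U R K b) (x : Space N) : Summable fun l => rb P U l x :=
  summable_of_tsum_enorm_ne_top
    (ne_top_of_le_ne_top (h.tsum_bk_ne_top x) (ENNReal.tsum_le_tsum fun l => enorm_rb_le P U l x))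

theorem K_nonneg (h : SmoothCoef P M U R K b) : 0 ≤ K := by
  obtain ⟨g, r₀, _, hK, _⟩ := h.repr
  exact (abs_nonneg _).trans (hK 1 le_rfl (by omega) 0)

theorem measurable (h : SmoothCoef P M U R K b) : Measurable b := by
  obtain ⟨g, r₀, hg, _, hb⟩ := h.repr
  rw [show b = fun x => g (r₀ + ∑' l, rb P U l x) from funext hb]
  exact hg.continuous.measurable.comp
    ((Measurable.tsum fun l => (rb_continuous P U l).measurable).const_add _)

theorem bounded (h : SmoothCoef P M U R K b) : ∃ A, ∀ x, |b x| ≤ A := by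
  obtain ⟨X, hX, hX'⟩ := h.summable
  obtain ⟨g, r₀, hg, hK, hb⟩ := h.repr
  refine ⟨|g r₀| + K * (∑' l, X l).toReal, fun x => ?_⟩
  have h1 := lipschitz_of_iteratedDeriv hg hK (r₀ + ∑' l, rb P U l x) r₀
  rw [← hb, add_sub_cancel_left] at h1
  have h2 : ‖∑' l, rb P U l x‖ₑ ≤ ∑' l, X l :=
    enorm_tsum_le_tsum_enorm.trans
      (ENNReal.tsum_le_tsum fun l => (enorm_rb_le P U l x).trans (hX l x))
  have h3 := ENNReal.toReal_mono (ENNReal.mul_ne_top ENNReal.ofReal_ne_top hX')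
    (h1.trans (by gcongr : _ ≤ ENNReal.ofReal K * ∑' l, X l))
  rw [ENNReal.toReal_mul, ENNReal.toReal_ofReal h.K_nonneg, toReal_enorm, Real.norm_eq_abs] at h3
  have h4 : |b x| ≤ |g r₀| + |b x - g r₀| := by
    simpa using abs_add_le (g r₀) (b x - g r₀)
  linarith

theorem enorm_sub_le (h : SmoothCoef P M U R K b) (x y : Space N) :
    ‖b x - b y‖ₑ ≤ ENNReal.ofReal K * ∑' l, ‖rb P U l x - rb P U l y‖ₑ := by
  obtain ⟨g, r₀, hg, hK, hb⟩ := h.repr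
  rw [hb, hb]
  refine (lipschitz_of_iteratedDeriv hg hK _ _).trans ?_
  rw [add_sub_add_left_eq_sub, ← (h.summable_rb x).tsum_sub (h.summable_rb y)]
  gcongr
  exact enorm_tsum_le_tsum_enorm

theorem summable_low (h : SmoothCoef P M U R K b) (n : ℤ) (x : Space N) :
    Summable fun j : ℕ => rb P U (n - 1 - j) x :=
  (h.summable_rb x).comp_injective fun i j hij => by simpa using hij

theorem summable_high (h : SmoothCoef P M U R K b) (n : ℤ) (x : Space N) :
    Summable fun j : ℕ => rb P U (n + j) x :=
  (h.summable_rb x).comp_injective fun i j hij => by simpa using hij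

theorem tsum_rb_eq (h : SmoothCoef P M U R K b) (n : ℤ) (x : Space N) :
    ∑' l, rb P U l x = ∑' j : ℕ, rb P U (n - 1 - j) x + ∑' j : ℕ, rb P U (n + j) x := by
  have h1 : HasSum (fun j : ℤ => rb P U (n + j) x)
      (∑' j : ℕ, rb P U (n + j) x + ∑' j : ℕ, rb P U (n - 1 - j) x) := by
    refine HasSum.of_nat_of_neg_add_one (h.summable_high n x).hasSum ?_
    convert (h.summable_low n x).hasSum using 3
    ring
  have h2 := ((Equiv.addLeft n).hasSum_iff (f := fun l => rb P U l x)).1 h1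
  rw [h2.tsum_eq, add_comm]

end SmoothCoef

end SmoothCoefficients

/-! ### Pairings of coefficients with functions without low frequencies -/

section Averages

theorem exists_cutoff : ∃ β : 𝓢(Space N, ℂ), β 0 = 1 ∧ ∀ η, β η ≠ 0 → 2 * Real.pi * ‖η‖ ≤ 1 / 4 := by
  let f : ContDiffBump (0 : Space N) :=
    ⟨1 / (16 * Real.pi), 1 / (8 * Real.pi), by positivity,
      one_div_lt_one_div_of_lt (by positivity) (by nlinarith [Real.pi_pos])⟩
  have hc : HasCompactSupport fun x => ((f x : ℝ) : ℂ) :=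
    f.hasCompactSupport.comp_left (g := fun r : ℝ => (r : ℂ)) (by simp)
  refine ⟨hc.toSchwartzMap (Complex.ofRealCLM.contDiff.comp f.contDiff), ?_, fun η hη => ?_⟩
  · change ((f 0 : ℝ) : ℂ) = 1
    rw [f.one_of_mem_closedBall (by simp [f.rIn_pos.le]), Complex.ofReal_one]
  · have h1 : f η ≠ 0 := fun h0 => hη (by change ((f η : ℝ) : ℂ) = 0; rw [h0, Complex.ofReal_zero])
    have h2 : η ∈ Function.support f := h1
    rw [f.support_eq, Metric.mem_ball, dist_zero_right] at h2
    have h3 : ‖η‖ < 1 / (8 * Real.pi) := h2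
    rw [lt_div_iff₀ (by positivity)] at h3
    linarith

/-- A symbol equal to `1` at the origin with a small support. -/
def cutoff (N : ℕ) : 𝓢(Space N, ℂ) := exists_cutoff.choose

theorem cutoff_zero : cutoff N 0 = 1 := exists_cutoff.choose_spec.1

theorem cutoff_support {η : Space N} (h : cutoff N η ≠ 0) : 2 * Real.pi * ‖η‖ ≤ 1 / 4 :=
  exists_cutoff.choose_spec.2 η h

theorem integral_fourier_cutoff : ∫ z, 𝓕 (cutoff N) z = 1 := by
  have h : 𝓕⁻ (𝓕 (cutoff N)) 0 = 1 := by rw [fInv_fourier, cutoff_zero]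
  rw [SchwartzMap.fourierInv_coe, Real.fourierInv_eq] at h
  simpa using h

theorem integral_fourier_mul_comp (h : ℝˣ) (χ : 𝓢(Space N, ℂ)) (b : Space N → ℂ) (y : Space N) :
    ∫ z, 𝓕 χ z * b (y - (h : ℝ) • z) = ∫ w, tr w (𝓕 (dilate h χ)) y * b w := by
  have h1 := Measure.integral_comp_smul (volume : Measure (Space N))
    (fun u => 𝓕 χ ((h : ℝ)⁻¹ • u) * b (y - u)) (h : ℝ)
  simp_rw [smul_smul, inv_mul_cancel₀ h.ne_zero, one_smul] at h1
  rw [h1, ← integral_sub_left_eq_self _ volume y, ← integral_smul]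
  refine integral_congr_ae (Filter.Eventually.of_forall fun w => ?_)
  simp only [tr_apply, fourier_dilate, sub_sub_cancel]
  simp [Space, mul_assoc]

theorem lintegral_comp_sub_smul {h : ℝ} (hh : h ≠ 0) (y : Space N) {f : Space N → ℝ≥0∞}
    (hf : Measurable f) :
    ∫⁻ z, f (y - h • z) = ENNReal.ofReal |(h ^ N)⁻¹| * ∫⁻ w, f w := by
  have h1 := Measure.map_addHaar_smul (volume : Measure (Space N)) hh
  have h2 : ∫⁻ u, f (y - u) ∂(Measure.map (fun x => h • x) volume) = ∫⁻ z, f (y - h • z) :=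
    lintegral_map (hf.comp (measurable_const.sub measurable_id)) (measurable_const_smul h)
  rw [← h2, h1, lintegral_smul_measure, lintegral_sub_left_eq_self f y]
  simp [Space]

/-- For k = 0 the shift disappears and the value at y comes out. For 1 ≤ k ≤ M the change of
variables w = y - k 2^{-n}z produces a kernel of scale 2^{-n}, up to constants depending on M. -/
theorem exists_lintegral_fourier_mul_comp_le (χ : 𝓢(Space N, ℂ)) (M : ℕ) : ∃ C : ℝ, 0 ≤ C ∧
    ∀ k ≤ M, ∀ (n : ℤ) (f : Space N → ℝ≥0∞) (y : Space N), Measurable f →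
      ∫⁻ z, ‖𝓕 χ z‖ₑ * f (y - (k : ℝ) • ((2 : ℝ) ^ (-n) • z)) ≤
        ENNReal.ofReal C * (f y + cv n f y) := by
  obtain ⟨B, hB0, hB⟩ := exists_kernelBound χ
  have hB1 : ∀ z : Space N, ‖𝓕 χ z‖ₑ ≤ ENNReal.ofReal (B * Phi 0 z) := by
    intro z
    have h1 := hB.enorm_le hB0 0 0 (-z)
    rw [tr_apply, fourier_dl, sub_zero, ← ENNReal.ofReal_mul hB0] at h1
    have h2 := hB.enorm_le hB0 0 z 0
    have h3 := hB.enorm_le hB0 0 0 z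
    rw [tr_apply, fourier_dl, ← ENNReal.ofReal_mul hB0] at h3
    simp only [zpow_zero, one_pow, Complex.ofReal_one, one_mul, one_smul, sub_zero, zero_sub] at h3
    refine h3.trans_eq ?_
    simp [Phi]
  refine ⟨B * (CPhi N).toReal + B * (M + 1) ^ (N + 1), by positivity, ?_⟩
  intro k hk n f y hf
  have hsplit : ∀ a b : ℝ≥0∞, ENNReal.ofReal (B * (CPhi N).toReal + B * (M + 1) ^ (N + 1)) * (a + b) =
      ENNReal.ofReal (B * (CPhi N).toReal) * a + ENNReal.ofReal (B * (M + 1) ^ (N + 1)) * b +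
      (ENNReal.ofReal (B * (CPhi N).toReal) * b + ENNReal.ofReal (B * (M + 1) ^ (N + 1)) * a) := by
    intro a b
    rw [ENNReal.ofReal_add (by positivity) (by positivity)]
    ring
  rw [hsplit]
  refine le_trans ?_ le_self_add
  rcases Nat.eq_zero_or_pos k with rfl | hk0
  · refine le_trans ?_ le_self_add
    simp only [Nat.cast_zero, zero_smul, sub_zero]
    have hm : Measurable fun z => ‖𝓕 χ z‖ₑ := (𝓕 χ).continuous.enorm.measurable
    rw [lintegral_mul_const _ hm]
    gcongr
    refine (lintegral_mono hB1).trans_eq ?_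
    simp_rw [ENNReal.ofReal_mul hB0]
    rw [lintegral_const_mul' _ _ ENNReal.ofReal_ne_top, lintegral_Phi,
      ENNReal.ofReal_toReal (CPhi_ne_top N)]
  · refine le_trans ?_ le_add_self
    have hk1 : (1 : ℝ) ≤ k := by exact_mod_cast hk0
    have hkM : (k : ℝ) ≤ M := by exact_mod_cast hk
    have hn : (0 : ℝ) < 2 ^ n := by positivity
    have hh : (k : ℝ) * (2 : ℝ) ^ (-n) ≠ 0 := by positivity
    have h1 : ∀ z : Space N, ‖𝓕 χ z‖ₑ * f (y - (k : ℝ) • ((2 : ℝ) ^ (-n) • z)) ≤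
        (fun w => ENNReal.ofReal (B * (M + 1) ^ (N + 1) / (2 ^ n) ^ N) *
          (ENNReal.ofReal (Phi n (y - w)) * f w)) (y - ((k : ℝ) * (2 : ℝ) ^ (-n)) • z) := by
      intro z
      simp only [sub_sub_cancel, smul_smul]
      rw [← mul_assoc, ← ENNReal.ofReal_mul (by positivity)]
      gcongr
      refine (hB1 z).trans (ENNReal.ofReal_le_ofReal ?_)
      have h2 : (2 : ℝ) ^ n * ‖((k : ℝ) * (2 : ℝ) ^ (-n)) • z‖ = k * ‖z‖ := by
        rw [norm_smul, Real.norm_of_nonneg (by positivity), zpow_neg]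
        field_simp
      unfold Phi
      rw [h2, zpow_zero, one_pow, one_mul, mul_one_div, div_mul_div_comm,
        div_le_div_iff₀ (by positivity) (by positivity)]
      have h3 : 1 + k * ‖z‖ ≤ (M + 1) * (1 + ‖z‖) := by nlinarith [norm_nonneg z]
      calc B * ((2 ^ n) ^ N * (1 + k * ‖z‖) ^ (N + 1))
          ≤ B * ((2 ^ n) ^ N * ((M + 1) * (1 + ‖z‖)) ^ (N + 1)) := by gcongr
        _ = _ := by rw [mul_pow]; ring
    have hm : Measurable fun w => ENNReal.ofReal (B * (M + 1) ^ (N + 1) / (2 ^ n) ^ N) *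
        (ENNReal.ofReal (Phi n (y - w)) * f w) := by
      refine Measurable.const_mul (Measurable.mul ?_ hf) _
      exact ENNReal.measurable_ofReal.comp
        ((Phi_continuous n).comp (continuous_const.sub continuous_id)).measurable
    refine (lintegral_mono h1).trans ((lintegral_comp_sub_smul hh y hm).le.trans ?_)
    rw [lintegral_const_mul' _ _ ENNReal.ofReal_ne_top, ← mul_assoc,
      ← ENNReal.ofReal_mul (by positivity), cv]
    refine mul_le_mul' (ENNReal.ofReal_le_ofReal ?_) le_rfl
    rw [abs_of_pos (by positivity), mul_pow, zpow_neg, inv_pow]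
    have h4 : (1 : ℝ) ≤ (k : ℝ) ^ N := one_le_pow₀ hk1
    have h5 : ((k : ℝ) ^ N * ((2 ^ n) ^ N)⁻¹)⁻¹ * (B * (M + 1) ^ (N + 1) / (2 ^ n) ^ N) =
        B * (M + 1) ^ (N + 1) / (k : ℝ) ^ N := by
      field_simp
    rw [h5]
    exact div_le_self (by positivity) h4

theorem lintegral_fourier_mul_pow_ne_top (χ : 𝓢(Space N, ℂ)) (m : ℕ) :
    ∫⁻ z, ‖𝓕 χ z‖ₑ * ENNReal.ofReal ((1 + ‖z‖) ^ m) ≠ ⊤ := by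
  set B : ℝ := 2 ^ (m + (N + 1)) * ((Finset.Iic ((m + (N + 1), 0) : ℕ × ℕ)).sup
    fun i => SchwartzMap.seminorm ℂ i.1 i.2) (𝓕 χ) with hB
  have hB0 : 0 ≤ B := by positivity
  have h1 : ∀ z : Space N, ‖𝓕 χ z‖ₑ * ENNReal.ofReal ((1 + ‖z‖) ^ m) ≤
      ENNReal.ofReal B * ENNReal.ofReal (Phi 0 z) := by
    intro z
    have := SchwartzMap.one_add_le_sup_seminorm_apply (𝕜 := ℂ) (m := (m + (N + 1), 0))
      (k := m + (N + 1)) (n := 0) le_rfl le_rfl (𝓕 χ) z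
    rw [norm_iteratedFDeriv_zero, ← hB, pow_add] at this
    rw [← ofReal_norm, ← ENNReal.ofReal_mul (norm_nonneg _), ← ENNReal.ofReal_mul hB0]
    refine ENNReal.ofReal_le_ofReal ?_
    rw [Phi, zpow_zero, one_pow, one_mul, mul_one_div, le_div_iff₀ (by positivity)]
    linarith
  refine ne_top_of_le_ne_top ?_ (lintegral_mono h1)
  rw [lintegral_const_mul' _ _ ENNReal.ofReal_ne_top, lintegral_Phi]
  exact ENNReal.mul_ne_top ENNReal.ofReal_ne_top (CPhi_ne_top N)

/-- The bound for the part of a smooth coefficient that oscillates at frequencies at least `2^n`. -/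
def osc (P : LittlewoodPaley N) (M : ℕ) (U : Dist N) (n : ℤ) (y : Space N) : ℝ≥0∞ :=
  lo P M U n y + (hi P U n y + cv n (hi P U n) y)

theorem osc_measurable (P : LittlewoodPaley N) (M : ℕ) (U : Dist N) (n : ℤ) :
    Measurable (osc P M U n) :=
  (lo_measurable n).add ((hi_measurable n).add (cv_measurable n (hi_measurable n).aemeasurable))

/-- The coefficient is compared with g of its low-frequency part. On the latter the differences of
order M gain; the error, bounded through the Lipschitz constant of g by the high blocks, is
estimated term by term without using cancellation in the difference. -/
theorem exists_enorm_average_le (P : LittlewoodPaley N) {M : ℕ} (hM : 1 ≤ M) : ∃ C : ℝ, 0 ≤ C ∧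
    ∀ {U : Dist N} {R K : ℝ} {b : Space N → ℝ}, SmoothCoef P M U R K b → ∀ (n : ℤ) (y : Space N),
      ‖∫ z, 𝓕 (cutoff N) z * ((∑ k ∈ Finset.range (M + 1), ((-1 : ℝ) ^ (M - k) * M.choose k) *
          b (y - (k : ℝ) • ((2 : ℝ) ^ (-n) • z)) : ℝ) : ℂ)‖ₑ ≤
        ENNReal.ofReal (C * K * (1 + R) ^ M) * osc P M U n y := by
  obtain ⟨C₁, hC₁0, hC₁⟩ := exists_fwdDiff_lowPart_le P hM
  obtain ⟨C₂, hC₂0, hC₂⟩ := exists_lintegral_fourier_mul_comp_le (cutoff N) M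
  set I := ∫⁻ z, ‖𝓕 (cutoff N) z‖ₑ * ENNReal.ofReal ((1 + ‖z‖) ^ (M + N + 1)) with hI
  have hIt : I ≠ ⊤ := lintegral_fourier_mul_pow_ne_top _ _
  refine ⟨C₁ * I.toReal + ∑ k ∈ Finset.range (M + 1), (M.choose k : ℝ) * C₂, by positivity, ?_⟩
  intro U R K b h n y
  have hK := h.K_nonneg
  have hR := h.nonneg
  obtain ⟨g, r₀, hg, hgK, hb⟩ := h.repr
  have hlow : ∀ x, ‖b x - g (lowPart P U r₀ n x)‖ₑ ≤ ENNReal.ofReal K * hi P U n x := by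
    intro x
    rw [hb]
    refine (lipschitz_of_iteratedDeriv hg hgK _ _).trans ?_
    gcongr
    rw [lowPart, h.tsum_rb_eq n, add_sub_add_left_eq_sub, add_sub_cancel_left]
    exact enorm_tsum_le_tsum_enorm.trans (ENNReal.tsum_le_tsum fun j => enorm_rb_le P U _ x)
  have hpt : ∀ z, ‖∑ k ∈ Finset.range (M + 1), ((-1 : ℝ) ^ (M - k) * M.choose k) *
      b (y - (k : ℝ) • ((2 : ℝ) ^ (-n) • z))‖ₑ ≤
      ENNReal.ofReal (C₁ * K * (1 + R) ^ M) * ENNReal.ofReal ((1 + ‖z‖) ^ (M + N + 1)) *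
        lo P M U n y + ∑ k ∈ Finset.range (M + 1), ENNReal.ofReal (M.choose k * K) *
          hi P U n (y - (k : ℝ) • ((2 : ℝ) ^ (-n) • z)) := by
    intro z
    have h1 := hC₁ U R hR h.bound g K hg hgK r₀ n (h.summable_low n) y (-z)
    rw [norm_neg, ENNReal.ofReal_mul (by positivity)] at h1
    have h2 : ∀ k : ℕ, y + (k : ℝ) • ((2 : ℝ) ^ (-n) • (-z)) = y - (k : ℝ) • ((2 : ℝ) ^ (-n) • z) := by
      intro k
      rw [smul_neg, smul_neg, sub_eq_add_neg]
    simp_rw [h2] at h1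
    have h3 : ∑ k ∈ Finset.range (M + 1), ((-1 : ℝ) ^ (M - k) * M.choose k) *
        b (y - (k : ℝ) • ((2 : ℝ) ^ (-n) • z)) =
        ∑ k ∈ Finset.range (M + 1), ((-1 : ℝ) ^ (M - k) * M.choose k) *
          g (lowPart P U r₀ n (y - (k : ℝ) • ((2 : ℝ) ^ (-n) • z))) +
        ∑ k ∈ Finset.range (M + 1), ((-1 : ℝ) ^ (M - k) * M.choose k) *
          (b (y - (k : ℝ) • ((2 : ℝ) ^ (-n) • z)) -
            g (lowPart P U r₀ n (y - (k : ℝ) • ((2 : ℝ) ^ (-n) • z)))) := by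
      rw [← Finset.sum_add_distrib]
      refine Finset.sum_congr rfl fun k _ => ?_
      ring
    rw [h3]
    refine (enorm_add_le _ _).trans (add_le_add h1 ((enorm_sum_le _ _).trans ?_))
    refine Finset.sum_le_sum fun k _ => ?_
    rw [enorm_mul, ENNReal.ofReal_mul (by positivity), mul_assoc]
    refine mul_le_mul' (le_of_eq ?_) (hlow _)
    rw [← ofReal_norm]
    congr 1
    simp
  have hθ : Measurable fun z => ‖𝓕 (cutoff N) z‖ₑ := (𝓕 (cutoff N)).continuous.enorm.measurable
  calc _ ≤ ∫⁻ z, ‖𝓕 (cutoff N) z * ((∑ k ∈ Finset.range (M + 1), ((-1 : ℝ) ^ (M - k) * M.choose k) *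
          b (y - (k : ℝ) • ((2 : ℝ) ^ (-n) • z)) : ℝ) : ℂ)‖ₑ := enorm_integral_le_lintegral_enorm _
    _ ≤ ∫⁻ z, (ENNReal.ofReal (C₁ * K * (1 + R) ^ M) * lo P M U n y *
          (‖𝓕 (cutoff N) z‖ₑ * ENNReal.ofReal ((1 + ‖z‖) ^ (M + N + 1))) +
        ∑ k ∈ Finset.range (M + 1), ENNReal.ofReal (M.choose k * K) *
          (‖𝓕 (cutoff N) z‖ₑ * hi P U n (y - (k : ℝ) • ((2 : ℝ) ^ (-n) • z)))) := by
        refine lintegral_mono fun z => ?_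
        simp only
        rw [enorm_mul]
        refine (mul_le_mul_right ((le_of_eq ?_).trans (hpt z)) _).trans (le_of_eq ?_)
        · rw [← ofReal_norm, ← ofReal_norm, Complex.norm_real]
        · rw [mul_add, Finset.mul_sum]
          congr 1
          · ring
          · exact Finset.sum_congr rfl fun k _ => by ring
    _ = ENNReal.ofReal (C₁ * K * (1 + R) ^ M) * lo P M U n y * I +
        ∑ k ∈ Finset.range (M + 1), ENNReal.ofReal (M.choose k * K) *
          ∫⁻ z, ‖𝓕 (cutoff N) z‖ₑ * hi P U n (y - (k : ℝ) • ((2 : ℝ) ^ (-n) • z)) := by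
        have hm1 : Measurable fun z : Space N => ‖𝓕 (cutoff N) z‖ₑ *
            ENNReal.ofReal ((1 + ‖z‖) ^ (M + N + 1)) :=
          hθ.mul (by fun_prop)
        have hm2 : ∀ k : ℕ, Measurable fun z => ‖𝓕 (cutoff N) z‖ₑ *
            hi P U n (y - (k : ℝ) • ((2 : ℝ) ^ (-n) • z)) := fun k =>
          hθ.mul ((hi_measurable n).comp (by fun_prop))
        rw [lintegral_add_left (hm1.const_mul _), lintegral_const_mul _ hm1,
          lintegral_finsetSum _ fun k _ => (hm2 k).const_mul _]
        simp_rw [lintegral_const_mul' _ _ ENNReal.ofReal_ne_top]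
        rw [hI]
    _ ≤ ENNReal.ofReal (C₁ * K * (1 + R) ^ M) * lo P M U n y * ENNReal.ofReal I.toReal +
        ∑ k ∈ Finset.range (M + 1), ENNReal.ofReal (M.choose k * K) *
          (ENNReal.ofReal C₂ * (hi P U n y + cv n (hi P U n) y)) := by
        rw [ENNReal.ofReal_toReal hIt]
        gcongr with k hk
        exact hC₂ k (Nat.lt_succ_iff.1 (Finset.mem_range.1 hk)) n _ y (hi_measurable n)
    _ = ENNReal.ofReal (C₁ * I.toReal * (K * (1 + R) ^ M)) * lo P M U n y +
        ENNReal.ofReal ((∑ k ∈ Finset.range (M + 1), (M.choose k : ℝ) * C₂) * K) *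
          (hi P U n y + cv n (hi P U n) y) := by
        congr 1
        · rw [mul_right_comm, ← ENNReal.ofReal_mul (by positivity)]
          congr 2
          ring
        · simp_rw [← mul_assoc (ENNReal.ofReal (_ * K)),
            fun k : ℕ => (ENNReal.ofReal_mul (p := (M.choose k : ℝ) * K) (q := C₂)
              (by positivity)).symm]
          rw [← Finset.sum_mul, ← ENNReal.ofReal_sum_of_nonneg fun k _ => by positivity,
            Finset.sum_mul]
          congr 3
          ext k
          ring
    _ ≤ _ := by
        rw [osc, mul_add (ENNReal.ofReal (_ * (1 + R) ^ M)) (lo P M U n y)]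
        have h1 : (1 : ℝ) ≤ (1 + R) ^ M := one_le_pow₀ (by linarith)
        have h2 : 0 ≤ ∑ k ∈ Finset.range (M + 1), (M.choose k : ℝ) * C₂ := by positivity
        have h3 : 0 ≤ I.toReal := ENNReal.toReal_nonneg
        refine add_le_add (mul_le_mul' (ENNReal.ofReal_le_ofReal ?_) le_rfl)
          (mul_le_mul' (ENNReal.ofReal_le_ofReal ?_) le_rfl)
        · rw [mul_assoc _ K]
          gcongr
          linarith
        · calc _ ≤ (C₁ * I.toReal + ∑ k ∈ Finset.range (M + 1), (M.choose k : ℝ) * C₂) * K * 1 := by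
                rw [mul_one]
                gcongr
                nlinarith [mul_nonneg hC₁0 h3]
            _ ≤ _ := by gcongr

/-- A smooth coefficient only enters through its oscillation in pairings with functions without low
frequencies. -/
theorem exists_enorm_integral_smoothCoef_le (P : LittlewoodPaley N) {M : ℕ} (hM : 1 ≤ M) :
    ∃ C : ℝ, 0 ≤ C ∧ ∀ {U : Dist N} {R K : ℝ} {b : Space N → ℝ}, SmoothCoef P M U R K b →
    ∀ (n : ℤ) (F : Space N → ℂ), Integrable F →
      (∀ h : ℝˣ, (2 : ℝ) ^ (-n) ≤ h → ∀ w, ∫ y, F y * tr w (𝓕 (dilate h (cutoff N))) y = 0) →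
      ‖∫ y, (b y : ℂ) * F y‖ₑ ≤
        ENNReal.ofReal (C * K * (1 + R) ^ M) * ∫⁻ y, osc P M U n y * ‖F y‖ₑ := by
  obtain ⟨C, hC0, hC⟩ := exists_enorm_average_le P hM
  refine ⟨C, hC0, ?_⟩
  intro U R K b h n F hF hvan
  obtain ⟨A, hA⟩ := h.bounded
  have hbm : Measurable fun y => (b y : ℂ) := Complex.measurable_ofReal.comp h.measurable
  set θ := 𝓕 (cutoff N) with hθ
  have hθi : ∀ (k : ℕ) (y : Space N), Integrable fun z => θ z *
      (b (y - (k : ℝ) • ((2 : ℝ) ^ (-n) • z)) : ℂ) := by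
    intro k y
    simp_rw [mul_comm (θ _)]
    refine θ.integrable.bdd_mul (c := A) (hbm.comp (by fun_prop)).aestronglyMeasurable
      (Filter.Eventually.of_forall fun z => ?_)
    rw [Complex.norm_real]
    exact hA _
  set T : ℕ → Space N → ℂ := fun k y => ∫ z, θ z * (b (y - (k : ℝ) • ((2 : ℝ) ^ (-n) • z)) : ℂ)
    with hT
  have hT0 : ∀ y, T 0 y = b y := by
    intro y
    simp only [hT, Nat.cast_zero, zero_smul, sub_zero]
    rw [integral_mul_const, hθ, integral_fourier_cutoff, one_mul]
  -- For k ≥ 1 the average of b at scale k 2^{-n} is smoothed by a kernel whose frequencies are at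
  -- most 2^n/4, so its pairing with F vanishes. In the M-th difference only the term k = 0
  -- survives, and it equals b because the averaging kernel has integral 1. Up to sign, the pairing
  -- of b with F is thus the pairing of F with the averaged M-th difference of b.
  have hTk : ∀ k : ℕ, 1 ≤ k → Integrable (fun y => F y * T k y) ∧ ∫ y, F y * T k y = 0 := by
    intro k hk
    have hk0 : (0 : ℝ) < (k : ℝ) * (2 : ℝ) ^ (-n) := by positivity
    set h' : ℝˣ := Units.mk0 ((k : ℝ) * (2 : ℝ) ^ (-n)) hk0.ne' with hh'
    have hle : (2 : ℝ) ^ (-n) ≤ h' := by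
      rw [hh', Units.val_mk0]
      refine le_mul_of_one_le_left (by positivity) (by exact_mod_cast hk)
    set Θ := 𝓕 (dilate h' (cutoff N)) with hΘ
    have h1 : ∀ y, T k y = ∫ w, tr w Θ y * (b w : ℂ) := by
      intro y
      rw [hΘ, ← integral_fourier_mul_comp]
      simp only [hT, hh', Units.val_mk0, smul_smul, hθ]
    have h2 : Integrable (Function.uncurry fun y w => F y * (tr w Θ y * (b w : ℂ)))
        (volume.prod volume) := by
      have h3 := (hF.convolution_integrand (ContinuousLinearMap.mul ℂ ℂ)
        (Θ.integrable (μ := volume)).comp_neg).swap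
      refine (h3.bdd_mul (f := fun z : Space N × Space N => (b z.2 : ℂ)) (c := A)
        (hbm.comp measurable_snd).aestronglyMeasurable (Filter.Eventually.of_forall fun z => ?_)).congr
        (Filter.Eventually.of_forall fun z => ?_)
      · rw [Complex.norm_real]
        exact hA _
      · simp only [Function.uncurry, tr_apply, Function.comp_apply, Prod.fst_swap, Prod.snd_swap,
          ContinuousLinearMap.mul_apply', neg_sub]
        ring
    simp_rw [h1]
    simp_rw [← integral_const_mul]
    refine ⟨h2.integral_prod_left, ?_⟩
    rw [integral_integral_swap h2]
    refine integral_eq_zero_of_ae (Filter.Eventually.of_forall fun w => ?_)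
    simp only [← mul_assoc]
    rw [integral_mul_const, hvan h' hle w, zero_mul]
    rfl
  have hT0' : Integrable fun y => F y * T 0 y := by
    simp_rw [hT0, mul_comm (F _)]
    refine hF.bdd_mul (c := A) hbm.aestronglyMeasurable (Filter.Eventually.of_forall fun z => ?_)
    rw [Complex.norm_real]
    exact hA _
  have hE : ∀ y, ∫ z, θ z * ((∑ k ∈ Finset.range (M + 1), ((-1 : ℝ) ^ (M - k) * M.choose k) *
      b (y - (k : ℝ) • ((2 : ℝ) ^ (-n) • z)) : ℝ) : ℂ) =
      ∑ k ∈ Finset.range (M + 1), (((-1 : ℝ) ^ (M - k) * M.choose k : ℝ) : ℂ) * T k y := by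
    intro y
    simp only [hT]
    simp_rw [← integral_const_mul]
    rw [← integral_finsetSum _ fun k _ => (hθi k y).const_mul _]
    refine integral_congr_ae (Filter.Eventually.of_forall fun z => ?_)
    simp only [Complex.ofReal_sum, Finset.mul_sum]
    refine Finset.sum_congr rfl fun k _ => ?_
    push_cast
    ring
  have hsum : ∫ y, F y * ∑ k ∈ Finset.range (M + 1),
      (((-1 : ℝ) ^ (M - k) * M.choose k : ℝ) : ℂ) * T k y = (-1) ^ M * ∫ y, (b y : ℂ) * F y := by
    simp_rw [Finset.mul_sum, mul_left_comm (F _)]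
    rw [integral_finsetSum]
    · simp_rw [integral_const_mul]
      rw [Finset.sum_eq_single_of_mem 0 (by simp) fun k _ hk => by
        rw [(hTk k (Nat.one_le_iff_ne_zero.2 hk)).2, mul_zero]]
      simp [hT0, mul_comm]
    · intro k _
      refine Integrable.const_mul ?_ _
      rcases Nat.eq_zero_or_pos k with rfl | hk
      · exact hT0'
      · exact (hTk k hk).1
  have hfin : ‖∫ y, (b y : ℂ) * F y‖ₑ = ‖∫ y, F y * ∑ k ∈ Finset.range (M + 1),
      (((-1 : ℝ) ^ (M - k) * M.choose k : ℝ) : ℂ) * T k y‖ₑ := by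
    rw [hsum, enorm_mul]
    simp
  rw [hfin]
  refine (enorm_integral_le_lintegral_enorm _).trans ?_
  rw [← lintegral_const_mul' _ _ ENNReal.ofReal_ne_top]
  refine lintegral_mono fun y => ?_
  simp only
  rw [enorm_mul, ← hE, mul_comm, ← mul_assoc]
  gcongr
  exact hC h n y

/-- The product of functions localized at distant frequencies has no low frequencies. -/
theorem integral_mul_eq_zero_of_separated (V : Dist N) {S g : 𝓢(Space N, ℂ)} {k j : ℤ} {h : ℝˣ}
    (hkj : 3 ≤ |j - k|) (hh : (2 : ℝ) ^ (-(max j k)) ≤ h)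
    (hS : ∀ η, 𝓕⁻ S η ≠ 0 → 3 / 4 * (2 : ℝ) ^ k ≤ 2 * Real.pi * ‖η‖ ∧
      2 * Real.pi * ‖η‖ ≤ 8 / 3 * (2 : ℝ) ^ k)
    (hg : ∀ η, 𝓕⁻ g η ≠ 0 → 3 / 4 * (2 : ℝ) ^ j ≤ 2 * Real.pi * ‖η‖ ∧
      2 * Real.pi * ‖η‖ ≤ 8 / 3 * (2 : ℝ) ^ j) (w : Space N) :
    ∫ y, S y * V (tr y g) * tr w (𝓕 (dilate h (cutoff N))) y = 0 := by
  set Θ := tr w (𝓕 (dilate h (cutoff N))) with hΘ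
  have h1 := (V.integral_tr_mul g (pmul S Θ)).2
  have h2 : conv (pmul S Θ) g = 0 := by
    refine conv_eq_zero fun η => ?_
    by_contra! hne
    refine hne.1 (fInv_pmul_eq_zero fun ζ => ?_)
    by_contra! hne'
    have h3 := hS ζ hne'.1
    have h4 := hg η hne.2
    -- With m = max(j,k), the cutoff contributes frequencies at most 2^m/4 and the smaller of the
    -- two annuli at most (8/3) 2^{m-3} = 2^m/3. Their sum 7/12 is less than 3/4, the inner radius
    -- of the larger annulus, so the three frequencies cannot match.
    have h5 : 2 * Real.pi * ‖η - ζ‖ ≤ 1 / 4 * (2 : ℝ) ^ (max j k) := by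
      have h6 := hne'.2
      rw [hΘ, Ne, fInv_tr_eq_zero_iff, fInv_fourier, dilate_apply] at h6
      have h7 := cutoff_support h6
      have h8 : 0 < (2 : ℝ) ^ (-(max j k)) := by positivity
      rw [norm_smul, Real.norm_of_nonneg (h8.le.trans hh)] at h7
      have h9 : (2 : ℝ) ^ (-(max j k)) * (2 : ℝ) ^ (max j k) = 1 := by
        rw [← zpow_add₀ two_ne_zero]; simp
      have h10 : (2 : ℝ) ^ (-(max j k)) * (2 * Real.pi * ‖η - ζ‖) ≤ 1 / 4 := by
        refine le_trans ?_ h7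
        calc _ ≤ (h : ℝ) * (2 * Real.pi * ‖η - ζ‖) := by gcongr
          _ = _ := by ring
      have h11 : 0 < (2 : ℝ) ^ (max j k) := by positivity
      calc 2 * Real.pi * ‖η - ζ‖ = (2 : ℝ) ^ (-(max j k)) * (2 * Real.pi * ‖η - ζ‖) *
            (2 : ℝ) ^ (max j k) := by linear_combination -(2 * Real.pi * ‖η - ζ‖) * h9
        _ ≤ _ := by gcongr
    have hπ := Real.pi_pos
    have h6 : 2 * Real.pi * ‖η‖ ≤ 2 * Real.pi * ‖η - ζ‖ + 2 * Real.pi * ‖ζ‖ := by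
      rw [← mul_add]
      gcongr
      simpa using norm_add_le (η - ζ) ζ
    have h7 : 2 * Real.pi * ‖ζ‖ ≤ 2 * Real.pi * ‖η - ζ‖ + 2 * Real.pi * ‖η‖ := by
      rw [← mul_add]
      gcongr
      simpa [norm_sub_rev] using norm_sub_le (ζ - η) (-η)
    rcases le_total j k with hle | hle
    · rw [max_eq_right hle] at h5
      rw [abs_of_nonpos (by omega)] at hkj
      have h8 : (2 : ℝ) ^ j ≤ 2 ^ (k - 3) := zpow_le_zpow_right₀ (by norm_num) (by omega)
      rw [zpow_sub₀ two_ne_zero] at h8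
      norm_num at h8
      have : (0 : ℝ) < 2 ^ k := by positivity
      linarith [h3.1, h4.2]
    · rw [max_eq_left hle] at h5
      rw [abs_of_nonneg (by omega)] at hkj
      have h8 : (2 : ℝ) ^ k ≤ 2 ^ (j - 3) := zpow_le_zpow_right₀ (by norm_num) (by omega)
      rw [zpow_sub₀ two_ne_zero] at h8
      norm_num at h8
      have : (0 : ℝ) < 2 ^ j := by positivity
      linarith [h3.2, h4.1]
  rw [h2, map_zero] at h1
  rw [h1]
  refine integral_congr_ae (Filter.Eventually.of_forall fun y => ?_)
  simp only [pmul_apply]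
  ring

end Averages

/-! ### Weak form of the viscous terms, block by block -/

/-- The components of a vector valued distribution. -/
def comp (f : 𝓢'(Space N, CVec N)) (i : Fin N) : Dist N :=
  (EuclideanSpace.proj i : CVec N →L[ℂ] ℂ).comp
    ⟨(f : 𝓢(Space N, ℂ) →ₗ[ℂ] CVec N), f.continuous⟩

theorem block_apply (P : LittlewoodPaley N) (f : 𝓢'(Space N, CVec N)) (j : ℤ) (x : Space N)
    (i : Fin N) : P.block j f x i = comp f i (P.kernel j x) := rfl

theorem block_eq (P : LittlewoodPaley N) (f : 𝓢'(Space N, CVec N)) (j : ℤ) :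
    P.block j f = fun x => WithLp.toLp 2 fun i => comp f i (P.kernel j x) := rfl

theorem continuous_block (P : LittlewoodPaley N) (f : 𝓢'(Space N, CVec N)) (j : ℤ) :
    Continuous (P.block j f) := by
  rw [block_eq]
  exact (PiLp.continuous_toLp 2 _).comp
    (continuous_pi fun i => (comp f i).continuous_kernel P j)

/-- The minus sign comes from differentiating the kernel h_k(x - y) in x instead of y. It is also
the minus sign in `vpi`. -/
theorem fderiv_block (P : LittlewoodPaley N) (f : 𝓢'(Space N, CVec N)) (j : ℤ) (x v : Space N)
    (i : Fin N) : (fderiv ℝ (P.block j f) x v) i =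
      -comp f i (tr x (dv v (𝓕 (dl j (P.symbolS 0))))) := by
  have h : HasFDerivAt (P.block j f)
      (((PiLp.continuousLinearEquiv 2 ℝ fun _ : Fin N => ℂ).symm : _ →L[ℝ] CVec N).comp
        (ContinuousLinearMap.pi fun i => (comp f i).trDeriv (𝓕 (dl j (P.symbolS 0))) x)) x := by
    have h1 : HasFDerivAt (fun x (i : Fin N) => comp f i (P.kernel j x))
        (ContinuousLinearMap.pi fun i => (comp f i).trDeriv (𝓕 (dl j (P.symbolS 0))) x) x := by
      refine hasFDerivAt_pi.2 fun i => ?_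
      simp_rw [P.kernel_eq]
      exact (comp f i).hasFDerivAt_tr _ x
    exact (ContinuousLinearEquiv.hasFDerivAt
      (PiLp.continuousLinearEquiv 2 ℝ fun _ : Fin N => ℂ).symm).comp x h1
  rw [h.fderiv]
  rfl

/-- The integral of `a` against a function of the type appearing in the weak form of the equation. -/
def pairing (a : Space N → ℝ) (S g : 𝓢(Space N, ℂ)) (U : Dist N) : ℂ :=
  ∫ y, (a y : ℂ) * (S y * U (tr y g))

theorem integrable_pairing {a : Space N → ℝ} (ha : AEStronglyMeasurable a volume) {A : ℝ}
    (hA : ∀ᵐ x, |a x| ≤ A) (S g : 𝓢(Space N, ℂ)) (U : Dist N) :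
    Integrable fun y => (a y : ℂ) * (S y * U (tr y g)) := by
  refine (U.integral_tr_mul g S).1.bdd_mul (c := A)
    (Complex.continuous_ofReal.comp_aestronglyMeasurable ha) ?_
  filter_upwards [hA] with x hx
  rwa [Complex.norm_real]

theorem pairing_congr {a b : Space N → ℝ} (h : a =ᵐ[volume] b) (S g : 𝓢(Space N, ℂ)) (U : Dist N) :
    pairing a S g U = pairing b S g U := by
  refine integral_congr_ae ?_
  filter_upwards [h] with x hx
  rw [hx]

/-- The `i`-th component of the weak form of the viscous terms. -/
def vpi (P : LittlewoodPaley N) (V : 𝓢'(Space N, CVec N)) (m₁ m₂ : Space N → ℝ) (j : ℤ)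
    (ψ : 𝓢(Space N, ℂ)) (i : Fin N) : ℂ :=
  -∑ b, (pairing m₁ (dv (unitVec b) ψ) (dv (unitVec b) (𝓕 (dl j (P.symbolS 0)))) (comp V i) +
    pairing m₂ (dv (unitVec i) ψ) (dv (unitVec b) (𝓕 (dl j (P.symbolS 0)))) (comp V b))

/-- The weak form of the viscous terms, tested against a vector field. -/
def vp (P : LittlewoodPaley N) (V : 𝓢'(Space N, CVec N)) (m₁ m₂ : Space N → ℝ) (j : ℤ)
    (ψ : Fin N → 𝓢(Space N, ℂ)) : ℂ := ∑ i, vpi P V m₁ m₂ j (ψ i) i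

theorem vpi_congr {P : LittlewoodPaley N} {V : 𝓢'(Space N, CVec N)} {m₁ m₂ m₁' m₂' : Space N → ℝ}
    (h₁ : m₁ =ᵐ[volume] m₁') (h₂ : m₂ =ᵐ[volume] m₂') (j : ℤ) (ψ : 𝓢(Space N, ℂ)) (i : Fin N) :
    vpi P V m₁ m₂ j ψ i = vpi P V m₁' m₂' j ψ i := by
  unfold vpi
  simp_rw [pairing_congr h₁, pairing_congr h₂]

theorem viscousPairing_eq_vpi {m l : ℝ → ℝ} {r : Space N → ℝ}
    (hm : AEStronglyMeasurable (fun x => m (r x)) volume)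
    (hl : AEStronglyMeasurable (fun x => l (r x) + m (r x)) volume) {A : ℝ}
    (hmA : ∀ᵐ x, |m (r x)| ≤ A) (hlA : ∀ᵐ x, |l (r x) + m (r x)| ≤ A)
    (P : LittlewoodPaley N) (V : 𝓢'(Space N, CVec N)) (j : ℤ) (ψ : 𝓢(Space N, ℂ)) (i : Fin N) :
    viscousPairing m l r (P.block j V) ψ i =
      vpi P V (fun x => m (r x)) (fun x => l (r x) + m (r x)) j ψ i := by
  unfold viscousPairing vpi pairing
  simp_rw [← Finset.sum_neg_distrib]
  rw [Finset.sum_congr rfl fun b _ => congrArg Neg.neg (integral_add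
    (integrable_pairing hm hmA _ _ _) (integrable_pairing hl hlA _ _ _)).symm]
  simp_rw [← integral_neg]
  rw [← integral_finsetSum]
  · refine integral_congr_ae (Filter.Eventually.of_forall fun x => ?_)
    simp only [fderiv_block, ← dv_apply]
    rw [Finset.mul_sum, Finset.sum_mul, ← Finset.sum_add_distrib]
    refine Finset.sum_congr rfl fun b _ => ?_
    ring
  · intro b _
    exact ((integrable_pairing hm hmA _ _ _).add (integrable_pairing hl hlA _ _ _)).neg

/-- The modulus of the blocks of a vector valued distribution. -/
def bv (P : LittlewoodPaley N) (V : 𝓢'(Space N, CVec N)) (j : ℤ) (y : Space N) : ℝ≥0∞ :=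
  ‖P.block j V y‖ₑ

/-- A function that controls the gradient of the `j`-th block. -/
def gv (P : LittlewoodPaley N) (V : 𝓢'(Space N, CVec N)) (j : ℤ) (y : Space N) : ℝ≥0∞ :=
  tw j * cv j (bv P V j) y

theorem bv_measurable (P : LittlewoodPaley N) (V : 𝓢'(Space N, CVec N)) (j : ℤ) :
    Measurable (bv P V j) := (continuous_block P V j).enorm.measurable

theorem gv_measurable (P : LittlewoodPaley N) (V : 𝓢'(Space N, CVec N)) (j : ℤ) :
    Measurable (gv P V j) := (cv_measurable j (bv_measurable P V j).aemeasurable).const_mul _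

theorem bk_comp_le (P : LittlewoodPaley N) (V : 𝓢'(Space N, CVec N)) (i : Fin N) (j : ℤ)
    (y : Space N) : bk P (comp V i) j y ≤ bv P V j y := by
  rw [bk, bv, ← ofReal_norm, ← ofReal_norm, ← block_apply]
  exact ENNReal.ofReal_le_ofReal (PiLp.norm_apply_le _ i)

theorem exists_enorm_tr_dv_le (P : LittlewoodPaley N) : ∃ C : ℝ, 0 ≤ C ∧
    ∀ (V : 𝓢'(Space N, CVec N)) (i b : Fin N) (j : ℤ) (y : Space N),
      ‖comp V i (tr y (dv (unitVec b) (𝓕 (dl j (P.symbolS 0)))))‖ₑ ≤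
        ENNReal.ofReal C * gv P V j y := by
  choose B hB0 hB using fun b : Fin N => exists_kernelBound (mulc (unitVec b) P.fat)
  refine ⟨∑ b, B b, Finset.sum_nonneg fun b _ => hB0 b, fun V i b j y => ?_⟩
  rw [dv_fourier_dl, map_smul, map_smul, enorm_smul]
  have h1 := (comp V i).enorm_le_cv (hB0 b) ((factorsThrough_symbolS P).mulc (unitVec b)) (hB b) j y
  have h2 : ‖(2 : ℂ) ^ j‖ₑ = tw j := by
    rw [tw_intCast, ← ofReal_norm, norm_zpow]; norm_num
  rw [h2, gv]
  calc tw j * _ ≤ tw j * (ENNReal.ofReal (∑ b, B b) * cv j (bv P V j) y) := by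
        gcongr
        refine h1.trans ?_
        gcongr
        · exact Finset.single_le_sum (f := B) (fun b _ => hB0 b) (Finset.mem_univ b)
        · exact cv_mono j (Filter.Eventually.of_forall fun z => bk_comp_le P V i j z) y
    _ = _ := by ring

/-- The test function with symbol `χ` at frequency `2^k`, centered at `x`. -/
def tf (k : ℤ) (x : Space N) : 𝓢(Space N, ℂ) →L[ℂ] 𝓢(Space N, ℂ) :=
  (tr x).comp ((FourierTransform.fourierCLM ℂ 𝓢(Space N, ℂ)).comp (dl k))

theorem tf_apply (k : ℤ) (x : Space N) (χ : 𝓢(Space N, ℂ)) : tf k x χ = tr x (𝓕 (dl k χ)) := rfl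

theorem dv_tf (v : Space N) (k : ℤ) (x : Space N) (χ : 𝓢(Space N, ℂ)) :
    dv v (tf k x χ) = ((2 : ℂ) ^ k) • tf k x (mulc v χ) := by
  rw [tf_apply, dv_tr, dv_fourier_dl, map_smul, tf_apply]

/-- An annular symbol vanishes in a neighbourhood of the origin, so the test function is insensitive
to polynomials. -/
theorem testSpace_tf {χ : 𝓢(Space N, ℂ)} (hχ : Annular χ) (k : ℤ) (x : Space N) :
    tf k x χ ∈ testSpace N := by
  intro n
  have h1 : ∀ᶠ η in nhds (0 : Space N), (𝓕 (tf k x χ) : 𝓢(Space N, ℂ)) η = 0 := by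
    have h2 : ∀ᶠ η in nhds (0 : Space N), 2 * Real.pi * ((2 : ℝ) ^ (-k) * ‖η‖) < 3 / 8 := by
      have : Filter.Tendsto (fun η : Space N => 2 * Real.pi * ((2 : ℝ) ^ (-k) * ‖η‖)) (nhds 0)
          (nhds (2 * Real.pi * ((2 : ℝ) ^ (-k) * ‖(0 : Space N)‖))) := by
        refine Continuous.tendsto (by fun_prop) _
      rw [norm_zero, mul_zero, mul_zero] at this
      exact this.eventually_lt_const (by norm_num)
    filter_upwards [h2] with η hη
    have h3 : 𝓕 (tf k x χ) η = 𝓕⁻ (tf k x χ) (-η) := by rw [fInv_apply, neg_neg]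
    rw [h3, tf_apply, fInv_tr_eq_zero_iff, fInv_fourier, dl_apply]
    by_contra h
    have h4 := (hχ _ h).1
    rw [norm_smul, norm_neg, Real.norm_of_nonneg (by positivity)] at h4
    linarith
  have h2 : (⇑(𝓕 (tf k x χ) : 𝓢(Space N, ℂ))) =ᶠ[nhds 0] fun _ => (0 : ℂ) := h1
  rw [(h2.iteratedFDeriv ℝ n).self_of_nhds]
  simp

/-- The symbols `c` of a vector field for which the operator with constant coefficients
`m Δ + (l + m) ∇ div` acts as the multiple `m + α (l + m)` of the Laplacian. The symbols `c'` are
used to localize. -/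
structure VectorSymbol (P : LittlewoodPaley N) (α : ℝ) (c c' : Fin N → 𝓢(Space N, ℂ)) : Prop where
  annular : ∀ i, Annular (c i)
  annular' : ∀ i, Annular (c' i)
  factors : ∀ i, FactorsThrough P (c i) (c' i)
  graddiv : ∀ b, mulc (unitVec b) (∑ i, mulc (unitVec i) (c i)) = (α : ℂ) • lap (c b)

namespace VectorSymbol

variable {P : LittlewoodPaley N} {α : ℝ} {c c' : Fin N → 𝓢(Space N, ℂ)}

theorem mulc_comm (v w : Space N) (χ : 𝓢(Space N, ℂ)) : mulc v (mulc w χ) = mulc w (mulc v χ) := by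
  ext η
  simp only [mulc_apply]
  ring

theorem lap_mulc (v : Space N) (χ : 𝓢(Space N, ℂ)) :
    BesovMomentum.lap (mulc v χ) = mulc v (BesovMomentum.lap χ) := by
  ext η
  simp only [mulc_apply, lap_apply]
  ring

/-- The Laplacian, like the heat flow below, is a scalar multiplier: it commutes with the operator
and preserves the multiple α. Both stabilities are needed, because the Duhamel formula tests the
equation with evolved symbols and with their derivatives in σ. -/
theorem lap (h : VectorSymbol P α c c') :
    VectorSymbol P α (fun i => BesovMomentum.lap (c i)) (fun i => BesovMomentum.lap (c' i)) where
  annular i := (h.annular i).lap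
  annular' i := (h.annular' i).lap
  factors i η := by rw [lap_apply, lap_apply, h.factors i η]; ring
  graddiv b := by
    simp_rw [← lap_mulc]
    rw [← map_sum, ← lap_mulc, h.graddiv b, map_smul]

theorem hs (h : VectorSymbol P α c c') (σ : ℝ) :
    VectorSymbol P α (fun i => BesovMomentum.hs (c i) σ) (fun i => BesovMomentum.hs (c' i) σ) where
  annular i := (h.annular i).hs σ
  annular' i := (h.annular' i).hs σ
  factors i η := by rw [hs_apply (h.annular i), hs_apply (h.annular' i), h.factors i η]; ring
  graddiv b := by
    ext η
    have h1 := congrArg (fun f : 𝓢(Space N, ℂ) => f η) (h.graddiv b)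
    simp only [mulc_apply, _root_.sum_apply, _root_.smul_apply, lap_apply, smul_eq_mul,
      hs_apply (h.annular _)] at h1 ⊢
    simp_rw [mul_left_comm _ (Real.exp _ : ℂ)]
    rw [← Finset.mul_sum, mul_left_comm, h1]

end VectorSymbol

/-- The transition is complete at r = 1/8, below the smallest value 9/64 of |2πη|² on the annulus.
The function therefore inverts the symbol of -Δ on annular symbols without a singularity at 0. -/
theorem contDiff_cutoff_inv : ∃ g : ℝ → ℝ, ContDiff ℝ ((⊤ : ℕ∞) : WithTop ℕ∞) g ∧
    ∀ r, 9 / 64 ≤ r → g r = r⁻¹ := by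
  refine ⟨fun r => Real.smoothTransition (16 * r - 1) * r⁻¹, ?_, fun r hr => ?_⟩
  · rw [contDiff_iff_contDiffAt]
    intro r
    by_cases hr : r = 0
    · have : (fun r : ℝ => Real.smoothTransition (16 * r - 1) * r⁻¹) =ᶠ[nhds r] fun _ => 0 := by
        have h1 : ∀ᶠ s in nhds r, s < 1 / 16 := by
          rw [hr]; exact Filter.Tendsto.eventually_lt_const (by norm_num) Filter.tendsto_id
        filter_upwards [h1] with s hs
        rw [Real.smoothTransition.zero_of_nonpos (by linarith), zero_mul]
      exact contDiffAt_const.congr_of_eventuallyEq this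
    · exact ((Real.smoothTransition.contDiff.comp (by fun_prop)).contDiffAt).mul
        (contDiffAt_inv ℝ hr)
  · simp only
    rw [Real.smoothTransition.one_of_one_le (by linarith), one_mul]

/-- Helmholtz decomposition of the block Δ_0 in direction e. The gradient part is ∂_e ∇ Δ^{-1} Δ_0,
on which ∇div is the Laplacian (α = 1); what remains is divergence free (α = 0). The two multiples m
+ α(l + m) are l + 2m and m, exactly the quantities assumed to be bounded below. -/
theorem exists_vectorSymbol (P : LittlewoodPaley N) (e : Fin N) :
    ∃ c₁ c₁' c₀ c₀' : Fin N → 𝓢(Space N, ℂ), VectorSymbol P 1 c₁ c₁' ∧ VectorSymbol P 0 c₀ c₀' ∧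
      ∀ i, c₁ i + c₀ i = if i = e then P.symbolS 0 else 0 := by
  obtain ⟨g, hg, hgr⟩ := contDiff_cutoff_inv
  set χ := fc (P.symbolS 0) g with hχ
  set χ' := fc P.fat g with hχ'
  have hg1 : ∀ {f : 𝓢(Space N, ℂ)}, Annular f → ∀ η, (sqSymbol η : ℂ) * (g (sqSymbol η) * f η) = f η := by
    intro f hf η
    by_cases h : f η = 0
    · simp [h]
    · have h1 := (hf.sqSymbol_mem h).1
      have h0 : (sqSymbol η : ℂ) ≠ 0 := by
        exact_mod_cast (show sqSymbol η ≠ 0 by linarith)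
      rw [hgr _ h1]
      push_cast
      field_simp
  have ha : ∀ {f : 𝓢(Space N, ℂ)}, Annular f → Annular (fc f g) := by
    intro f hf η hη
    rw [fc_apply hf hg] at hη
    exact hf η (right_ne_zero_of_mul hη)
  have hlap : BesovMomentum.lap χ = -P.symbolS 0 := by
    ext η
    rw [lap_apply, hχ, fc_apply P.annular_symbolS hg, neg_mul, hg1 P.annular_symbolS]
    rfl
  have hlap' : BesovMomentum.lap χ' = -P.fat := by
    ext η
    rw [lap_apply, hχ', fc_apply P.annular_fat hg, neg_mul, hg1 P.annular_fat]
    rfl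
  have hf : FactorsThrough P χ χ' := by
    intro η
    rw [hχ, hχ', fc_apply P.annular_symbolS hg, fc_apply P.annular_fat hg, mul_assoc, P.fat_mul]
  have han : ∀ {f : 𝓢(Space N, ℂ)}, Annular f → Annular (-f) := fun hf η hη =>
    hf η (by simpa using hη)
  have hadd : ∀ {f f' : 𝓢(Space N, ℂ)}, Annular f → Annular f' → Annular (f + f') := by
    intro f f' hf hf' η hη
    by_cases h : f η = 0
    · refine hf' η fun h' => hη ?_
      rw [_root_.add_apply, h, h', add_zero]
    · exact hf η h
  have hite : ∀ {f : 𝓢(Space N, ℂ)}, Annular f → ∀ i, Annular (if i = e then f else 0) := by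
    intro f hf i η hη
    split_ifs at hη with h
    · exact hf η hη
    · exact absurd rfl hη
  set q : 𝓢(Space N, ℂ) → Fin N → 𝓢(Space N, ℂ) := fun f i =>
    -mulc (unitVec e) (mulc (unitVec i) f) with hq
  have hqsum : ∀ f, ∑ i, mulc (unitVec i) (q f i) = -mulc (unitVec e) (BesovMomentum.lap f) := by
    intro f
    simp only [hq, map_neg, lap_eq_sum, map_sum, Finset.sum_neg_distrib]
    congr 1
    refine Finset.sum_congr rfl fun i _ => ?_
    rw [VectorSymbol.mulc_comm]
  have hqa : ∀ {f : 𝓢(Space N, ℂ)}, Annular f → ∀ i, Annular (q f i) := fun hf i =>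
    han ((hf.mulc _).mulc _)
  have hqf : ∀ i, FactorsThrough P (q χ i) (q χ' i) := by
    intro i η
    have := ((hf.mulc (unitVec i)).mulc (unitVec e)) η
    simp only [hq, _root_.neg_apply, this, neg_mul]
  refine ⟨q χ, q χ', fun i => (if i = e then P.symbolS 0 else 0) + -q χ i,
    fun i => (if i = e then P.fat else 0) + -q χ' i, ?_, ?_, fun i => by simp⟩
  · refine ⟨hqa (ha P.annular_symbolS), hqa (ha P.annular_fat), hqf, fun b => ?_⟩
    rw [hqsum, hlap]
    simp only [hq, map_neg, neg_neg, VectorSymbol.lap_mulc, hlap, neg_neg, Complex.ofReal_one, one_smul]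
    exact VectorSymbol.mulc_comm _ _ _
  · refine ⟨fun i => hadd (hite P.annular_symbolS i) (han (hqa (ha P.annular_symbolS) i)),
      fun i => hadd (hite P.annular_fat i) (han (hqa (ha P.annular_fat) i)), fun i η => ?_,
      fun b => ?_⟩
    · have h1 := hqf i η
      simp only [_root_.add_apply, _root_.neg_apply, h1]
      split_ifs with h
      · rw [add_mul, P.fat_mul]; ring
      · simp
    · have h1 : ∑ i, mulc (unitVec i) ((if i = e then P.symbolS 0 else 0) + -q χ i) = 0 := by
        simp only [map_add, map_neg, Finset.sum_add_distrib, Finset.sum_neg_distrib, hqsum, hlap]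
        rw [Finset.sum_eq_single e (fun i _ hi => by rw [if_neg hi, map_zero]) (by simp), if_pos rfl]
        simp
      rw [h1, map_zero]
      simp

/-! ### Pointwise bounds for test functions and for increments of coefficients -/

section Pairings

variable {P : LittlewoodPaley N} {M : ℕ} {U : Dist N} {R K : ℝ} {b : Space N → ℝ}

theorem enorm_two_zpow (k : ℤ) : ‖(2 : ℂ) ^ k‖ₑ = tw k := by
  rw [tw_intCast, ← ofReal_norm, norm_zpow]; norm_num

theorem enorm_dv_tf_le {B : ℝ} (hB : 0 ≤ B) {e : Fin N} {χ : 𝓢(Space N, ℂ)}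
    (h : KernelBound B (mulc (unitVec e) χ)) (k : ℤ) (x y : Space N) :
    ‖dv (unitVec e) (tf k x χ) y‖ₑ * ENNReal.ofReal (1 + (2 : ℝ) ^ k * ‖x - y‖) ≤
      tw k * (ENNReal.ofReal B * ENNReal.ofReal (Phi k (x - y))) := by
  have h0 : 0 < 1 + (2 : ℝ) ^ k * ‖x - y‖ := by positivity
  rw [dv_tf, _root_.smul_apply, enorm_smul, enorm_two_zpow, mul_assoc, tf_apply]
  refine mul_le_mul' le_rfl ?_
  rw [← ofReal_norm, ← ENNReal.ofReal_mul (norm_nonneg _), ← ENNReal.ofReal_mul hB]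
  refine ENNReal.ofReal_le_ofReal ?_
  have h1 := h.norm_le k x y
  rw [mul_div_assoc', le_div_iff₀ h0] at h1
  exact h1

theorem enorm_dv_tf_le' {B : ℝ} (hB : 0 ≤ B) {e : Fin N} {χ : 𝓢(Space N, ℂ)}
    (h : KernelBound B (mulc (unitVec e) χ)) (k : ℤ) (x y : Space N) :
    ‖dv (unitVec e) (tf k x χ) y‖ₑ ≤
      tw k * (ENNReal.ofReal B * ENNReal.ofReal (Phi k (x - y))) := by
  refine le_trans ?_ (enorm_dv_tf_le hB h k x y)
  refine le_mul_of_one_le_right' ?_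
  rw [ENNReal.one_le_ofReal]
  have : 0 ≤ (2 : ℝ) ^ k * ‖x - y‖ := by positivity
  linarith

theorem lintegral_mul_enorm_dv_tf_le {B : ℝ} (hB : 0 ≤ B) {e : Fin N} {χ : 𝓢(Space N, ℂ)}
    (h : KernelBound B (mulc (unitVec e) χ)) (k : ℤ) (x : Space N) {f : Space N → ℂ} {C : ℝ}
    {g q : Space N → ℝ≥0∞} (hf : ∀ y, ‖f y‖ₑ ≤ ENNReal.ofReal C * g y) :
    ∫⁻ y, q y * ‖dv (unitVec e) (tf k x χ) y * f y‖ₑ ≤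
      ENNReal.ofReal B * ENNReal.ofReal C * (tw k * cv k (fun y => q y * g y) x) := by
  unfold cv
  rw [← mul_assoc, ← lintegral_const_mul' _ _
    (ENNReal.mul_ne_top (ENNReal.mul_ne_top ENNReal.ofReal_ne_top ENNReal.ofReal_ne_top)
      (tw_ne_top _))]
  refine lintegral_mono fun y => ?_
  simp only
  rw [enorm_mul]
  calc q y * (‖dv (unitVec e) (tf k x χ) y‖ₑ * ‖f y‖ₑ) ≤
        q y * (tw k * (ENNReal.ofReal B * ENNReal.ofReal (Phi k (x - y))) *
          (ENNReal.ofReal C * g y)) := by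
        gcongr
        · exact enorm_dv_tf_le' hB h k x y
        · exact hf y
    _ = _ := by ring

theorem fInv_dv_ne_zero {v : Space N} {f : 𝓢(Space N, ℂ)} {η : Space N} (h : 𝓕⁻ (dv v f) η ≠ 0) :
    𝓕⁻ f η ≠ 0 := by
  rw [fInv_dv] at h
  exact right_ne_zero_of_mul h

theorem fInv_fourier_dl_support (P : LittlewoodPaley N) {j : ℤ} {η : Space N}
    (h : 𝓕⁻ (𝓕 (dl j (P.symbolS 0))) η ≠ 0) :
    3 / 4 * (2 : ℝ) ^ j ≤ 2 * Real.pi * ‖η‖ ∧ 2 * Real.pi * ‖η‖ ≤ 8 / 3 * (2 : ℝ) ^ j := by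
  rw [fInv_fourier, ← P.symbolS_eq_dl] at h
  exact P.symbolS_support h

/-- For l ≥ k the difference is bounded by the two values. For l ≤ k Bernstein's inequality on the
segment gives 2^l|x-y| ≤ 2^{l-k}(1 + 2^k|x-y|). The two cases are the weight min(1, 2^{l-k}). -/
theorem exists_rb_sub_le (P : LittlewoodPaley N) : ∃ C : ℝ, 0 ≤ C ∧
    ∀ (U : Dist N) (X : ℤ → ℝ≥0∞), (∀ l y, bk P U l y ≤ X l) → (∀ l y, cv l (bk P U l) y ≤ X l) →
    ∀ (k l : ℤ) (x y : Space N), ‖rb P U l y - rb P U l x‖ₑ ≤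
      ENNReal.ofReal (C * (1 + (2 : ℝ) ^ k * ‖x - y‖)) * (tw (min 0 (l - k)) * X l) := by
  obtain ⟨B, hB0, hB⟩ := exists_iteratedDeriv_block_le P 1
  refine ⟨B + 2, by positivity, fun U X hX hX' k l x y => ?_⟩
  have hz : 0 ≤ (2 : ℝ) ^ k * ‖x - y‖ := by positivity
  by_cases htop : X l = ⊤
  · rw [htop, ENNReal.mul_top (tw_ne_zero _), ENNReal.mul_top]
    · exact le_top
    · rw [Ne, ENNReal.ofReal_eq_zero, not_le]
      positivity
  rcases le_total k l with hkl | hkl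
  · have h1 : (min 0 ((l : ℝ) - k)) = 0 := min_eq_left (by
      have : (k : ℝ) ≤ l := by exact_mod_cast hkl
      linarith)
    rw [h1, tw_zero, one_mul]
    calc ‖rb P U l y - rb P U l x‖ₑ ≤ ‖rb P U l y‖ₑ + ‖rb P U l x‖ₑ := enorm_sub_le
      _ ≤ X l + X l := add_le_add ((enorm_rb_le P U l y).trans (hX l y))
          ((enorm_rb_le P U l x).trans (hX l x))
      _ = ENNReal.ofReal 2 * X l := by simp [two_mul]
      _ ≤ _ := by
          gcongr
          nlinarith
  · have h1 : (min 0 ((l : ℝ) - k)) = l - k := min_eq_right (by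
      have : (l : ℝ) ≤ k := by exact_mod_cast hkl
      linarith)
    rw [h1]
    set f : ℝ → ℝ := fun t => rb P U l (x + t • (y - x)) with hf
    have hc : ContDiff ℝ ((0 : ℕ) + 1) f := by
      have := U.contDiff_line (𝓕 (dl l (P.symbolS 0))) x (y - x)
      simp_rw [← P.kernel_eq] at this
      exact this.of_le (by exact_mod_cast le_top)
    set L : ℝ := 2 ^ l * ‖y - x‖ * B * (X l).toReal with hL
    have h2 := lipschitz_of_iteratedDeriv (K := L) hc (fun i hi1 hi2 t => by
      obtain rfl : i = 1 := by omega
      have h3 := (hB U l x (y - x) t).trans (mul_le_mul_right (hX' l _) _)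
      have h4 := ENNReal.toReal_mono (ENNReal.mul_ne_top ENNReal.ofReal_ne_top htop) h3
      rw [toReal_enorm, ENNReal.toReal_mul, ENNReal.toReal_ofReal (by positivity), pow_one,
        Real.norm_eq_abs] at h4
      exact h4) 1 0
    simp only [hf, one_smul, zero_smul, add_zero, add_sub_cancel, sub_zero, enorm_one, mul_one] at h2
    refine h2.trans ?_
    rw [hL, ENNReal.ofReal_mul (by positivity), ENNReal.ofReal_toReal htop, ← mul_assoc, tw,
      ← ENNReal.ofReal_mul (by positivity)]
    refine mul_le_mul' (ENNReal.ofReal_le_ofReal ?_) le_rfl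
    rw [norm_sub_rev, Real.rpow_sub (by norm_num), Real.rpow_intCast, Real.rpow_intCast]
    have hk : (0 : ℝ) < 2 ^ k := by positivity
    have hl : (0 : ℝ) < 2 ^ l := by positivity
    rw [mul_div_assoc', le_div_iff₀ hk]
    have h5 : 2 ^ l * (2 ^ k * ‖x - y‖) * B ≤ 2 ^ l * ((B + 2) * (1 + 2 ^ k * ‖x - y‖)) := by
      rw [mul_assoc]
      refine mul_le_mul_of_nonneg_left ?_ hl.le
      nlinarith
    linarith

/-- The size of the oscillation of the coefficients at scale `2^{-k}`. -/
def ysum (k : ℤ) (X : ℤ → ℝ≥0∞) : ℝ≥0∞ := ∑' l : ℤ, tw (min 0 (l - k)) * X l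

/-- The outer function is Lipschitz, so the bounds for increments of the blocks are summed. The
growth in |x-y| is linear, which one spare power of decay of the kernels can absorb. -/
theorem exists_enorm_smoothCoef_sub_le (P : LittlewoodPaley N) : ∃ C : ℝ, 0 ≤ C ∧
    ∀ {M : ℕ} {U : Dist N} {R K : ℝ} {b : Space N → ℝ}, SmoothCoef P M U R K b →
    ∀ (X : ℤ → ℝ≥0∞), (∀ l y, bk P U l y ≤ X l) → (∀ l y, cv l (bk P U l) y ≤ X l) →
    ∀ (k : ℤ) (x y : Space N), ‖b y - b x‖ₑ ≤
      ENNReal.ofReal (C * K) * ysum k X * ENNReal.ofReal (1 + (2 : ℝ) ^ k * ‖x - y‖) := by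
  obtain ⟨C, hC0, hC⟩ := exists_rb_sub_le P
  refine ⟨C, hC0, fun {M U R K b} h X hX hX' k x y => ?_⟩
  refine (h.enorm_sub_le y x).trans ?_
  calc _ ≤ ENNReal.ofReal K * ∑' l : ℤ, ENNReal.ofReal (C * (1 + (2 : ℝ) ^ k * ‖x - y‖)) *
        (tw (min 0 (l - k)) * X l) := by
        gcongr with l
        exact hC U X hX hX' k l x y
    _ = _ := by
        rw [ENNReal.tsum_mul_left, ysum, ENNReal.ofReal_mul hC0, ENNReal.ofReal_mul hC0]
        ring

end Pairings

/-! ### The viscous terms at frequency 2^k: distant blocks and frozen coefficients -/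

section Viscous

variable {P : LittlewoodPaley N}

theorem enorm_vpi_le {V : 𝓢'(Space N, CVec N)} {b₁ b₂ : Space N → ℝ} {j : ℤ}
    {ψ : 𝓢(Space N, ℂ)} {i : Fin N} {D : ℝ≥0∞}
    (h₁ : ∀ b, ‖pairing b₁ (dv (unitVec b) ψ) (dv (unitVec b) (𝓕 (dl j (P.symbolS 0))))
      (comp V i)‖ₑ ≤ D)
    (h₂ : ∀ b, ‖pairing b₂ (dv (unitVec i) ψ) (dv (unitVec b) (𝓕 (dl j (P.symbolS 0))))
      (comp V b)‖ₑ ≤ D) :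
    ‖vpi P V b₁ b₂ j ψ i‖ₑ ≤ ENNReal.ofReal (2 * N) * D := by
  rw [vpi, enorm_neg]
  calc _ ≤ ∑ _b : Fin N, (D + D) := by
        refine (enorm_sum_le _ _).trans (Finset.sum_le_sum fun b _ => ?_)
        exact (enorm_add_le _ _).trans (add_le_add (h₁ b) (h₂ b))
    _ = _ := by
        simp only [Finset.sum_const, Finset.card_univ, Fintype.card_fin, nsmul_eq_mul]
        rw [ENNReal.ofReal_mul (by norm_num), ENNReal.ofReal_natCast, ENNReal.ofReal_ofNat]
        ring

/-- The test function and the block have distant frequencies, so their product has none below a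
fraction of 2^{max(j,k)} and the coefficient is felt only through its oscillation at the scale
2^{-max(j,k)}. -/
theorem exists_enorm_vpi_le_of_far (P : LittlewoodPaley N) {M : ℕ} (hM : 1 ≤ M) : ∃ C : ℝ, 0 ≤ C ∧
    ∀ {U : Dist N} {R K : ℝ} {b₁ b₂ : Space N → ℝ}, SmoothCoef P M U R K b₁ →
      SmoothCoef P M U R K b₂ → ∀ (V : 𝓢'(Space N, CVec N)) {B : ℝ}, 0 ≤ B →
    ∀ {χ χ' : 𝓢(Space N, ℂ)}, FactorsThrough P χ χ' →
      (∀ e, KernelBound B (mulc (unitVec e) χ)) → ∀ (k j : ℤ), 3 ≤ |j - k| → ∀ (x : Space N) (i : Fin N),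
      ‖vpi P V b₁ b₂ j (tf k x χ) i‖ₑ ≤ ENNReal.ofReal (C * (K * (1 + R) ^ M) * B) *
        (tw k * cv k (fun y => osc P M U (max j k) y * gv P V j y) x) := by
  obtain ⟨C₁, hC₁0, hC₁⟩ := exists_enorm_integral_smoothCoef_le P hM
  obtain ⟨C₂, hC₂0, hC₂⟩ := exists_enorm_tr_dv_le P
  refine ⟨2 * N * (C₁ * C₂), by positivity, ?_⟩
  intro U R K b₁ b₂ h₁ h₂ V B hB χ χ' hd hdB k j hkj x i
  have hK := h₁.K_nonneg
  have hR := h₁.nonneg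
  have key : ∀ {b : Space N → ℝ}, SmoothCoef P M U R K b → ∀ e a c : Fin N,
      ‖pairing b (dv (unitVec e) (tf k x χ)) (dv (unitVec a) (𝓕 (dl j (P.symbolS 0))))
        (comp V c)‖ₑ ≤ ENNReal.ofReal (C₁ * C₂ * (K * (1 + R) ^ M) * B) *
          (tw k * cv k (fun y => osc P M U (max j k) y * gv P V j y) x) := by
    intro b h e a c
    refine (hC₁ h (max j k) _ ((comp V c).integral_tr_mul _ _).1 fun h' hh' w => ?_).trans ?_
    · refine integral_mul_eq_zero_of_separated (comp V c) hkj hh' (fun η hη => ?_) (fun η hη => ?_) w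
      · exact hd.fInv_support (x := x) (fInv_dv_ne_zero hη)
      · exact fInv_fourier_dl_support P (fInv_dv_ne_zero hη)
    · calc _ ≤ ENNReal.ofReal (C₁ * K * (1 + R) ^ M) * (ENNReal.ofReal B * ENNReal.ofReal C₂ *
            (tw k * cv k (fun y => osc P M U (max j k) y * gv P V j y) x)) := by
            gcongr
            exact lintegral_mul_enorm_dv_tf_le hB (hdB e) k x (hC₂ V c a j)
        _ = _ := by
            rw [← mul_assoc, ← ENNReal.ofReal_mul hB, ← ENNReal.ofReal_mul (by positivity)]
            congr 2
            ring
  refine (enorm_vpi_le (fun b => key h₁ b b i) (fun b => key h₂ i b b)).trans (le_of_eq ?_)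
  rw [← mul_assoc, ← ENNReal.ofReal_mul (by positivity)]
  congr 2
  ring

/-- A crude bound by the supremum A of the coefficients. It serves only to justify integrability for
the neighbouring blocks; A does not enter the final constant. -/
theorem exists_enorm_vpi_le (P : LittlewoodPaley N) : ∃ C : ℝ, 0 ≤ C ∧
    ∀ {A : ℝ} {b₁ b₂ : Space N → ℝ}, (∀ᵐ x, |b₁ x| ≤ A) → (∀ᵐ x, |b₂ x| ≤ A) → 0 ≤ A →
    ∀ (V : 𝓢'(Space N, CVec N)) {B : ℝ}, 0 ≤ B → ∀ {χ : 𝓢(Space N, ℂ)},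
      (∀ e, KernelBound B (mulc (unitVec e) χ)) → ∀ (k j : ℤ) (x : Space N) (i : Fin N),
      ‖vpi P V b₁ b₂ j (tf k x χ) i‖ₑ ≤
        ENNReal.ofReal (C * A * B) * (tw k * cv k (gv P V j) x) := by
  obtain ⟨C₂, hC₂0, hC₂⟩ := exists_enorm_tr_dv_le P
  refine ⟨2 * N * C₂, by positivity, ?_⟩
  intro A b₁ b₂ h₁ h₂ hA V B hB χ hdB k j x i
  have key : ∀ {b : Space N → ℝ}, (∀ᵐ x, |b x| ≤ A) → ∀ e a c : Fin N,
      ‖pairing b (dv (unitVec e) (tf k x χ)) (dv (unitVec a) (𝓕 (dl j (P.symbolS 0))))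
        (comp V c)‖ₑ ≤ ENNReal.ofReal (C₂ * A * B) * (tw k * cv k (gv P V j) x) := by
    intro b h e a c
    refine (enorm_integral_le_lintegral_enorm _).trans ?_
    calc _ ≤ ∫⁻ y, ENNReal.ofReal A * (1 * ‖dv (unitVec e) (tf k x χ) y *
          comp V c (tr y (dv (unitVec a) (𝓕 (dl j (P.symbolS 0)))))‖ₑ) := by
          refine lintegral_mono_ae ?_
          filter_upwards [h] with y hy
          rw [enorm_mul, one_mul]
          gcongr
          rw [← ofReal_norm, Complex.norm_real]
          exact ENNReal.ofReal_le_ofReal hy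
      _ ≤ ENNReal.ofReal A * (ENNReal.ofReal B * ENNReal.ofReal C₂ *
            (tw k * cv k (fun y => 1 * gv P V j y) x)) := by
          rw [lintegral_const_mul' _ _ ENNReal.ofReal_ne_top]
          gcongr
          exact lintegral_mul_enorm_dv_tf_le (q := fun _ => 1) hB (hdB e) k x (hC₂ V c a j)
      _ = _ := by
          simp_rw [one_mul]
          rw [← mul_assoc, ← ENNReal.ofReal_mul hB, ← ENNReal.ofReal_mul hA]
          congr 2
          ring
  refine (enorm_vpi_le (fun b => key h₁ b b i) (fun b => key h₂ i b b)).trans (le_of_eq ?_)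
  rw [← mul_assoc, ← ENNReal.ofReal_mul (by positivity)]
  congr 2
  ring

/-- The indices of the blocks treated with frozen coefficients. -/
abbrev diag (k : ℤ) : Finset ℤ := Finset.Icc (k - 2) (k + 2)

/-- The outer indices k ± 2 contribute nothing, since their annuli miss that of Δ_k. They are
included because the estimate for distant blocks starts at |j-k| = 3. -/
theorem sum_conv_diag (P : LittlewoodPaley N) (k : ℤ) {S : 𝓢(Space N, ℂ)}
    (hS : ∀ η, 𝓕⁻ S η ≠ 0 → 3 / 4 * (2 : ℝ) ^ k ≤ 2 * Real.pi * ‖η‖ ∧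
      2 * Real.pi * ‖η‖ ≤ 8 / 3 * (2 : ℝ) ^ k) :
    ∑ i ∈ diag k, conv S (𝓕 (dl i (P.symbolS 0))) = S := by
  have h0 : ∑ i ∈ LittlewoodPaley.near k, conv S (𝓕 (P.symbolS i)) =
      ∑ i ∈ diag k, conv S (𝓕 (P.symbolS i)) := by
    refine Finset.sum_subset (Finset.Icc_subset_Icc (by omega) (by omega)) fun i hi hi' => ?_
    refine conv_eq_zero fun η => ?_
    by_contra! hne
    have h1 := hS η hne.1
    have h2 := hne.2
    rw [fInv_fourier] at h2
    have h3 := P.symbolS_support h2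
    have hk : (0 : ℝ) < 2 ^ k := by positivity
    rw [Finset.mem_Icc] at hi hi'
    rcases (show i = k - 2 ∨ i = k + 2 by omega) with rfl | rfl
    · rw [zpow_sub₀ two_ne_zero] at h3
      norm_num at h3
      linarith [h1.1, h3.2]
    · rw [zpow_add₀ two_ne_zero] at h3
      norm_num at h3
      linarith [h1.2, h3.1]
  simp_rw [← P.symbolS_eq_dl]
  rw [← h0, sum_conv_near P k hS]

/-- The viscous terms with coefficients frozen at `x` act as a multiple of the Laplacian. -/
theorem sum_frozen {α : ℝ} {d d' : Fin N → 𝓢(Space N, ℂ)} (hd : VectorSymbol P α d d')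
    (V : 𝓢'(Space N, CVec N)) (k : ℤ) (x : Space N) (a₁ a₂ : ℂ) :
    ∑ j ∈ diag k, ∑ i, ∑ b, (a₁ * (∫ y, dv (unitVec b) (tf k x (d i)) y *
        comp V i (tr y (dv (unitVec b) (𝓕 (dl j (P.symbolS 0)))))) +
      a₂ * (∫ y, dv (unitVec i) (tf k x (d i)) y *
        comp V b (tr y (dv (unitVec b) (𝓕 (dl j (P.symbolS 0))))))) =
      (2 : ℂ) ^ (2 * k) * (a₁ + a₂ * α) * ∑ i, comp V i (tf k x (lap (d i))) := by
  have h1 : ∀ i e b c : Fin N, ∑ j ∈ diag k, ∫ y, dv (unitVec e) (tf k x (d i)) y *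
      comp V c (tr y (dv (unitVec b) (𝓕 (dl j (P.symbolS 0))))) =
      (2 : ℂ) ^ (2 * k) * comp V c (tf k x (mulc (unitVec b) (mulc (unitVec e) (d i)))) := by
    intro i e b c
    simp_rw [← ((comp V c).integral_tr_mul _ _).2, conv_dv]
    rw [← map_sum, ← map_sum, sum_conv_diag P k fun η hη => ?_]
    · rw [dv_tf, map_smul, dv_tf, smul_smul, ← zpow_add₀ two_ne_zero, map_smul, smul_eq_mul, two_mul]
    · exact (hd.factors i).fInv_support (x := x) (fInv_dv_ne_zero hη)
  have h2 : ∑ j ∈ diag k, ∑ i, ∑ b, (a₁ * (∫ y, dv (unitVec b) (tf k x (d i)) y *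
        comp V i (tr y (dv (unitVec b) (𝓕 (dl j (P.symbolS 0)))))) +
      a₂ * (∫ y, dv (unitVec i) (tf k x (d i)) y *
        comp V b (tr y (dv (unitVec b) (𝓕 (dl j (P.symbolS 0))))))) =
      ∑ i, ∑ b, (a₁ * ((2 : ℂ) ^ (2 * k) *
          comp V i (tf k x (mulc (unitVec b) (mulc (unitVec b) (d i))))) +
        a₂ * ((2 : ℂ) ^ (2 * k) *
          comp V b (tf k x (mulc (unitVec b) (mulc (unitVec i) (d i)))))) := by
    rw [Finset.sum_comm]
    refine Finset.sum_congr rfl fun i _ => ?_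
    rw [Finset.sum_comm]
    refine Finset.sum_congr rfl fun b _ => ?_
    rw [Finset.sum_add_distrib, ← Finset.mul_sum, ← Finset.mul_sum, h1, h1]
  have h3 : ∑ i, ∑ b, comp V i (tf k x (mulc (unitVec b) (mulc (unitVec b) (d i)))) =
      ∑ i, comp V i (tf k x (lap (d i))) := by
    refine Finset.sum_congr rfl fun i _ => ?_
    rw [lap_eq_sum, map_sum, map_sum]
  have h4 : ∑ i, ∑ b, comp V b (tf k x (mulc (unitVec b) (mulc (unitVec i) (d i)))) =
      α * ∑ i, comp V i (tf k x (lap (d i))) := by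
    rw [Finset.sum_comm, Finset.mul_sum]
    refine Finset.sum_congr rfl fun b _ => ?_
    rw [← map_sum, ← map_sum, ← map_sum, hd.graddiv, map_smul, map_smul, smul_eq_mul]
  rw [h2]
  simp_rw [Finset.sum_add_distrib, ← Finset.mul_sum]
  rw [h3, h4]
  ring

/-- Writing b(y) = b(x) + (b(y) - b(x)), the constant part sums over the neighbouring blocks to the
exact multiple of the Laplacian (`sum_frozen`). The increment is at most a constant times Y_k(1 +
2^k|x-y|), with Y_k = `ysum k X`, and the linear growth is paid by the spare decay in
`enorm_dv_tf_le`. -/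
theorem exists_enorm_sum_vp_add_le (P : LittlewoodPaley N) : ∃ C : ℝ, 0 ≤ C ∧
    ∀ {M : ℕ} {U : Dist N} {R K : ℝ} {b₁ b₂ : Space N → ℝ}, SmoothCoef P M U R K b₁ →
      SmoothCoef P M U R K b₂ →
    ∀ (X : ℤ → ℝ≥0∞), (∀ l y, bk P U l y ≤ X l) → (∀ l y, cv l (bk P U l) y ≤ X l) →
    ∀ (V : 𝓢'(Space N, CVec N)) {B α : ℝ}, 0 ≤ B →
    ∀ {d d' : Fin N → 𝓢(Space N, ℂ)}, VectorSymbol P α d d' →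
      (∀ i e, KernelBound B (mulc (unitVec e) (d i))) → ∀ (k : ℤ) (x : Space N),
      ‖∑ j ∈ diag k, vp P V b₁ b₂ j (fun i => tf k x (d i)) +
        (2 : ℂ) ^ (2 * k) * (b₁ x + b₂ x * α) * ∑ i, comp V i (tf k x (lap (d i)))‖ₑ ≤
      ENNReal.ofReal (C * K * B) * (tw k * ∑ j ∈ diag k, ysum k X * cv k (gv P V j) x) := by
  obtain ⟨C₁, hC₁0, hC₁⟩ := exists_enorm_smoothCoef_sub_le P
  obtain ⟨C₂, hC₂0, hC₂⟩ := exists_enorm_tr_dv_le P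
  refine ⟨N * (2 * N) * (C₁ * C₂), by positivity, ?_⟩
  intro M U R K b₁ b₂ h₁ h₂ X hX hX' V B α hB d d' hd hdB k x
  have hK := h₁.K_nonneg
  have key : ∀ {b : Space N → ℝ}, SmoothCoef P M U R K b → ∀ (i e a c : Fin N) (j : ℤ),
      ‖pairing (fun y => b y - b x) (dv (unitVec e) (tf k x (d i)))
        (dv (unitVec a) (𝓕 (dl j (P.symbolS 0)))) (comp V c)‖ₑ ≤
      ENNReal.ofReal (C₁ * C₂ * K * B) * (tw k * (ysum k X * cv k (gv P V j) x)) := by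
    intro b h i e a c j
    refine (enorm_integral_le_lintegral_enorm _).trans ?_
    have hm : Measurable fun y => ENNReal.ofReal (Phi k (x - y)) * gv P V j y :=
      (ENNReal.measurable_ofReal.comp
        ((Phi_continuous k).comp (continuous_const.sub continuous_id)).measurable).mul
        (gv_measurable P V j)
    calc _ ≤ ∫⁻ y, ENNReal.ofReal (C₁ * C₂ * K * B) * tw k * ysum k X *
          (ENNReal.ofReal (Phi k (x - y)) * gv P V j y) := by
          refine lintegral_mono fun y => ?_
          simp only
          rw [enorm_mul, enorm_mul, ← ofReal_norm ((_ : ℝ) : ℂ), Complex.norm_real, ofReal_norm]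
          calc _ ≤ ENNReal.ofReal (C₁ * K) * ysum k X * ENNReal.ofReal (1 + (2 : ℝ) ^ k * ‖x - y‖) *
                (‖dv (unitVec e) (tf k x (d i)) y‖ₑ * (ENNReal.ofReal C₂ * gv P V j y)) := by
                gcongr
                · exact hC₁ h X hX hX' k x y
                · exact hC₂ V c a j y
            _ = ENNReal.ofReal (C₁ * K) * ysum k X * (‖dv (unitVec e) (tf k x (d i)) y‖ₑ *
                  ENNReal.ofReal (1 + (2 : ℝ) ^ k * ‖x - y‖)) *
                  (ENNReal.ofReal C₂ * gv P V j y) := by ring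
            _ ≤ ENNReal.ofReal (C₁ * K) * ysum k X *
                  (tw k * (ENNReal.ofReal B * ENNReal.ofReal (Phi k (x - y)))) *
                  (ENNReal.ofReal C₂ * gv P V j y) := by
                exact mul_le_mul' (mul_le_mul' le_rfl (enorm_dv_tf_le hB (hdB i e) k x y)) le_rfl
            _ = _ := by
                have h3 : ENNReal.ofReal (C₁ * C₂ * K * B) =
                    ENNReal.ofReal (C₁ * K) * ENNReal.ofReal C₂ * ENNReal.ofReal B := by
                  rw [← ENNReal.ofReal_mul (by positivity), ← ENNReal.ofReal_mul (by positivity)]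
                  congr 1
                  ring
                rw [h3]
                ring
      _ = _ := by
          rw [lintegral_const_mul _ hm, cv]
          ring
  have hsplit : ∀ {b : Space N → ℝ}, SmoothCoef P M U R K b → ∀ S g U',
      pairing b S g U' = pairing (fun y => b y - b x) S g U' + b x * ∫ y, S y * U' (tr y g) := by
    intro b h S g U'
    obtain ⟨A, hA⟩ := h.bounded
    have h1 := integrable_pairing h.measurable.aestronglyMeasurable
      (Filter.Eventually.of_forall hA) S g U'
    have h2 := (U'.integral_tr_mul g S).1.const_mul (b x : ℂ)
    unfold pairing
    rw [← integral_const_mul, ← sub_eq_iff_eq_add, ← integral_sub h1 h2]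
    refine integral_congr_ae (Filter.Eventually.of_forall fun y => ?_)
    simp only [Complex.ofReal_sub]
    ring
  have hsum : ∑ j ∈ diag k, vp P V b₁ b₂ j (fun i => tf k x (d i)) +
      (2 : ℂ) ^ (2 * k) * (b₁ x + b₂ x * α) * ∑ i, comp V i (tf k x (lap (d i))) =
      ∑ j ∈ diag k, vp P V (fun y => b₁ y - b₁ x) (fun y => b₂ y - b₂ x) j
        (fun i => tf k x (d i)) := by
    rw [← sum_frozen hd V k x (b₁ x) (b₂ x), ← Finset.sum_add_distrib]
    refine Finset.sum_congr rfl fun j _ => ?_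
    unfold vp
    rw [← Finset.sum_add_distrib]
    refine Finset.sum_congr rfl fun i _ => ?_
    unfold vpi
    rw [neg_add_eq_iff_eq_add, ← sub_eq_add_neg, eq_sub_iff_add_eq, ← Finset.sum_add_distrib]
    refine Finset.sum_congr rfl fun b _ => ?_
    rw [hsplit h₁, hsplit h₂]
    ring
  rw [hsum, Finset.mul_sum, Finset.mul_sum]
  refine (enorm_sum_le _ _).trans (Finset.sum_le_sum fun j _ => ?_)
  refine (enorm_sum_le _ _).trans ((Finset.sum_le_sum fun i _ => enorm_vpi_le
    (fun b => key h₁ i b b i j) (fun b => key h₂ i i b b j)).trans (le_of_eq ?_))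
  rw [Finset.sum_const, Finset.card_univ, Fintype.card_fin, nsmul_eq_mul,
    ← ENNReal.ofReal_natCast, ← mul_assoc, ← mul_assoc, ← ENNReal.ofReal_mul (by positivity),
    ← ENNReal.ofReal_mul (by positivity)]
  congr 2
  ring

end Viscous

/-- Seen as a functional of the test function S, the pairing is a tempered distribution, because
both factors besides S are bounded. This makes `Dist.hasDerivAt_hs` applicable to the viscous terms.
-/
theorem exists_dist_eq_pairing {a : Space N → ℝ} (ha : AEStronglyMeasurable a volume) {A : ℝ}
    (hA : ∀ᵐ x, |a x| ≤ A) (g : 𝓢(Space N, ℂ)) (U : Dist N) {D : ℝ}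
    (hD : ∀ y, ‖U (tr y g)‖ ≤ D) : ∃ L : Dist N, ∀ S, L S = pairing a S g U := by
  have hA' : ∀ᵐ x : Space N, |a x| ≤ |A| := hA.mono fun x hx => hx.trans (le_abs_self A)
  set n := (volume : Measure (Space N)).integrablePower with hn
  set Q := (2 : ℝ) ^ n * ∫ x : Space N, (1 + ‖x‖) ^ (-(n : ℝ)) with hQ
  have hQ0 : 0 ≤ Q := mul_nonneg (by positivity) (integral_nonneg fun x => by positivity)
  have hb : ∀ f : 𝓢(Space N, ℂ), ‖pairing a f g U‖ ≤ |A| * |D| * ∫ y, ‖f y‖ := by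
    intro f
    rw [← integral_const_mul]
    refine norm_integral_le_of_norm_le (f.integrable.norm.const_mul _) ?_
    filter_upwards [hA'] with y hy
    rw [norm_mul, norm_mul, Complex.norm_real, Real.norm_eq_abs]
    have h1 := (hD y).trans (le_abs_self D)
    calc |a y| * (‖f y‖ * ‖U (tr y g)‖) ≤ |A| * (‖f y‖ * |D|) := by gcongr
      _ = _ := by ring
  refine ⟨SchwartzMap.mkCLMtoNormedSpace (fun f => pairing a f g U) (fun f f' => ?_)
    (fun c f => ?_) ⟨{(0, 0), (n, 0)}, |A| * |D| * (Q * 2), by positivity, fun f => ?_⟩, fun S => rfl⟩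
  · unfold pairing
    rw [← integral_add (integrable_pairing ha hA f g U) (integrable_pairing ha hA f' g U)]
    refine integral_congr_ae (Filter.Eventually.of_forall fun y => ?_)
    simp only [_root_.add_apply]
    ring
  · unfold pairing
    rw [RingHom.id_apply, smul_eq_mul, ← integral_const_mul]
    refine integral_congr_ae (Filter.Eventually.of_forall fun y => ?_)
    simp only [_root_.smul_apply, smul_eq_mul]
    ring
  · refine (hb f).trans ?_
    rw [mul_assoc (|A| * |D|)]
    refine mul_le_mul_of_nonneg_left ?_ (by positivity)
    have h1 := SchwartzMap.integral_pow_mul_iteratedFDeriv_le ℂ (volume : Measure (Space N)) f 0 0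
    simp only [pow_zero, norm_iteratedFDeriv_zero, one_mul, zero_add] at h1
    refine h1.trans ?_
    rw [mul_assoc Q]
    gcongr
    have h2 : ∀ i ∈ ({(0, 0), (n, 0)} : Finset (ℕ × ℕ)), SchwartzMap.seminorm ℂ i.1 i.2 f ≤
        (({(0, 0), (n, 0)} : Finset (ℕ × ℕ)).sup (schwartzSeminormFamily ℂ (Space N) ℂ)) f :=
      fun i hi => Seminorm.le_finset_sup_apply (p := schwartzSeminormFamily ℂ (Space N) ℂ) hi
    have h3 := h2 (0, 0) (by simp)
    have h4 := h2 (n, 0) (by simp)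
    simp only at h3 h4
    linarith

theorem exists_dist_eq_vpi (P : LittlewoodPaley N) {V : 𝓢'(Space N, CVec N)} {m₁ m₂ : Space N → ℝ}
    (hm₁ : AEStronglyMeasurable m₁ volume) (hm₂ : AEStronglyMeasurable m₂ volume) {A : ℝ}
    (hA₁ : ∀ᵐ x, |m₁ x| ≤ A) (hA₂ : ∀ᵐ x, |m₂ x| ≤ A) {j : ℤ} {D : ℝ}
    (hD : ∀ y, gv P V j y ≤ ENNReal.ofReal D) (i : Fin N) :
    ∃ L : Dist N, ∀ ψ, L ψ = vpi P V m₁ m₂ j ψ i := by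
  obtain ⟨C, hC0, hC⟩ := exists_enorm_tr_dv_le P
  have hb : ∀ (c b : Fin N) (y : Space N),
      ‖comp V c (tr y (dv (unitVec b) (𝓕 (dl j (P.symbolS 0)))))‖ ≤ C * |D| := by
    intro c b y
    have h1 := (hC V c b j y).trans (mul_le_mul_right (hD y) _)
    rw [← ENNReal.ofReal_mul hC0, ← ofReal_norm] at h1
    have h2 := (ENNReal.ofReal_le_ofReal_iff' ).1 h1
    rcases h2 with h2 | h2
    · exact h2.trans (by gcongr; exact le_abs_self D)
    · exact h2.trans (by positivity)
  choose L₁ hL₁ using fun b : Fin N => exists_dist_eq_pairing hm₁ hA₁ _ (comp V i) (hb i b)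
  choose L₂ hL₂ using fun b : Fin N => exists_dist_eq_pairing hm₂ hA₂ _ (comp V b) (hb b b)
  refine ⟨-∑ b, ((L₁ b).comp (dv (unitVec b)) + (L₂ b).comp (dv (unitVec i))), fun ψ => ?_⟩
  rw [vpi, _root_.neg_apply, _root_.sum_apply]
  simp only [_root_.add_apply, ContinuousLinearMap.comp_apply, hL₁, hL₂]

/-! ### The localized equation and its solution formula at a fixed point -/

/-- The data of the momentum equation that are needed for estimates at frequency `2^k` near `x`. -/
structure LocalBounds (P : LittlewoodPaley N) (T : ℝ) (μ₁ μ₂ : ℝ → Space N → ℝ)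
    (G : ℝ → 𝓢'(Space N, CVec N)) (u₀ : 𝓢'(Space N, CVec N)) (u : ℝ → 𝓢'(Space N, CVec N))
    (k : ℤ) (x : Space N) (A : ℝ) (D : ℤ → ℝ → ℝ≥0∞) : Prop where
  meas₁ : AEStronglyMeasurable (Function.uncurry μ₁) ((volume.restrict (Set.Ioc 0 T)).prod volume)
  meas₂ : AEStronglyMeasurable (Function.uncurry μ₂) ((volume.restrict (Set.Ioc 0 T)).prod volume)
  bound : ∀ᵐ s ∂(volume.restrict (Set.Ioc 0 T)), (∀ᵐ y, |μ₁ s y| ≤ A) ∧ ∀ᵐ y, |μ₂ s y| ≤ A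
  gv_bound : ∀ᵐ s ∂(volume.restrict (Set.Ioc 0 T)), ∀ j, ∃ D, ∀ y,
    gv P (u s) j y ≤ ENNReal.ofReal D
  meas_u : ∀ ψ, AEStronglyMeasurable (fun t => u t ψ) (volume.restrict (Set.Ioc 0 T))
  meas_G : ∀ ψ, AEStronglyMeasurable (fun t => G t ψ) (volume.restrict (Set.Ioc 0 T))
  equation : ∀ ψ ∈ testSpace N, ∀ i : Fin N, ∀ᵐ t ∂(volume.restrict (Set.Ioc 0 T)),
    HasSum (fun j : ℤ => ∫ s in Set.Ioc 0 t, vpi P (u s) (μ₁ s) (μ₂ s) j ψ i)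
      (u₀ ψ i - u t ψ i + ∫ s in Set.Ioc 0 t, G s ψ i)
  meas_D : ∀ j, AEMeasurable (D j) (volume.restrict (Set.Ioc 0 T))
  lintegral_D : ∫⁻ s in Set.Ioc 0 T, ∑' j, D j s ≠ ⊤
  vpi_le : ∀ᵐ s ∂(volume.restrict (Set.Ioc 0 T)), ∀ (χ χ' : 𝓢(Space N, ℂ)) (B : ℝ), 0 ≤ B →
    FactorsThrough P χ χ' → (∀ e, KernelBound B (mulc (unitVec e) χ)) → ∀ j i,
    ‖vpi P (u s) (μ₁ s) (μ₂ s) j (tf k x χ) i‖ₑ ≤ ENNReal.ofReal B * D j s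
  lintegral_G : ∫⁻ s in Set.Ioc 0 T, cv k (bv P (G s) k) x ≠ ⊤

theorem bv_joint {P : LittlewoodPaley N} {α : Type*} [MeasurableSpace α] {μ : Measure α}
    {V : α → 𝓢'(Space N, CVec N)} (hV : ∀ ψ, AEStronglyMeasurable (fun s => V s ψ) μ) (j : ℤ) :
    AEMeasurable (Function.uncurry fun s => bv P (V s) j) (μ.prod volume) :=
  (aestronglyMeasurable_uncurry_of_continuous volume
    (Filter.Eventually.of_forall fun s => continuous_block P (V s) j)
    (fun x => hV (P.kernel j x))).enorm

theorem cv_aemeasurable {α : Type*} [MeasurableSpace α] {μ : Measure α} [SFinite μ] (k : ℤ)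
    {f : α → Space N → ℝ≥0∞} (hf : AEMeasurable (Function.uncurry f) (μ.prod volume))
    (x : Space N) : AEMeasurable (fun a => cv k (f a) x) μ := by
  unfold cv
  have h1 : AEMeasurable (fun z : α × Space N => ENNReal.ofReal (Phi k (x - z.2)) * f z.1 z.2)
      (μ.prod volume) := by
    refine AEMeasurable.mul ?_ hf
    exact ((ENNReal.measurable_ofReal.comp ((Phi_continuous k).comp
      (continuous_const.sub continuous_id)).measurable).comp measurable_snd).aemeasurable
  exact h1.lintegral_prod_right'

theorem aestronglyMeasurable_pairing {T : ℝ} {a : ℝ → Space N → ℝ} {V : ℝ → Dist N}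
    (ha : AEStronglyMeasurable (Function.uncurry a) ((volume.restrict (Set.Ioc 0 T)).prod volume))
    (hV : ∀ ψ, AEStronglyMeasurable (fun t => V t ψ) (volume.restrict (Set.Ioc 0 T)))
    (S g : 𝓢(Space N, ℂ)) :
    AEStronglyMeasurable (fun s => pairing (a s) S g (V s)) (volume.restrict (Set.Ioc 0 T)) := by
  unfold pairing
  have h1 : AEStronglyMeasurable (Function.uncurry fun s y => V s (tr y g))
      ((volume.restrict (Set.Ioc 0 T)).prod volume) :=
    aestronglyMeasurable_uncurry_of_continuous volume
      (Filter.Eventually.of_forall fun s => (V s).continuous_tr g) fun y => hV _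
  have h2 : AEStronglyMeasurable (fun z : ℝ × Space N => S z.2)
      ((volume.restrict (Set.Ioc 0 T)).prod volume) :=
    (S.continuous.comp continuous_snd).aestronglyMeasurable
  exact ((Complex.continuous_ofReal.comp_aestronglyMeasurable ha).mul
    (h2.mul h1)).integral_prod_right'

theorem aestronglyMeasurable_comp {T : ℝ} {V : ℝ → 𝓢'(Space N, CVec N)}
    (hV : ∀ ψ, AEStronglyMeasurable (fun t => V t ψ) (volume.restrict (Set.Ioc 0 T)))
    (i : Fin N) (ψ : 𝓢(Space N, ℂ)) :
    AEStronglyMeasurable (fun t => comp (V t) i ψ) (volume.restrict (Set.Ioc 0 T)) :=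
  (EuclideanSpace.proj i : CVec N →L[ℂ] ℂ).continuous.comp_aestronglyMeasurable (hV ψ)

theorem exists_kernelBound_vectorSymbol {P : LittlewoodPaley N} {α : ℝ} {c c' : Fin N → 𝓢(Space N, ℂ)}
    (h : VectorSymbol P α c c') : ∃ B, 0 ≤ B ∧ ∀ σ, -1 ≤ σ →
      (∀ i e, KernelBound (B * Real.exp (-(σ / 16))) (mulc (unitVec e) (hs (c i) σ))) ∧
      ∀ i, KernelBound (B * Real.exp (-(σ / 16))) (hs (c' i) σ) := by
  choose B₁ hB₁0 hB₁ using fun i e : Fin N =>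
    exists_kernelBound_hs_of_neg_one_le ((h.annular i).mulc (unitVec e))
  choose B₂ hB₂0 hB₂ using fun i : Fin N => exists_kernelBound_hs_of_neg_one_le (h.annular' i)
  have h1 : 0 ≤ ∑ i, ∑ e, B₁ i e :=
    Finset.sum_nonneg fun i _ => Finset.sum_nonneg fun e _ => hB₁0 i e
  have h2 : 0 ≤ ∑ i, B₂ i := Finset.sum_nonneg fun i _ => hB₂0 i
  refine ⟨∑ i, ∑ e, B₁ i e + ∑ i, B₂ i, by positivity, fun σ hσ => ⟨fun i e => ?_, fun i => ?_⟩⟩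
  · rw [mulc_hs (h.annular i)]
    refine (hB₁ i e σ hσ).mono ?_
    gcongr
    have h3 := Finset.single_le_sum (fun e _ => hB₁0 i e) (Finset.mem_univ e)
    have h4 := Finset.single_le_sum (f := fun i => ∑ e, B₁ i e)
      (fun i _ => Finset.sum_nonneg fun e _ => hB₁0 i e) (Finset.mem_univ i)
    linarith
  · refine (hB₂ i σ hσ).mono ?_
    gcongr
    have h3 := Finset.single_le_sum (fun i _ => hB₂0 i) (Finset.mem_univ i)
    linarith

namespace LocalBounds

variable {P : LittlewoodPaley N} {T : ℝ} {μ₁ μ₂ : ℝ → Space N → ℝ}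
  {G : ℝ → 𝓢'(Space N, CVec N)} {u₀ : 𝓢'(Space N, CVec N)} {u : ℝ → 𝓢'(Space N, CVec N)}
  {k : ℤ} {x : Space N} {A : ℝ} {D : ℤ → ℝ → ℝ≥0∞} {α : ℝ} {c c' : Fin N → 𝓢(Space N, ℂ)}

/-- The forcing of the equation for the frequency localized solution. -/
def force (P : LittlewoodPaley N) (μ₁ μ₂ : ℝ → Space N → ℝ)
    (G : ℝ → 𝓢'(Space N, CVec N)) (u : ℝ → 𝓢'(Space N, CVec N)) (k : ℤ) (x : Space N)
    (c : Fin N → 𝓢(Space N, ℂ)) (s σ : ℝ) : ℂ :=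
  ∑ i, (comp (G s) i (tf k x (hs (c i) σ)) -
    ∑' j, vpi P (u s) (μ₁ s) (μ₂ s) j (tf k x (hs (c i) σ)) i)

theorem ae_lt_top (h : LocalBounds P T μ₁ μ₂ G u₀ u k x A D) :
    ∀ᵐ s ∂(volume.restrict (Set.Ioc 0 T)), ∑' j, D j s ≠ ⊤ :=
  (MeasureTheory.ae_lt_top' (AEMeasurable.tsum h.meas_D) h.lintegral_D).mono fun _ hs => hs.ne

theorem ae_meas (h : LocalBounds P T μ₁ μ₂ G u₀ u k x A D) :
    ∀ᵐ s ∂(volume.restrict (Set.Ioc 0 T)), AEStronglyMeasurable (μ₁ s) volume ∧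
      AEStronglyMeasurable (μ₂ s) volume := by
  filter_upwards [h.meas₁.prodMk_left, h.meas₂.prodMk_left] with s h1 h2 using ⟨h1, h2⟩

theorem hasDerivAt_comp_tf (V : Dist N) {χ : 𝓢(Space N, ℂ)} (hχ : Annular χ) (σ : ℝ) :
    HasDerivAt (fun σ => V (tf k x (hs χ σ))) (V (tf k x (hs (lap χ) σ))) σ :=
  Dist.hasDerivAt_hs (V.comp (tf k x)) hχ σ

theorem summable_vpi (h : LocalBounds P T μ₁ μ₂ G u₀ u k x A D) :
    ∀ᵐ s ∂(volume.restrict (Set.Ioc 0 T)), ∀ (χ χ' : 𝓢(Space N, ℂ)) (i : Fin N),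
      FactorsThrough P χ χ' →
      Summable fun j => vpi P (u s) (μ₁ s) (μ₂ s) j (tf k x χ) i := by
  filter_upwards [h.ae_lt_top, h.vpi_le] with s hs1 hs2 χ χ' i hχ
  choose B hB0 hB using fun e : Fin N => exists_kernelBound (mulc (unitVec e) χ)
  have h1 := hs2 χ χ' (∑ e, B e) (Finset.sum_nonneg fun e _ => hB0 e) hχ fun e =>
    (hB e).mono (Finset.single_le_sum (fun e _ => hB0 e) (Finset.mem_univ e))
  refine summable_of_tsum_enorm_ne_top (ne_top_of_le_ne_top ?_
    (ENNReal.tsum_le_tsum fun j => h1 j i))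
  rw [ENNReal.tsum_mul_left]
  exact ENNReal.mul_ne_top ENNReal.ofReal_ne_top hs1

/-- Termwise differentiation of the series over the blocks. Each term is a distribution applied to
the evolved test function, and the differentiated series is dominated by the summable `D`. -/
theorem hasDerivAt_force (h : LocalBounds P T μ₁ μ₂ G u₀ u k x A D) (hc : VectorSymbol P α c c') :
    ∀ᵐ s ∂(volume.restrict (Set.Ioc 0 T)), ∀ σ, 0 ≤ σ →
      HasDerivAt (force P μ₁ μ₂ G u k x c s)
        (force P μ₁ μ₂ G u k x (fun i => lap (c i)) s σ) σ := by
  obtain ⟨B, hB0, hB⟩ := exists_kernelBound_vectorSymbol hc.lap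
  filter_upwards [h.ae_lt_top, h.vpi_le, h.ae_meas, h.bound, h.gv_bound, h.summable_vpi] with
    s hs1 hs2 hs3 hs4 hs5 hs6 σ hσ
  unfold force
  refine HasDerivAt.fun_sum fun i _ => ?_
  refine (hasDerivAt_comp_tf (comp (G s) i) (hc.annular i) σ).sub ?_
  -- Largest value of B e^{-τ/16} on the interval τ > -1 on which the derivatives must be dominated.
  set E : ℝ := B * Real.exp (1 / 16) with hE
  refine hasDerivAt_tsum_of_isPreconnected (𝕜 := ℝ) (F := ℂ)
    (g := fun j τ => vpi P (u s) (μ₁ s) (μ₂ s) j (tf k x (hs (c i) τ)) i)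
    (g' := fun j τ => vpi P (u s) (μ₁ s) (μ₂ s) j (tf k x (hs (lap (c i)) τ)) i) (t := Set.Ioi (-1)) (y₀ := σ)
    (u := fun j => (ENNReal.ofReal E * D j s).toReal) ?_ isOpen_Ioi isPreconnected_Ioi ?_ ?_ ?_ ?_ ?_
  · refine ENNReal.summable_toReal ?_
    rw [ENNReal.tsum_mul_left]
    exact ENNReal.mul_ne_top ENNReal.ofReal_ne_top hs1
  · intro j τ _
    obtain ⟨D', hD'⟩ := hs5 j
    obtain ⟨L, hL⟩ := exists_dist_eq_vpi P hs3.1 hs3.2 hs4.1 hs4.2 hD' i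
    simp_rw [← hL]
    exact hasDerivAt_comp_tf L (hc.annular i) τ
  · intro j τ hτ
    have hτ' : -1 ≤ τ := (Set.mem_Ioi.1 hτ).le
    have h1 := hs2 (hs (lap (c i)) τ) (hs (lap (c' i)) τ) E (by positivity) ((hc.lap.hs τ).factors i)
      (fun e => ((hB τ hτ').1 i e).mono (by rw [hE]; gcongr; linarith)) j i
    rw [← toReal_enorm]
    refine ENNReal.toReal_mono ?_ h1
    exact ENNReal.mul_ne_top ENNReal.ofReal_ne_top (ENNReal.ne_top_of_tsum_ne_top hs1 j)
  · exact Set.mem_Ioi.2 (by linarith)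
  · exact hs6 _ _ i ((hc.hs σ).factors i)
  · exact Set.mem_Ioi.2 (by linarith)

theorem aestronglyMeasurable_vpi (h : LocalBounds P T μ₁ μ₂ G u₀ u k x A D) (j : ℤ)
    (ψ : 𝓢(Space N, ℂ)) (i : Fin N) :
    AEStronglyMeasurable (fun s => vpi P (u s) (μ₁ s) (μ₂ s) j ψ i)
      (volume.restrict (Set.Ioc 0 T)) := by
  unfold vpi
  refine AEStronglyMeasurable.neg ?_
  refine Finset.aestronglyMeasurable_fun_sum _ fun b _ => ?_
  exact (aestronglyMeasurable_pairing h.meas₁ (aestronglyMeasurable_comp h.meas_u i) _ _).add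
    (aestronglyMeasurable_pairing h.meas₂ (aestronglyMeasurable_comp h.meas_u b) _ _)

theorem aestronglyMeasurable_tsum_vpi (h : LocalBounds P T μ₁ μ₂ G u₀ u k x A D)
    {χ χ' : 𝓢(Space N, ℂ)} (hχ : FactorsThrough P χ χ') (i : Fin N) :
    AEStronglyMeasurable (fun s => ∑' j, vpi P (u s) (μ₁ s) (μ₂ s) j (tf k x χ) i)
      (volume.restrict (Set.Ioc 0 T)) := by
  refine aestronglyMeasurable_of_tendsto_ae (Filter.atTop : Filter (Finset ℤ))
    (f := fun I s => ∑ j ∈ I, vpi P (u s) (μ₁ s) (μ₂ s) j (tf k x χ) i)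
    (fun I => Finset.aestronglyMeasurable_fun_sum _ fun j _ => h.aestronglyMeasurable_vpi j _ i) ?_
  filter_upwards [h.summable_vpi] with s hs
  exact (hs χ χ' i hχ).hasSum

theorem aestronglyMeasurable_force (h : LocalBounds P T μ₁ μ₂ G u₀ u k x A D)
    (hc : VectorSymbol P α c c') (σ : ℝ) :
    AEStronglyMeasurable (fun s => force P μ₁ μ₂ G u k x c s σ) (volume.restrict (Set.Ioc 0 T)) := by
  unfold force
  refine Finset.aestronglyMeasurable_fun_sum _ fun i _ => ?_
  exact (aestronglyMeasurable_comp h.meas_G i _).sub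
    (h.aestronglyMeasurable_tsum_vpi ((hc.hs σ).factors i) i)

/-- The function that dominates the forcing. -/
def dom (P : LittlewoodPaley N) (G : ℝ → 𝓢'(Space N, CVec N)) (k : ℤ) (x : Space N)
    (D : ℤ → ℝ → ℝ≥0∞) (s : ℝ) : ℝ≥0∞ := cv k (bv P (G s) k) x + ∑' j, D j s

theorem enorm_comp_tf_le (V : 𝓢'(Space N, CVec N)) (i : Fin N) {B : ℝ} (hB : 0 ≤ B)
    {χ χ' : 𝓢(Space N, ℂ)} (hχ : FactorsThrough P χ χ') (h : KernelBound B χ') (k : ℤ)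
    (x : Space N) : ‖comp V i (tf k x χ)‖ₑ ≤ ENNReal.ofReal B * cv k (bv P V k) x := by
  refine ((comp V i).enorm_le_cv hB hχ h k x).trans ?_
  gcongr
  exact cv_mono k (Filter.Eventually.of_forall fun y => bk_comp_le P V i k y) x

theorem exists_enorm_force_le (h : LocalBounds P T μ₁ μ₂ G u₀ u k x A D)
    (hc : VectorSymbol P α c c') : ∃ B : ℝ, 0 ≤ B ∧ ∀ᵐ s ∂(volume.restrict (Set.Ioc 0 T)),
      ∀ σ, 0 ≤ σ → ‖force P μ₁ μ₂ G u k x c s σ‖ₑ ≤ ENNReal.ofReal B * dom P G k x D s := by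
  obtain ⟨B, hB0, hB⟩ := exists_kernelBound_vectorSymbol hc
  refine ⟨N * B, by positivity, ?_⟩
  filter_upwards [h.vpi_le] with s hs2 σ hσ
  have hexp : B * Real.exp (-(σ / 16)) ≤ B :=
    mul_le_of_le_one_right hB0 (Real.exp_le_one_iff.2 (by linarith))
  have h1 : ∀ i, ‖comp (G s) i (tf k x (hs (c i) σ)) -
      ∑' j, vpi P (u s) (μ₁ s) (μ₂ s) j (tf k x (hs (c i) σ)) i‖ₑ ≤
      ENNReal.ofReal B * dom P G k x D s := by
    intro i
    rw [dom, mul_add, ← ENNReal.tsum_mul_left]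
    refine enorm_sub_le.trans (add_le_add ?_ ?_)
    · exact enorm_comp_tf_le _ i hB0 ((hc.hs σ).factors i)
        (((hB σ (by linarith)).2 i).mono hexp) k x
    · refine (enorm_tsum_le_tsum_enorm).trans (ENNReal.tsum_le_tsum fun j => ?_)
      exact hs2 _ _ B hB0 ((hc.hs σ).factors i)
        (fun e => ((hB σ (by linarith)).1 i e).mono hexp) j i
  refine (enorm_sum_le _ _).trans ((Finset.sum_le_sum fun i _ => h1 i).trans (le_of_eq ?_))
  rw [Finset.sum_const, Finset.card_univ, Fintype.card_fin, nsmul_eq_mul,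
    ENNReal.ofReal_mul (by positivity), ENNReal.ofReal_natCast, mul_assoc]

end LocalBounds

namespace LocalBounds

variable {P : LittlewoodPaley N} {T : ℝ} {μ₁ μ₂ : ℝ → Space N → ℝ}
  {G : ℝ → 𝓢'(Space N, CVec N)} {u₀ : 𝓢'(Space N, CVec N)} {u : ℝ → 𝓢'(Space N, CVec N)}
  {k : ℤ} {x : Space N} {A : ℝ} {D : ℤ → ℝ → ℝ≥0∞} {α : ℝ} {c c' : Fin N → 𝓢(Space N, ℂ)}

theorem ae_mono_Ioc {p : ℝ → Prop} {T t : ℝ} (ht : t ≤ T)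
    (h : ∀ᵐ s ∂(volume.restrict (Set.Ioc 0 T)), p s) :
    ∀ᵐ s ∂(volume.restrict (Set.Ioc 0 t)), p s :=
  ae_mono (Measure.restrict_mono (Set.Ioc_subset_Ioc_right ht) le_rfl) h

/-- The field tested with symbols `c` at parameter `σ`. -/
def tested (V : 𝓢'(Space N, CVec N)) (k : ℤ) (x : Space N) (c : Fin N → 𝓢(Space N, ℂ)) (σ : ℝ) : ℂ :=
  ∑ i, comp V i (tf k x (hs (c i) σ))

theorem integrable_of_enorm_le {f : ℝ → ℂ} {μ : Measure ℝ} (hf : AEStronglyMeasurable f μ)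
    {g : ℝ → ℝ≥0∞} {B : ℝ} (hg : ∫⁻ s, g s ∂μ ≠ ⊤)
    (h : ∀ᵐ s ∂μ, ‖f s‖ₑ ≤ ENNReal.ofReal B * g s) : Integrable f μ := by
  refine ⟨hf, ?_⟩
  refine lt_of_le_of_lt (lintegral_mono_ae h) ?_
  rw [lintegral_const_mul' _ _ ENNReal.ofReal_ne_top]
  exact (ENNReal.mul_ne_top ENNReal.ofReal_ne_top hg).lt_top

/-- The weak equation gives a series of time integrals; the summable majorant `D` allows the sum and
the integral to be exchanged. The exceptional set of times depends on σ, and `duhamel` removes this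
dependence by continuity in σ. -/
theorem tested_eq (h : LocalBounds P T μ₁ μ₂ G u₀ u k x A D) (hc : VectorSymbol P α c c') {σ : ℝ}
    (hσ : 0 ≤ σ) : ∀ᵐ t ∂(volume.restrict (Set.Ioc 0 T)), tested (u t) k x c σ =
      tested u₀ k x c σ + ∫ s in Set.Ioc 0 t, force P μ₁ μ₂ G u k x c s σ := by
  obtain ⟨B, hB0, hB⟩ := exists_kernelBound_vectorSymbol hc
  have hexp : B * Real.exp (-(σ / 16)) ≤ B :=
    mul_le_of_le_one_right hB0 (Real.exp_le_one_iff.2 (by linarith))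
  have heq := ae_all_iff.2 fun i =>
    h.equation (tf k x (hs (c i) σ)) (testSpace_tf ((hc.annular i).hs σ) k x) i
  filter_upwards [heq, ae_restrict_mem measurableSet_Ioc] with t ht htm
  have hsub : volume.restrict (Set.Ioc 0 t) ≤ volume.restrict (Set.Ioc 0 T) :=
    Measure.restrict_mono (Set.Ioc_subset_Ioc_right htm.2) le_rfl
  have hvpi : ∀ i : Fin N, ∀ᵐ s ∂(volume.restrict (Set.Ioc 0 t)), ∀ j,
      ‖vpi P (u s) (μ₁ s) (μ₂ s) j (tf k x (hs (c i) σ)) i‖ₑ ≤ ENNReal.ofReal B * D j s := by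
    intro i
    filter_upwards [ae_mono_Ioc htm.2 h.vpi_le] with s hs j
    exact hs _ _ B hB0 ((hc.hs σ).factors i)
      (fun e => ((hB σ (by linarith)).1 i e).mono hexp) j i
  have hDt : ∫⁻ s in Set.Ioc 0 t, ∑' j, D j s ≠ ⊤ :=
    ne_top_of_le_ne_top h.lintegral_D (lintegral_mono' hsub le_rfl)
  have hGt : ∫⁻ s in Set.Ioc 0 t, cv k (bv P (G s) k) x ≠ ⊤ :=
    ne_top_of_le_ne_top h.lintegral_G (lintegral_mono' hsub le_rfl)
  have hG : ∀ i : Fin N, Integrable (fun s => comp (G s) i (tf k x (hs (c i) σ)))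
      (volume.restrict (Set.Ioc 0 t)) := fun i =>
    integrable_of_enorm_le ((aestronglyMeasurable_comp h.meas_G i _).mono_measure hsub) hGt
      (Filter.Eventually.of_forall fun s => enorm_comp_tf_le _ i hB0 ((hc.hs σ).factors i)
        (((hB σ (by linarith)).2 i).mono hexp) k x)
  have hV : ∀ i : Fin N, Integrable
      (fun s => ∑' j, vpi P (u s) (μ₁ s) (μ₂ s) j (tf k x (hs (c i) σ)) i)
      (volume.restrict (Set.Ioc 0 t)) := fun i =>
    integrable_of_enorm_le
      ((h.aestronglyMeasurable_tsum_vpi ((hc.hs σ).factors i) i).mono_measure hsub) hDt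
      ((hvpi i).mono fun s hs => by
        rw [← ENNReal.tsum_mul_left]
        exact enorm_tsum_le_tsum_enorm.trans (ENNReal.tsum_le_tsum hs))
  have hsum : ∀ i : Fin N,
      ∫ s in Set.Ioc 0 t, ∑' j, vpi P (u s) (μ₁ s) (μ₂ s) j (tf k x (hs (c i) σ)) i =
      comp u₀ i (tf k x (hs (c i) σ)) - comp (u t) i (tf k x (hs (c i) σ)) +
        ∫ s in Set.Ioc 0 t, comp (G s) i (tf k x (hs (c i) σ)) := by
    intro i
    have h1 := (ht i).tsum_eq
    rw [← integral_tsum (fun j => (h.aestronglyMeasurable_vpi j _ i).mono_measure hsub)] at h1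
    · exact h1
    · refine ne_top_of_le_ne_top (ENNReal.mul_ne_top (a := ENNReal.ofReal B)
        ENNReal.ofReal_ne_top hDt) ?_
      rw [lintegral_tsum fun j => (h.meas_D j).mono_measure hsub, ← ENNReal.tsum_mul_left]
      refine ENNReal.tsum_le_tsum fun j => ?_
      rw [← lintegral_const_mul' _ _ ENNReal.ofReal_ne_top]
      exact lintegral_mono_ae ((hvpi i).mono fun s hs => hs j)
  unfold force tested
  have hGV : ∀ i ∈ Finset.univ, Integrable (fun s => comp (G s) i (tf k x (hs (c i) σ)) -
      ∑' j, vpi P (u s) (μ₁ s) (μ₂ s) j (tf k x (hs (c i) σ)) i)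
      (volume.restrict (Set.Ioc 0 t)) := fun i _ => (hG i).sub (hV i)
  rw [integral_finsetSum _ hGV, ← Finset.sum_add_distrib]
  refine Finset.sum_congr rfl fun i _ => ?_
  rw [integral_sub (hG i) (hV i), hsum i]
  ring

theorem continuous_tested (V : 𝓢'(Space N, CVec N)) (hc : ∀ i, Annular (c i)) :
    Continuous (tested V k x c) :=
  continuous_finsetSum _ fun i _ => Dist.continuous_hs ((comp V i).comp (tf k x)) (hc i)

theorem hasDerivAt_tested (V : 𝓢'(Space N, CVec N)) (hc : ∀ i, Annular (c i)) (σ : ℝ) :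
    HasDerivAt (tested V k x c) (tested V k x (fun i => lap (c i)) σ) σ :=
  HasDerivAt.fun_sum fun i _ => hasDerivAt_comp_tf (comp V i) (hc i) σ

theorem enorm_tested_le (V : 𝓢'(Space N, CVec N)) (hc : VectorSymbol P α c c') {B : ℝ} (hB : 0 ≤ B)
    {σ : ℝ} (h : ∀ i, KernelBound B (hs (c' i) σ)) :
    ‖tested V k x c σ‖ₑ ≤ ENNReal.ofReal (N * B) * cv k (bv P V k) x := by
  refine (enorm_sum_le _ _).trans ((Finset.sum_le_sum fun i _ =>
    enorm_comp_tf_le V i hB ((hc.hs σ).factors i) (h i) k x).trans (le_of_eq ?_))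
  rw [Finset.sum_const, Finset.card_univ, Fintype.card_fin, nsmul_eq_mul,
    ENNReal.ofReal_mul (by positivity), ENNReal.ofReal_natCast, mul_assoc]

/-- The pointwise bound of the frequency localized solution. -/
theorem ae_enorm_tested_le (h : LocalBounds P T μ₁ μ₂ G u₀ u k x A D) (hc : VectorSymbol P α c c')
    {B : ℝ} (hB0 : 0 ≤ B) (hB : ∀ σ, 0 ≤ σ →
      (∀ i e, KernelBound (B * Real.exp (-(σ / 16))) (mulc (unitVec e) (hs (c i) σ))) ∧
      ∀ i, KernelBound (B * Real.exp (-(σ / 16))) (hs (c' i) σ))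
    {ν₀ : ℝ → ℝ} (hν : AEMeasurable ν₀ (volume.restrict (Set.Ioc 0 T))) {c₁ A' : ℝ} (hc₁ : 0 < c₁)
    (hνb : ∀ᵐ s ∂(volume.restrict (Set.Ioc 0 T)), c₁ ≤ ν₀ s ∧ ν₀ s ≤ A') {E : ℝ → ℝ≥0∞}
    (hE : ∀ᵐ s ∂(volume.restrict (Set.Ioc 0 T)), ∀ (d d' : Fin N → 𝓢(Space N, ℂ)) (B : ℝ), 0 ≤ B →
      VectorSymbol P α d d' → (∀ i e, KernelBound B (mulc (unitVec e) (d i))) →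
      ‖∑' j, vp P (u s) (μ₁ s) (μ₂ s) j (fun i => tf k x (d i)) +
        (2 : ℂ) ^ (2 * k) * ν₀ s * ∑ i, comp (u s) i (tf k x (lap (d i)))‖ₑ ≤
        ENNReal.ofReal B * E s) :
    ∀ᵐ t ∂(volume.restrict (Set.Ioc 0 T)), ‖∑ i, comp (u t) i (tf k x (c i))‖ₑ ≤
      ENNReal.ofReal ((N + 1) * B) *
        (ENNReal.ofReal (Real.exp (-(c₁ / 16 * 2 ^ (2 * k) * t))) * cv k (bv P u₀ k) x +
          ∫⁻ s in Set.Ioc 0 t, ENNReal.ofReal (Real.exp (-(c₁ / 16 * 2 ^ (2 * k) * (t - s)))) *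
            (cv k (bv P (G s) k) x + E s)) := by
  set μT := volume.restrict (Set.Ioc 0 T) with hμT
  have hk : (0 : ℝ) < 2 ^ (2 * k) := by positivity
  -- A measurable version of ν₀, clamped between its almost sure bounds, so that ν is measurable and
  -- bounded above and below at every time, as the Duhamel formula requires.
  set ν : ℝ → ℝ := fun s => 2 ^ (2 * k) * max c₁ (min (hν.mk ν₀ s) A') with hνdef
  have hνm : Measurable ν :=
    (measurable_const.max (hν.measurable_mk.min measurable_const)).const_mul _
  have hν1 : ∀ s, 2 ^ (2 * k) * c₁ ≤ ν s := fun s =>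
    mul_le_mul_of_nonneg_left (le_max_left _ _) hk.le
  have hν2 : ∀ s, ν s ≤ 2 ^ (2 * k) * max c₁ A' := fun s =>
    mul_le_mul_of_nonneg_left (max_le_max le_rfl (min_le_right _ _)) hk.le
  have hν0 : ∀ s, 0 ≤ ν s := fun s => le_trans (by positivity) (hν1 s)
  have hνe : ∀ᵐ s ∂μT, ν s = 2 ^ (2 * k) * ν₀ s := by
    filter_upwards [hν.ae_eq_mk, hνb] with s hs1 hs2
    simp only [hνdef]
    rw [← hs1, min_eq_left hs2.2, max_eq_right hs2.1]
  obtain ⟨B₁, hB₁0, hB₁⟩ := h.exists_enorm_force_le hc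
  obtain ⟨B₂, hB₂0, hB₂⟩ := h.exists_enorm_force_le hc.lap
  have hdomm : AEMeasurable (dom P G k x D) μT :=
    (cv_aemeasurable k (bv_joint h.meas_G k) x).add (AEMeasurable.tsum h.meas_D)
  have hdom : ∫⁻ s, dom P G k x D s ∂μT ≠ ⊤ := by
    unfold dom
    rw [lintegral_add_left' (cv_aemeasurable k (bv_joint h.meas_G k) x)]
    exact ENNReal.add_ne_top.2 ⟨h.lintegral_G, h.lintegral_D⟩
  have hdomt : ∀ᵐ s ∂μT, dom P G k x D s ≠ ⊤ :=
    (MeasureTheory.ae_lt_top' hdomm hdom).mono fun s hs => hs.ne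
  have hbnd : ∀ {B' : ℝ} {z : ℂ} {s : ℝ}, 0 ≤ B' → B' ≤ B₁ + B₂ → dom P G k x D s ≠ ⊤ →
      ‖z‖ₑ ≤ ENNReal.ofReal B' * dom P G k x D s → ‖z‖ ≤ (B₁ + B₂) * (dom P G k x D s).toReal := by
    intro B' z s hB' hle hs hz
    have h1 := ENNReal.toReal_mono (ENNReal.mul_ne_top ENNReal.ofReal_ne_top hs) hz
    rw [toReal_enorm, ENNReal.toReal_mul, ENNReal.toReal_ofReal hB'] at h1
    exact h1.trans (by gcongr)
  have key := duhamel (T := T) (A := force P μ₁ μ₂ G u k x c)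
    (A' := force P μ₁ μ₂ G u k x fun i => lap (c i))
    (bnd := fun s => (B₁ + B₂) * (dom P G k x D s).toReal)
    (b := tested u₀ k x c) (b' := tested u₀ k x fun i => lap (c i))
    (w := fun t => tested (u t) k x c) (w' := fun t => tested (u t) k x fun i => lap (c i))
    (h.hasDerivAt_force hc)
    ((h.hasDerivAt_force hc.lap).mono fun s hs σ hσ => (hs σ hσ).continuousAt.continuousWithinAt)
    (fun σ _ => h.aestronglyMeasurable_force hc σ)
    (fun σ _ => h.aestronglyMeasurable_force hc.lap σ)
    ((integrable_toReal_of_lintegral_ne_top hdomm hdom).const_mul _)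
    (by
      filter_upwards [hB₁, hdomt] with s hs hst σ hσ
      exact hbnd hB₁0 (by linarith) hst (hs σ hσ))
    (by
      filter_upwards [hB₂, hdomt] with s hs hst σ hσ
      exact hbnd hB₂0 (by linarith) hst (hs σ hσ))
    (fun σ _ => hasDerivAt_tested u₀ hc.annular σ)
    (continuous_tested u₀ fun i => (hc.annular i).lap).continuousOn
    (h.tested_eq hc le_rfl) (fun σ hσ => h.tested_eq hc.lap hσ)
    (Filter.Eventually.of_forall fun t =>
      (continuous_tested (u t) fun i => (hc.annular i).lap).continuousOn)
    hνm hν0 hν2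
  have hint : ∀ s t, s ≤ t → 2 ^ (2 * k) * c₁ * (t - s) ≤ ∫ y in s..t, ν y := by
    intro s t hst
    have hi : IntervalIntegrable ν volume s t := by
      rw [intervalIntegrable_iff]
      refine Measure.integrableOn_of_bounded (M := 2 ^ (2 * k) * max c₁ A') (by simp)
        hνm.aestronglyMeasurable (Filter.Eventually.of_forall fun y => ?_)
      rw [Real.norm_of_nonneg (hν0 y)]
      exact hν2 y
    have h1 := intervalIntegral.integral_mono_on hst (intervalIntegrable_const) hi
      (fun y _ => hν1 y)
    rw [intervalIntegral.integral_const, smul_eq_mul] at h1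
    linarith
  have hexp : ∀ s t, s ≤ t → Real.exp (-((∫ y in s..t, ν y) / 16)) ≤
      Real.exp (-(c₁ / 16 * 2 ^ (2 * k) * (t - s))) := by
    intro s t hst
    rw [Real.exp_le_exp]
    have := hint s t hst
    linarith
  filter_upwards [key, ae_restrict_mem measurableSet_Ioc] with t ht htm
  have h0 : tested (u t) k x c 0 = ∑ i, comp (u t) i (tf k x (c i)) := by
    unfold tested
    simp_rw [hs_zero (hc.annular _)]
  rw [← h0, ht, mul_add]
  refine (enorm_add_le _ _).trans (add_le_add ?_ ?_)
  · have hσ : 0 ≤ ∫ y in (0 : ℝ)..t, ν y := by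
      have := hint 0 t htm.1.le
      have h2 : 0 ≤ 2 ^ (2 * k) * c₁ * (t - 0) := by rw [sub_zero]; have := htm.1; positivity
      linarith
    refine (enorm_tested_le u₀ hc (by positivity) ((hB _ hσ).2)).trans ?_
    rw [← mul_assoc (ENNReal.ofReal ((N + 1) * B)), ← ENNReal.ofReal_mul (by positivity)]
    refine mul_le_mul' (ENNReal.ofReal_le_ofReal ?_) le_rfl
    have h3 := hexp 0 t htm.1.le
    rw [sub_zero] at h3
    rw [mul_assoc]
    exact mul_le_mul (by linarith) (mul_le_mul_of_nonneg_left h3 hB0) (by positivity)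
      (by positivity)
  · refine (enorm_integral_le_lintegral_enorm _).trans ?_
    rw [← lintegral_const_mul' _ _ ENNReal.ofReal_ne_top]
    refine lintegral_mono_ae ?_
    filter_upwards [ae_mono_Ioc htm.2 hE, ae_mono_Ioc htm.2 hνe, ae_mono_Ioc htm.2 h.summable_vpi,
      ae_restrict_mem measurableSet_Ioc] with s hs1 hs2 hs3 hsm
    set σ := ∫ y in s..t, ν y with hσdef
    have hσ : 0 ≤ σ := by
      have := hint s t hsm.2
      have h2 : 0 ≤ 2 ^ (2 * k) * c₁ * (t - s) := by
        have : 0 ≤ t - s := by linarith [hsm.2]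
        positivity
      linarith
    have hb : B * Real.exp (-(σ / 16)) ≤ B * Real.exp (-(c₁ / 16 * 2 ^ (2 * k) * (t - s))) := by
      have := hexp s t hsm.2
      gcongr
    have h1 := hs1 (fun i => hs (c i) σ) (fun i => hs (c' i) σ) _ (by positivity) (hc.hs σ)
      ((hB σ hσ).1)
    -- The central cancellation: along the characteristic, the Laplacian produced by the evolution
    -- of the test function combines with the viscous terms into the difference between variable and
    -- frozen coefficients, that is, into the commutator bounded by `E`.
    have h2 : force P μ₁ μ₂ G u k x c s σ -
        (ν s : ℂ) * tested (u s) k x (fun i => lap (c i)) σ = tested (G s) k x c σ -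
        (∑' j, vp P (u s) (μ₁ s) (μ₂ s) j (fun i => tf k x (hs (c i) σ)) +
        (2 : ℂ) ^ (2 * k) * ν₀ s * ∑ i, comp (u s) i (tf k x (lap (hs (c i) σ)))) := by
      unfold force tested vp
      rw [Summable.tsum_finsetSum fun i _ => hs3 _ _ i ((hc.hs σ).factors i),
        Finset.sum_sub_distrib, hs2]
      simp_rw [lap_hs (hc.annular _)]
      push_cast
      ring
    rw [h2]
    refine enorm_sub_le.trans ?_
    rw [← mul_assoc (ENNReal.ofReal ((N + 1) * B)), ← ENNReal.ofReal_mul (by positivity), mul_add]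
    refine add_le_add ((enorm_tested_le (G s) hc (by positivity) ((hB _ hσ).2)).trans ?_)
      (h1.trans ?_)
    · refine mul_le_mul' (ENNReal.ofReal_le_ofReal ?_) le_rfl
      rw [mul_assoc]
      refine mul_le_mul (by linarith) hb (by positivity) (by positivity)
    · refine mul_le_mul' (ENNReal.ofReal_le_ofReal ?_) le_rfl
      rw [mul_assoc]
      refine hb.trans (le_mul_of_one_le_left (by positivity) ?_)
      have : (0 : ℝ) ≤ N := by positivity
      linarith

end LocalBounds

/-! ### Pointwise bound of the blocks of the solution -/

/-- The heat kernel factor `e^{-a(t-s)}` for `s ≤ t`, extended by zero. -/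
def heatFactor (a t s : ℝ) : ℝ≥0∞ :=
  if s ≤ t then ENNReal.ofReal (Real.exp (-(a * (t - s)))) else 0

theorem heatFactor_measurable (a : ℝ) : Measurable fun z : ℝ × ℝ => heatFactor a z.1 z.2 := by
  unfold heatFactor
  refine Measurable.ite (measurableSet_le measurable_snd measurable_fst) ?_ measurable_const
  fun_prop

theorem lintegral_Ioc_eq_heatFactor {a t T : ℝ} (ht : t ≤ T) (f : ℝ → ℝ≥0∞) :
    ∫⁻ s in Set.Ioc 0 t, ENNReal.ofReal (Real.exp (-(a * (t - s)))) * f s =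
      ∫⁻ s in Set.Ioc 0 T, heatFactor a t s * f s := by
  have h1 : Set.Ioc 0 t = Set.Iic t ∩ Set.Ioc 0 T := by
    ext s
    simp only [Set.mem_Ioc, Set.mem_inter_iff, Set.mem_Iic]
    constructor
    · rintro ⟨h1, h2⟩
      exact ⟨h2, h1, h2.trans ht⟩
    · rintro ⟨h1, h2, h3⟩
      exact ⟨h2, h1⟩
  rw [h1, ← Measure.restrict_restrict measurableSet_Iic, ← lintegral_indicator measurableSet_Iic]
  refine lintegral_congr fun s => ?_
  by_cases hs : s ≤ t
  · rw [Set.indicator_of_mem (Set.mem_Iic.2 hs), heatFactor, if_pos hs]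
  · rw [Set.indicator_of_notMem (by simpa using hs), heatFactor, if_neg hs, zero_mul]

theorem bv_le_sum_comp (P : LittlewoodPaley N) (V : 𝓢'(Space N, CVec N)) (k : ℤ) (x : Space N) :
    bv P V k x ≤ ∑ e, ‖comp V e (P.kernel k x)‖ₑ := by
  have h1 : ‖P.block k V x‖ ≤ ∑ e, ‖P.block k V x e‖ := by
    have h2 : P.block k V x = ∑ e, EuclideanSpace.single e (P.block k V x e) := by
      ext b
      rw [WithLp.ofLp_sum, Finset.sum_apply]
      simp [Finset.sum_ite_eq]
    calc ‖P.block k V x‖ = ‖∑ e, EuclideanSpace.single e (P.block k V x e)‖ := by rw [← h2]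
      _ ≤ ∑ e, ‖EuclideanSpace.single e (P.block k V x e)‖ := norm_sum_le _ _
      _ = _ := by simp
  unfold bv
  rw [← ofReal_norm]
  refine (ENNReal.ofReal_le_ofReal h1).trans ?_
  rw [ENNReal.ofReal_sum_of_nonneg fun _ _ => norm_nonneg _]
  refine Finset.sum_le_sum fun e _ => ?_
  rw [ofReal_norm]
  rfl

/-- The pointwise bound of the dyadic blocks of the solution. -/
theorem exists_bv_le (P : LittlewoodPaley N) : ∃ C : ℝ, 0 ≤ C ∧
    ∀ {T : ℝ} {μ₁ μ₂ : ℝ → Space N → ℝ} {G : ℝ → 𝓢'(Space N, CVec N)}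
      {u₀ : 𝓢'(Space N, CVec N)} {u : ℝ → 𝓢'(Space N, CVec N)} {k : ℤ} {x : Space N} {A : ℝ}
      {D : ℤ → ℝ → ℝ≥0∞}, LocalBounds P T μ₁ μ₂ G u₀ u k x A D →
    AEMeasurable (fun s => μ₁ s x) (volume.restrict (Set.Ioc 0 T)) →
    AEMeasurable (fun s => μ₂ s x) (volume.restrict (Set.Ioc 0 T)) →
    ∀ {c₁ A' : ℝ}, 0 < c₁ →
    (∀ᵐ s ∂(volume.restrict (Set.Ioc 0 T)), c₁ ≤ μ₁ s x ∧ c₁ ≤ μ₁ s x + μ₂ s x ∧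
      μ₁ s x ≤ A' ∧ μ₁ s x + μ₂ s x ≤ A') →
    ∀ {E : ℝ → ℝ≥0∞}, (∀ᵐ s ∂(volume.restrict (Set.Ioc 0 T)), ∀ (α : ℝ)
      (d d' : Fin N → 𝓢(Space N, ℂ)) (B : ℝ), 0 ≤ B →
      VectorSymbol P α d d' → (∀ i e, KernelBound B (mulc (unitVec e) (d i))) →
      ‖∑' j, vp P (u s) (μ₁ s) (μ₂ s) j (fun i => tf k x (d i)) +
        (2 : ℂ) ^ (2 * k) * (μ₁ s x + μ₂ s x * α) * ∑ i, comp (u s) i (tf k x (lap (d i)))‖ₑ ≤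
        ENNReal.ofReal B * E s) →
    ∀ᵐ t ∂(volume.restrict (Set.Ioc 0 T)), bv P (u t) k x ≤ ENNReal.ofReal C *
        (ENNReal.ofReal (Real.exp (-(c₁ / 16 * 2 ^ (2 * k) * t))) * cv k (bv P u₀ k) x +
          ∫⁻ s in Set.Ioc 0 T, heatFactor (c₁ / 16 * 2 ^ (2 * k)) t s *
            (cv k (bv P (G s) k) x + E s)) := by
  -- For each direction e the component of Δ_k u along e is the sum of its tests with the gradient
  -- and the solenoidal symbols. These evolve with the diffusivities μ₁ + μ₂ and μ₁, both at least
  -- c₁, hence with the same decay.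
  choose d₁ d₁' d₀ d₀' hd₁ hd₀ hd using exists_vectorSymbol P
  choose B₁ hB₁0 hB₁ using fun e => exists_kernelBound_vectorSymbol (hd₁ e)
  choose B₀ hB₀0 hB₀ using fun e => exists_kernelBound_vectorSymbol (hd₀ e)
  have hS1 : 0 ≤ ∑ e, B₁ e := Finset.sum_nonneg fun e _ => hB₁0 e
  have hS0 : 0 ≤ ∑ e, B₀ e := Finset.sum_nonneg fun e _ => hB₀0 e
  refine ⟨∑ e, ((N + 1) * B₁ e + (N + 1) * B₀ e), Finset.sum_nonneg fun e _ =>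
    add_nonneg (mul_nonneg (by positivity) (hB₁0 e)) (mul_nonneg (by positivity) (hB₀0 e)), ?_⟩
  intro T μ₁ μ₂ G u₀ u k x A D h hm₁ hm₂ c₁ A' hc₁ hb E hE
  have key₁ := fun e => h.ae_enorm_tested_le (hd₁ e) (hB₁0 e)
    (fun σ hσ => hB₁ e σ (by linarith)) (ν₀ := fun s => μ₁ s x + μ₂ s x) (hm₁.add hm₂) hc₁
    (A' := A') (hb.mono fun s hs => ⟨hs.2.1, hs.2.2.2⟩) (E := E) (by
      filter_upwards [hE] with s hs d d' B hB hdd hdB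
      have h1 := hs 1 d d' B hB hdd hdB
      push_cast
      rwa [Complex.ofReal_one, mul_one] at h1)
  have key₀ := fun e => h.ae_enorm_tested_le (hd₀ e) (hB₀0 e)
    (fun σ hσ => hB₀ e σ (by linarith)) (ν₀ := fun s => μ₁ s x) hm₁ hc₁
    (A' := A') (hb.mono fun s hs => ⟨hs.1, hs.2.2.1⟩) (E := E) (by
      filter_upwards [hE] with s hs d d' B hB hdd hdB
      have h1 := hs 0 d d' B hB hdd hdB
      rwa [Complex.ofReal_zero, mul_zero, add_zero] at h1)
  filter_upwards [ae_all_iff.2 key₁, ae_all_iff.2 key₀, ae_restrict_mem measurableSet_Ioc] with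
    t h1 h0 ht
  rw [← lintegral_Ioc_eq_heatFactor ht.2]
  refine (bv_le_sum_comp P (u t) k x).trans ?_
  rw [ENNReal.ofReal_sum_of_nonneg fun e _ => add_nonneg
    (mul_nonneg (by positivity) (hB₁0 e)) (mul_nonneg (by positivity) (hB₀0 e)), Finset.sum_mul]
  refine Finset.sum_le_sum fun e _ => ?_
  rw [ENNReal.ofReal_add (mul_nonneg (by positivity) (hB₁0 e)) (mul_nonneg (by positivity) (hB₀0 e)),
    add_mul]
  refine le_trans (le_of_eq ?_) ((enorm_add_le _ _).trans (add_le_add (h1 e) (h0 e)))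
  congr 1
  rw [← Finset.sum_add_distrib]
  have h2 : ∀ i, comp (u t) i (tf k x (d₁ e i)) + comp (u t) i (tf k x (d₀ e i)) =
      if i = e then comp (u t) i (tf k x (P.symbolS 0)) else 0 := by
    intro i
    rw [← map_add, ← map_add, hd]
    split_ifs <;> simp
  simp_rw [h2]
  rw [Finset.sum_ite_eq' Finset.univ e, if_pos (Finset.mem_univ e), P.kernel_eq, tf_apply]

/-! ### L^p bounds of the oscillation and of the commutator -/

section Remainder

variable {P : LittlewoodPaley N} {M : ℕ} {U : Dist N} {V : 𝓢'(Space N, CVec N)} {p : ℝ}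
  {X : ℤ → ℝ≥0∞}

theorem tw_neg_mul_tw (a : ℝ) : tw (-a) * tw a = 1 := by
  rw [← tw_add, neg_add_cancel, tw_zero]

theorem le_tw_neg_mul {a : ℝ} {y z : ℝ≥0∞} (h : tw a * y ≤ z) : y ≤ tw (-a) * z := by
  calc y = tw (-a) * (tw a * y) := by rw [← mul_assoc, tw_neg_mul_tw, one_mul]
    _ ≤ _ := mul_le_mul_right h _

theorem tsum_low_le (f : ℤ → ℝ≥0∞) (n : ℤ) : ∑' j : ℕ, f (n - 1 - j) ≤ ∑' l, f l :=
  ENNReal.tsum_comp_le_tsum_of_injective (f := fun j : ℕ => n - 1 - (j : ℤ))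
    (fun a b h => by simp only at h; omega) f

theorem tsum_high_le (f : ℤ → ℝ≥0∞) (n : ℤ) : ∑' j : ℕ, f (n + j) ≤ ∑' l, f l :=
  ENNReal.tsum_comp_le_tsum_of_injective (f := fun j : ℕ => n + (j : ℤ))
    (fun a b h => by simp only at h; omega) f

theorem ysum_anti {k n : ℤ} (h : k ≤ n) (X : ℤ → ℝ≥0∞) : ysum n X ≤ ysum k X := by
  have h' : (k : ℝ) ≤ n := by exact_mod_cast h
  refine ENNReal.tsum_le_tsum fun l => mul_le_mul' (tw_mono ?_) le_rfl
  exact min_le_min le_rfl (by linarith)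

/-- A low block of index n-1-j has L^p norm at most 2^{-nN/p} 2^{(j+1)N/p} X_{n-1-j}. The
differences give 2^{-(j+1)M}, and M ≥ N/p + 1 leaves the factor 2^{-(j+1)}, which is the weight of
this block in `ysum`. -/
theorem lp_lo_le (hp : 1 ≤ p) (hM : N / p + 1 ≤ M)
    (hX : ∀ l : ℤ, tw (l * (N / p)) * lp p volume (bk P U l) ≤ X l) (n : ℤ) :
    lp p volume (lo P M U n) ≤ CPhi N * (tw (-(n * (N / p))) * ysum n X) := by
  unfold lo
  refine (lp_tsum_le hp fun j =>
    ((cv_measurable _ (bk_measurable P U _).aemeasurable).const_mul _).aemeasurable).trans ?_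
  calc _ ≤ ∑' j : ℕ, CPhi N * (tw (-(n * (N / p))) *
        (tw (min 0 (((n - 1 - j : ℤ) : ℝ) - n)) * X (n - 1 - j))) := by
        refine ENNReal.tsum_le_tsum fun j => ?_
        rw [lp_const_mul (by linarith) (cv_measurable _ (bk_measurable P U _).aemeasurable).aemeasurable]
        calc _ ≤ tw (-((j + 1) * M)) * (CPhi N * (tw (-(((n - 1 - j : ℤ) : ℝ) * (N / p))) *
              X (n - 1 - j))) := by
              refine mul_le_mul_right ((lp_cv_le hp _ (bk_measurable P U _).aemeasurable).trans ?_) _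
              exact mul_le_mul_right (le_tw_neg_mul (hX _)) _
          _ = CPhi N * (tw (-((j + 1) * M) + -(((n - 1 - j : ℤ) : ℝ) * (N / p))) *
              X (n - 1 - j)) := by rw [tw_add]; ring
          _ ≤ CPhi N * (tw (-(n * (N / p)) + min 0 (((n - 1 - j : ℤ) : ℝ) - n)) *
              X (n - 1 - j)) := by
              refine mul_le_mul_right (mul_le_mul' (tw_mono ?_) le_rfl) _
              push_cast
              have hj : (0 : ℝ) ≤ j := by positivity
              rw [min_eq_right (by linarith)]
              have := mul_le_mul_of_nonneg_left hM (by linarith : (0 : ℝ) ≤ j + 1)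
              linarith
          _ = _ := by rw [tw_add]; ring
    _ = CPhi N * (tw (-(n * (N / p))) * ∑' j : ℕ,
        (tw (min 0 (((n - 1 - j : ℤ) : ℝ) - n)) * X (n - 1 - j))) := by
        rw [ENNReal.tsum_mul_left, ENNReal.tsum_mul_left]
    _ ≤ _ := by
        refine mul_le_mul_right (mul_le_mul_right ?_ _) _
        exact tsum_low_le (fun l => tw (min 0 ((l : ℝ) - n)) * X l) n

theorem lp_hi_le (hp : 1 ≤ p)
    (hX : ∀ l : ℤ, tw (l * (N / p)) * lp p volume (bk P U l) ≤ X l) (n : ℤ) :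
    lp p volume (hi P U n) ≤ tw (-(n * (N / p))) * ysum n X := by
  unfold hi
  refine (lp_tsum_le hp fun j => (bk_measurable P U _).aemeasurable).trans ?_
  calc _ ≤ ∑' j : ℕ, tw (-(n * (N / p))) * (tw (min 0 (((n + j : ℤ) : ℝ) - n)) * X (n + j)) := by
        refine ENNReal.tsum_le_tsum fun j => (le_tw_neg_mul (hX _)).trans ?_
        rw [← mul_assoc, ← tw_add]
        refine mul_le_mul' (tw_mono ?_) le_rfl
        push_cast
        have hj : (0 : ℝ) ≤ j := by positivity
        rw [min_eq_left (by linarith)]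
        have : 0 ≤ j * ((N : ℝ) / p) := by positivity
        linarith
    _ = tw (-(n * (N / p))) * ∑' j : ℕ, (tw (min 0 (((n + j : ℤ) : ℝ) - n)) * X (n + j)) := by
        rw [ENNReal.tsum_mul_left]
    _ ≤ _ := mul_le_mul_right (tsum_high_le (fun l => tw (min 0 ((l : ℝ) - n)) * X l) n) _

theorem lp_osc_le (hp : 1 ≤ p) (hM : N / p + 1 ≤ M)
    (hX : ∀ l : ℤ, tw (l * (N / p)) * lp p volume (bk P U l) ≤ X l) (n : ℤ) :
    lp p volume (osc P M U n) ≤ (1 + 2 * CPhi N) * (tw (-(n * (N / p))) * ysum n X) := by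
  unfold osc
  have h1 : Measurable (cv n (hi P U n)) := cv_measurable n (hi_measurable n).aemeasurable
  refine (lp_add_le hp (lo_measurable n).aemeasurable
    ((hi_measurable n).add h1).aemeasurable).trans ?_
  have h2 := lp_add_le hp (hi_measurable (P := P) (U := U) n).aemeasurable h1.aemeasurable
    (μ := volume)
  have h3 := lp_cv_le hp n (hi_measurable (P := P) (U := U) n).aemeasurable
  calc _ ≤ CPhi N * (tw (-(n * (N / p))) * ysum n X) + (tw (-(n * (N / p))) * ysum n X +
        CPhi N * (tw (-(n * (N / p))) * ysum n X)) :=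
        add_le_add (lp_lo_le hp hM hX n) (h2.trans (add_le_add (lp_hi_le hp hX n)
          (h3.trans (mul_le_mul_right (lp_hi_le hp hX n) _))))
    _ = _ := by ring

/-- The part of the commutator at frequency `2^k` that comes from the `j`-th block. -/
def remTerm (P : LittlewoodPaley N) (M : ℕ) (U : Dist N) (V : 𝓢'(Space N, CVec N))
    (X : ℤ → ℝ≥0∞) (k j : ℤ) (x : Space N) : ℝ≥0∞ :=
  tw k * if 3 ≤ |j - k| then cv k (fun y => osc P M U (max j k) y * gv P V j y) x
    else ysum k X * cv k (gv P V j) x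

/-- A bound for the commutator at frequency `2^k`. -/
def rem (P : LittlewoodPaley N) (M : ℕ) (U : Dist N) (V : 𝓢'(Space N, CVec N))
    (X : ℤ → ℝ≥0∞) (k : ℤ) (x : Space N) : ℝ≥0∞ := ∑' j, remTerm P M U V X k j x

theorem remTerm_measurable (k j : ℤ) : Measurable (remTerm P M U V X k j) := by
  unfold remTerm
  split_ifs
  · exact (cv_measurable k ((osc_measurable P M U _).mul
      (gv_measurable P V j)).aemeasurable).const_mul _
  · exact ((cv_measurable k (gv_measurable P V j).aemeasurable).const_mul _).const_mul _

theorem lp_gv_le (hp : 1 ≤ p) (V : 𝓢'(Space N, CVec N)) (j : ℤ) :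
    lp p volume (gv P V j) ≤ CPhi N * (tw j * lp p volume (bv P V j)) := by
  unfold gv
  rw [lp_const_mul (by linarith) (cv_measurable j (bv_measurable P V j).aemeasurable).aemeasurable]
  refine (mul_le_mul_right (lp_cv_le hp j (bv_measurable P V j).aemeasurable) _).trans
    (le_of_eq (by ring))

theorem gv_le (hp : 1 ≤ p) (V : 𝓢'(Space N, CVec N)) (j : ℤ) (y : Space N) :
    gv P V j y ≤ (1 + CPhi N) * (tw (j + j * (N / p)) * lp p volume (bv P V j)) := by
  unfold gv
  refine (mul_le_mul_right (cv_le hp j (bv_measurable P V j).aemeasurable y) _).trans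
    (le_of_eq ?_)
  rw [tw_add]
  ring

/-- Three regimes. For j ≥ k + 3 the oscillation at scale 2^{-j} and the gradient are both taken in
L^p, and the average at scale 2^{-k} costs only 2^{kN/p} (Bernstein from L^{p/2} to L^p, hence p ≥
2); the exponents match exactly. For j ≤ k - 3 the gradient is taken in L^∞ at the price 2^{jN/p},
and the comparison of exponents reduces to k - j ≤ (N/p)(k - j), that is, to p ≤ N. For |j-k| ≤ 2
the exponents differ by a bounded amount, paid by the factor 2^{2N/p}. -/
theorem lp_remTerm_le (hp : 2 ≤ p) (hpN : p ≤ N) (hM : N / p + 1 ≤ M)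
    (hX : ∀ l : ℤ, tw (l * (N / p)) * lp p volume (bk P U l) ≤ X l) (k j : ℤ) :
    lp p volume (remTerm P M U V X k j) ≤ (1 + tw (2 * (N / p))) * (2 * (1 + CPhi N) ^ 4) *
      (tw (k * (N / p)) * (ysum k X * (tw (-|(j - k : ℝ)|) *
        (tw (j * (-(N / p) + 2)) * lp p volume (bv P V j))))) := by
  have hp1 : 1 ≤ p := by linarith
  have hp0 : 0 < p := by linarith
  have hNp : 1 ≤ N / p := (one_le_div hp0).2 hpN
  set Y := ysum k X
  set b := lp p volume (bv P V j)
  have hC : CPhi N ≤ 1 + CPhi N := le_add_self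
  have hC1 : 1 ≤ 1 + CPhi N := le_self_add
  have hC2 : 1 + 2 * CPhi N ≤ 2 * (1 + CPhi N) := by
    rw [mul_add, mul_one]; gcongr; norm_num
  have hT : (1 : ℝ≥0∞) ≤ 1 + tw (2 * (N / p)) := le_self_add
  have fin : ∀ {e : ℝ} {L Q : ℝ≥0∞}, L ≤ Q * (tw e * (Y * b)) → Q ≤ 2 * (1 + CPhi N) ^ 4 →
      e ≤ 2 * (N / p) + (k * (N / p) + (-|(j - k : ℝ)| + j * (-(N / p) + 2))) →
      (3 ≤ |j - k| → e ≤ k * (N / p) + (-|(j - k : ℝ)| + j * (-(N / p) + 2))) →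
      L ≤ (1 + tw (2 * (N / p))) * (2 * (1 + CPhi N) ^ 4) *
      (tw (k * (N / p)) * (Y * (tw (-|(j - k : ℝ)|) * (tw (j * (-(N / p) + 2)) * b)))) := by
    intro e L Q h1 h2 h3 h4
    refine h1.trans ?_
    have h5 : tw e ≤ (1 + tw (2 * (N / p))) *
        tw (k * (N / p) + (-|(j - k : ℝ)| + j * (-(N / p) + 2))) := by
      refine (tw_mono h3).trans ?_
      rw [tw_add]
      exact mul_le_mul' le_add_self le_rfl
    calc _ ≤ (2 * (1 + CPhi N) ^ 4) * (((1 + tw (2 * (N / p))) *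
        tw (k * (N / p) + (-|(j - k : ℝ)| + j * (-(N / p) + 2)))) * (Y * b)) :=
          mul_le_mul' h2 (mul_le_mul' h5 le_rfl)
      _ = _ := by rw [tw_add, tw_add]; ring
  have hgm := gv_measurable P V j
  by_cases hfar : 3 ≤ |j - k|
  · have hom := osc_measurable P M U (max j k)
    have hcm : Measurable (cv k fun y => osc P M U (max j k) y * gv P V j y) :=
      cv_measurable k (hom.mul hgm).aemeasurable
    unfold remTerm
    simp only [if_pos hfar]
    rw [lp_const_mul hp0 hcm.aemeasurable]
    rcases le_total k j with hkj | hkj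
    · rw [max_eq_left hkj]
      have hkj' : (k : ℝ) ≤ j := by exact_mod_cast hkj
      have h1 := lp_cv_mul_le hp k (osc_measurable P M U j).aemeasurable hgm.aemeasurable
      have h2 := (lp_osc_le hp1 hM hX j).trans (mul_le_mul_right (mul_le_mul_right
        (ysum_anti hkj X) _) _)
      have h3 := lp_gv_le (P := P) hp1 V j
      refine fin (e := k + (k * (N / p) + (-(j * (N / p)) + j)))
        (Q := (1 + CPhi N) ^ 2 * ((1 + 2 * CPhi N) * CPhi N)) ?_ ?_ ?_ ?_
      · refine (mul_le_mul_right (h1.trans (mul_le_mul_right (mul_le_mul_right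
          (mul_le_mul' h2 h3) _) _)) _).trans (le_of_eq ?_)
        rw [tw_add, tw_add, tw_add]
        ring
      · calc _ ≤ (1 + CPhi N) ^ 2 * ((2 * (1 + CPhi N)) * (1 + CPhi N)) := by gcongr
          _ = _ := by ring
      all_goals
        rw [abs_of_nonneg (by linarith : (0 : ℝ) ≤ j - k)]
        intros
        nlinarith
    · rw [max_eq_right hkj]
      have hkj' : (j : ℝ) ≤ k := by exact_mod_cast hkj
      have hok := osc_measurable P M U k
      have h1 : lp p volume (cv k fun y => osc P M U k y * gv P V j y) ≤
          CPhi N * (((1 + 2 * CPhi N) * (tw (-(k * (N / p))) * Y)) *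
            ((1 + CPhi N) * (tw (j + j * (N / p)) * b))) := by
        refine (lp_cv_le hp1 k (hok.mul hgm).aemeasurable).trans (mul_le_mul_right ?_ _)
        calc _ ≤ lp p volume (fun y => ((1 + CPhi N) * (tw (j + j * (N / p)) * b)) *
              osc P M U k y) := lp_mono hp0.le fun y => by
                rw [mul_comm]
                exact mul_le_mul' (gv_le hp1 V j y) le_rfl
          _ = ((1 + CPhi N) * (tw (j + j * (N / p)) * b)) * lp p volume (osc P M U k) :=
              lp_const_mul hp0 hok.aemeasurable _
          _ ≤ _ := by
              rw [mul_comm]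
              exact mul_le_mul' (lp_osc_le hp1 hM hX k) le_rfl
      refine fin (e := k + (-(k * (N / p)) + (j + j * (N / p))))
        (Q := CPhi N * ((1 + 2 * CPhi N) * (1 + CPhi N))) ?_ ?_ ?_ ?_
      · refine (mul_le_mul_right h1 _).trans (le_of_eq ?_)
        rw [tw_add (k : ℝ), tw_add (-(k * (N / p)))]
        ring
      · calc _ ≤ (1 + CPhi N) * ((2 * (1 + CPhi N)) * (1 + CPhi N)) * 1 := by
              rw [mul_one]; gcongr
          _ ≤ (1 + CPhi N) * ((2 * (1 + CPhi N)) * (1 + CPhi N)) * (1 + CPhi N) := by gcongr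
          _ = _ := by ring
      all_goals
        rw [abs_of_nonpos (by linarith : (j - k : ℝ) ≤ 0)]
        intros
        nlinarith
  · have hnear : |(j - k : ℝ)| ≤ 2 := by
      have : |j - k| ≤ 2 := by omega
      exact_mod_cast this
    have hcm := cv_measurable k hgm.aemeasurable
    unfold remTerm
    simp only [if_neg hfar]
    rw [lp_const_mul hp0 (hcm.const_mul _).aemeasurable, lp_const_mul hp0 hcm.aemeasurable]
    have h1 := (lp_cv_le hp1 k hgm.aemeasurable).trans (mul_le_mul_right (lp_gv_le hp1 V j) _)
    refine fin (e := k + j) (Q := CPhi N * CPhi N) ?_ ?_ ?_ (fun h => absurd h hfar)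
    · refine (mul_le_mul_right (mul_le_mul_right h1 _) _).trans (le_of_eq ?_)
      rw [tw_add]
      ring
    · calc _ ≤ (1 + CPhi N) * (1 + CPhi N) * (1 * (1 * 1)) := by rw [mul_one, mul_one, mul_one]; gcongr
        _ ≤ (1 + CPhi N) * (1 + CPhi N) * ((1 + CPhi N) * ((1 + CPhi N) * 2)) := by
            gcongr; norm_num
        _ = _ := by ring
    · have h2 := abs_nonneg (j - k : ℝ)
      rcases abs_cases (j - k : ℝ) with ⟨h3, h4⟩ | ⟨h3, h4⟩ <;> rw [h3] at hnear ⊢ <;> nlinarith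

/-- The sum that controls the commutator at frequency `2^k`. -/
def usum (p : ℝ) (k : ℤ) (b : ℤ → ℝ≥0∞) : ℝ≥0∞ :=
  ∑' j : ℤ, tw (-|(j - k : ℝ)|) * (tw (j * (-(N / p) + 2)) * b j)

theorem lp_rem_le (hp : 2 ≤ p) (hpN : p ≤ N) (hM : N / p + 1 ≤ M)
    (hX : ∀ l : ℤ, tw (l * (N / p)) * lp p volume (bk P U l) ≤ X l) (k : ℤ) :
    lp p volume (rem P M U V X k) ≤ (1 + tw (2 * (N / p))) * (2 * (1 + CPhi N) ^ 4) *
      (tw (k * (N / p)) * (ysum k X * usum (N := N) p k fun j => lp p volume (bv P V j))) := by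
  refine (lp_tsum_le (by linarith) fun j => (remTerm_measurable k j).aemeasurable).trans ?_
  refine (ENNReal.tsum_le_tsum fun j => lp_remTerm_le hp hpN hM hX k j).trans (le_of_eq ?_)
  rw [ENNReal.tsum_mul_left, ENNReal.tsum_mul_left, ENNReal.tsum_mul_left]
  rfl

end Remainder

/-! ### The full commutator and its measurability -/

section Commutator

variable {P : LittlewoodPaley N} {M : ℕ}

theorem mem_diag {k j : ℤ} : j ∈ diag k ↔ ¬3 ≤ |j - k| := by
  rw [diag, Finset.mem_Icc, not_le, abs_lt]
  omega

/-- The series over the blocks is split into the finite diagonal, where the frozen term is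
subtracted, and the distant blocks, each already small without subtraction. Finiteness of `rem` at x
makes the distant series converge. The factor (1 + R)^M comes from the distant blocks only and is at
least 1 on the diagonal. -/
theorem exists_commutator_le (P : LittlewoodPaley N) (hM : 1 ≤ M) : ∃ C : ℝ, 0 ≤ C ∧
    ∀ {U : Dist N} {R K : ℝ} {b₁ b₂ m₁ m₂ : Space N → ℝ}, SmoothCoef P M U R K b₁ →
      SmoothCoef P M U R K b₂ → m₁ =ᵐ[volume] b₁ → m₂ =ᵐ[volume] b₂ →
    ∀ {X : ℤ → ℝ≥0∞}, (∀ l y, bk P U l y ≤ X l) → (∀ l y, cv l (bk P U l) y ≤ X l) →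
    ∀ {V : 𝓢'(Space N, CVec N)} {k : ℤ} {x : Space N}, rem P M U V X k x ≠ ⊤ →
    ∀ (α : ℝ) (d d' : Fin N → 𝓢(Space N, ℂ)) (B : ℝ), 0 ≤ B → VectorSymbol P α d d' →
      (∀ i e, KernelBound B (mulc (unitVec e) (d i))) →
      ‖∑' j, vp P V m₁ m₂ j (fun i => tf k x (d i)) +
        (2 : ℂ) ^ (2 * k) * (b₁ x + b₂ x * α) * ∑ i, comp V i (tf k x (lap (d i)))‖ₑ ≤
      ENNReal.ofReal B * (ENNReal.ofReal (C * (K * (1 + R) ^ M)) * rem P M U V X k x) := by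
  obtain ⟨C₁, hC₁0, hC₁⟩ := exists_enorm_vpi_le_of_far P hM
  obtain ⟨C₂, hC₂0, hC₂⟩ := exists_enorm_sum_vp_add_le P
  refine ⟨N * C₁ + C₂, by positivity, ?_⟩
  intro U R K b₁ b₂ m₁ m₂ h₁ h₂ hb₁ hb₂ X hX hX' V k x hr α d d' B hB hd hdB
  have hK := h₁.K_nonneg
  have hR := h₁.nonneg
  set ψ : Fin N → 𝓢(Space N, ℂ) := fun i => tf k x (d i)
  have hvp : ∀ j, vp P V m₁ m₂ j ψ = vp P V b₁ b₂ j ψ := fun j =>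
    Finset.sum_congr rfl fun i _ => vpi_congr hb₁ hb₂ j _ i
  simp_rw [hvp]
  have hfar : ∀ j, 3 ≤ |j - k| → ‖vp P V b₁ b₂ j ψ‖ₑ ≤
      ENNReal.ofReal (N * C₁ * (K * (1 + R) ^ M) * B) * remTerm P M U V X k j x := by
    intro j hj
    rw [remTerm, if_pos hj]
    refine (enorm_sum_le _ _).trans ((Finset.sum_le_sum fun i _ =>
      hC₁ h₁ h₂ V hB (hd.factors i) (hdB i) k j hj x i).trans (le_of_eq ?_))
    rw [Finset.sum_const, Finset.card_univ, Fintype.card_fin, nsmul_eq_mul, ← mul_assoc,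
      ← ENNReal.ofReal_natCast, ← ENNReal.ofReal_mul (by positivity)]
    congr 2
    ring
  have hfar' : ∀ j, ‖if 3 ≤ |j - k| then vp P V b₁ b₂ j ψ else 0‖ₑ ≤
      ENNReal.ofReal (N * C₁ * (K * (1 + R) ^ M) * B) *
        if 3 ≤ |j - k| then remTerm P M U V X k j x else 0 := by
    intro j
    split_ifs with hj
    · exact hfar j hj
    · simp
  have hle : ∑' j, (if 3 ≤ |j - k| then remTerm P M U V X k j x else 0) ≤ rem P M U V X k x := by
    refine ENNReal.tsum_le_tsum fun j => ?_
    split_ifs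
    · exact le_rfl
    · exact zero_le
  have hsum : ∑' j, ‖if 3 ≤ |j - k| then vp P V b₁ b₂ j ψ else 0‖ₑ ≤
      ENNReal.ofReal (N * C₁ * (K * (1 + R) ^ M) * B) * rem P M U V X k x := by
    refine (ENNReal.tsum_le_tsum hfar').trans ?_
    rw [ENNReal.tsum_mul_left]
    exact mul_le_mul_right hle _
  have hs1 : Summable fun j => if 3 ≤ |j - k| then vp P V b₁ b₂ j ψ else 0 :=
    summable_of_tsum_enorm_ne_top (ne_top_of_le_ne_top
      (ENNReal.mul_ne_top ENNReal.ofReal_ne_top hr) hsum)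
  have hs2 : HasSum (fun j => if 3 ≤ |j - k| then 0 else vp P V b₁ b₂ j ψ)
      (∑ j ∈ diag k, vp P V b₁ b₂ j ψ) := by
    have h1 := hasSum_sum_of_ne_finset_zero (L := SummationFilter.unconditional ℤ)
      (f := fun j => if 3 ≤ |j - k| then 0 else vp P V b₁ b₂ j ψ) (s := diag k) (fun j hj => by
        rw [mem_diag, not_not] at hj
        simp only [if_pos hj])
    rwa [Finset.sum_congr rfl fun j hj => if_neg (mem_diag.1 hj)] at h1
  have hs3 : ∑' j, vp P V b₁ b₂ j ψ = ∑ j ∈ diag k, vp P V b₁ b₂ j ψ +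
      ∑' j, if 3 ≤ |j - k| then vp P V b₁ b₂ j ψ else 0 := by
    have h1 := (hs2.add hs1.hasSum).tsum_eq
    rw [← h1]
    refine tsum_congr fun j => ?_
    split_ifs <;> simp
  have hdiag : tw k * ∑ j ∈ diag k, ysum k X * cv k (gv P V j) x ≤ rem P M U V X k x := by
    rw [Finset.mul_sum]
    refine le_trans (le_of_eq (Finset.sum_congr rfl fun j hj => ?_)) (ENNReal.sum_le_tsum (diag k))
    rw [remTerm, if_neg (mem_diag.1 hj)]
  rw [hs3, add_right_comm]
  refine (enorm_add_le _ _).trans ((add_le_add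
    ((hC₂ h₁ h₂ X hX hX' V hB hd hdB k x).trans (mul_le_mul' (ENNReal.ofReal_le_ofReal
      (q := C₂ * (K * (1 + R) ^ M) * B) ?_) hdiag))
    (enorm_tsum_le_tsum_enorm.trans hsum)).trans (le_of_eq ?_))
  · have : 1 ≤ (1 + R) ^ M := one_le_pow₀ (by linarith)
    have : K ≤ K * (1 + R) ^ M := le_mul_of_one_le_right hK this
    gcongr
  · rw [← add_mul, ← ENNReal.ofReal_add (by positivity) (by positivity),
      ← mul_assoc (ENNReal.ofReal B), ← ENNReal.ofReal_mul hB]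
    congr 2
    ring

/-- A bound of the `j`-th viscous term tested at frequency `2^k`. -/
def domTerm (P : LittlewoodPaley N) (M : ℕ) (U : Dist N) (V : 𝓢'(Space N, CVec N))
    (X : ℤ → ℝ≥0∞) (c c' : ℝ) (k j : ℤ) (x : Space N) : ℝ≥0∞ :=
  ENNReal.ofReal c * remTerm P M U V X k j x +
    if 3 ≤ |j - k| then 0 else ENNReal.ofReal c' * (tw k * cv k (gv P V j) x)

/-- Provides the majorants `D` of `LocalBounds`. The undifferenced coefficients contribute on the
diagonal only, where their crude bound A is used for finiteness alone. -/
theorem exists_enorm_vpi_le_domTerm (P : LittlewoodPaley N) (hM : 1 ≤ M) : ∃ C : ℝ, 0 ≤ C ∧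
    ∀ {U : Dist N} {R K : ℝ} {b₁ b₂ m₁ m₂ : Space N → ℝ}, SmoothCoef P M U R K b₁ →
      SmoothCoef P M U R K b₂ → m₁ =ᵐ[volume] b₁ → m₂ =ᵐ[volume] b₂ →
    ∀ {A : ℝ}, (∀ᵐ x, |m₁ x| ≤ A) → (∀ᵐ x, |m₂ x| ≤ A) → 0 ≤ A →
    ∀ (X : ℤ → ℝ≥0∞) (V : 𝓢'(Space N, CVec N)) (k : ℤ) (x : Space N),
    ∀ (χ χ' : 𝓢(Space N, ℂ)) (B : ℝ), 0 ≤ B → FactorsThrough P χ χ' →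
      (∀ e, KernelBound B (mulc (unitVec e) χ)) → ∀ j i,
      ‖vpi P V m₁ m₂ j (tf k x χ) i‖ₑ ≤ ENNReal.ofReal B *
        domTerm P M U V X (C * (K * (1 + R) ^ M)) (C * A) k j x := by
  obtain ⟨C₁, hC₁0, hC₁⟩ := exists_enorm_vpi_le_of_far P hM
  obtain ⟨C₂, hC₂0, hC₂⟩ := exists_enorm_vpi_le P
  refine ⟨C₁ + C₂, by positivity, ?_⟩
  intro U R K b₁ b₂ m₁ m₂ h₁ h₂ hb₁ hb₂ A hA₁ hA₂ hA X V k x χ χ' B hB hd hdB j i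
  have hK := h₁.K_nonneg
  have hR := h₁.nonneg
  unfold domTerm
  by_cases hj : 3 ≤ |j - k|
  · rw [if_pos hj, add_zero, remTerm, if_pos hj, vpi_congr hb₁ hb₂, ← mul_assoc,
      ← ENNReal.ofReal_mul hB]
    refine (hC₁ h₁ h₂ V hB hd hdB k j hj x i).trans
      (mul_le_mul' (ENNReal.ofReal_le_ofReal ?_) le_rfl)
    rw [mul_comm]
    gcongr
    linarith
  · rw [if_neg hj, mul_add]
    refine ((hC₂ hA₁ hA₂ hA V hB hdB k j x i).trans ?_).trans le_add_self
    rw [← mul_assoc (ENNReal.ofReal B), ← ENNReal.ofReal_mul hB]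
    refine mul_le_mul' (ENNReal.ofReal_le_ofReal ?_) le_rfl
    rw [mul_comm]
    gcongr
    linarith

theorem tsum_domTerm_le (U : Dist N) (V : 𝓢'(Space N, CVec N)) (X : ℤ → ℝ≥0∞) (c c' : ℝ) (k : ℤ)
    (x : Space N) : ∑' j, domTerm P M U V X c c' k j x ≤
      ENNReal.ofReal c * rem P M U V X k x +
        ∑ j ∈ diag k, ENNReal.ofReal c' * (tw k * cv k (gv P V j) x) := by
  unfold domTerm
  rw [ENNReal.tsum_add, ENNReal.tsum_mul_left]
  refine add_le_add le_rfl ?_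
  rw [tsum_eq_sum (s := diag k) fun j hj => by rw [mem_diag, not_not] at hj; rw [if_pos hj]]
  exact Finset.sum_le_sum fun j hj => by rw [if_neg (mem_diag.1 hj)]

variable {α : Type*} [MeasurableSpace α] {μ : Measure α}
  {U : α → Dist N} {V : α → 𝓢'(Space N, CVec N)}

theorem bk_joint (hU : ∀ ψ, AEStronglyMeasurable (fun s => U s ψ) μ) (l : ℤ) :
    AEMeasurable (Function.uncurry fun s => bk P (U s) l) (μ.prod volume) :=
  (aestronglyMeasurable_uncurry_of_continuous volume
    (Filter.Eventually.of_forall fun s => (U s).continuous_kernel P l)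
    (fun x => hU (P.kernel l x))).enorm

variable [SFinite μ]

theorem gv_joint (hV : ∀ ψ, AEStronglyMeasurable (fun s => V s ψ) μ) (j : ℤ) :
    AEMeasurable (Function.uncurry fun s => gv P (V s) j) (μ.prod volume) :=
  (cv_joint_aemeasurable j (bv_joint hV j)).const_mul _

theorem osc_joint (hU : ∀ ψ, AEStronglyMeasurable (fun s => U s ψ) μ) (n : ℤ) :
    AEMeasurable (Function.uncurry fun s => osc P M (U s) n) (μ.prod volume) := by
  have h1 : AEMeasurable (Function.uncurry fun s => hi P (U s) n) (μ.prod volume) :=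
    AEMeasurable.tsum fun j : ℕ => bk_joint hU (n + j)
  have h2 : AEMeasurable (Function.uncurry fun s => lo P M (U s) n) (μ.prod volume) :=
    AEMeasurable.tsum fun j : ℕ =>
      (cv_joint_aemeasurable (n - 1 - j) (bk_joint hU (n - 1 - j))).const_mul _
  exact h2.add (h1.add (cv_joint_aemeasurable n h1))

theorem remTerm_joint (hU : ∀ ψ, AEStronglyMeasurable (fun s => U s ψ) μ)
    (hV : ∀ ψ, AEStronglyMeasurable (fun s => V s ψ) μ) (X : ℤ → ℝ≥0∞) (k j : ℤ) :
    AEMeasurable (Function.uncurry fun s => remTerm P M (U s) (V s) X k j) (μ.prod volume) := by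
  unfold remTerm
  by_cases h : 3 ≤ |j - k|
  · simp only [if_pos h]
    exact (cv_joint_aemeasurable (f := fun s y => osc P M (U s) (max j k) y * gv P (V s) j y) k
      ((osc_joint hU _).mul (gv_joint hV j))).const_mul _
  · simp only [if_neg h]
    exact ((cv_joint_aemeasurable k (gv_joint hV j)).const_mul _).const_mul _

theorem rem_joint (hU : ∀ ψ, AEStronglyMeasurable (fun s => U s ψ) μ)
    (hV : ∀ ψ, AEStronglyMeasurable (fun s => V s ψ) μ) (X : ℤ → ℝ≥0∞) (k : ℤ) :
    AEMeasurable (Function.uncurry fun s => rem P M (U s) (V s) X k) (μ.prod volume) :=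
  AEMeasurable.tsum fun j => remTerm_joint hU hV X k j

theorem domTerm_joint (hU : ∀ ψ, AEStronglyMeasurable (fun s => U s ψ) μ)
    (hV : ∀ ψ, AEStronglyMeasurable (fun s => V s ψ) μ) (X : ℤ → ℝ≥0∞) (c c' : ℝ) (k j : ℤ) :
    AEMeasurable (Function.uncurry fun s => domTerm P M (U s) (V s) X c c' k j)
      (μ.prod volume) := by
  unfold domTerm
  refine ((remTerm_joint hU hV X k j).const_mul _).add ?_
  by_cases h : 3 ≤ |j - k|
  · simp only [if_pos h]
    exact aemeasurable_const
  · simp only [if_neg h]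
    exact ((cv_joint_aemeasurable k (gv_joint hV j)).const_mul _).const_mul _

end Commutator

/-! ### Exchanging almost every time and almost every point -/

section ProductMeasure

variable {α β : Type*} [MeasurableSpace α] [MeasurableSpace β] {μ : Measure α} {ν : Measure β}
  [SFinite ν]

/-- Null measurability of the set is essential: it is replaced by a measurable subset with null
difference, to which Fubini applies. -/
theorem ae_prod_of_ae_ae {q : α × β → Prop} (hq : NullMeasurableSet {z | q z} (μ.prod ν))
    (h : ∀ᵐ a ∂μ, ∀ᵐ b ∂ν, q (a, b)) : ∀ᵐ z ∂(μ.prod ν), q z := by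
  obtain ⟨t, ht1, ht2, ht3⟩ := hq.exists_measurable_subset_ae_eq
  have h1 := Measure.ae_ae_of_ae_prod (Filter.eventuallyEq_set.1 ht3)
  have h2 : ∀ᵐ z ∂(μ.prod ν), z ∈ t := by
    rw [Measure.ae_prod_mem_iff_ae_ae_mem ht2]
    filter_upwards [h, h1] with a ha1 ha2
    filter_upwards [ha1, ha2] with b hb1 hb2
    exact hb2.2 hb1
  exact h2.mono fun z hz => ht1 hz

theorem lp_aemeasurable {p : ℝ} {f : α → β → ℝ≥0∞}
    (hf : AEMeasurable (Function.uncurry f) (μ.prod ν)) : AEMeasurable (fun a => lp p ν (f a)) μ :=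
  (AEMeasurable.lintegral_prod_right' (hf.pow_const p)).pow_const _

theorem ae_ne_top_of_lp_ne_top {p : ℝ} (hp : 0 < p) {f : α → ℝ≥0∞} (hf : AEMeasurable f μ)
    (h : lp p μ f ≠ ⊤) : ∀ᵐ a ∂μ, f a ≠ ⊤ := by
  have h1 : ∫⁻ a, f a ^ p ∂μ ≠ ⊤ := by
    rw [← lp_rpow hp]
    exact ENNReal.rpow_ne_top_of_nonneg hp.le h
  filter_upwards [ae_lt_top' (hf.pow_const p) h1] with a ha hf'
  rw [hf', ENNReal.top_rpow_of_pos hp] at ha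
  exact lt_irrefl _ ha

theorem ae_slice_left {γ : Type*} [MeasurableSpace γ] {f : α → β → γ}
    (hf : AEMeasurable (Function.uncurry f) (μ.prod ν)) :
    ∀ᵐ a ∂μ, AEMeasurable (f a) ν := by
  filter_upwards [Measure.ae_ae_of_ae_prod hf.ae_eq_mk] with a ha
  exact ⟨fun b => hf.mk _ (a, b), hf.measurable_mk.comp measurable_prodMk_left, ha⟩

variable [SFinite μ]

theorem ae_ae_swap_of_ae_prod {q : α × β → Prop} (h : ∀ᵐ z ∂(μ.prod ν), q z) :
    ∀ᵐ b ∂ν, ∀ᵐ a ∂μ, q (a, b) :=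
  Measure.ae_ae_of_ae_prod (Measure.measurePreserving_swap.quasiMeasurePreserving.ae h)

theorem lp_lintegral_swap_le {p : ℝ} (hp : 1 ≤ p) {f : α → β → ℝ≥0∞}
    (hf : AEMeasurable (Function.uncurry f) (μ.prod ν)) :
    lp p ν (fun b => ∫⁻ a, f a b ∂μ) ≤ ∫⁻ a, lp p ν (f a) ∂μ :=
  lp_lintegral_le (f := fun b a => f a b) hp hf.prod_swap

theorem ae_lintegral_ne_top {p : ℝ} (hp : 1 ≤ p) {f : α → β → ℝ≥0∞}
    (hf : AEMeasurable (Function.uncurry f) (μ.prod ν)) (h : ∫⁻ a, lp p ν (f a) ∂μ ≠ ⊤) :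
    ∀ᵐ b ∂ν, ∫⁻ a, f a b ∂μ ≠ ⊤ :=
  ae_ne_top_of_lp_ne_top (by linarith)
    (AEMeasurable.lintegral_prod_right' (f := fun z : β × α => f z.2 z.1) hf.prod_swap)
    (ne_top_of_le_ne_top h (lp_lintegral_swap_le hp hf))

theorem ae_slice {γ : Type*} [MeasurableSpace γ] {f : α → β → γ}
    (hf : AEMeasurable (Function.uncurry f) (μ.prod ν)) :
    ∀ᵐ b ∂ν, AEMeasurable (fun a => f a b) μ := by
  filter_upwards [ae_ae_swap_of_ae_prod hf.ae_eq_mk] with b hb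
  exact ⟨fun a => hf.mk _ (a, b), hf.measurable_mk.comp measurable_prodMk_right, hb⟩

theorem aemeasurable_lintegral_heatFactor_mul (a : ℝ) {μ : Measure ℝ} [SFinite μ]
    {H : ℝ → β → ℝ≥0∞} (hH : AEMeasurable (Function.uncurry H) (μ.prod ν)) :
    AEMeasurable (fun z : ℝ × β => ∫⁻ s, heatFactor a z.1 s * H s z.2 ∂μ) (μ.prod ν) := by
  have hq : Measure.QuasiMeasurePreserving (fun z : (ℝ × β) × ℝ => (z.2, z.1.2))
      ((μ.prod ν).prod μ) (μ.prod ν) :=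
    Measure.measurePreserving_swap.quasiMeasurePreserving.comp
      (Measure.quasiMeasurePreserving_snd.comp
        (measurePreserving_prodAssoc μ ν μ).quasiMeasurePreserving)
  refine AEMeasurable.lintegral_prod_right'
    (f := fun z : (ℝ × β) × ℝ => heatFactor a z.1.1 z.2 * H z.2 z.1.2) ?_
  refine AEMeasurable.mul ?_ (hH.comp_quasiMeasurePreserving hq)
  exact ((heatFactor_measurable a).comp
    ((measurable_fst.comp measurable_fst).prodMk measurable_snd)).aemeasurable

end ProductMeasure

/-! ### L^p estimate of the blocks for almost every time -/

/-- The solution of a momentum equation whose coefficients are smooth functions of the sum of a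
Littlewood-Paley series. -/
structure MomentumData (P : LittlewoodPaley N) (M : ℕ) (T p c₁ A R K : ℝ) (U : ℝ → Dist N)
    (b₁ b₂ μ₁ μ₂ : ℝ → Space N → ℝ) (X : ℤ → ℝ≥0∞) (G : ℝ → 𝓢'(Space N, CVec N))
    (u₀ : 𝓢'(Space N, CVec N)) (u : ℝ → 𝓢'(Space N, CVec N)) : Prop where
  c_pos : 0 < c₁
  A_nonneg : 0 ≤ A
  meas_U : ∀ ψ, AEStronglyMeasurable (fun t => U t ψ) (volume.restrict (Set.Ioc 0 T))
  meas_u : ∀ ψ, AEStronglyMeasurable (fun t => u t ψ) (volume.restrict (Set.Ioc 0 T))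
  meas_G : ∀ ψ, AEStronglyMeasurable (fun t => G t ψ) (volume.restrict (Set.Ioc 0 T))
  coef : ∀ᵐ s ∂(volume.restrict (Set.Ioc 0 T)),
    SmoothCoef P M (U s) R K (b₁ s) ∧ SmoothCoef P M (U s) R K (b₂ s)
  X_bound : ∀ᵐ s ∂(volume.restrict (Set.Ioc 0 T)), (∀ l y, bk P (U s) l y ≤ X l) ∧
    (∀ l y, cv l (bk P (U s) l) y ≤ X l) ∧
    ∀ l : ℤ, tw (l * (N / p)) * lp p volume (bk P (U s) l) ≤ X l
  meas₁ : AEMeasurable (Function.uncurry μ₁) ((volume.restrict (Set.Ioc 0 T)).prod volume)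
  meas₂ : AEMeasurable (Function.uncurry μ₂) ((volume.restrict (Set.Ioc 0 T)).prod volume)
  repr : ∀ᵐ z ∂((volume.restrict (Set.Ioc 0 T)).prod volume),
    μ₁ z.1 z.2 = b₁ z.1 z.2 ∧ μ₂ z.1 z.2 = b₂ z.1 z.2
  bounds : ∀ᵐ z ∂((volume.restrict (Set.Ioc 0 T)).prod volume),
    c₁ ≤ μ₁ z.1 z.2 ∧ c₁ ≤ μ₁ z.1 z.2 + μ₂ z.1 z.2 ∧ |μ₁ z.1 z.2| ≤ A ∧ |μ₂ z.1 z.2| ≤ A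
  int_u : ∀ j, ∫⁻ s in Set.Ioc 0 T, lp p volume (bv P (u s) j) ≠ ⊤
  int_G : ∀ j, ∫⁻ s in Set.Ioc 0 T, lp p volume (bv P (G s) j) ≠ ⊤
  equation : ∀ ψ ∈ testSpace N, ∀ i : Fin N, ∀ᵐ t ∂(volume.restrict (Set.Ioc 0 T)),
    HasSum (fun j : ℤ => ∫ s in Set.Ioc 0 t, vpi P (u s) (μ₁ s) (μ₂ s) j ψ i)
      (u₀ ψ i - u t ψ i + ∫ s in Set.Ioc 0 t, G s ψ i)

/-- The constant of the commutator estimate in `L^p`. -/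
def CRem (N : ℕ) (p : ℝ) : ℝ≥0∞ := (1 + tw (2 * (N / p))) * (2 * (1 + CPhi N) ^ 4)

theorem CRem_ne_top (N : ℕ) (p : ℝ) : CRem N p ≠ ⊤ := by
  have h1 : 1 + CPhi N ≠ ⊤ := ENNReal.add_ne_top.2 ⟨ENNReal.one_ne_top, CPhi_ne_top N⟩
  refine ENNReal.mul_ne_top (ENNReal.add_ne_top.2 ⟨ENNReal.one_ne_top, tw_ne_top _⟩)
    (ENNReal.mul_ne_top ENNReal.ofNat_ne_top (ENNReal.pow_ne_top h1))

namespace MomentumData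

variable {P : LittlewoodPaley N} {M : ℕ} {T p c₁ A R K : ℝ} {U : ℝ → Dist N}
    {b₁ b₂ μ₁ μ₂ : ℝ → Space N → ℝ} {X : ℤ → ℝ≥0∞} {G : ℝ → 𝓢'(Space N, CVec N)}
    {u₀ : 𝓢'(Space N, CVec N)} {u : ℝ → 𝓢'(Space N, CVec N)}

/-- The sizes X of the blocks of the coefficient are bounds uniform in time, so the time integral
falls on the blocks of u alone. -/
theorem lintegral_lp_rem_le (h : MomentumData P M T p c₁ A R K U b₁ b₂ μ₁ μ₂ X G u₀ u)
    (hp : 2 ≤ p) (hpN : p ≤ N) (hM : N / p + 1 ≤ M) (k : ℤ) :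
    ∫⁻ s in Set.Ioc 0 T, lp p volume (rem P M (U s) (u s) X k) ≤ CRem N p *
      (tw (k * (N / p)) * (ysum k X *
        usum (N := N) p k fun j => ∫⁻ s in Set.Ioc 0 T, lp p volume (bv P (u s) j))) := by
  have hm : ∀ j, AEMeasurable (fun s => lp p volume (bv P (u s) j))
      (volume.restrict (Set.Ioc 0 T)) := fun j => lp_aemeasurable (bv_joint h.meas_u j)
  calc _ ≤ ∫⁻ s in Set.Ioc 0 T, CRem N p * (tw (k * (N / p)) * (ysum k X *
        usum (N := N) p k fun j => lp p volume (bv P (u s) j))) := by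
        refine lintegral_mono_ae ?_
        filter_upwards [h.X_bound] with s hs
        exact lp_rem_le hp hpN hM hs.2.2 k
    _ = _ := by
        have hm' : ∀ j : ℤ, AEMeasurable (fun s => tw (-|(j - k : ℝ)|) *
            (tw (j * (-(N / p) + 2)) * lp p volume (bv P (u s) j)))
            (volume.restrict (Set.Ioc 0 T)) := fun j => ((hm j).const_mul _).const_mul _
        have hu : AEMeasurable (fun s => usum (N := N) p k fun j => lp p volume (bv P (u s) j))
            (volume.restrict (Set.Ioc 0 T)) := AEMeasurable.tsum hm'
        rw [lintegral_const_mul'' _ ((hu.const_mul _).const_mul _),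
          lintegral_const_mul'' _ (hu.const_mul _), lintegral_const_mul'' _ hu]
        unfold usum
        rw [lintegral_tsum hm']
        simp_rw [lintegral_const_mul'' _ ((hm _).const_mul _), lintegral_const_mul'' _ (hm _)]

theorem ae_coef (h : MomentumData P M T p c₁ A R K U b₁ b₂ μ₁ μ₂ X G u₀ u) :
    ∀ᵐ s ∂(volume.restrict (Set.Ioc 0 T)), SmoothCoef P M (U s) R K (b₁ s) ∧
      SmoothCoef P M (U s) R K (b₂ s) ∧ μ₁ s =ᵐ[volume] b₁ s ∧ μ₂ s =ᵐ[volume] b₂ s ∧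
      (∀ᵐ y, |μ₁ s y| ≤ A) ∧ ∀ᵐ y, |μ₂ s y| ≤ A := by
  filter_upwards [h.coef, Measure.ae_ae_of_ae_prod h.repr, Measure.ae_ae_of_ae_prod h.bounds] with
    s h1 h2 h3
  exact ⟨h1.1, h1.2, h2.mono fun y hy => hy.1, h2.mono fun y hy => hy.2,
    h3.mono fun y hy => hy.2.2.1, h3.mono fun y hy => hy.2.2.2⟩

/-- By Minkowski's inequality the time integrals of the commutator and of the gradients belong to
L^p in x, hence they are finite for almost every x. The forcing is finite at every x, by Bernstein.
-/
theorem exists_localBounds (P : LittlewoodPaley N) (hM : 1 ≤ M) : ∃ C : ℝ,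
    ∀ {T p c₁ A R K : ℝ} {U : ℝ → Dist N}
      {b₁ b₂ μ₁ μ₂ : ℝ → Space N → ℝ} {X : ℤ → ℝ≥0∞} {G : ℝ → 𝓢'(Space N, CVec N)}
      {u₀ : 𝓢'(Space N, CVec N)} {u : ℝ → 𝓢'(Space N, CVec N)},
    MomentumData P M T p c₁ A R K U b₁ b₂ μ₁ μ₂ X G u₀ u → 2 ≤ p → ∀ k : ℤ,
      ∫⁻ s in Set.Ioc 0 T, lp p volume (rem P M (U s) (u s) X k) ≠ ⊤ →
      ∀ᵐ x, LocalBounds P T μ₁ μ₂ G u₀ u k x A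
        (fun j s => domTerm P M (U s) (u s) X (C * (K * (1 + R) ^ M)) (C * A) k j x) := by
  obtain ⟨C, hC0, hC⟩ := exists_enorm_vpi_le_domTerm P hM
  refine ⟨C, ?_⟩
  intro T p c₁ A R K U b₁ b₂ μ₁ μ₂ X G u₀ u h hp k hrem
  have hp1 : 1 ≤ p := by linarith
  have hp0 : 0 < p := by linarith
  have hrm := rem_joint (P := P) (M := M) h.meas_U h.meas_u X k
  have hgvm : ∀ j, AEMeasurable (Function.uncurry fun s => cv k (gv P (u s) j))
      ((volume.restrict (Set.Ioc 0 T)).prod volume) := fun j =>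
    cv_joint_aemeasurable k (gv_joint h.meas_u j)
  have hgv : ∀ j, ∫⁻ s in Set.Ioc 0 T, lp p volume (cv k (gv P (u s) j)) ≠ ⊤ := by
    intro j
    have hm := lp_aemeasurable (p := p) (bv_joint (P := P) h.meas_u j)
    refine ne_top_of_le_ne_top (ENNReal.mul_ne_top (CPhi_ne_top N) (ENNReal.mul_ne_top
      (CPhi_ne_top N) (ENNReal.mul_ne_top (tw_ne_top j) (h.int_u j)))) ?_
    rw [← lintegral_const_mul'' _ hm, ← lintegral_const_mul'' _ (hm.const_mul _),
      ← lintegral_const_mul'' _ ((hm.const_mul _).const_mul _)]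
    exact lintegral_mono fun s => (lp_cv_le hp1 k (gv_measurable P (u s) j).aemeasurable).trans
      (mul_le_mul_right (lp_gv_le hp1 (u s) j) _)
  filter_upwards [ae_lintegral_ne_top hp1 hrm hrem, ae_all_iff.2 fun j => ae_slice
      (domTerm_joint (P := P) (M := M) h.meas_U h.meas_u X (C * (K * (1 + R) ^ M)) (C * A) k j),
    ae_all_iff.2 fun j => ae_lintegral_ne_top hp1 (hgvm j) (hgv j),
    ae_slice hrm, ae_all_iff.2 fun j => ae_slice (hgvm j)] with x hx1 hx2 hx3 hx4 hx5
  exact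
    { meas₁ := h.meas₁.aestronglyMeasurable
      meas₂ := h.meas₂.aestronglyMeasurable
      bound := h.ae_coef.mono fun s hs => ⟨hs.2.2.2.2.1, hs.2.2.2.2.2⟩
      gv_bound := by
        filter_upwards [ae_all_iff.2 fun j => ae_lt_top'
          (lp_aemeasurable (bv_joint h.meas_u j)) (h.int_u j)] with s hs j
        have hne : (1 + CPhi N) * (tw (j + j * (N / p)) * lp p volume (bv P (u s) j)) ≠ ⊤ :=
          ENNReal.mul_ne_top (ENNReal.add_ne_top.2 ⟨ENNReal.one_ne_top, CPhi_ne_top N⟩)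
            (ENNReal.mul_ne_top (tw_ne_top _) (hs j).ne)
        exact ⟨_, fun y => (gv_le hp1 (u s) j y).trans (ENNReal.ofReal_toReal hne).ge⟩
      meas_u := h.meas_u
      meas_G := h.meas_G
      equation := h.equation
      meas_D := hx2
      lintegral_D := by
        refine ne_top_of_le_ne_top ?_ (lintegral_mono fun s => tsum_domTerm_le _ _ _ _ _ _ _)
        rw [lintegral_add_left' (hx4.const_mul _), lintegral_const_mul'' _ hx4,
          lintegral_finsetSum' _ fun j _ => ((hx5 j).const_mul _).const_mul _]
        refine ENNReal.add_ne_top.2 ⟨ENNReal.mul_ne_top ENNReal.ofReal_ne_top hx1,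
          ENNReal.sum_ne_top.2 fun j _ => ?_⟩
        rw [lintegral_const_mul'' _ ((hx5 j).const_mul _), lintegral_const_mul'' _ (hx5 j)]
        exact ENNReal.mul_ne_top ENNReal.ofReal_ne_top
          (ENNReal.mul_ne_top (tw_ne_top _) (hx3 j))
      vpi_le := by
        filter_upwards [h.ae_coef] with s hs
        exact hC hs.1 hs.2.1 hs.2.2.1 hs.2.2.2.1 hs.2.2.2.2.1 hs.2.2.2.2.2 h.A_nonneg X (u s) k x
      lintegral_G := by
        have hm := lp_aemeasurable (p := p) (bv_joint (P := P) h.meas_G k)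
        refine ne_top_of_le_ne_top (ENNReal.mul_ne_top (a := 1 + CPhi N) (ENNReal.add_ne_top.2
          ⟨ENNReal.one_ne_top, CPhi_ne_top N⟩) (ENNReal.mul_ne_top (tw_ne_top (k * (N / p)))
          (h.int_G k))) ?_
        rw [← lintegral_const_mul'' _ hm, ← lintegral_const_mul'' _ (hm.const_mul _)]
        exact lintegral_mono fun s => cv_le hp1 k (bv_measurable P (G s) k).aemeasurable x }

/-- The bound of the dyadic blocks of the solution in `L^p`, for almost every time. -/
theorem exists_lp_le (P : LittlewoodPaley N) (hM : 1 ≤ M) : ∃ C : ℝ≥0∞, C ≠ ⊤ ∧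
    ∀ {T p c₁ A R K : ℝ} {U : ℝ → Dist N}
      {b₁ b₂ μ₁ μ₂ : ℝ → Space N → ℝ} {X : ℤ → ℝ≥0∞} {G : ℝ → 𝓢'(Space N, CVec N)}
      {u₀ : 𝓢'(Space N, CVec N)} {u : ℝ → 𝓢'(Space N, CVec N)},
    MomentumData P M T p c₁ A R K U b₁ b₂ μ₁ μ₂ X G u₀ u → 2 ≤ p → ∀ k : ℤ,
      ∫⁻ s in Set.Ioc 0 T, lp p volume (rem P M (U s) (u s) X k) ≠ ⊤ →
      ∀ᵐ t ∂(volume.restrict (Set.Ioc 0 T)), lp p volume (bv P (u t) k) ≤ C *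
        (ENNReal.ofReal (Real.exp (-(c₁ / 16 * 2 ^ (2 * k) * t))) * lp p volume (bv P u₀ k) +
          ∫⁻ s in Set.Ioc 0 T, heatFactor (c₁ / 16 * 2 ^ (2 * k)) t s *
            (lp p volume (bv P (G s) k) +
              ENNReal.ofReal (K * (1 + R) ^ M) * lp p volume (rem P M (U s) (u s) X k))) := by
  obtain ⟨C₁, hC₁⟩ := exists_localBounds P hM
  obtain ⟨C₂, hC₂0, hC₂⟩ := exists_bv_le P
  obtain ⟨C₃, hC₃0, hC₃⟩ := exists_commutator_le P hM
  refine ⟨ENNReal.ofReal C₂ * (CPhi N + ENNReal.ofReal C₃), ENNReal.mul_ne_top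
    ENNReal.ofReal_ne_top (ENNReal.add_ne_top.2 ⟨CPhi_ne_top N, ENNReal.ofReal_ne_top⟩), ?_⟩
  intro T p c₁ A R K U b₁ b₂ μ₁ μ₂ X G u₀ u h hp k hrem
  have hp1 : 1 ≤ p := by linarith
  have hp0 : 0 < p := by linarith
  set μT := volume.restrict (Set.Ioc 0 T) with hμT
  have hrm := rem_joint (P := P) (M := M) h.meas_U h.meas_u X k
  have hGm := cv_joint_aemeasurable k (bv_joint (P := P) h.meas_G k)
  have hbm := bv_joint (P := P) h.meas_u k
  set L : ℝ≥0∞ := ENNReal.ofReal (C₃ * (K * (1 + R) ^ M)) with hL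
  set a := c₁ / 16 * (2 : ℝ) ^ (2 * k) with ha
  set H : ℝ → Space N → ℝ≥0∞ := fun s x =>
    cv k (bv P (G s) k) x + L * rem P M (U s) (u s) X k x with hH
  have hHm : AEMeasurable (Function.uncurry H) (μT.prod volume) := hGm.add (hrm.const_mul _)
  have hI : AEMeasurable (fun z : ℝ × Space N => ∫⁻ s, heatFactor a z.1 s * H s z.2 ∂μT)
      (μT.prod volume) := aemeasurable_lintegral_heatFactor_mul a hHm
  have hI₀ : AEMeasurable (fun z : ℝ × Space N =>
      ENNReal.ofReal (Real.exp (-(a * z.1))) * cv k (bv P u₀ k) z.2) (μT.prod volume) :=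
    ((ENNReal.measurable_ofReal.comp (Real.measurable_exp.comp
      (measurable_fst.const_mul a).neg)).mul
      ((cv_measurable k (bv_measurable P u₀ k).aemeasurable).comp measurable_snd)).aemeasurable
  -- The Duhamel argument works at a fixed x, and its exceptional set of times depends on x. Since
  -- both sides are jointly measurable, the two quantifiers can be exchanged afterwards.
  have hpt : ∀ᵐ x, ∀ᵐ t ∂μT, bv P (u t) k x ≤ ENNReal.ofReal C₂ *
      (ENNReal.ofReal (Real.exp (-(a * t))) * cv k (bv P u₀ k) x +
        ∫⁻ s, heatFactor a t s * H s x ∂μT) := by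
    filter_upwards [hC₁ h hp k hrem, ae_slice h.meas₁, ae_slice h.meas₂,
      ae_ae_swap_of_ae_prod h.bounds, ae_ae_swap_of_ae_prod h.repr,
      ae_lintegral_ne_top hp1 hrm hrem, ae_slice hrm] with x hx1 hx2 hx3 hx4 hx5 hx6 hx7
    refine hC₂ hx1 hx2 hx3 (A' := A + A) h.c_pos ?_ ?_
    · filter_upwards [hx4] with s hs
      have h1 := le_of_abs_le hs.2.2.1
      have h2 := le_of_abs_le hs.2.2.2
      exact ⟨hs.1, hs.2.1, by linarith [h.A_nonneg], by linarith⟩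
    · filter_upwards [h.ae_coef, h.X_bound, hx5, ae_lt_top' hx7 hx6] with s hs1 hs2 hs3 hs4
      have h1 := hC₃ hs1.1 hs1.2.1 hs1.2.2.1 hs1.2.2.2.1 hs2.1 hs2.2.1 hs4.ne
      simp only [hs3.1, hs3.2]
      exact h1
  have hpt' := Measure.ae_ae_of_ae_prod (Measure.measurePreserving_swap.quasiMeasurePreserving.ae
    (ae_prod_of_ae_ae (μ := (volume : Measure (Space N))) (ν := μT)
      (q := fun z => bv P (u z.2) k z.1 ≤ ENNReal.ofReal C₂ *
        (ENNReal.ofReal (Real.exp (-(a * z.2))) * cv k (bv P u₀ k) z.1 +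
          ∫⁻ s, heatFactor a z.2 s * H s z.1 ∂μT))
      (nullMeasurableSet_le hbm.prod_swap (((hI₀.add hI).const_mul _).prod_swap)) hpt))
  filter_upwards [hpt', ae_slice_left (f := fun t x => ∫⁻ s, heatFactor a t s * H s x ∂μT) hI]
    with t ht hIt
  have hm1 : Measurable (cv k (bv P u₀ k)) := cv_measurable k (bv_measurable P u₀ k).aemeasurable
  have hK' : AEMeasurable (Function.uncurry fun s x => heatFactor a t s * H s x)
      (μT.prod volume) := by
    refine AEMeasurable.mul ?_ hHm
    exact ((heatFactor_measurable a).comp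
      (measurable_const.prodMk measurable_fst)).aemeasurable
  -- Minkowski moves the L^p norm in x inside the time integral; the heat factor depends on time
  -- only and comes out.
  have hint : lp p volume (fun x => ∫⁻ s, heatFactor a t s * H s x ∂μT) ≤
      (CPhi N + ENNReal.ofReal C₃) * ∫⁻ s, heatFactor a t s * (lp p volume (bv P (G s) k) +
        ENNReal.ofReal (K * (1 + R) ^ M) * lp p volume (rem P M (U s) (u s) X k)) ∂μT := by
    refine (lp_lintegral_swap_le hp1 hK').trans ?_
    rw [← lintegral_const_mul' _ _ (ENNReal.add_ne_top.2 ⟨CPhi_ne_top N, ENNReal.ofReal_ne_top⟩)]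
    refine lintegral_mono_ae ?_
    filter_upwards [ae_slice_left hGm, ae_slice_left hrm] with s hs1' hs2'
    rw [lp_const_mul (f := H s) hp0 (hs1'.add (hs2'.const_mul _)), mul_left_comm]
    refine mul_le_mul_right ((lp_add_le hp1 hs1' (hs2'.const_mul _)).trans ?_) _
    rw [lp_const_mul hp0 hs2', mul_add]
    refine add_le_add ((lp_cv_le hp1 k (bv_measurable P (G s) k).aemeasurable).trans
      (mul_le_mul' le_self_add le_rfl)) ?_
    rw [hL, ENNReal.ofReal_mul hC₃0, mul_assoc]
    exact mul_le_mul' le_add_self le_rfl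
  refine (lp_mono_ae hp0.le ht).trans ?_
  simp only [Prod.swap_prod_mk]
  rw [lp_const_mul hp0 (f := fun x => ENNReal.ofReal (Real.exp (-(a * t))) * cv k (bv P u₀ k) x +
    ∫⁻ s, heatFactor a t s * H s x ∂μT) ((hm1.const_mul _).aemeasurable.add hIt),
    mul_assoc (ENNReal.ofReal C₂)]
  refine mul_le_mul_right ((lp_add_le hp1 (hm1.const_mul _).aemeasurable hIt).trans ?_) _
  rw [mul_add]
  refine add_le_add ?_ hint
  rw [lp_const_mul hp0 hm1.aemeasurable, mul_left_comm]
  exact mul_le_mul_right ((lp_cv_le hp1 k (bv_measurable P u₀ k).aemeasurable).trans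
    (mul_le_mul' le_self_add le_rfl)) _

end MomentumData

/-! ### Heat factors in time and the weights ω -/

section TimeNorms

theorem lintegral_exp_neg {b T : ℝ} (hb : 0 < b) (hT : 0 ≤ T) :
    ∫⁻ t in Set.Ioc 0 T, ENNReal.ofReal (Real.exp (-(b * t))) =
      ENNReal.ofReal ((1 - Real.exp (-(b * T))) / b) := by
  have hc : Continuous fun t : ℝ => Real.exp (-(b * t)) := by fun_prop
  rw [← ofReal_integral_eq_lintegral_ofReal
    (hc.integrableOn_Icc.mono_set Set.Ioc_subset_Icc_self)
    (Filter.Eventually.of_forall fun t => (Real.exp_pos _).le),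
    ← intervalIntegral.integral_of_le hT]
  congr 1
  have h1 : ∀ t ∈ Set.uIcc 0 T, HasDerivAt (fun t => -(Real.exp (-(b * t)) / b))
      (Real.exp (-(b * t))) t := by
    intro t _
    have h2 := ((((hasDerivAt_id t).const_mul b).neg).exp.div_const b).neg
    refine h2.congr_deriv ?_
    simp only [id_eq]
    field_simp
    rfl
  rw [intervalIntegral.integral_eq_sub_of_hasDerivAt h1 (hc.intervalIntegrable _ _)]
  simp only [mul_zero, neg_zero, Real.exp_zero]
  ring

theorem eWeight_nonneg (c : ℝ) (l : ℤ) (t : ℝ) : 0 ≤ eWeight c l t := Real.sqrt_nonneg _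

theorem eWeight_le_one (c : ℝ) (l : ℤ) (t : ℝ) : eWeight c l t ≤ 1 := by
  unfold eWeight
  refine Real.sqrt_le_iff.2 ⟨zero_le_one, ?_⟩
  linarith [Real.exp_pos (-(c * (2 : ℝ) ^ (2 * l) * t))]

theorem eWeight_pos {c t : ℝ} (hc : 0 < c) (ht : 0 < t) (l : ℤ) : 0 < eWeight c l t := by
  unfold eWeight
  rw [Real.sqrt_pos, sub_pos, Real.exp_lt_one_iff]
  have : 0 < c * (2 : ℝ) ^ (2 * l) * t := by positivity
  linarith

theorem eWeight_mono {c t : ℝ} (hc : 0 < c) (ht : 0 < t) {k l : ℤ} (h : k ≤ l) :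
    eWeight c k t ≤ eWeight c l t := by
  unfold eWeight
  have h1 : (2 : ℝ) ^ (2 * k) ≤ 2 ^ (2 * l) := zpow_le_zpow_right₀ (by norm_num) (by omega)
  gcongr

theorem summable_omegaWeight (c : ℝ) (k : ℤ) (t : ℝ) :
    Summable fun l : Set.Ici k => (2 : ℝ) ^ (k - (l : ℤ)) * eWeight c (l : ℤ) t := by
  let e : ℕ → Set.Ici k := fun n => ⟨k + n, by simp⟩
  have he : Function.Bijective e := by
    refine ⟨fun a b hab => ?_, fun l => ?_⟩
    · have := congrArg Subtype.val hab
      simp only [e] at this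
      omega
    · obtain ⟨n, hn⟩ := Int.le.dest (Set.mem_Ici.1 l.2)
      exact ⟨n, Subtype.ext hn⟩
  rw [← (Equiv.ofBijective e he).summable_iff]
  refine Summable.of_nonneg_of_le (fun n => mul_nonneg (by positivity) (eWeight_nonneg _ _ _))
    (fun n => ?_) (summable_geometric_two)
  simp only [Function.comp_apply, Equiv.ofBijective_apply, e]
  refine (mul_le_of_le_one_right (by positivity) (eWeight_le_one _ _ _)).trans (le_of_eq ?_)
  rw [show k - (k + (n : ℤ)) = -(n : ℤ) by ring, zpow_neg, zpow_natCast, one_div, inv_pow]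

theorem le_omegaWeight (c : ℝ) {k l : ℤ} (h : k ≤ l) (t : ℝ) :
    (2 : ℝ) ^ (k - l) * eWeight c l t ≤ omegaWeight c k t :=
  (summable_omegaWeight c k t).le_tsum ⟨l, h⟩ fun j _ =>
    mul_nonneg (by positivity) (eWeight_nonneg _ _ _)

theorem eWeight_le_omegaWeight (c : ℝ) (k : ℤ) (t : ℝ) : eWeight c k t ≤ omegaWeight c k t := by
  have := le_omegaWeight c (le_refl k) t
  rwa [sub_self, zpow_zero, one_mul] at this

/-- The reason for the definition of ω: e_k min(1, 2^{l-k}) ≤ ω_l. For l ≥ k this is e_k ≤ e_l ≤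
ω_l, and for l ≤ k the product 2^{l-k} e_k is one of the terms of the sum defining ω_l. -/
theorem eWeight_mul_ysum_le {c t : ℝ} (hc : 0 < c) (ht : 0 < t) (k : ℤ) (X : ℤ → ℝ≥0∞) :
    ENNReal.ofReal (eWeight c k t) * ysum k X ≤
      ∑' l, ENNReal.ofReal (omegaWeight c l t) * X l := by
  unfold ysum
  rw [← ENNReal.tsum_mul_left]
  refine ENNReal.tsum_le_tsum fun l => ?_
  rw [← mul_assoc]
  refine mul_le_mul' ?_ le_rfl
  rcases le_total k l with h | h
  · have h' : (k : ℝ) ≤ l := by exact_mod_cast h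
    rw [min_eq_left (by linarith), tw_zero, mul_one]
    exact ENNReal.ofReal_le_ofReal ((eWeight_mono hc ht h).trans (eWeight_le_omegaWeight c l t))
  · have h' : (l : ℝ) ≤ k := by exact_mod_cast h
    rw [min_eq_right (by linarith), show (l : ℝ) - k = ((l - k : ℤ) : ℝ) by push_cast; rfl,
      tw_intCast, ← ENNReal.ofReal_mul (eWeight_nonneg _ _ _), mul_comm]
    exact ENNReal.ofReal_le_ofReal (le_omegaWeight c h t)

theorem enn_rpow_le_one_add {x : ℝ≥0∞} {r : ℝ} (h0 : 0 ≤ r) (h1 : r ≤ 1) : x ^ r ≤ 1 + x := by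
  calc x ^ r ≤ (1 + x) ^ r := ENNReal.rpow_le_rpow le_add_self h0
    _ ≤ (1 + x) ^ (1 : ℝ) := ENNReal.rpow_le_rpow_of_exponent_le le_self_add h1
    _ = _ := ENNReal.rpow_one _

/-- The constant of the smoothing estimates in time. -/
def CHeat (κ : ℝ) : ℝ≥0∞ := 1 + ENNReal.ofReal κ⁻¹

/-- The integral of the q-th power is at most (1 - e^{-κ 2^{2k}T})/(κ 2^{2k}), hence at most κ^{-1}
2^{-2k} e_k², because κ ≤ c. The q-th root leaves e_k^{2/q}, and since e_k ≤ 1 and q ≤ 2 this is at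
most e_k. -/
theorem lp_exp_le {q κ c a T : ℝ} (hq1 : 1 ≤ q) (hq2 : q ≤ 2) (hκ : 0 < κ) (hκc : κ ≤ c)
    (hT : 0 < T) (k : ℤ) (ha : κ * 2 ^ (2 * k) ≤ a) :
    lp q (volume.restrict (Set.Ioc 0 T)) (fun t => ENNReal.ofReal (Real.exp (-(a * t)))) ≤
      CHeat κ * (tw (-(k * (2 / q))) * ENNReal.ofReal (eWeight c k T)) := by
  have hk : (0 : ℝ) < 2 ^ (2 * k) := by positivity
  have hb : 0 < κ * (2 : ℝ) ^ (2 * k) := by positivity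
  have hr0 : 0 ≤ 1 / q := by positivity
  have hr1 : 1 / q ≤ 1 := (div_le_one (by linarith)).2 hq1
  have h1 : ∫⁻ t in Set.Ioc 0 T, ENNReal.ofReal (Real.exp (-(a * t))) ^ q ≤
      ENNReal.ofReal κ⁻¹ * (tw (-(2 * k)) * ENNReal.ofReal (eWeight c k T) ^ (2 : ℝ)) := by
    calc _ ≤ ∫⁻ t in Set.Ioc 0 T, ENNReal.ofReal (Real.exp (-(κ * 2 ^ (2 * k) * t))) := by
          refine lintegral_mono_ae ?_
          filter_upwards [ae_restrict_mem measurableSet_Ioc] with t ht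
          rw [ENNReal.ofReal_rpow_of_pos (Real.exp_pos _), ← Real.exp_mul]
          refine ENNReal.ofReal_le_ofReal (Real.exp_le_exp.2 ?_)
          have h2 : κ * 2 ^ (2 * k) * t ≤ a * t := mul_le_mul_of_nonneg_right ha ht.1.le
          have h3 : 0 ≤ κ * 2 ^ (2 * k) * t := mul_nonneg hb.le ht.1.le
          nlinarith
      _ = ENNReal.ofReal ((1 - Real.exp (-(κ * 2 ^ (2 * k) * T))) / (κ * 2 ^ (2 * k))) :=
          lintegral_exp_neg hb hT.le
      _ ≤ ENNReal.ofReal (κ⁻¹ * (2 ^ (-(2 * k)) * eWeight c k T ^ 2)) := by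
          refine ENNReal.ofReal_le_ofReal ?_
          have h2 : 1 - Real.exp (-(κ * 2 ^ (2 * k) * T)) ≤ eWeight c k T ^ 2 := by
            unfold eWeight
            have h3 : κ * 2 ^ (2 * k) * T ≤ c * 2 ^ (2 * k) * T := by gcongr
            have h4 : Real.exp (-(c * 2 ^ (2 * k) * T)) ≤ Real.exp (-(κ * 2 ^ (2 * k) * T)) :=
              Real.exp_le_exp.2 (by linarith)
            have h5 : Real.exp (-(κ * 2 ^ (2 * k) * T)) ≤ 1 :=
              Real.exp_le_one_iff.2 (by have := mul_pos hb hT; linarith)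
            rw [Real.sq_sqrt (by linarith)]
            linarith
          rw [zpow_neg, div_eq_mul_inv, mul_inv]
          calc _ ≤ eWeight c k T ^ 2 * (κ⁻¹ * (2 ^ (2 * k))⁻¹) := by gcongr
            _ = _ := by ring
      _ = _ := by
          rw [ENNReal.ofReal_mul (by positivity), ENNReal.ofReal_mul (by positivity),
            ENNReal.ofReal_pow (eWeight_nonneg _ _ _), ENNReal.rpow_ofNat,
            show -(2 * (k : ℝ)) = ((-(2 * k) : ℤ) : ℝ) by push_cast; rfl, tw_intCast]
  calc _ ≤ (ENNReal.ofReal κ⁻¹ * (tw (-(2 * k)) * ENNReal.ofReal (eWeight c k T) ^ (2 : ℝ))) ^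
        (1 / q) := ENNReal.rpow_le_rpow h1 hr0
    _ = ENNReal.ofReal κ⁻¹ ^ (1 / q) * (tw (-(k * (2 / q))) *
        ENNReal.ofReal (eWeight c k T) ^ (2 * (1 / q))) := by
        rw [ENNReal.mul_rpow_of_nonneg _ _ hr0, ENNReal.mul_rpow_of_nonneg _ _ hr0, tw_rpow,
          ENNReal.rpow_mul]
        congr 3
        ring
    _ ≤ _ := by
        refine mul_le_mul' (enn_rpow_le_one_add hr0 hr1) (mul_le_mul_right ?_ _)
        have h2 : (1 : ℝ) ≤ 2 * (1 / q) := by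
          rw [mul_one_div, le_div_iff₀ (by linarith)]
          linarith
        calc _ ≤ ENNReal.ofReal (eWeight c k T) ^ (1 : ℝ) :=
              ENNReal.rpow_le_rpow_of_exponent_ge
                (by rw [← ENNReal.ofReal_one]; exact ENNReal.ofReal_le_ofReal (eWeight_le_one _ _ _)) h2
          _ = _ := ENNReal.rpow_one _

theorem lp_heatFactor_le {q a T s : ℝ} (hq : 0 < q) (hs : 0 ≤ s) :
    lp q (volume.restrict (Set.Ioc 0 T)) (fun t => heatFactor a t s) ≤
      lp q (volume.restrict (Set.Ioc 0 T)) (fun t => ENNReal.ofReal (Real.exp (-(a * t)))) := by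
  refine ENNReal.rpow_le_rpow ?_ (by positivity)
  set F : ℝ → ℝ≥0∞ := fun t => ENNReal.ofReal (Real.exp (-(a * t))) ^ q
  calc _ = ∫⁻ t, (Set.Ioc 0 T).indicator (fun t => heatFactor a t s ^ q) t :=
        (lintegral_indicator measurableSet_Ioc _).symm
    _ ≤ ∫⁻ t, (Set.Icc 0 T).indicator F (t - s) := by
        refine lintegral_mono fun t => ?_
        by_cases ht : t ∈ Set.Ioc 0 T
        · rw [Set.indicator_of_mem ht, heatFactor]
          by_cases hst : s ≤ t
          · rw [if_pos hst, Set.indicator_of_mem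
              (show t - s ∈ Set.Icc 0 T from ⟨by linarith, by linarith [ht.2]⟩)]
          · rw [if_neg hst, ENNReal.zero_rpow_of_pos hq]
            exact zero_le
        · rw [Set.indicator_of_notMem ht]
          exact zero_le
    _ = ∫⁻ t, (Set.Icc 0 T).indicator F t := lintegral_sub_right_eq_self _ s
    _ = ∫⁻ t in Set.Icc 0 T, F t := lintegral_indicator measurableSet_Icc _
    _ = ∫⁻ t in Set.Ioc 0 T, F t := by rw [Measure.restrict_congr_set Ioc_ae_eq_Icc]

/-- Young's inequality L^q * L^1 on a time interval: Minkowski, then translation of the heat factor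
to start at time 0. -/
theorem lp_heat_convolution_le {q a T : ℝ} (hq : 1 ≤ q) {h : ℝ → ℝ≥0∞}
    (hh : AEMeasurable h (volume.restrict (Set.Ioc 0 T))) :
    lp q (volume.restrict (Set.Ioc 0 T))
        (fun t => ∫⁻ s in Set.Ioc 0 T, heatFactor a t s * h s) ≤
      lp q (volume.restrict (Set.Ioc 0 T)) (fun t => ENNReal.ofReal (Real.exp (-(a * t)))) *
        ∫⁻ s in Set.Ioc 0 T, h s := by
  have hm : Measurable fun z : ℝ × ℝ => heatFactor a z.2 z.1 :=
    (heatFactor_measurable a).comp measurable_swap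
  have hF : AEMeasurable (Function.uncurry fun s t => heatFactor a t s * h s)
      ((volume.restrict (Set.Ioc 0 T)).prod (volume.restrict (Set.Ioc 0 T))) :=
    hm.aemeasurable.mul (hh.comp_quasiMeasurePreserving Measure.quasiMeasurePreserving_fst)
  refine (lp_lintegral_swap_le hq hF).trans ?_
  rw [← lintegral_const_mul'' _ hh]
  refine lintegral_mono_ae ?_
  filter_upwards [ae_restrict_mem measurableSet_Ioc] with s hs
  have h1 : Measurable fun t => heatFactor a t s :=
    (heatFactor_measurable a).comp (measurable_id.prodMk measurable_const)
  simp_rw [mul_comm _ (h s)]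
  rw [lp_const_mul (by linarith) h1.aemeasurable]
  exact mul_le_mul_right (lp_heatFactor_le (by linarith) hs.1.le) _

theorem timeNorm_eq_lp {T q : ℝ} (hq : 0 < q) (g : ℝ → ℝ≥0∞) :
    timeNorm T (ENNReal.ofReal q) g = lp q (volume.restrict (Set.Ioc 0 T)) g := by
  unfold timeNorm lp
  rw [eLpNorm_eq_lintegral_rpow_enorm_toReal (by simpa using hq) ENNReal.ofReal_ne_top,
    ENNReal.toReal_ofReal hq.le]
  simp

theorem timeNorm_one (T : ℝ) (g : ℝ → ℝ≥0∞) : timeNorm T 1 g = ∫⁻ t in Set.Ioc 0 T, g t := by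
  unfold timeNorm
  rw [eLpNorm_one_eq_lintegral_enorm]
  simp

theorem le_eLpNorm_top_count (f : ℤ → ℝ≥0∞) (k : ℤ) : f k ≤ eLpNorm f ∞ Measure.count := by
  rw [eLpNorm_exponent_top]
  have h1 := ae_le_eLpNormEssSup (f := f) (μ := Measure.count)
  rw [Filter.Eventually, mem_ae_iff, Measure.count_eq_zero_iff] at h1
  by_contra h2
  have : k ∈ ({x | ‖f x‖ₑ ≤ eLpNormEssSup f Measure.count} : Set ℤ)ᶜ := by simpa using h2
  rw [h1] at this
  exact this

theorem eLpNorm_top_count_le {f : ℤ → ℝ≥0∞} {B : ℝ≥0∞} (h : ∀ k, f k ≤ B) :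
    eLpNorm f ∞ Measure.count ≤ B := by
  rw [eLpNorm_exponent_top]
  exact essSup_le_of_ae_le _ (Filter.Eventually.of_forall h)

theorem eLpNorm_one_count (f : ℤ → ℝ≥0∞) : eLpNorm f 1 Measure.count = ∑' k, f k := by
  rw [eLpNorm_one_eq_lintegral_enorm, lintegral_count]
  simp

theorem tsum_tw_neg_abs_le (k : ℤ) : ∑' j : ℤ, tw (-|(j - k : ℝ)|) ≤ 4 := by
  have h1 : ∑' j : ℤ, tw (-|(j - k : ℝ)|) = ∑' j : ℤ, tw (-|(j : ℝ)|) := by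
    rw [← (Equiv.subRight k).tsum_eq fun j : ℤ => tw (-|(j : ℝ)|)]
    exact tsum_congr fun j => by simp
  have h2 : ∀ n : ℕ, tw (-(n : ℝ)) = 2⁻¹ ^ n := by
    intro n
    rw [show -(n : ℝ) = -1 * n by ring, ← tw_rpow, ENNReal.rpow_natCast]
    congr 1
    rw [show (-1 : ℝ) = ((-1 : ℤ) : ℝ) by norm_num, tw_intCast, zpow_neg_one,
      ENNReal.ofReal_inv_of_pos (by norm_num), ENNReal.ofReal_ofNat]
  have h3 : ∑' n : ℕ, tw (-(n : ℝ)) = 2 := by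
    simp_rw [h2]
    rw [ENNReal.tsum_geometric, ENNReal.one_sub_inv_two, inv_inv]
  rw [h1, (HasSum.of_nat_of_neg_add_one (f := fun j : ℤ => tw (-|(j : ℝ)|))
    ENNReal.summable.hasSum ENNReal.summable.hasSum).tsum_eq]
  calc _ ≤ ∑' n : ℕ, tw (-(n : ℝ)) + ∑' n : ℕ, tw (-(n : ℝ)) := by
        refine add_le_add (ENNReal.tsum_le_tsum fun n => tw_mono ?_)
          (ENNReal.tsum_le_tsum fun n => tw_mono ?_)
        · simp
        · push_cast
          rw [abs_of_nonpos (by have : (0 : ℝ) ≤ n := by positivity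
                                linarith)]
          linarith
    _ = 4 := by rw [h3]; norm_num

end TimeNorms

/-! ### From the density to a distribution: blocks of bounded functions -/

section Slices

theorem integral_fourier (χ : 𝓢(Space N, ℂ)) : ∫ z, 𝓕 χ z = χ 0 := by
  have h : 𝓕⁻ (𝓕 χ) 0 = χ 0 := by rw [fInv_fourier]
  rw [SchwartzMap.fourierInv_coe, Real.fourierInv_eq] at h
  simpa using h

theorem integral_kernel (P : LittlewoodPaley N) (l : ℤ) (x : Space N) :
    ∫ y, P.kernel l x y = 0 := by
  have h0 : P.symbolS l 0 = 0 := by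
    by_contra h
    have h1 := (P.symbolS_support h).1
    rw [norm_zero, mul_zero] at h1
    have : (0 : ℝ) < 2 ^ l := by positivity
    linarith
  rw [P.kernel_eq, ← P.symbolS_eq_dl]
  simp_rw [tr_apply]
  rw [integral_sub_right_eq_self (fun y => 𝓕 (P.symbolS l) y), integral_fourier, h0]

/-- The distribution defined by a bounded measurable function. -/
theorem exists_dist_of_bounded {f : Space N → ℝ} (hf : AEStronglyMeasurable f volume)
    (hA : ∃ A, ∀ᵐ x, |f x| ≤ A) : ∃ L : Dist N, ∀ S : 𝓢(Space N, ℂ), L S = ∫ y, (f y : ℂ) * S y := by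
  obtain ⟨A, hA⟩ := hA
  -- Integration over the whole space takes the value 1 on every translate of the normalized kernel,
  -- so the pairing built from it reduces to the plain integral of f S.
  have h1 : ∀ y : Space N, SchwartzMap.integralCLM ℂ volume (tr y (𝓕 (cutoff N))) = 1 := by
    intro y
    rw [SchwartzMap.integralCLM_apply]
    simp_rw [tr_apply]
    rw [integral_sub_right_eq_self (fun z => 𝓕 (cutoff N) z), integral_fourier_cutoff]
  obtain ⟨L, hL⟩ := exists_dist_eq_pairing hf hA (𝓕 (cutoff N)) (SchwartzMap.integralCLM ℂ volume)
    (D := 1) fun y => by rw [h1, norm_one]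
  refine ⟨L, fun S => ?_⟩
  rw [hL, pairing]
  simp_rw [h1, mul_one]

open Classical in
/-- The distribution defined by a function, if it is bounded and measurable. -/
def distOf (f : Space N → ℝ) : Dist N :=
  if h : AEStronglyMeasurable f volume ∧ ∃ A, ∀ᵐ x, |f x| ≤ A then
    (exists_dist_of_bounded h.1 h.2).choose else 0

variable {f : Space N → ℝ} {P : LittlewoodPaley N}

theorem distOf_apply (hf : AEStronglyMeasurable f volume) (hA : ∃ A, ∀ᵐ x, |f x| ≤ A)
    (S : 𝓢(Space N, ℂ)) : distOf f S = ∫ y, (f y : ℂ) * S y := by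
  rw [distOf, dif_pos ⟨hf, hA⟩]
  exact (exists_dist_of_bounded hf hA).choose_spec S

theorem distOf_kernel (hf : AEStronglyMeasurable f volume) (hA : ∃ A, ∀ᵐ x, |f x| ≤ A) (l : ℤ)
    (y : Space N) : distOf f (P.kernel l y) = P.blockFun l f y := by
  rw [distOf_apply hf hA]
  exact integral_congr_ae (Filter.Eventually.of_forall fun z => mul_comm _ _)

/-- The kernels have mean zero, so a constant may be added to f. With r₀ = ρ̲ the blocks of ρ - ρ̲
are bounded by the supremum of ρ alone, which keeps ρ̲ out of the constants. -/
theorem exists_enorm_blockFun_le (P : LittlewoodPaley N) : ∃ B : ℝ, 0 ≤ B ∧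
    ∀ {f : Space N → ℝ}, AEStronglyMeasurable f volume → ∀ {r₀ R : ℝ}, 0 ≤ R →
    (∀ᵐ x, |r₀ + f x| ≤ R) → ∀ l x, ‖P.blockFun l f x‖ₑ ≤ ENNReal.ofReal (B * R) := by
  obtain ⟨B, hB0, hB⟩ := exists_kernelBound (P.symbolS 0)
  refine ⟨B * (CPhi N).toReal, by positivity, ?_⟩
  intro f hf r₀ R hR hfR l x
  have h1 : Integrable fun y => P.kernel l x y * ((r₀ + f y : ℝ) : ℂ) :=
    (P.kernel l x).integrable.mul_bdd (c := R)
      (Complex.continuous_ofReal.comp_aestronglyMeasurable (hf.const_add r₀))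
      (hfR.mono fun y hy => by rwa [Complex.norm_real])
  have h2 : P.blockFun l f x = ∫ y, P.kernel l x y * ((r₀ + f y : ℝ) : ℂ) := by
    have h3 : Integrable fun y => P.kernel l x y * (r₀ : ℂ) :=
      (P.kernel l x).integrable.mul_const _
    have h4 : P.blockFun l f x = ∫ y, (P.kernel l x y * ((r₀ + f y : ℝ) : ℂ) -
        P.kernel l x y * (r₀ : ℂ)) := by
      refine integral_congr_ae (Filter.Eventually.of_forall fun y => ?_)
      push_cast
      ring
    rw [h4, integral_sub h1 h3, integral_mul_const, integral_kernel, zero_mul, sub_zero]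
  rw [h2, P.kernel_eq]
  refine (enorm_integral_mul_le hB0 hB l x _).trans ?_
  have h5 : cv l (fun y => ‖((r₀ + f y : ℝ) : ℂ)‖ₑ) x ≤
      cv l (fun _ => ENNReal.ofReal R * 1) x := by
    refine cv_mono l (hfR.mono fun y hy => ?_) x
    rw [mul_one, ← ofReal_norm, Complex.norm_real]
    exact ENNReal.ofReal_le_ofReal hy
  rw [cv_const_mul l _ ENNReal.ofReal_ne_top, cv_one] at h5
  refine (mul_le_mul_right h5 _).trans (le_of_eq ?_)
  rw [ENNReal.ofReal_mul (by positivity), ENNReal.ofReal_mul hB0,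
    ENNReal.ofReal_toReal (CPhi_ne_top N)]
  ring

theorem exists_bk_le (P : LittlewoodPaley N) : ∃ C : ℝ≥0∞, C ≠ ⊤ ∧ 1 ≤ C ∧
    ∀ {p : ℝ}, 1 ≤ p → ∀ (U : Dist N) (l : ℤ) (y : Space N),
      bk P U l y ≤ C * (tw (l * (N / p)) * lp p volume (bk P U l)) ∧
      cv l (bk P U l) y ≤ C * (tw (l * (N / p)) * lp p volume (bk P U l)) := by
  obtain ⟨B, hB0, hB⟩ := exists_kernelBound P.fat
  have hC : 1 + CPhi N ≠ ⊤ := ENNReal.add_ne_top.2 ⟨ENNReal.one_ne_top, CPhi_ne_top N⟩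
  refine ⟨(1 + ENNReal.ofReal B) * (1 + CPhi N), ENNReal.mul_ne_top
    (ENNReal.add_ne_top.2 ⟨ENNReal.one_ne_top, ENNReal.ofReal_ne_top⟩) hC,
    one_le_mul le_self_add le_self_add, ?_⟩
  intro p hp U l y
  have h1 := cv_le hp l (bk_measurable P U l).aemeasurable y
  have h2 : bk P U l y ≤ ENNReal.ofReal B * cv l (bk P U l) y := by
    have h3 := U.enorm_le_cv hB0 (factorsThrough_symbolS P) hB l y
    rw [← P.kernel_eq] at h3
    exact h3
  constructor
  · rw [mul_assoc]
    exact h2.trans (mul_le_mul' le_add_self h1)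
  · rw [mul_assoc]
    refine h1.trans (le_mul_of_one_le_left zero_le le_self_add)

theorem smoothCoef_distOf {M : ℕ} {p R K : ℝ} (hp : 1 ≤ p) (hR : 0 ≤ R)
    (hf : AEStronglyMeasurable f volume) (hA : ∃ A, ∀ᵐ x, |f x| ≤ A)
    (hfR : ∀ l x, ‖P.blockFun l f x‖ₑ ≤ ENNReal.ofReal R)
    (hs : ∑' l : ℤ, tw (l * (N / p)) * lp p volume (fun y => ‖P.blockFun l f y‖ₑ) ≠ ⊤)
    {g : ℝ → ℝ} (hg : ContDiff ℝ (M + 1) g)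
    (hgK : ∀ i, 1 ≤ i → i ≤ M + 1 → ∀ r, |iteratedDeriv i g r| ≤ K) (r₀ : ℝ) :
    SmoothCoef P M (distOf f) R K fun x => g (r₀ + ∑' l, rb P (distOf f) l x) := by
  have hbk : ∀ l, bk P (distOf f) l = fun y => ‖P.blockFun l f y‖ₑ := fun l => by
    funext y
    rw [bk, distOf_kernel hf hA]
  obtain ⟨C, hC, -, h⟩ := exists_bk_le P
  refine ⟨hR, fun l y => by rw [hbk]; exact hfR l y,
    ⟨fun l => C * (tw (l * (N / p)) * lp p volume (bk P (distOf f) l)), fun l y => (h hp _ l y).1, ?_⟩,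
    ⟨g, r₀, hg, hgK, fun x => rfl⟩⟩
  rw [ENNReal.tsum_mul_left]
  simp_rw [hbk]
  exact ENNReal.mul_ne_top hC hs

theorem rb_joint {α : Type*} [MeasurableSpace α] {μ : Measure α} {U : α → Dist N}
    (hU : ∀ ψ, AEStronglyMeasurable (fun s => U s ψ) μ) (l : ℤ) :
    AEStronglyMeasurable (Function.uncurry fun s => rb P (U s) l) (μ.prod volume) :=
  aestronglyMeasurable_uncurry_of_continuous volume
    (Filter.Eventually.of_forall fun s => rb_continuous P (U s) l)
    (fun x => Complex.continuous_re.comp_aestronglyMeasurable (hU (P.kernel l x)))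

theorem tsum_rb_joint {α : Type*} [MeasurableSpace α] {μ : Measure α} [SFinite μ] {U : α → Dist N}
    (hU : ∀ ψ, AEStronglyMeasurable (fun s => U s ψ) μ)
    (hs : ∀ᵐ s ∂μ, ∀ x, Summable fun l => rb P (U s) l x) :
    AEMeasurable (Function.uncurry fun s x => ∑' l, rb P (U s) l x) (μ.prod volume) := by
  refine (aestronglyMeasurable_of_tendsto_ae (Filter.atTop : Filter (Finset ℤ))
    (f := fun I z => ∑ l ∈ I, rb P (U z.1) l z.2)
    (fun I => Finset.aestronglyMeasurable_fun_sum _ fun l _ => rb_joint hU l) ?_).aemeasurable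
  have h1 := (Measure.quasiMeasurePreserving_fst (μ := μ)
    (ν := (volume : Measure (Space N)))).ae hs
  filter_upwards [h1] with z hz
  exact (hz z.2).hasSum

theorem meas_distOf {α : Type*} [MeasurableSpace α] {μ : Measure α} [SFinite μ]
    {F : α → Space N → ℝ} (hF : AEMeasurable (Function.uncurry F) (μ.prod volume))
    (hA : ∀ᵐ s ∂μ, ∃ A, ∀ᵐ x, |F s x| ≤ A) (ψ : 𝓢(Space N, ℂ)) :
    AEStronglyMeasurable (fun s => distOf (F s) ψ) μ := by
  have h1 : AEStronglyMeasurable (fun s => ∫ y, (F s y : ℂ) * ψ y) μ := by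
    refine AEStronglyMeasurable.integral_prod_right'
      (f := fun z : α × Space N => (F z.1 z.2 : ℂ) * ψ z.2) ?_
    exact (Complex.continuous_ofReal.comp_aestronglyMeasurable hF.aestronglyMeasurable).mul
      (ψ.continuous.comp_aestronglyMeasurable measurable_snd.aestronglyMeasurable)
  refine h1.congr ?_
  filter_upwards [ae_slice_left hF, hA] with s hs1 hs2
  exact (distOf_apply hs1.aestronglyMeasurable hs2 ψ).symm

end Slices

/-! ### From the hypotheses of the theorem to the data of the estimates -/

theorem ae_abs_le_supNorm {T : ℝ} {F : ℝ → Space N → ℝ} (h : supNorm T F ≠ ⊤) :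
    ∀ᵐ s ∂(volume.restrict (Set.Ioc 0 T)), ∀ᵐ x, |F s x| ≤ (supNorm T F).toReal := by
  have h1 := ae_le_eLpNormEssSup (f := fun s => eLpNorm (F s) ∞ volume)
    (μ := volume.restrict (Set.Ioc 0 T))
  filter_upwards [h1] with s hs
  filter_upwards [ae_le_eLpNormEssSup (f := F s) (μ := volume)] with x hx
  have h2 : ‖F s x‖ₑ ≤ supNorm T F := by
    unfold supNorm timeNorm
    rw [eLpNorm_exponent_top]
    refine hx.trans (le_trans (le_of_eq ?_) hs)
    rw [eLpNorm_exponent_top]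
    rfl
  rw [← ENNReal.toReal_le_toReal (by simp) h, toReal_enorm, Real.norm_eq_abs] at h2
  exact h2

theorem supNorm_ne_top {T C : ℝ} {F : ℝ → Space N → ℝ}
    (h : ∀ᵐ s ∂(volume.restrict (Set.Ioc 0 T)), ∀ᵐ x, |F s x| ≤ C) : supNorm T F ≠ ⊤ := by
  refine ne_top_of_le_ne_top (b := ENNReal.ofReal C) ENNReal.ofReal_ne_top ?_
  unfold supNorm timeNorm
  rw [eLpNorm_exponent_top]
  refine essSup_le_of_ae_le _ (h.mono fun s hs => ?_)
  change eLpNorm (F s) ∞ volume ≤ _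
  rw [eLpNorm_exponent_top]
  refine essSup_le_of_ae_le _ (hs.mono fun x hx => ?_)
  simp only [← ofReal_norm]
  exact ENNReal.ofReal_le_ofReal hx

theorem le_timeNorm_top (T : ℝ) (g : ℝ → ℝ≥0∞) :
    ∀ᵐ s ∂(volume.restrict (Set.Ioc 0 T)), g s ≤ timeNorm T ∞ g := by
  unfold timeNorm
  rw [eLpNorm_exponent_top]
  exact ae_le_eLpNormEssSup (f := g)

theorem besovNorm_one {p s : ℝ} (hp : 0 < p) (b : ℤ → Space N → ℂ) :
    besovNorm s (ENNReal.ofReal p) 1 b = ∑' l : ℤ, tw (l * s) * lp p volume (fun y => ‖b l y‖ₑ) := by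
  unfold besovNorm
  rw [eLpNorm_one_count]
  exact tsum_congr fun l => by rw [eLpNorm_eq_lp hp]; rfl

theorem le_besovNorm_top {p s : ℝ} (hp : 0 < p) (P : LittlewoodPaley N) (V : 𝓢'(Space N, CVec N))
    (k : ℤ) : tw (k * s) * lp p volume (bv P V k) ≤
      besovNorm s (ENNReal.ofReal p) ∞ (fun k => P.block k V) := by
  unfold besovNorm
  refine le_trans (le_of_eq ?_) (le_eLpNorm_top_count _ k)
  simp only
  rw [eLpNorm_eq_lp hp]
  rfl

/-- Outside the range of ρ nothing is known of m and l, while partial sums of the Littlewood-Paley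
series may leave that range. The coefficients are therefore replaced by extensions with globally
bounded derivatives, composed with the series of ρ - ρ̲; they agree with the original ones almost
everywhere. The blocks are bounded by R = B‖ρ‖_∞, and X collects the quantities 2^{jN/p} sup_t
‖Δ_j(ρ - ρ̲)‖_{L^p}. -/
theorem exists_momentumData (P : LittlewoodPaley N) (M : ℕ) : ∃ (B C : ℝ) (C₀ : ℝ≥0∞),
    0 ≤ B ∧ 0 ≤ C ∧ C₀ ≠ ⊤ ∧
    ∀ {p : ℝ}, 2 ≤ p → ∀ {c₁ K T ρbar : ℝ}, 0 < c₁ → ∀ {m l : ℝ → ℝ},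
      ContDiff ℝ ((⊤ : ℕ∞) : WithTop ℕ∞) m → ContDiff ℝ ((⊤ : ℕ∞) : WithTop ℕ∞) l →
    ∀ {ρ : ℝ → Space N → ℝ}, IsCriticalPerturbation P p T (fun t x => ρ t x - ρbar) →
      (∀ n : ℕ, 1 ≤ n → n ≤ M + 1 → ∀ r : ℝ, ENNReal.ofReal |r| ≤ supNorm T ρ →
        |iteratedDeriv n m r| ≤ K ∧ |iteratedDeriv n l r| ≤ K) →
      (∀ᵐ t ∂(volume.restrict (Set.Ioc 0 T)), ∀ᵐ x ∂(volume : Measure (Space N)),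
        c₁ ≤ m (ρ t x) ∧ c₁ ≤ l (ρ t x) + 2 * m (ρ t x)) →
    ∀ {G : ℝ → 𝓢'(Space N, CVec N)}, (∀ ψ : 𝓢(Space N, ℂ),
        AEStronglyMeasurable (fun t => G t ψ) (volume.restrict (Set.Ioc 0 T))) →
      timeNorm T 1 (fun t => besovNorm (-((N : ℝ) / p)) (ENNReal.ofReal p) ∞
        (fun k => P.block k (G t))) < ∞ →
    ∀ {u₀ : 𝓢'(Space N, CVec N)} {u : ℝ → 𝓢'(Space N, CVec N)},
      IsMomentumSolution P (ENNReal.ofReal p) T m l ρ G u₀ u →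
    supNorm T ρ ≠ ⊤ ∧ ∃ (A : ℝ) (U : ℝ → Dist N) (b₁ b₂ : ℝ → Space N → ℝ),
      MomentumData P M T p c₁ A (B * (supNorm T ρ).toReal) (C * K) U b₁ b₂
        (fun s x => m (ρ s x)) (fun s x => l (ρ s x) + m (ρ s x))
        (fun j => C₀ * (tw (j * (N / p)) * timeNorm T ∞ fun s =>
          lp p volume fun y => ‖P.blockFun j (fun x => ρ s x - ρbar) y‖ₑ)) G u₀ u := by
  obtain ⟨B, hB0, hB⟩ := exists_enorm_blockFun_le P
  obtain ⟨C, hC0, hC⟩ := exists_extension M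
  obtain ⟨C₀, hC₀, hC₀1, hC₀'⟩ := exists_bk_le P
  refine ⟨B, C * 2, C₀, hB0, by positivity, hC₀, ?_⟩
  intro p hp c₁ K T ρbar hc₁ m l hm hl ρ hρ hK hell G hGm hG u₀ u hu
  have hp1 : 1 ≤ p := by linarith
  have hp0 : 0 < p := by linarith
  set μT := volume.restrict (Set.Ioc 0 T) with hμT
  set f : ℝ → Space N → ℝ := fun s x => ρ s x - ρbar with hf
  have hfA : ∀ᵐ s ∂μT, ∃ A, ∀ᵐ x, |f s x| ≤ A :=
    (ae_abs_le_supNorm hρ.bounded.ne).mono fun s hs => ⟨_, hs⟩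
  have hsup : supNorm T ρ ≠ ⊤ := by
    refine supNorm_ne_top (C := (supNorm T f).toReal + |ρbar|) ?_
    filter_upwards [ae_abs_le_supNorm hρ.bounded.ne] with s hs
    filter_upwards [hs] with x hx
    calc |ρ s x| = |f s x + ρbar| := by simp [hf]
      _ ≤ |f s x| + |ρbar| := abs_add_le _ _
      _ ≤ _ := by linarith
  refine ⟨hsup, ?_⟩
  set R := (supNorm T ρ).toReal with hR
  have hR0 : 0 ≤ R := ENNReal.toReal_nonneg
  have hρR := ae_abs_le_supNorm hsup
  have hrR : ∀ r : ℝ, |r| ≤ R → ENNReal.ofReal |r| ≤ supNorm T ρ := fun r hr =>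
    ENNReal.ofReal_le_of_le_toReal hr
  have hK0 : 0 ≤ K := (abs_nonneg _).trans (hK 1 le_rfl (by omega) 0 (by simp)).1
  have hlm : ContDiff ℝ ((⊤ : ℕ∞) : WithTop ℕ∞) (fun r => l r + m r) := hl.add hm
  -- The bound 2K is the one needed for l + m; it is used for m as well, so that both coefficients
  -- share the same constants.
  obtain ⟨g₁, hg₁, hg₁e, hg₁K⟩ := hC m R (2 * K) hm hR0 fun n h1 h2 r hr =>
    ((hK n h1 h2 r (hrR r hr)).1).trans (by linarith)
  obtain ⟨g₂, hg₂, hg₂e, hg₂K⟩ := hC (fun r => l r + m r) R (2 * K) hlm hR0 fun n h1 h2 r hr => by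
    have h3 := hK n h1 h2 r (hrR r hr)
    have hn : ((n : ℕ∞) : WithTop ℕ∞) ≤ ((⊤ : ℕ∞) : WithTop ℕ∞) := by exact_mod_cast le_top
    have h4 : iteratedDeriv n (fun r => l r + m r) r = iteratedDeriv n l r + iteratedDeriv n m r :=
      iteratedDeriv_fun_add (hl.contDiffAt.of_le hn) (hm.contDiffAt.of_le hn)
    rw [h4]
    exact (abs_add_le _ _).trans (by linarith [h3.1, h3.2])
  simp only [← mul_assoc] at hg₁K hg₂K
  -- Suprema of the coefficients on the range of ρ, by compactness. They are used for integrability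
  -- and for clamping the diffusivity, never in the constants of the estimate.
  obtain ⟨A₁, hA₁⟩ := (isCompact_Icc (a := -R) (b := R)).exists_bound_of_continuousOn
    hm.continuous.continuousOn
  obtain ⟨A₂, hA₂⟩ := (isCompact_Icc (a := -R) (b := R)).exists_bound_of_continuousOn
    hlm.continuous.continuousOn
  set A := |A₁| + |A₂| with hAdef
  have hmA : ∀ r, |r| ≤ R → |m r| ≤ A := fun r hr =>
    (hA₁ r (abs_le.1 hr)).trans ((le_abs_self _).trans (le_add_of_nonneg_right (abs_nonneg _)))
  have hlA : ∀ r, |r| ≤ R → |l r + m r| ≤ A := fun r hr =>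
    (hA₂ r (abs_le.1 hr)).trans ((le_abs_self _).trans (le_add_of_nonneg_left (abs_nonneg _)))
  set U : ℝ → Dist N := fun s => distOf (f s) with hU
  have hUm : ∀ ψ, AEStronglyMeasurable (fun s => U s ψ) μT := meas_distOf hρ.measurable hfA
  have hfm := ae_slice_left hρ.measurable
  have hρm : AEMeasurable (Function.uncurry ρ) (μT.prod volume) := by
    refine (hρ.measurable.add_const ρbar).congr (Filter.Eventually.of_forall fun z => ?_)
    simp [Function.uncurry, hf]
  have hμ₁ : AEMeasurable (Function.uncurry fun s x => m (ρ s x)) (μT.prod volume) :=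
    hm.continuous.measurable.comp_aemeasurable hρm
  have hμ₂ : AEMeasurable (Function.uncurry fun s x => l (ρ s x) + m (ρ s x)) (μT.prod volume) :=
    hlm.continuous.measurable.comp_aemeasurable hρm
  have hfin : ∀ᵐ s ∂μT, ∑' j : ℤ, tw (j * (N / p)) *
      lp p volume (fun y => ‖P.blockFun j (f s) y‖ₑ) ≠ ⊤ := by
    filter_upwards [le_timeNorm_top T fun t => besovNorm ((N : ℝ) / p) (ENNReal.ofReal p) 1
      (fun k => P.blockFun k (f t))] with s hs
    rw [← besovNorm_one hp0]
    exact ne_top_of_le_ne_top hρ.norm_lt.ne hs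
  have hvp : ∀ᵐ s ∂μT, ∀ j ψ i, viscousPairing m l (ρ s) (P.block j (u s)) ψ i =
      vpi P (u s) (fun x => m (ρ s x)) (fun x => l (ρ s x) + m (ρ s x)) j ψ i := by
    filter_upwards [ae_slice_left hμ₁, ae_slice_left hμ₂, hρR] with s hs1 hs2 hs3 j ψ i
    exact viscousPairing_eq_vpi hs1.aestronglyMeasurable hs2.aestronglyMeasurable
      (hs3.mono fun x hx => hmA _ hx) (hs3.mono fun x hx => hlA _ hx) P (u s) j ψ i
  have hcoef : ∀ᵐ s ∂μT,
      SmoothCoef P M (U s) (B * R) (C * 2 * K) (fun x => g₁ (ρbar + ∑' j, rb P (U s) j x)) ∧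
      SmoothCoef P M (U s) (B * R) (C * 2 * K) (fun x => g₂ (ρbar + ∑' j, rb P (U s) j x)) := by
    filter_upwards [hfm, hfA, hρR, hfin] with s hs1 hs2 hs3 hs4
    have h1 := hB hs1.aestronglyMeasurable (r₀ := ρbar) hR0 (hs3.mono fun x hx => by
      simpa [hf] using hx)
    exact ⟨smoothCoef_distOf hp1 (by positivity) hs1.aestronglyMeasurable hs2 h1 hs4 hg₁ hg₁K ρbar,
      smoothCoef_distOf hp1 (by positivity) hs1.aestronglyMeasurable hs2 h1 hs4 hg₂ hg₂K ρbar⟩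
  have hsumrb : ∀ᵐ s ∂μT, ∀ x, Summable fun j => rb P (U s) j x :=
    hcoef.mono fun s hs x => hs.1.summable_rb x
  have hSm := tsum_rb_joint (P := P) hUm hsumrb
  have hser : ∀ᵐ z ∂(μT.prod volume), ρ z.1 z.2 = ρbar + ∑' j, rb P (U z.1) j z.2 := by
    refine ae_prod_of_ae_ae (nullMeasurableSet_eq_fun hρm (hSm.const_add ρbar)) ?_
    filter_upwards [hfm, hfA, hρ.series] with s hs1 hs2 hs3
    filter_upwards [hs3] with x hx
    have h1 : HasSum (fun j => rb P (U s) j x) (f s x) := by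
      have h2 := Complex.hasSum_re hx
      rw [Complex.ofReal_re] at h2
      refine h2.congr_fun fun j => ?_
      change (distOf (f s) (P.kernel j x)).re = _
      rw [distOf_kernel hs1.aestronglyMeasurable hs2]
    rw [h1.tsum_eq]
    simp [hf]
  have hbdR : ∀ᵐ z ∂(μT.prod volume), |ρ z.1 z.2| ≤ R :=
    ae_prod_of_ae_ae (nullMeasurableSet_le hρm.norm aemeasurable_const) hρR
  have hell₁ : ∀ᵐ z ∂(μT.prod volume), c₁ ≤ m (ρ z.1 z.2) :=
    ae_prod_of_ae_ae (nullMeasurableSet_le aemeasurable_const hμ₁)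
      (hell.mono fun s hs => hs.mono fun x hx => hx.1)
  have hell₂ : ∀ᵐ z ∂(μT.prod volume), c₁ ≤ m (ρ z.1 z.2) + (l (ρ z.1 z.2) + m (ρ z.1 z.2)) :=
    ae_prod_of_ae_ae (nullMeasurableSet_le aemeasurable_const (hμ₁.add hμ₂))
      (hell.mono fun s hs => hs.mono fun x hx => by
        simp only
        linarith [hx.2])
  refine ⟨A, U, fun s x => g₁ (ρbar + ∑' j, rb P (U s) j x),
    fun s x => g₂ (ρbar + ∑' j, rb P (U s) j x), ?_⟩
  exact
    { c_pos := hc₁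
      A_nonneg := by positivity
      meas_U := hUm
      meas_u := hu.measurable
      meas_G := hGm
      coef := hcoef
      X_bound := by
        filter_upwards [hfm, hfA, ae_all_iff.2 fun j : ℤ => le_timeNorm_top T fun s =>
          lp p volume fun y => ‖P.blockFun j (f s) y‖ₑ] with s hs1 hs2 hs3
        have hbk : ∀ j, lp p volume (bk P (U s) j) ≤ timeNorm T ∞ fun s =>
            lp p volume fun y => ‖P.blockFun j (f s) y‖ₑ := by
          intro j
          refine le_trans (le_of_eq ?_) (hs3 j)
          congr 1
          funext y
          rw [bk, hU, distOf_kernel hs1.aestronglyMeasurable hs2]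
        have h1 : ∀ j : ℤ, tw (j * (N / p)) * lp p volume (bk P (U s) j) ≤
            tw (j * (N / p)) * timeNorm T ∞ fun s =>
              lp p volume fun y => ‖P.blockFun j (f s) y‖ₑ := fun j =>
          mul_le_mul_right (hbk j) _
        exact ⟨fun j y => (hC₀' hp1 (U s) j y).1.trans (mul_le_mul_right (h1 j) _),
          fun j y => (hC₀' hp1 (U s) j y).2.trans (mul_le_mul_right (h1 j) _),
          fun j => (h1 j).trans (le_mul_of_one_le_left zero_le hC₀1)⟩
      meas₁ := hμ₁
      meas₂ := hμ₂
      repr := by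
        filter_upwards [hser, hbdR] with z hz1 hz2
        rw [← hz1, hg₁e _ hz2, hg₂e _ hz2]
        exact ⟨rfl, rfl⟩
      bounds := by
        filter_upwards [hell₁, hell₂, hbdR] with z h1 h2 h3
        exact ⟨h1, h2, hmA _ h3, hlA _ h3⟩
      int_u := fun j => by
        have h1 := (hu.block_integrable j).ne
        rw [timeNorm_one] at h1
        simp_rw [eLpNorm_eq_lp hp0] at h1
        exact h1
      int_G := fun j => by
        rw [timeNorm_one] at hG
        refine ne_top_of_le_ne_top (ENNReal.mul_ne_top (tw_ne_top (-(j * (-((N : ℝ) / p)))))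
          hG.ne) ?_
        rw [← lintegral_const_mul' _ _ (tw_ne_top _)]
        exact lintegral_mono fun s => le_tw_neg_mul (le_besovNorm_top hp0 P (G s) j)
      equation := fun ψ hψ i => by
        filter_upwards [hu.equation ψ hψ i, ae_restrict_mem measurableSet_Ioc] with t ht htm
        exact ht.congr_fun fun j => integral_congr_ae
          ((LocalBounds.ae_mono_Ioc htm.2 hvp).mono fun s hs => (hs j ψ i).symm) }

/-- Taking the L^q norm in time of the bound by Duhamel, both the free evolution and the forced part
carry the norm of the heat factor. It contributes 2^{-2k/q} and the weight e_k(T), which later turns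
`ysum` into the ω-weighted norm. -/
theorem MomentumData.exists_lp_lp_le (P : LittlewoodPaley N) {M : ℕ} (hM : 1 ≤ M) :
    ∃ C : ℝ≥0∞, C ≠ ⊤ ∧
    ∀ {T p c₁ A R K : ℝ} {U : ℝ → Dist N}
      {b₁ b₂ μ₁ μ₂ : ℝ → Space N → ℝ} {X : ℤ → ℝ≥0∞} {G : ℝ → 𝓢'(Space N, CVec N)}
      {u₀ : 𝓢'(Space N, CVec N)} {u : ℝ → 𝓢'(Space N, CVec N)},
    MomentumData P M T p c₁ A R K U b₁ b₂ μ₁ μ₂ X G u₀ u → 2 ≤ p → 0 < T →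
    ∀ {q κ c : ℝ}, 1 ≤ q → q ≤ 2 → 0 < κ → κ ≤ c → κ ≤ c₁ / 16 → ∀ k : ℤ,
      ∫⁻ s in Set.Ioc 0 T, lp p volume (rem P M (U s) (u s) X k) ≠ ⊤ →
      tw (k * (-(N / p) + 2 / q)) *
        lp q (volume.restrict (Set.Ioc 0 T)) (fun t => lp p volume (bv P (u t) k)) ≤
      C * CHeat κ * (tw (k * (-(N / p))) * ENNReal.ofReal (eWeight c k T) *
        (lp p volume (bv P u₀ k) + ((∫⁻ s in Set.Ioc 0 T, lp p volume (bv P (G s) k)) +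
          ENNReal.ofReal (K * (1 + R) ^ M) *
            ∫⁻ s in Set.Ioc 0 T, lp p volume (rem P M (U s) (u s) X k)))) := by
  obtain ⟨C, hC, h1⟩ := MomentumData.exists_lp_le P hM
  refine ⟨C, hC, ?_⟩
  intro T p c₁ A R K U b₁ b₂ μ₁ μ₂ X G u₀ u h hp hT q κ c hq1 hq2 hκ hκc hκc₁ k hrem
  set a := c₁ / 16 * (2 : ℝ) ^ (2 * k)
  set H : ℝ → ℝ≥0∞ := fun s => lp p volume (bv P (G s) k) +
    ENNReal.ofReal (K * (1 + R) ^ M) * lp p volume (rem P M (U s) (u s) X k) with hH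
  have hq0 : 0 < q := by linarith
  have hGm := lp_aemeasurable (p := p) (bv_joint (P := P) h.meas_G k)
  have hrm := lp_aemeasurable (p := p) (rem_joint (P := P) (M := M) h.meas_U h.meas_u X k)
  have hHm : AEMeasurable H (volume.restrict (Set.Ioc 0 T)) := hGm.add (hrm.const_mul _)
  have hHi : ∫⁻ s in Set.Ioc 0 T, H s = (∫⁻ s in Set.Ioc 0 T, lp p volume (bv P (G s) k)) +
      ENNReal.ofReal (K * (1 + R) ^ M) *
        ∫⁻ s in Set.Ioc 0 T, lp p volume (rem P M (U s) (u s) X k) := by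
    rw [lintegral_add_left' hGm, lintegral_const_mul' _ _ ENNReal.ofReal_ne_top]
  have hIm : AEMeasurable (fun t => ∫⁻ s in Set.Ioc 0 T, heatFactor a t s * H s)
      (volume.restrict (Set.Ioc 0 T)) := by
    refine AEMeasurable.lintegral_prod_right' (f := fun z : ℝ × ℝ => heatFactor a z.1 z.2 * H z.2) ?_
    exact (heatFactor_measurable a).aemeasurable.mul
      (hHm.comp_quasiMeasurePreserving Measure.quasiMeasurePreserving_snd)
  have hem : Measurable fun t : ℝ => ENNReal.ofReal (Real.exp (-(a * t))) := by fun_prop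
  set e := lp q (volume.restrict (Set.Ioc 0 T)) (fun t => ENNReal.ofReal (Real.exp (-(a * t))))
  have he : e ≤ CHeat κ * (tw (-(k * (2 / q))) * ENNReal.ofReal (eWeight c k T)) :=
    lp_exp_le hq1 hq2 hκ hκc hT k (mul_le_mul_of_nonneg_right hκc₁ (by positivity))
  have h2 : lp q (volume.restrict (Set.Ioc 0 T)) (fun t => lp p volume (bv P (u t) k)) ≤
      C * (e * (lp p volume (bv P u₀ k) + ∫⁻ s in Set.Ioc 0 T, H s)) := by
    refine (lp_mono_ae hq0.le (h1 h hp k hrem)).trans ?_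
    simp_rw [mul_comm (ENNReal.ofReal (Real.exp _))]
    rw [lp_const_mul hq0 (f := fun t => lp p volume (bv P u₀ k) *
      ENNReal.ofReal (Real.exp (-(a * t))) + ∫⁻ s in Set.Ioc 0 T, heatFactor a t s * H s)
      ((hem.const_mul _).aemeasurable.add hIm)]
    refine mul_le_mul_right ((lp_add_le hq1 (hem.const_mul _).aemeasurable hIm).trans ?_) _
    rw [lp_const_mul hq0 hem.aemeasurable, mul_add, mul_comm]
    exact add_le_add le_rfl (lp_heat_convolution_le hq1 hHm)
  rw [← hHi]
  refine (mul_le_mul_right (h2.trans (mul_le_mul_right (mul_le_mul' he le_rfl) _)) _).trans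
    (le_of_eq ?_)
  have h3 : tw (k * (-(N / p) + 2 / q)) * tw (-(k * (2 / q))) = tw (k * (-(N / p))) := by
    rw [← tw_add]
    congr 1
    ring
  rw [← h3]
  ring

theorem cheminLernerNorm_block {w : ℤ → ℝ} {T s q p : ℝ} (hp : 0 < p) (hq : 0 < q)
    (P : LittlewoodPaley N) (V : ℝ → 𝓢'(Space N, CVec N)) :
    cheminLernerNorm w T s (ENNReal.ofReal q) (ENNReal.ofReal p) ∞ (fun k t => P.block k (V t)) =
      eLpNorm (fun k : ℤ => tw (k * s) * ENNReal.ofReal (w k) *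
        lp q (volume.restrict (Set.Ioc 0 T)) fun t => lp p volume (bv P (V t) k))
        ∞ Measure.count := by
  unfold cheminLernerNorm
  congr 1
  funext k
  rw [ENNReal.ofReal_mul (by positivity), timeNorm_eq_lp hq]
  simp_rw [eLpNorm_eq_lp hp]
  rfl

theorem lp_one (T : ℝ) (g : ℝ → ℝ≥0∞) :
    lp 1 (volume.restrict (Set.Ioc 0 T)) g = ∫⁻ t in Set.Ioc 0 T, g t := by
  unfold lp
  simp

theorem usum_le {p : ℝ} {Z : ℝ≥0∞} {b : ℤ → ℝ≥0∞}
    (h : ∀ j : ℤ, tw (j * (-(N / p) + 2)) * b j ≤ Z) (k : ℤ) : usum (N := N) p k b ≤ 4 * Z := by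
  unfold usum
  refine (ENNReal.tsum_le_tsum fun j => mul_le_mul_right (h j) _).trans ?_
  rw [ENNReal.tsum_mul_right]
  exact mul_le_mul' (tsum_tw_neg_abs_le k) le_rfl

/-- The factor e_k is distributed: it is dropped on the initial data, bounded by ω_k on the forcing,
and multiplied with `ysum` on the commutator. The convolution in the index j with 2^{-|j-k|} is
harmless for a supremum over j. -/
theorem MomentumData.exists_cheminLernerNorm_le (P : LittlewoodPaley N) {M : ℕ} (hM : 1 ≤ M) :
    ∃ C : ℝ≥0∞, C ≠ ⊤ ∧
    ∀ {T p c₁ A R K : ℝ} {U : ℝ → Dist N}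
      {b₁ b₂ μ₁ μ₂ : ℝ → Space N → ℝ} {X : ℤ → ℝ≥0∞} {G : ℝ → 𝓢'(Space N, CVec N)}
      {u₀ : 𝓢'(Space N, CVec N)} {u : ℝ → 𝓢'(Space N, CVec N)},
    MomentumData P M T p c₁ A R K U b₁ b₂ μ₁ μ₂ X G u₀ u → 2 ≤ p → p ≤ N → (N : ℝ) / p + 1 ≤ M →
    0 < T → ∀ {κ c : ℝ}, 0 < κ → κ ≤ c → κ ≤ c₁ / 16 → ∀ {Z : ℝ≥0∞},
      cheminLernerNorm (fun _ => 1) T (-((N : ℝ) / p) + 2) (ENNReal.ofReal 1) (ENNReal.ofReal p) ∞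
        (fun k t => P.block k (u t)) = Z →
      (∑' l, ENNReal.ofReal (omegaWeight c l T) * X l) * Z ≠ ⊤ →
    ∀ {q : ℝ}, 1 ≤ q → q ≤ 2 →
      cheminLernerNorm (fun _ => 1) T (-((N : ℝ) / p) + 2 / q) (ENNReal.ofReal q)
        (ENNReal.ofReal p) ∞ (fun k t => P.block k (u t)) ≤
      C * CHeat κ * (besovNorm (-((N : ℝ) / p)) (ENNReal.ofReal p) ∞ (fun k => P.block k u₀) +
        cheminLernerNorm (fun k => omegaWeight c k T) T (-((N : ℝ) / p)) (ENNReal.ofReal 1)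
          (ENNReal.ofReal p) ∞ (fun k t => P.block k (G t)) +
        ENNReal.ofReal (K * (1 + R) ^ M) * (4 * CRem N p *
          ((∑' l, ENNReal.ofReal (omegaWeight c l T) * X l) * Z))) := by
  obtain ⟨C, hC, h1⟩ := MomentumData.exists_lp_lp_le P hM
  refine ⟨C, hC, ?_⟩
  intro T p c₁ A R K U b₁ b₂ μ₁ μ₂ X G u₀ u h hp hpN hMp hT κ c hκ hκc hκc₁ Z hZ hWZ q hq1 hq2
  have hp0 : 0 < p := by linarith
  have hc : 0 < c := hκ.trans_le hκc
  set W := ∑' l, ENNReal.ofReal (omegaWeight c l T) * X l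
  rw [cheminLernerNorm_block hp0 (by linarith : 0 < q)]
  refine eLpNorm_top_count_le fun k => ?_
  have hu : usum (N := N) p k (fun j => ∫⁻ s in Set.Ioc 0 T, lp p volume (bv P (u s) j)) ≤
      4 * Z := by
    refine usum_le (fun j => ?_) k
    rw [← hZ, cheminLernerNorm_block hp0 one_pos]
    refine le_trans (le_of_eq ?_) (le_eLpNorm_top_count _ j)
    rw [ENNReal.ofReal_one, mul_one, lp_one]
  have hr := h.lintegral_lp_rem_le hp hpN hMp k
  set e := ENNReal.ofReal (eWeight c k T)
  set I := ∫⁻ s in Set.Ioc 0 T, lp p volume (rem P M (U s) (u s) X k)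
  -- Positivity of e_k, due to T > 0, is what converts finiteness of e_k times the commutator bound
  -- into finiteness of the bound itself. The latter is required before the Duhamel estimate can be
  -- applied.
  have he0 : e ≠ 0 := by simpa [e] using eWeight_pos hc hT k
  have he1 : e ≤ 1 := ENNReal.ofReal_le_one.2 (eWeight_le_one _ _ _)
  have hyu : e * (ysum k X * usum (N := N) p k
      fun j => ∫⁻ s in Set.Ioc 0 T, lp p volume (bv P (u s) j)) ≤ 4 * (W * Z) := by
    rw [← mul_assoc]
    refine (mul_le_mul' (eWeight_mul_ysum_le hc hT k X) hu).trans (le_of_eq ?_)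
    ring
  have hyu' := ne_top_of_le_ne_top (ENNReal.mul_ne_top ENNReal.ofNat_ne_top hWZ) hyu
  have hI : I ≠ ⊤ := by
    refine ne_top_of_le_ne_top (ENNReal.mul_ne_top (CRem_ne_top N p)
      (ENNReal.mul_ne_top (tw_ne_top _) fun h3 => hyu' ?_)) hr
    rw [h3, ENNReal.mul_top he0]
  refine (le_of_eq ?_).trans
    ((h1 h hp hT hq1 hq2 hκ hκc hκc₁ k hI).trans (mul_le_mul_right ?_ _))
  · rw [ENNReal.ofReal_one, mul_one]
  have hu₀ : tw (k * (-(N / p))) * e * lp p volume (bv P u₀ k) ≤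
      besovNorm (-((N : ℝ) / p)) (ENNReal.ofReal p) ∞ (fun k => P.block k u₀) := by
    refine le_trans ?_ (le_besovNorm_top hp0 P u₀ k)
    exact mul_le_mul' (mul_le_of_le_one_right' he1) le_rfl
  have hG : tw (k * (-(N / p))) * e * (∫⁻ s in Set.Ioc 0 T, lp p volume (bv P (G s) k)) ≤
      cheminLernerNorm (fun k => omegaWeight c k T) T (-((N : ℝ) / p)) (ENNReal.ofReal 1)
          (ENNReal.ofReal p) ∞ (fun k t => P.block k (G t)) := by
    rw [cheminLernerNorm_block hp0 one_pos]
    refine le_trans ?_ (le_eLpNorm_top_count _ k)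
    rw [lp_one]
    exact mul_le_mul' (mul_le_mul_right
      (ENNReal.ofReal_le_ofReal (eWeight_le_omegaWeight c k T)) _) le_rfl
  have hR : tw (k * (-(N / p))) * e * I ≤ 4 * CRem N p * (W * Z) := by
    refine (mul_le_mul_right hr _).trans ?_
    have h3 : tw (k * (-(N / p))) * tw (k * (N / p)) = 1 := by
      rw [← tw_add, ← tw_zero]
      congr 1
      ring
    calc _ = (tw (k * (-(N / p))) * tw (k * (N / p))) * CRem N p * (e * (ysum k X *
          usum (N := N) p k fun j => ∫⁻ s in Set.Ioc 0 T, lp p volume (bv P (u s) j))) := by ring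
      _ ≤ 1 * CRem N p * (4 * (W * Z)) := by
          rw [h3]
          exact mul_le_mul_right hyu _
      _ = _ := by ring
  rw [← add_assoc, mul_add, mul_add]
  refine add_le_add (add_le_add hu₀ hG) ?_
  rw [mul_left_comm]
  exact mul_le_mul_right hR _

end BesovMomentum

end

/-! ### Conclusion: choice of the constants -/

theorem mainTheorem6 (N : ℕ) (p : ℝ) (hp2 : 2 ≤ p) (hpN : p ≤ (N : ℝ))
    (P : BesovMomentum.LittlewoodPaley N)
    (c₁ c K : ℝ) (hc₁ : 0 < c₁) (hc : 0 < c) :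
    ∃ C : ℝ, 0 < C ∧
      ∀ (T ρbar : ℝ) (_hT : 0 < T) (m l : ℝ → ℝ)
        (_hm : ContDiff ℝ ((⊤ : ℕ∞) : WithTop ℕ∞) m)
        (_hl : ContDiff ℝ ((⊤ : ℕ∞) : WithTop ℕ∞) l)
        (ρ : ℝ → BesovMomentum.Space N → ℝ)
        (_hρ : BesovMomentum.IsCriticalPerturbation P p T (fun t x => ρ t x - ρbar))
        (_hK : ∀ n : ℕ, 1 ≤ n → n ≤ ⌊(N : ℝ) / p⌋₊ + 3 →
          ∀ r : ℝ, ENNReal.ofReal |r| ≤ BesovMomentum.supNorm T ρ →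
            |iteratedDeriv n m r| ≤ K ∧ |iteratedDeriv n l r| ≤ K)
        (_hell : ∀ᵐ t ∂(volume.restrict (Set.Ioc 0 T)),
          ∀ᵐ x ∂(volume : Measure (BesovMomentum.Space N)),
            c₁ ≤ m (ρ t x) ∧ c₁ ≤ l (ρ t x) + 2 * m (ρ t x))
        (G : ℝ → 𝓢'(BesovMomentum.Space N, BesovMomentum.CVec N))
        (_hGmeas : ∀ ψ : 𝓢(BesovMomentum.Space N, ℂ),
          AEStronglyMeasurable (fun t => G t ψ) (volume.restrict (Set.Ioc 0 T)))
        (_hG : BesovMomentum.timeNorm T 1 (fun t => BesovMomentum.besovNorm (-((N : ℝ) / p))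
          (ENNReal.ofReal p) ∞ (fun k => P.block k (G t))) < ∞)
        (u₀ : 𝓢'(BesovMomentum.Space N, BesovMomentum.CVec N))
        (_hu₀ : BesovMomentum.besovNorm (-((N : ℝ) / p)) (ENNReal.ofReal p) ∞
          (fun k => P.block k u₀) < ∞)
        (u : ℝ → 𝓢'(BesovMomentum.Space N, BesovMomentum.CVec N))
        (_hu : BesovMomentum.IsMomentumSolution P (ENNReal.ofReal p) T m l ρ G u₀ u),
        BesovMomentum.cheminLernerNorm (fun _ => 1) T (-((N : ℝ) / p) + 2) 1 (ENNReal.ofReal p) ∞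
            (fun k t => P.block k (u t)) +
          BesovMomentum.cheminLernerNorm (fun _ => 1) T (-((N : ℝ) / p) + 1) 2 (ENNReal.ofReal p) ∞
            (fun k t => P.block k (u t)) ≤
        ENNReal.ofReal C *
          (BesovMomentum.besovNorm (-((N : ℝ) / p)) (ENNReal.ofReal p) ∞
              (fun k => P.block k u₀) +
            BesovMomentum.cheminLernerNorm (fun k => BesovMomentum.omegaWeight c k T) T
              (-((N : ℝ) / p)) 1 (ENNReal.ofReal p) ∞ (fun k t => P.block k (G t)) +
            (1 + BesovMomentum.supNorm T ρ) ^ (⌊(N : ℝ) / p⌋₊ + 2) *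
              BesovMomentum.cheminLernerNorm (fun k => BesovMomentum.omegaWeight c k T) T
                ((N : ℝ) / p) ∞ (ENNReal.ofReal p) 1
                (fun k t => P.blockFun k (fun x => ρ t x - ρbar)) *
              BesovMomentum.cheminLernerNorm (fun _ => 1) T (-((N : ℝ) / p) + 2) 1
                (ENNReal.ofReal p) ∞ (fun k t => P.block k (u t))) := by
  -- The differences have order M, with M ≥ N/p + 1 for the summation of low frequencies, and they
  -- use derivatives up to order M + 1 = [N/p] + 3 of the coefficients, which are those controlled
  -- by K.
  set M := ⌊(N : ℝ) / p⌋₊ + 2 with hMdef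
  have hp0 : 0 < p := by linarith
  have hM1 : 1 ≤ M := by omega
  have hMp : (N : ℝ) / p + 1 ≤ M := by
    have := Nat.lt_floor_add_one ((N : ℝ) / p)
    rw [hMdef]
    push_cast
    linarith
  obtain ⟨B, C, C₀, hB, hC, hC₀, hdata⟩ := BesovMomentum.exists_momentumData P M
  obtain ⟨C₁, hC₁, hmain⟩ := BesovMomentum.MomentumData.exists_cheminLernerNorm_le P hM1
  -- The rate κ is at most the parabolic rate c₁/16, and at most c so that the heat factor is
  -- controlled by the weights e_k defined with c.
  set κ := min (c₁ / 16) c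
  have hκ : 0 < κ := lt_min (by positivity) hc
  set D : ℝ≥0∞ := ENNReal.ofReal (C * K * (1 + B) ^ M) * (4 * BesovMomentum.CRem N p * C₀)
  have hD : D ≠ ⊤ := ENNReal.mul_ne_top ENNReal.ofReal_ne_top (ENNReal.mul_ne_top
    (ENNReal.mul_ne_top ENNReal.ofNat_ne_top (BesovMomentum.CRem_ne_top N p)) hC₀)
  -- The summand 1 makes the constant positive and at least 1; the factor 2 accounts for the two
  -- norms on the left.
  set E : ℝ≥0∞ := 1 + 2 * (C₁ * BesovMomentum.CHeat κ * (1 + D))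
  have hE : E ≠ ⊤ := by
    refine ENNReal.add_ne_top.2 ⟨ENNReal.one_ne_top, ENNReal.mul_ne_top ENNReal.ofNat_ne_top
      (ENNReal.mul_ne_top (ENNReal.mul_ne_top hC₁ ?_)
        (ENNReal.add_ne_top.2 ⟨ENNReal.one_ne_top, hD⟩))⟩
    exact ENNReal.add_ne_top.2 ⟨ENNReal.one_ne_top, ENNReal.ofReal_ne_top⟩
  have hE0 : E ≠ 0 := by simp [E]
  refine ⟨E.toReal, ENNReal.toReal_pos hE0 hE, ?_⟩
  intro T ρbar hT m l hm hl ρ hρ hK hell G hGm hG u₀ _ u hu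
  rw [ENNReal.ofReal_toReal hE]
  obtain ⟨hsup, A, U, b₁, b₂, h⟩ := hdata hp2 hc₁ hm hl hρ hK hell hGm hG hu
  have hK0 : 0 ≤ K := (abs_nonneg _).trans (hK 1 le_rfl (by omega) 0 (by simp)).1
  set S := BesovMomentum.supNorm T ρ
  set W := BesovMomentum.cheminLernerNorm (fun k => BesovMomentum.omegaWeight c k T) T
    ((N : ℝ) / p) ∞ (ENNReal.ofReal p) 1 (fun k t => P.blockFun k (fun x => ρ t x - ρbar)) with hW
  have hWX : (∑' j : ℤ, ENNReal.ofReal (BesovMomentum.omegaWeight c j T) *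
      (C₀ * (BesovMomentum.tw (j * (N / p)) * BesovMomentum.timeNorm T ∞ fun s =>
        BesovMomentum.lp p volume fun y => ‖P.blockFun j (fun x => ρ s x - ρbar) y‖ₑ))) =
      C₀ * W := by
    rw [hW, BesovMomentum.cheminLernerNorm, BesovMomentum.eLpNorm_one_count, ← ENNReal.tsum_mul_left]
    refine tsum_congr fun j => ?_
    simp_rw [BesovMomentum.eLpNorm_eq_lp hp0]
    rw [ENNReal.ofReal_mul (by positivity), BesovMomentum.tw]
    ring
  set Z := BesovMomentum.cheminLernerNorm (fun _ => 1) T (-((N : ℝ) / p) + 2) 1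
    (ENNReal.ofReal p) ∞ (fun k t => P.block k (u t)) with hZ
  set Y := BesovMomentum.besovNorm (-((N : ℝ) / p)) (ENNReal.ofReal p) ∞ (fun k => P.block k u₀)
  set H := BesovMomentum.cheminLernerNorm (fun k => BesovMomentum.omegaWeight c k T) T
    (-((N : ℝ) / p)) 1 (ENNReal.ofReal p) ∞ (fun k t => P.block k (G t))
  have hS1 : 1 ≤ (1 + S) ^ M := one_le_pow₀ le_self_add
  have hE1 : 1 ≤ E := le_self_add
  -- If the product is infinite the right-hand side is infinite. Otherwise, with 0 · ∞ = 0, one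
  -- factor may still be infinite when the other vanishes, and the estimate below covers this case.
  by_cases hWZ : W * Z = ⊤
  · refine le_top.trans (le_of_eq (top_unique ?_).symm)
    calc ⊤ = 1 * (1 * (W * Z)) := by rw [hWZ, one_mul, one_mul]
      _ ≤ E * (Y + H + (1 + S) ^ M * W * Z) := by
          refine mul_le_mul' hE1 (le_trans ?_ le_add_self)
          rw [mul_assoc]
          exact mul_le_mul' hS1 le_rfl
  -- From 1 + B s ≤ (1 + B)(1 + s): the constant B is moved out of the power, which leaves (1 +
  -- ‖ρ‖_∞)^M.
  have hS : ENNReal.ofReal (C * K * (1 + B * S.toReal) ^ M) ≤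
      ENNReal.ofReal (C * K * (1 + B) ^ M) * (1 + S) ^ M := by
    have hr : 0 ≤ S.toReal := ENNReal.toReal_nonneg
    have h1 : 1 + S = ENNReal.ofReal (1 + S.toReal) := by
      rw [ENNReal.ofReal_add zero_le_one hr, ENNReal.ofReal_one, ENNReal.ofReal_toReal hsup]
    rw [h1, ← ENNReal.ofReal_pow (by positivity), ← ENNReal.ofReal_mul (by positivity), mul_assoc _ _
      ((1 + S.toReal) ^ M), ← mul_pow]
    refine ENNReal.ofReal_le_ofReal (mul_le_mul_of_nonneg_left
      (pow_le_pow_left₀ (by positivity) ?_ M) (by positivity))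
    nlinarith
  have hq : ∀ q : ℝ, 1 ≤ q → q ≤ 2 →
      BesovMomentum.cheminLernerNorm (fun _ => 1) T (-((N : ℝ) / p) + 2 / q) (ENNReal.ofReal q)
        (ENNReal.ofReal p) ∞ (fun k t => P.block k (u t)) ≤
      C₁ * BesovMomentum.CHeat κ * (1 + D) * (Y + H + (1 + S) ^ M * W * Z) := by
    intro q hq1 hq2
    have hb := hmain h hp2 hpN hMp hT hκ (min_le_right _ _) (min_le_left _ _)
      (Z := Z) (by rw [ENNReal.ofReal_one])
      (by rw [hWX, mul_assoc]; exact ENNReal.mul_ne_top hC₀ hWZ) hq1 hq2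
    rw [hWX, ENNReal.ofReal_one] at hb
    refine hb.trans ?_
    rw [mul_assoc (C₁ * _) (1 + D)]
    refine mul_le_mul_right ?_ _
    calc _ ≤ Y + H + ENNReal.ofReal (C * K * (1 + B) ^ M) * (1 + S) ^ M *
          (4 * BesovMomentum.CRem N p * (C₀ * W * Z)) :=
          add_le_add le_rfl (mul_le_mul' hS le_rfl)
      _ = (Y + H) + D * ((1 + S) ^ M * W * Z) := by simp only [D]; ring
      _ ≤ (Y + H + (1 + S) ^ M * W * Z) + D * (Y + H + (1 + S) ^ M * W * Z) :=
          add_le_add le_self_add (mul_le_mul_right le_add_self _)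
      _ = _ := by ring
  have hq1 := hq 1 le_rfl one_le_two
  have hq2 := hq 2 one_le_two le_rfl
  rw [ENNReal.ofReal_one, div_one] at hq1
  rw [ENNReal.ofReal_ofNat, div_self two_ne_zero] at hq2
  refine (add_le_add hq1 hq2).trans ?_
  calc _ = 2 * (C₁ * BesovMomentum.CHeat κ * (1 + D)) * (Y + H + (1 + S) ^ M * W * Z) := by ring
    _ ≤ _ := mul_le_mul' le_add_self le_rfl
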